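/- **Setting.** Let $\mathbb T^d=\mathbb R^d/\mathbb Z^d$, $\bar r>12$ an integer, $T\in C^\infty(\mathbb T^d,\mathbb T^d)$, $\alpha\in C^\infty(\mathbb T^d,\mathbb R)$, $\beta\in C^\infty(\mathbb T^d,\mathbb R^d)$. For $\nu\in\mathbb R$ and $h\in C^{\bar r}(\mathbb T^d,\mathbb R)'$ with $h(1)=1$ put $T_{\nu,h}(x)=T(x)+\nu\beta(x)\,h(\alpha) \bmod 1$. For $h\in C^{\bar r}(\mathbb T^d,\mathbb R)'$ write $\int\varphi h=h(\varphi)$; functions $f$ and probability measures $\mu$ are identified with the distributions $\varphi\mapsto\int f\varphi\,dx$ and $\varphi\mapsto\int\varphi\,d\mu$. The transfer operator of $S\in C^{\bar r}(\mathbb T^d,\mathbb T^d)$ is given by $\int\varphi\,\mathcal L_Sh=\int(\varphi\circ S)\,h$ (on measures it is the push-forward $S_*$), and $\widetilde{\mathcal L}_\nu(h)=\mathcal L_{T_{\nu,h}}h$. Let $\mathcal T\subset C^{\bar r}(\mathbb T^d,\mathbb T^d)$ be a set of surjective maps closed under composition and let $\nu_*>0$ be such that $T_{\nu,\mu}\in\mathcal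 T$ for all $\nu\in[0,\nu_*]$ and all Borel probability measures $\mu$ on $\mathbb T^d$. Let $\mathcal B_0,\dots,\mathcal B_3$ be real Banach spaces with $C^{\bar r}(\mathbb T^d,\mathbb R)'\supset\mathcal B_0\supset\mathcal B_1\supset\mathcal B_2\supset\mathcal B_3\supset C^{\bar r}(\mathbb T^d,\mathbb R)$ (continuous injections) and $\|\cdot\|_{\mathcal B_i}\le\|\cdot\|_{\mathcal B_{i+1}}$, with $C^{\bar r}(\mathbb T^d,\mathbb R)$ dense in each $\mathcal B_i$ and each dual $\mathcal B_i'$. Let $\mathbb V=\{f\in\mathcal B_1:\int f=0\}$. Assume that there are $K,C_*\ge1$, $\bar c,\hat c>0$, $\vartheta\in(0,1)$, $\bar n\in\mathbb N$ such that: 1. $\mathcal L_S\in L(\mathcal B_i,\mathcal B_i)$ for all $S\in\mathcal T$, $0\le i\le3$; 2. $\partial_{x_k}\in L(\mathcal B_{i+1},\mathcal B_i)$ for $1\le k\le d$, $0\le i\le2$; 3. for every smooth $a$ and $0\le i\le 3$, multiplication by $a$ maps $\mathcal B_i$ to itself and $\|ab\|_{\mathcal B_i}\le C_*\|a\|_{C^{\bar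 ci+\hat c}}\|b\|_{\mathcal B_i}$; and $|\int b|\le C_*\|b\|_{\mathcal B_0}$ on $\mathcal B_0$; 4. the unit ball of $\mathcal B_{i+1}$ is relatively compact in $\mathcal B_i$, $0\le i\le2$; 5. for all $n$ and $S_1,\dots,S_n\in\mathcal T$: $\|\mathcal L_{S_n}\cdots\mathcal L_{S_1}b\|_{\mathcal B_0}\le C_*\|b\|_{\mathcal B_0}$ for $b\in\mathcal B_0$, and $\|\mathcal L_{S_n}\cdots\mathcal L_{S_1}b\|_{\mathcal B_i}\le C_*\vartheta^n\|b\|_{\mathcal B_i}+K\|b\|_{\mathcal B_{i-1}}$ for $b\in\mathcal B_i$, $1\le i\le3$; 6. for all $n\ge\bar n$, $S_1,\dots,S_n\in\mathcal T$ and $1\le i\le3$, the operator norm of $\mathcal L_{S_n}\cdots\mathcal L_{S_1}$ restricted to $\mathbb V\cap\mathcal B_i$ (with the norm of $\mathcal B_i$) is less than $\vartheta^n$. Let $d_w$ be a metric metrizing the weak topology on the space of Borel probability measures on $\mathbb T^d$. A Borel probability measure $h$ is *invariant* (for $\nu$) if $(T_{\nu,h})_*h=h$. An invariant $h$ is *visible*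 if there is a probability density $g\in C^\infty(\mathbb T^d)$ (so $g\ge0$, $\int g=1$) with $d_w(\widetilde{\mathcal L}_\nu^n(g),h)\to0$. An invariant $h$ is *physical* if there is a non-empty set $\mathcal A\subset C^\infty(\mathbb T^d,[0,\infty))\setminus\{0\}$, open in the (relative) $C^\infty$ topology, such that $\sup_{\mu\in\mathcal M_{\mathcal A}}d_w(\widetilde{\mathcal L}_\nu^n(\mu),h)\to0$ as $n\to\infty$, where $\mathcal M_{\mathcal A}$ is the set of probability measures with densities $g/\int g$, $g\in\mathcal A$. **Theorem.** Let $\nu\in[0,\nu_*]$ and let $h$ be a visible invariant measure. Then $h\in\mathcal B_3$. Moreover, $\widetilde{\mathcal L}_\nu$ has at $h$ the Gâteaux differential $\mathcal D_h\in L(\mathcal B_1,\mathcal B_1)$, $$\mathcal D_h(\phi)=\mathcal L_{T_{\nu,h}}\phi-\nu\,\operatorname{div}\big(\mathcal L_{T_{\nu,h}}(\beta h)\big)\int\alpha\phi,\qquad \operatorname{div}\big(\mathcal L_{T_{\nu,h}}(\beta h)\big)=\sum_{k=1}^d\partial_{x_k}\mathcal L_{T_{\nu,h}}(\beta_kh),$$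 in the following sense: let $\mathcal E$ be the set of $f\in\mathcal B_1$ with $\int f=1$ and $\int\alpha f=\int\alpha\,d\mu$ for some Borel probability measure $\mu$ (so that $T_{\nu,f}=T_{\nu,\mu}\in\mathcal T$ and $\widetilde{\mathcal L}_\nu(f)\in\mathcal B_1$); then $h\in\mathcal E$ and, for each $\phi\in\mathbb V$, $0$ is a limit point of $\{t\neq0: h+t\phi\in\mathcal E\}$ and $t^{-1}\big(\widetilde{\mathcal L}_\nu(h+t\phi)-\widetilde{\mathcal L}_\nu(h)\big)\to\mathcal D_h(\phi)$ in $\mathcal B_1$ as $t\to0$ in this set. There is a unique $\Theta(1)\in\mathbb V$ with $(\mathrm{Id}-\mathcal L_{T_{\nu,h}})\Theta(1)=-\nu\operatorname{div}(\mathcal L_{T_{\nu,h}}(\beta h))$; put $\Xi(1)=\int\alpha\,\Theta(1)$. Let $\sigma(\mathcal D_h)\subset\mathbb C$ be the spectrum of (the complexification of) $\mathcal D_h$ on $\mathcal B_1$. If $\sigma(\mathcal D_h)\setminus\{1\}\subset\{z\in\mathbb C:|z|<\kappa\}$ for some $\kappa\in(0,1)$ and $\Xi(1)\ne1$, then $h$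 is physical. On the contrary, if there is $z_1\in\sigma(\mathcal D_h)$ with $|z_1|>1$, then $h$ is not physical. -/

import Mathlib

open MeasureTheory Filter Topology Set
open scoped ContDiff

namespace MeanField

/-! ### The torus, functions and maps of class `C^n` -/

/-- The torus `𝕋^d = (ℝ/ℤ)^d`. -/
abbrev Torus (d : ℕ) : Type := UnitAddTorus (Fin d)

/-- The covering projection `ℝ^d → 𝕋^d`. -/
def proj {d : ℕ} (x : Fin d → ℝ) : Torus d := fun k => (x k : UnitAddCircle)

/-- `f : 𝕋^d → ℝ` is of class `C^n`. -/
def IsCn {d : ℕ} (n : WithTop ℕ∞) (f : Torus d → ℝ) : Prop :=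
  ContDiff ℝ n (fun x : Fin d → ℝ => f (proj x))

/-- `S : 𝕋^d → 𝕋^d` is of class `C^n`: it has a lift `ℝ^d → ℝ^d` of class `C^n`. (Every continuous
self-map of the torus has a continuous lift.) -/
def IsCnMap {d : ℕ} (n : WithTop ℕ∞) (S : Torus d → Torus d) : Prop :=
  ∃ F : (Fin d → ℝ) → (Fin d → ℝ), ContDiff ℝ n F ∧ ∀ x, proj (F x) = S (proj x)

theorem proj_add {d : ℕ} (x y : Fin d → ℝ) : proj (x + y) = proj x + proj y := by
  funext k; simp [proj]

theorem proj_int {d : ℕ} (m : Fin d → ℤ) : proj (fun k => (m k : ℝ)) = (0 : Torus d) := by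
  funext k
  simp only [proj, Pi.zero_apply]
  exact (AddCircle.coe_eq_zero_iff (1 : ℝ)).2 ⟨m k, by simp⟩

theorem isOpenQuotientMap_proj (d : ℕ) : IsOpenQuotientMap (proj : (Fin d → ℝ) → Torus d) :=
  IsOpenQuotientMap.piMap (fun _ => QuotientAddGroup.isOpenQuotientMap_mk)

theorem IsCnMap.continuous {d : ℕ} {n : WithTop ℕ∞} {S : Torus d → Torus d} (hS : IsCnMap n S) :
    Continuous S := by
  obtain ⟨F, hF, h⟩ := hS
  rw [(isOpenQuotientMap_proj d).isQuotientMap.continuous_iff]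
  have : S ∘ proj = proj ∘ F := by funext x; exact (h x).symm
  rw [this]
  exact (isOpenQuotientMap_proj d).continuous.comp hF.continuous

theorem IsCn.comp {d : ℕ} {n : WithTop ℕ∞} {f : Torus d → ℝ} {S : Torus d → Torus d}
    (hf : IsCn n f) (hS : IsCnMap n S) : IsCn n (fun x => f (S x)) := by
  obtain ⟨F, hF, h⟩ := hS
  have : (fun x : Fin d → ℝ => f (S (proj x))) = (fun x => f (proj x)) ∘ F := by
    funext x; simp [h x]
  unfold IsCn
  rw [this]
  exact ContDiff.comp hf hF

theorem IsCnMap.comp {d : ℕ} {n : WithTop ℕ∞} {S S' : Torus d → Torus d}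
    (hS : IsCnMap n S) (hS' : IsCnMap n S') : IsCnMap n (fun x => S (S' x)) := by
  obtain ⟨F, hF, h⟩ := hS
  obtain ⟨F', hF', h'⟩ := hS'
  exact ⟨F ∘ F', hF.comp hF', fun x => by simp [h, h']⟩

/-- The `C^k` norm `∑_{j ≤ k} sup_x ‖D^j f(x)‖` of a function on the torus of class `C^k`. -/
noncomputable def crNorm {d : ℕ} (k : ℕ) (f : Torus d → ℝ) : ℝ :=
  ∑ j ∈ Finset.range (k + 1),
    ⨆ x : Fin d → ℝ, ‖iteratedFDeriv ℝ j (fun y : Fin d → ℝ => f (proj y)) x‖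

theorem bddAbove_iteratedFDeriv {d : ℕ} {n : WithTop ℕ∞} {f : Torus d → ℝ} (hf : IsCn n f) {j : ℕ}
    (hj : (j : WithTop ℕ∞) ≤ n) :
    BddAbove (range fun x : Fin d → ℝ =>
      ‖iteratedFDeriv ℝ j (fun y : Fin d → ℝ => f (proj y)) x‖) := by
  have hc : Continuous fun x : Fin d → ℝ =>
      ‖iteratedFDeriv ℝ j (fun y : Fin d → ℝ => f (proj y)) x‖ :=
    (ContDiff.continuous_iteratedFDeriv hj hf).norm
  obtain ⟨M, hM⟩ := (isCompact_Icc (a := (0 : Fin d → ℝ)) (b := 1)).bddAbove_image hc.continuousOn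
  refine ⟨M, ?_⟩
  rintro _ ⟨x, rfl⟩
  let m : Fin d → ℝ := fun k => ((⌊x k⌋ : ℤ) : ℝ)
  have hper : (fun y : Fin d → ℝ => f (proj (y + m))) = fun y => f (proj y) := by
    funext y
    rw [proj_add, show proj m = (0 : Torus d) from proj_int _, add_zero]
  have h1 := iteratedFDeriv_comp_add_right (𝕜 := ℝ) (f := fun y : Fin d → ℝ => f (proj y)) j m (x - m)
  rw [hper, sub_add_cancel] at h1
  refine hM ⟨x - m, ⟨fun k => ?_, fun k => ?_⟩, by simp only [h1]⟩
  · simp only [Pi.zero_apply, Pi.sub_apply, m]; exact sub_nonneg.2 (Int.floor_le _)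
  · simp only [Pi.one_apply, Pi.sub_apply, m]
    have := (Int.lt_floor_add_one (x k)).le
    linarith

/-- The linear space of functions of class `C^r` on the torus. -/
def crSubmodule (d r : ℕ) : Submodule ℝ (Torus d → ℝ) where
  carrier := {f | IsCn (r : WithTop ℕ∞) f}
  add_mem' := fun {f g} hf hg => by
    have hf' : ContDiff ℝ (r : WithTop ℕ∞) (fun x : Fin d → ℝ => f (proj x)) := hf
    have hg' : ContDiff ℝ (r : WithTop ℕ∞) (fun x : Fin d → ℝ => g (proj x)) := hg
    exact hf'.add hg'
  zero_mem' := show ContDiff ℝ (r : WithTop ℕ∞) (fun _ : Fin d → ℝ => (0 : ℝ)) from contDiff_const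
  smul_mem' := fun c f hf => by
    have hf' : ContDiff ℝ (r : WithTop ℕ∞) (fun x : Fin d → ℝ => f (proj x)) := hf
    exact contDiff_const.smul hf'

/-- The normed space `C^r(𝕋^d, ℝ)`. -/
def Cr (d r : ℕ) : Type := crSubmodule d r

namespace Cr

variable {d r : ℕ}

instance : AddCommGroup (Cr d r) := inferInstanceAs (AddCommGroup (crSubmodule d r))

instance : Module ℝ (Cr d r) := inferInstanceAs (Module ℝ (crSubmodule d r))

instance : CoeFun (Cr d r) (fun _ => Torus d → ℝ) := ⟨fun f => f.1⟩

theorem isCn (f : Cr d r) : IsCn (r : WithTop ℕ∞) f := f.2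

theorem contDiffAt (f : Cr d r) {j : ℕ} (hj : j ∈ Finset.range (r + 1)) (x : Fin d → ℝ) :
    ContDiffAt ℝ (j : WithTop ℕ∞) (fun y : Fin d → ℝ => f (proj y)) x := by
  have h : ContDiff ℝ (r : WithTop ℕ∞) (fun y : Fin d → ℝ => f (proj y)) := f.2
  exact (h.of_le (by exact_mod_cast Nat.lt_succ_iff.1 (Finset.mem_range.1 hj))).contDiffAt

theorem bdd (f : Cr d r) {j : ℕ} (hj : j ∈ Finset.range (r + 1)) :
    BddAbove (range fun x : Fin d → ℝ =>
      ‖iteratedFDeriv ℝ j (fun y : Fin d → ℝ => f (proj y)) x‖) :=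
  bddAbove_iteratedFDeriv f.isCn (by exact_mod_cast Nat.lt_succ_iff.1 (Finset.mem_range.1 hj))

/-- The `C^r` norm on `C^r(𝕋^d, ℝ)`. -/
noncomputable def norm' (d r : ℕ) : AddGroupNorm (Cr d r) where
  toFun f := crNorm r f
  map_zero' := by
    refine Finset.sum_eq_zero fun j _ => ?_
    have : (fun y : Fin d → ℝ => (0 : Cr d r) (proj y)) = fun _ => (0 : ℝ) := rfl
    rw [this]
    simp
  add_le' f g := by
    unfold crNorm
    rw [← Finset.sum_add_distrib]
    refine Finset.sum_le_sum fun j hj => ciSup_le fun x => ?_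
    have h : (fun y : Fin d → ℝ => (f + g : Cr d r) (proj y)) =
        (fun y : Fin d → ℝ => f (proj y)) + fun y : Fin d → ℝ => g (proj y) := rfl
    rw [h, iteratedFDeriv_add_apply (f.contDiffAt hj x) (g.contDiffAt hj x)]
    exact (norm_add_le _ _).trans (add_le_add (le_ciSup (f.bdd hj) x) (le_ciSup (g.bdd hj) x))
  neg' f := by
    unfold crNorm
    have h : (fun y : Fin d → ℝ => (-f : Cr d r) (proj y)) =
        -(fun y : Fin d → ℝ => f (proj y)) := rfl
    simp [h, iteratedFDeriv_neg_apply]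
  eq_zero_of_map_eq_zero' f hf := by
    have hnn : ∀ j ∈ Finset.range (r + 1), 0 ≤ ⨆ x : Fin d → ℝ,
        ‖iteratedFDeriv ℝ j (fun y : Fin d → ℝ => f (proj y)) x‖ :=
      fun j _ => Real.iSup_nonneg fun x => norm_nonneg _
    have h0 := (Finset.sum_eq_zero_iff_of_nonneg hnn).1 hf 0 (by simp)
    apply Subtype.ext
    funext z
    obtain ⟨x, rfl⟩ := (isOpenQuotientMap_proj d).surjective z
    have := le_ciSup (f.bdd (j := 0) (by simp)) x
    rw [h0, norm_iteratedFDeriv_zero] at this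
    exact norm_le_zero_iff.1 this

noncomputable instance : NormedAddCommGroup (Cr d r) := (norm' d r).toNormedAddCommGroup

theorem norm_def (f : Cr d r) : ‖f‖ = crNorm r f := rfl

noncomputable instance : NormedSpace ℝ (Cr d r) where
  norm_smul_le c f := by
    rw [norm_def, norm_def]
    unfold crNorm
    rw [Finset.mul_sum]
    refine Finset.sum_le_sum fun j hj => ciSup_le fun x => ?_
    have h : (fun y : Fin d → ℝ => (c • f : Cr d r) (proj y)) =
        c • (fun y : Fin d → ℝ => f (proj y)) := rfl
    rw [h, iteratedFDeriv_const_smul_apply (f.contDiffAt hj x), norm_smul]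
    exact mul_le_mul_of_nonneg_left (le_ciSup (f.bdd hj) x) (norm_nonneg _)

end Cr

/-- The dual space `C^r(𝕋^d, ℝ)'`. -/
abbrev Dist (d r : ℕ) : Type := Cr d r →L[ℝ] ℝ

/-- The constant function `1` in `C^r`. -/
def oneCr (d r : ℕ) : Cr d r := 
  ⟨fun _ => 1,
    show ContDiff ℝ (r : WithTop ℕ∞) (fun _ : Fin d → ℝ => (1 : ℝ)) from contDiff_const⟩

/-- `C^∞(𝕋^d, ℝ)`. -/
def Smooth (d : ℕ) : Type := {f : Torus d → ℝ // IsCn ∞ f}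

namespace Smooth

variable {d : ℕ}

instance : CoeFun (Smooth d) (fun _ => Torus d → ℝ) := ⟨fun f => f.1⟩

/-- The inclusion `C^∞ ⊂ C^r`. -/
def toCr (r : ℕ) (f : Smooth d) : Cr d r :=
  ⟨f.1, by
    have hf : ContDiff ℝ ∞ (fun x : Fin d → ℝ => f (proj x)) := f.2
    have h' : ContDiff ℝ (r : WithTop ℕ∞) (fun x : Fin d → ℝ => f (proj x)) :=
      hf.of_le (by exact_mod_cast le_top)
    exact h'⟩

/-- The product of a smooth function and a `C^r` function. -/
def mulCr {r : ℕ} (a : Smooth d) (f : Cr d r) : Cr d r :=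
  ⟨fun x => a x * f x, by
    have ha : ContDiff ℝ (r : WithTop ℕ∞) (fun x : Fin d → ℝ => a (proj x)) := (a.toCr r).isCn
    have hf : ContDiff ℝ (r : WithTop ℕ∞) (fun x : Fin d → ℝ => f (proj x)) := f.isCn
    exact ha.mul hf⟩

theorem hasDerivAt_line (f : Smooth d) (x : Fin d → ℝ) (k : Fin d) :
    HasDerivAt (fun t : ℝ => f (proj x + proj (t • Pi.single k 1)))
      (fderiv ℝ (fun y : Fin d → ℝ => f (proj y)) x (Pi.single k 1)) 0 := by
  have hf : ContDiff ℝ ∞ (fun y : Fin d → ℝ => f (proj y)) := f.2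
  have hd : DifferentiableAt ℝ (fun y : Fin d → ℝ => f (proj y)) x :=
    (hf.differentiable (by simp)).differentiableAt
  have := hd.hasFDerivAt.hasLineDerivAt (Pi.single k (1 : ℝ))
  unfold HasLineDerivAt at this
  simpa only [proj_add] using this

/-- The partial derivative `∂_{x_k} f` of a smooth function on the torus. -/
noncomputable def partialDeriv (k : Fin d) (f : Smooth d) : Smooth d :=
  ⟨fun x => deriv (fun t : ℝ => f (x + proj (t • Pi.single k 1))) 0, by
    have hf : ContDiff ℝ ∞ (fun y : Fin d → ℝ => f (proj y)) := f.2
    have : (fun x : Fin d → ℝ =>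
        deriv (fun t : ℝ => f (proj x + proj (t • Pi.single k 1))) 0) =
        fun x => fderiv ℝ (fun y : Fin d → ℝ => f (proj y)) x (Pi.single k 1) := by
      funext x
      exact (f.hasDerivAt_line x k).deriv
    unfold IsCn
    rw [this]
    exact (hf.fderiv_right (m := ∞) (by simp)).clm_apply contDiff_const⟩

end Smooth

/-- The maps `𝕋^d → 𝕋^d` of class `C^r`. -/
def CrMap (d r : ℕ) : Type := {S : Torus d → Torus d // IsCnMap (r : WithTop ℕ∞) S}

namespace CrMap

variable {d r : ℕ}

instance : CoeFun (CrMap d r) (fun _ => Torus d → Torus d) := ⟨fun S => S.1⟩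

/-- Composition `S ∘ S'`. -/
def comp (S S' : CrMap d r) : CrMap d r := ⟨fun x => S (S' x), S.2.comp S'.2⟩

/-- `f ∘ S`, for `f` of class `C^r`. -/
def pullback (S : CrMap d r) (f : Cr d r) : Cr d r := ⟨fun x => f (S x), f.isCn.comp S.2⟩

end CrMap

/-! ### Mean field coupled maps -/

/-- The data of a mean field coupled map: `T ∈ C^∞(𝕋^d, 𝕋^d)`, `α ∈ C^∞(𝕋^d, ℝ)` and
`β ∈ C^∞(𝕋^d, ℝ^d)`, the latter given by its components. -/
structure CoupledSystem (d : ℕ) where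
  T : Torus d → Torus d
  T_smooth : IsCnMap ∞ T
  α : Smooth d
  β : Fin d → Smooth d

namespace CoupledSystem

variable {d : ℕ} (F : CoupledSystem d)

/-- The map `x ↦ T(x) + ν β(x) c mod 1`; the map `T_{ν,h}` is the one with `c = h(α)`. -/
def coupled (ν c : ℝ) (x : Torus d) : Torus d :=
  F.T x + proj (fun k => ν * F.β k x * c)

theorem coupled_smooth (ν c : ℝ) : IsCnMap ∞ (F.coupled ν c) := by
  obtain ⟨G, hG, h⟩ := F.T_smooth
  refine ⟨fun x => G x + fun k => ν * F.β k (proj x) * c, hG.add ?_, fun x => ?_⟩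
  · refine contDiff_pi.2 fun k => ?_
    exact (contDiff_const.mul (F.β k).2).mul contDiff_const
  · rw [proj_add, h]; rfl

/-- `T_{ν,h}` with `c = h(α)`, as a map of class `C^r`. -/
def coupledMap (r : ℕ) (ν c : ℝ) : CrMap d r :=
  ⟨F.coupled ν c, by
    obtain ⟨G, hG, h⟩ := F.coupled_smooth ν c
    exact ⟨G, hG.of_le (by exact_mod_cast le_top), h⟩⟩

/-- The mean `∫ α dμ` for a probability measure `μ`. -/
noncomputable def meanα (μ : ProbabilityMeasure (Torus d)) : ℝ :=
  ∫ x, F.α x ∂(μ : Measure (Torus d))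

/-- The nonlinear transfer operator on probability measures, `μ ↦ (T_{ν,μ})_* μ`. -/
noncomputable def push (ν : ℝ) (μ : ProbabilityMeasure (Torus d)) :
    ProbabilityMeasure (Torus d) :=
  μ.map (f := F.coupled ν (F.meanα μ)) (F.coupled_smooth ν _).continuous.aemeasurable

/-- `h` is an invariant measure: `(T_{ν,h})_* h = h`. -/
def IsInvariant (ν : ℝ) (h : ProbabilityMeasure (Torus d)) : Prop := F.push ν h = h

end CoupledSystem

/-! ### Visible and physical measures -/

/-- A metric on `X` that metrizes its topology. -/
structure CompatibleMetric (X : Type*) [TopologicalSpace X] where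
  dist : X → X → ℝ
  dist_self : ∀ x, dist x x = 0
  eq_of_dist_eq_zero : ∀ x y, dist x y = 0 → x = y
  dist_comm : ∀ x y, dist x y = dist y x
  dist_triangle : ∀ x y z, dist x z ≤ dist x y + dist y z
  nhds_basis : ∀ x, (𝓝 x).HasBasis (fun ε : ℝ => 0 < ε) (fun ε => {y | dist y x < ε})

/-- `μ` is absolutely continuous with density `ρ ≥ 0` with respect to Lebesgue measure. -/
def HasDensity {d : ℕ} (μ : ProbabilityMeasure (Torus d)) (ρ : Torus d → ℝ) : Prop :=
  (μ : Measure (Torus d)) = (volume : Measure (Torus d)).withDensity (fun x => ENNReal.ofReal (ρ x))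

/-- `h` is visible: it is invariant and is the weak limit of the orbit of a probability measure
with a smooth density. -/
def IsVisible {d : ℕ} (dw : CompatibleMetric (ProbabilityMeasure (Torus d)))
    (F : CoupledSystem d) (ν : ℝ) (h : ProbabilityMeasure (Torus d)) : Prop :=
  F.IsInvariant ν h ∧
    ∃ (g : Smooth d) (μ : ProbabilityMeasure (Torus d)), (∀ x, 0 ≤ g x) ∧ HasDensity μ g ∧
      Tendsto (fun n : ℕ => dw.dist ((F.push ν)^[n] μ) h) atTop (𝓝 0)

/-- `C^∞(𝕋^d, ℝ_+) ∖ {0}`. -/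
def nonnegSmooth (d : ℕ) : Set (Smooth d) := {g | (∀ x, 0 ≤ g x) ∧ ∃ x, g x ≠ 0}

/-- `A ⊂ C^∞(𝕋^d, ℝ_+) ∖ {0}` is open in the `C^∞` topology (the one given by all `C^k` norms). -/
def IsOpenFamily {d : ℕ} (A : Set (Smooth d)) : Prop :=
  A ⊆ nonnegSmooth d ∧
    ∀ g ∈ A, ∃ (k : ℕ) (ε : ℝ), 0 < ε ∧
      ∀ g' ∈ nonnegSmooth d, crNorm k (fun x => g' x - g x) < ε → g' ∈ A

/-- The set `M_A` of the probability measures with density `g / ∫ g`, `g ∈ A`. -/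
def normalizedMeasures {d : ℕ} (A : Set (Smooth d)) : Set (ProbabilityMeasure (Torus d)) :=
  {μ | ∃ g ∈ A, HasDensity μ (fun x => g x / ∫ y, g y)}

/-- `h` is physical: it is invariant and it attracts, uniformly in the weak topology, the measures
whose densities are in some non-empty open set of smooth densities. -/
def IsPhysical {d : ℕ} (dw : CompatibleMetric (ProbabilityMeasure (Torus d)))
    (F : CoupledSystem d) (ν : ℝ) (h : ProbabilityMeasure (Torus d)) : Prop :=
  F.IsInvariant ν h ∧
    ∃ A : Set (Smooth d), A.Nonempty ∧ IsOpenFamily A ∧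
      Tendsto (fun n : ℕ => ⨆ μ ∈ normalizedMeasures A, ENNReal.ofReal (dw.dist ((F.push ν)^[n] μ) h))
        atTop (𝓝 0)

/-! ### The scale of Banach spaces -/

universe u

/-- A scale `B_0 ⊃ B_1 ⊃ B_2 ⊃ B_3` of spaces of distributions on the torus, on which the
transfer operators of the maps in `𝒯`, the partial derivatives, and the multiplications by smooth
functions act as bounded operators. All the maps below are determined by the embeddings `J i`. -/
structure BanachScale {d : ℕ} (r : ℕ) (𝒯 : Set (CrMap d r)) (B : Fin 4 → Type u)
    [∀ i, NormedAddCommGroup (B i)] [∀ i, NormedSpace ℝ (B i)] where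
  /-- The embedding `B_i ⊂ C^r(𝕋^d, ℝ)'`. -/
  J : ∀ i, B i →L[ℝ] Dist d r
  J_injective : ∀ i, Function.Injective (J i)
  /-- The inclusion `B_{i+1} ⊂ B_i`. -/
  incl : ∀ i : Fin 3, B i.succ →L[ℝ] B i.castSucc
  J_incl : ∀ (i : Fin 3) (b : B i.succ), J i.castSucc (incl i b) = J i.succ b
  norm_incl_le : ∀ (i : Fin 3) (b : B i.succ), ‖incl i b‖ ≤ ‖b‖
  /-- The inclusion `C^r(𝕋^d, ℝ) ⊂ B_i`, where a function is identified with the distribution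
  `φ ↦ ∫ f φ`. -/
  emb : ∀ i, Cr d r →L[ℝ] B i
  J_emb : ∀ (i : Fin 4) (f φ : Cr d r), J i (emb i f) φ = ∫ x, f x * φ x
  dense_emb : ∀ i, DenseRange (emb i)
  /-- `C^r` is dense in the dual of `B_i`, `φ` being identified with `b ↦ ∫ φ b`. -/
  dense_dual : ∀ i, DenseRange (fun φ : Cr d r => (J i).flip φ)
  /-- The transfer operators `ℒ_S ∈ L(B_i, B_i)`: `∫ φ ℒ_S b = ∫ (φ ∘ S) b`. -/
  L : 𝒯 → ∀ i, B i →L[ℝ] B i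
  J_L : ∀ (S : 𝒯) (i : Fin 4) (b : B i) (φ : Cr d r),
    J i (L S i b) φ = J i b (CrMap.pullback (S : CrMap d r) φ)
  /-- The partial derivatives `∂_{x_k} ∈ L(B_{i+1}, B_i)`. -/
  D : Fin d → ∀ i : Fin 3, B i.succ →L[ℝ] B i.castSucc
  J_D : ∀ (k : Fin d) (i : Fin 3) (b : B i.succ) (φ : Smooth d),
    J i.castSucc (D k i b) (φ.toCr r) = -J i.succ b ((φ.partialDeriv k).toCr r)
  /-- The multiplication by a smooth function: `∫ φ (a b) = ∫ (a φ) b`. -/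
  mul : Smooth d → ∀ i, B i →L[ℝ] B i
  J_mul : ∀ (a : Smooth d) (i : Fin 4) (b : B i) (φ : Cr d r),
    J i (mul a i b) φ = J i b (a.mulCr φ)

namespace BanachScale

variable {d r : ℕ} {𝒯 : Set (CrMap d r)} {B : Fin 4 → Type u}
  [∀ i, NormedAddCommGroup (B i)] [∀ i, NormedSpace ℝ (B i)] (X : BanachScale r 𝒯 B)

/-- `∫ b`. -/
noncomputable def integral (i : Fin 4) : B i →L[ℝ] ℝ := (X.J i).flip (oneCr d r)

/-- `∫ a b`, for a smooth function `a`. -/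
noncomputable def pair (a : Smooth d) (i : Fin 4) : B i →L[ℝ] ℝ := (X.J i).flip (a.toCr r)

/-- The composition of the transfer operators of a list of maps in `𝒯`. -/
noncomputable def Lprod (l : List 𝒯) (i : Fin 4) : B i →L[ℝ] B i :=
  (l.map fun S => X.L S i).prod

/-- `b ∈ B_i` is the measure `μ`, that is, `∫ φ b = ∫ φ dμ` for all `φ`. -/
def Represents (i : Fin 4) (b : B i) (μ : ProbabilityMeasure (Torus d)) : Prop :=
  ∀ φ : Cr d r, X.J i b φ = ∫ x, φ x ∂(μ : Measure (Torus d))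

/-- The quantitative assumptions on the scale: bounds for the multiplication operators and for the
integral, compact inclusions, uniform Lasota–Yorke inequalities, and uniform contraction on
zero average elements. (A bound by a Hölder norm `C^s`, `s` not an integer, is a particular case
of the bound by the norm `C^⌈s⌉`, so integer exponents are general.) -/
structure Admissible : Prop where
  compact_incl : ∀ i : Fin 3, IsCompact (closure (X.incl i '' Metric.ball 0 1))
  bounds : ∃ (K Cs θ : ℝ) (cbar chat nbar : ℕ), 1 ≤ K ∧ 1 ≤ Cs ∧ 0 < θ ∧ θ < 1 ∧
    (∀ (a : Smooth d) (i : Fin 4) (b : B i),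
      ‖X.mul a i b‖ ≤ Cs * crNorm (cbar * (i : ℕ) + chat) a * ‖b‖) ∧
    (∀ b : B 0, |X.integral 0 b| ≤ Cs * ‖b‖) ∧
    (∀ (l : List 𝒯) (b : B 0), ‖X.Lprod l 0 b‖ ≤ Cs * ‖b‖) ∧
    (∀ (l : List 𝒯) (i : Fin 3) (b : B i.succ),
      ‖X.Lprod l i.succ b‖ ≤ Cs * θ ^ l.length * ‖b‖ + K * ‖X.incl i b‖) ∧
    (∀ l : List 𝒯, nbar ≤ l.length → ∀ i : Fin 3, ∃ q : ℝ, q < θ ^ l.length ∧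
      ∀ b : B i.succ, X.integral i.succ b = 0 → ‖X.Lprod l i.succ b‖ ≤ q * ‖b‖)

/-- `div(ℒ_S (β b)) = ∑_k ∂_{x_k} ℒ_S (β_k b) ∈ B_2`, for `b ∈ B_3`. -/
noncomputable def divL (β : Fin d → Smooth d) (S : 𝒯) (b : B 3) : B 2 :=
  ∑ k, X.D k 2 (X.L S 3 (X.mul (β k) 3 b))

/-- `div(ℒ_S (β b))` as an element of `B_1`. -/
noncomputable def divL1 (β : Fin d → Smooth d) (S : 𝒯) (b : B 3) : B 1 :=
  X.incl 1 (X.divL β S b)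

/-- The operator `φ ↦ ℒ_S φ - ν div(ℒ_S (β b)) ∫ α φ` on `B_1`. -/
noncomputable def linearized (F : CoupledSystem d) (ν : ℝ) (S : 𝒯) (b : B 3) : B 1 →L[ℝ] B 1 :=
  X.L S 1 - ν • (X.pair F.α 1).smulRight (X.divL1 F.β S b)

/-- `Θ = -ν (Id - ℒ_S)⁻¹ div(ℒ_S (β b))`, the inverse being the one on the zero average
elements of `B_1`. -/
def IsTheta (F : CoupledSystem d) (ν : ℝ) (S : 𝒯) (b : B 3) (Θ : B 1) : Prop :=
  X.integral 1 Θ = 0 ∧ Θ - X.L S 1 Θ = -(ν • X.divL1 F.β S b)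

open Classical in
/-- The nonlinear transfer operator `f ↦ ℒ_{T_{ν,f}} f` on `B_1`, for `T_{ν,f} ∈ 𝒯`. -/
noncomputable def nonlinear (F : CoupledSystem d) (ν : ℝ) (f : B 1) : B 1 :=
  if hf : F.coupledMap r ν (X.pair F.α 1 f) ∈ 𝒯 then X.L ⟨_, hf⟩ 1 f else 0

/-- The `f ∈ B_1` with `∫ f = 1` such that `∫ α f` is the mean of `α` with respect to some
probability measure `μ`, so that `T_{ν,f} = T_{ν,μ}`. -/
def nonlinearDomain (F : CoupledSystem d) : Set (B 1) :=
  {f | X.integral 1 f = 1 ∧ ∃ μ : ProbabilityMeasure (Torus d), X.pair F.α 1 f = F.meanα μ}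

end BanachScale

/-- `A` is the Gâteaux differential at `x`, with respect to directions in `V`, of the function `G`
with domain `s`. For each direction `v`, `0` is required to be a limit point of the `t ≠ 0` such
that `x + t v ∈ s`, so that the derivative in the direction `v` is unique. -/
def HasGateauxDifferential {E E' : Type*} [NormedAddCommGroup E] [NormedSpace ℝ E]
    [NormedAddCommGroup E'] [NormedSpace ℝ E'] (G : E → E') (s V : Set E) (A : E →L[ℝ] E')
    (x : E) : Prop :=
  x ∈ s ∧ ∀ v ∈ V, (𝓝[{t : ℝ | t ≠ 0 ∧ x + t • v ∈ s}] (0 : ℝ)).NeBot ∧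
    Tendsto (fun t : ℝ => t⁻¹ • (G (x + t • v) - G x))
      (𝓝[{t : ℝ | t ≠ 0 ∧ x + t • v ∈ s}] (0 : ℝ)) (𝓝 (A v))

/-- `z - A` on the complexification `E ⊕ iE` of `E`. -/
noncomputable def complexShift {E : Type*} [NormedAddCommGroup E] [NormedSpace ℝ E]
    (A : E →L[ℝ] E) (z : ℂ) : (E × E) →L[ℝ] (E × E) :=
  let u := ContinuousLinearMap.fst ℝ E E
  let v := ContinuousLinearMap.snd ℝ E E
  (z.re • u - z.im • v - A.comp u).prod (z.im • u + z.re • v - A.comp v)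

/-- The (complex) spectrum of a bounded operator on a real Banach space. -/
def complexSpectrum {E : Type*} [NormedAddCommGroup E] [NormedSpace ℝ E]
    (A : E →L[ℝ] E) : Set ℂ :=
  {z | ¬ IsUnit (complexShift A z)}

end MeanField

/-!
The operators are encoded as a `Core`: the transfer operators `L c` of `T + c ν β`, their derivatives
`W c` in `c`, and the functionals `I f = ∫ f`, `a f = ∫ α f`; the nonlinear operator is
`f ↦ L (a f) f`. Its linearization at `h` is `L + a(·) W h` (with `L = L (a h)`, `W = W (a h)`), a
rank one perturbation of an operator whose powers contract `𝕍` exponentially. The points `z` of its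
spectrum with `|z| > 1` are the reciprocals of the zeros of the characteristic function
`1 - ∑ j, a (L^j W h) z^(j+1)` in the open unit disc; zeros on the unit circle give eigenvalues too,
and the value at `1` is `1 - Ξ(1)`. That `h` lies in `B 3` follows from
the Lasota–Yorke inequalities, compactness, and uniqueness of the fixed point (`exists_represents`).

*Stability.* Without zeros in the closed unit disc the solutions of the renewal equation of the
linearization decay (`renewal_decay`), so `h` is exponentially attracting (`exists_attraction`).
Compactness and continuity carry this over to a neighbourhood of the visible density.

*Instability.* No invariant manifolds are used. A zero in the open unit disc gives a geometrically
decaying solution of the dual of the renewal equation for the difference of two attracted orbits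
(`exists_dual_sequence`). Pairing it with this difference shows that, for an open set of initial
densities, a convergent combination of the functionals `a ∘ L (c n) ⋯ L (c 0)` is a multiple of `I`
(`exists_relation`). Its tail provides `κ` with `κ ∘ L c = a - c I` and `κ (W c b) = -1` along the
orbits (`exists_conormal`). Such a `κ` is bounded by the total variation, and since the maps are
surjective it is determined by `κ ∘ L c`; so it depends only on `c`. Counting ranks, either the
orbits can be moved so as to give a curve of such functionals, or the linearizations are
nondegenerate (`exists_nondeg_or_curve`), and then the equations can be read pointwise near points
where `T + c ν β` is a local diffeomorphism. Critical values are dealt with by a Sard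
argument (`sub_le_of_regular`). The outcome (`exists_hasCurve_or_const`) is a curve of solutions of
`K t ∘ L (c + t) = a - (c + t) I` with `K' 0` proportional to `K 0`, or that `α` is constant. On
absolutely continuous probability measures `K t` takes values between the infimum and the supremum
of `α - (c + t)` over regular points, and both move with the same speed, whereas `K' 0 = l K 0`
scales them; so they coincide and `α` is constant after all (`const_of_hasCurve`). But for constant
`α` the characteristic function is `1` and has no zeros.
-/

namespace MeanField

universe u v

/-! ### Calculus on the torus -/

section TorusBasics

variable {d : ℕ}

lemma continuous_proj : Continuous (proj : (Fin d → ℝ) → Torus d) :=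
  (isOpenQuotientMap_proj d).continuous

lemma proj_surjective (z : Torus d) : ∃ x, proj x = z := (isOpenQuotientMap_proj d).surjective z

lemma proj_add_int (x : Fin d → ℝ) (m : Fin d → ℤ) : proj (x + fun k => (m k : ℝ)) = proj x := by
  rw [proj_add, proj_int, add_zero]

lemma proj_eq_iff {x y : Fin d → ℝ} :
    proj x = proj y ↔ ∃ m : Fin d → ℤ, x = y + fun k => (m k : ℝ) := by
  constructor
  · intro h
    have h' : ∀ k, ∃ m : ℤ, x k = y k + m := by
      intro k
      have hk : ((x k : UnitAddCircle)) = (y k : UnitAddCircle) := congrFun h k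
      have h0 : ((x k - y k : ℝ) : UnitAddCircle) = 0 := by rw [AddCircle.coe_sub, hk, sub_self]
      obtain ⟨m, hm⟩ := (AddCircle.coe_eq_zero_iff (1 : ℝ)).1 h0
      exact ⟨m, by simp at hm; linarith⟩
    choose m hm using h'
    exact ⟨m, funext hm⟩
  · rintro ⟨m, rfl⟩
    exact proj_add_int y m

lemma continuous_of_comp_proj {Y : Type*} [TopologicalSpace Y] {f : Torus d → Y}
    (h : Continuous fun x => f (proj x)) : Continuous f :=
  (isOpenQuotientMap_proj d).isQuotientMap.continuous_iff.2 h

lemma IsCn.continuous {n : WithTop ℕ∞} {f : Torus d → ℝ} (hf : IsCn n f) : Continuous f :=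
  continuous_of_comp_proj (ContDiff.continuous hf)

lemma Smooth.continuous (f : Smooth d) : Continuous f := f.2.continuous

lemma Cr.continuous {r : ℕ} (f : Cr d r) : Continuous f := f.isCn.continuous

lemma integrable_of_continuous {f : Torus d → ℝ} (hf : Continuous f)
    (μ : Measure (Torus d)) [IsFiniteMeasure μ] : Integrable f μ :=
  hf.integrable_of_hasCompactSupport (HasCompactSupport.of_compactSpace f)

lemma exists_bound {E : Type*} [NormedAddCommGroup E] {f : Torus d → E} (hf : Continuous f) :
    ∃ M, 0 ≤ M ∧ ∀ x, ‖f x‖ ≤ M := by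
  obtain ⟨M, hM⟩ := isCompact_univ.exists_bound_of_continuousOn (f := f) hf.continuousOn
  exact ⟨max M 0, le_max_right _ _, fun x => (hM x trivial).trans (le_max_left _ _)⟩

/-- A function on `ℝ^d` that is `ℤ^d`-periodic descends to the torus. -/
lemma exists_descend {Y : Type*} {g : (Fin d → ℝ) → Y}
    (hg : ∀ (x : Fin d → ℝ) (m : Fin d → ℤ), g (x + fun k => (m k : ℝ)) = g x) :
    ∃ f : Torus d → Y, ∀ x, f (proj x) = g x := by
  choose s hs using proj_surjective (d := d)
  refine ⟨fun z => g (s z), fun x => ?_⟩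
  obtain ⟨m, hm⟩ := proj_eq_iff.1 (hs (proj x))
  simp only [hm, hg]

end TorusBasics

section Mollification

variable {d : ℕ} {E : Type*} [NormedAddCommGroup E] [NormedSpace ℝ E] {φ : (Fin d → ℝ) → ℝ} {δ : ℝ}
  {g : (Fin d → ℝ) → E}

/-- The average of the translates of `g` with weight `φ`. -/
noncomputable def mollify (φ : (Fin d → ℝ) → ℝ) (g : (Fin d → ℝ) → E) (x : Fin d → ℝ) : E :=
  ∫ y, φ y • g (x - y)

/-- `g` is `ℤ^d`-periodic. -/
def IsPeriodic {Y : Type*} (g : (Fin d → ℝ) → Y) : Prop :=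
  ∀ (x : Fin d → ℝ) (m : Fin d → ℤ), g (x + fun k => (m k : ℝ)) = g x

lemma IsPeriodic.exists_mem_Icc {Y : Type*} {g : (Fin d → ℝ) → Y} (hg : IsPeriodic g)
    (x : Fin d → ℝ) : ∃ z ∈ Icc (0 : Fin d → ℝ) 1, ∀ y, g (x - y) = g (z - y) := by
  refine ⟨fun k => Int.fract (x k), ⟨fun k => Int.fract_nonneg _, fun k => (Int.fract_lt_one _).le⟩,
    fun y => ?_⟩
  have := hg ((fun k => Int.fract (x k)) - y) (fun k => ⌊x k⌋)
  rw [← this]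
  congr 1
  funext k
  have := Int.fract_add_floor (x k)
  simp only [Pi.sub_apply, Pi.add_apply]
  linarith

lemma IsPeriodic.exists_bound {E : Type*} [NormedAddCommGroup E] {g : (Fin d → ℝ) → E}
    (hg : IsPeriodic g) (hc : Continuous g) : ∃ M, 0 ≤ M ∧ ∀ x, ‖g x‖ ≤ M := by
  obtain ⟨M, hM⟩ := (isCompact_Icc (a := (0 : Fin d → ℝ)) (b := 1)).exists_bound_of_continuousOn
    (f := g) hc.continuousOn
  refine ⟨max M 0, le_max_right _ _, fun x => ?_⟩
  obtain ⟨z, hz, h⟩ := hg.exists_mem_Icc x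
  have := h 0
  rw [sub_zero, sub_zero] at this
  rw [this]
  exact (hM z hz).trans (le_max_left _ _)

lemma IsPeriodic.uniform {E : Type*} [NormedAddCommGroup E] {g : (Fin d → ℝ) → E}
    (hg : IsPeriodic g) (hc : Continuous g) {ε : ℝ} (hε : 0 < ε) :
    ∃ δ > 0, ∀ x y : Fin d → ℝ, ‖y‖ < δ → ‖g (x - y) - g x‖ ≤ ε := by
  have hK : IsCompact (Icc (-1 : Fin d → ℝ) 2) := isCompact_Icc
  have hu := hK.uniformContinuousOn_of_continuous (f := g) hc.continuousOn
  obtain ⟨δ, hδ, h⟩ := Metric.uniformContinuousOn_iff.1 hu ε hε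
  refine ⟨min δ 1, lt_min hδ one_pos, fun x y hy => ?_⟩
  obtain ⟨z, hz, hz'⟩ := hg.exists_mem_Icc x
  have h0 := hz' 0
  rw [sub_zero, sub_zero] at h0
  rw [hz' y, h0, ← dist_eq_norm]
  have hyk : ∀ k, |y k| < 1 := fun k =>
    (norm_le_pi_norm y k).trans_lt (hy.trans_le (min_le_right _ _))
  refine (h (z - y) ⟨fun k => ?_, fun k => ?_⟩ z ⟨fun k => ?_, fun k => ?_⟩ ?_).le
  · have := hz.1 k; have := abs_lt.1 (hyk k); simp at *; linarith
  · have := hz.2 k; have := abs_lt.1 (hyk k); simp at *; linarith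
  · have := hz.1 k; simp at *; linarith
  · have := hz.2 k; simp at *; linarith
  · rw [dist_eq_norm]; simpa using hy.trans_le (min_le_left _ _)

lemma IsPeriodic.fderiv (hg : IsPeriodic g) : IsPeriodic (fderiv ℝ g) := by
  intro x m
  have h1 : (fun y => g (y + fun k => (m k : ℝ))) = g := funext fun y => hg y m
  have h2 := fderiv_comp_add_right (𝕜 := ℝ) (f := g) (x := x) (fun k => (m k : ℝ))
  rw [h1] at h2
  exact h2.symm

/-- An approximate identity: a continuous probability density with support in the `δ`-ball. -/
structure IsKernel (φ : (Fin d → ℝ) → ℝ) (δ : ℝ) : Prop where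
  cont : Continuous φ
  nonneg : ∀ y, 0 ≤ φ y
  int_one : ∫ y, φ y = 1
  compact : HasCompactSupport φ
  small : ∀ y, φ y ≠ 0 → ‖y‖ < δ

lemma IsKernel.mono {δ' : ℝ} (h : IsKernel φ δ) (hδ : δ ≤ δ') :
    IsKernel φ δ' :=
  ⟨h.cont, h.nonneg, h.int_one, h.compact, fun y hy => (h.small y hy).trans_le hδ⟩

lemma IsKernel.integrable (h : IsKernel φ δ) : Integrable φ :=
  h.cont.integrable_of_hasCompactSupport h.compact

lemma IsKernel.integrable_smul (h : IsKernel φ δ) (hg : Continuous g)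
    (x : Fin d → ℝ) : Integrable fun y => φ y • g (x - y) := by
  refine Continuous.integrable_of_hasCompactSupport (h.cont.smul (hg.comp (by fun_prop))) ?_
  exact h.compact.smul_right

lemma mollify_close [CompleteSpace E] {ε : ℝ} (h : IsKernel φ δ) (hg : Continuous g)
    (hε : ∀ x y : Fin d → ℝ, ‖y‖ < δ → ‖g (x - y) - g x‖ ≤ ε) (x : Fin d → ℝ) :
    ‖mollify φ g x - g x‖ ≤ ε := by
  have h1 : mollify φ g x - g x = ∫ y, φ y • (g (x - y) - g x) := by
    simp_rw [smul_sub]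
    rw [integral_sub (h.integrable_smul hg x) (h.integrable.smul_const _), integral_smul_const,
      h.int_one, one_smul, mollify]
  rw [h1]
  refine (norm_integral_le_of_norm_le (h.integrable.mul_const ε) (ae_of_all _ fun y => ?_)).trans ?_
  · rw [norm_smul, Real.norm_of_nonneg (h.nonneg y)]
    by_cases hy : φ y = 0
    · simp [hy]
    · exact mul_le_mul_of_nonneg_left (hε x y (h.small y hy)) (h.nonneg y)
  · rw [integral_mul_const, h.int_one, one_mul]

lemma continuous_mollify (h : IsKernel φ δ) (hg : Continuous g)
    (hp : IsPeriodic g) : Continuous (mollify φ g) := by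
  obtain ⟨M, hM0, hM⟩ := hp.exists_bound hg
  refine continuous_of_dominated (bound := fun y => φ y * M)
    (fun x => (h.integrable_smul hg x).aestronglyMeasurable) (fun x => ae_of_all _ fun y => ?_)
    (h.integrable.mul_const _) (ae_of_all _ fun y => ?_)
  · rw [norm_smul, Real.norm_of_nonneg (h.nonneg y)]
    exact mul_le_mul_of_nonneg_left (hM _) (h.nonneg y)
  · fun_prop

lemma hasFDerivAt_mollify (h : IsKernel φ δ) (hg : ContDiff ℝ 1 g)
    (hp : IsPeriodic g) (x : Fin d → ℝ) :
    HasFDerivAt (mollify φ g) (mollify φ (fderiv ℝ g) x) x := by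
  have hc : Continuous (fderiv ℝ g) := hg.continuous_fderiv (by simp)
  obtain ⟨M, hM0, hM⟩ := hp.fderiv.exists_bound hc
  refine hasFDerivAt_integral_of_dominated_of_fderiv_le (bound := fun y => φ y * M) univ_mem
    (Eventually.of_forall fun x => (h.integrable_smul hg.continuous x).aestronglyMeasurable)
    (h.integrable_smul hg.continuous x)
    (F' := fun x y => φ y • fderiv ℝ g (x - y))
    (h.integrable_smul hc x).aestronglyMeasurable
    (ae_of_all _ fun y z _ => ?_) (h.integrable.mul_const _) (ae_of_all _ fun y z _ => ?_)
  · rw [norm_smul, Real.norm_of_nonneg (h.nonneg y)]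
    exact mul_le_mul_of_nonneg_left (hM _) (h.nonneg y)
  · have h1 : HasFDerivAt g (fderiv ℝ g (z - y)) (z - y) :=
      ((hg.differentiable (by simp)).differentiableAt).hasFDerivAt
    have h2 := h1.comp z ((hasFDerivAt_id z).sub_const y)
    exact h2.const_smul (φ y)

/-- Mollification approximates a periodic `C^j` function together with its derivatives of
order at most `j`. -/
lemma mollify_approx (j : ℕ) : ∀ {E : Type} [NormedAddCommGroup E] [NormedSpace ℝ E]
    [CompleteSpace E] {g : (Fin d → ℝ) → E}, ContDiff ℝ j g → IsPeriodic g → ∀ {ε : ℝ}, 0 < ε →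
    ∃ δ > 0, ∀ φ : (Fin d → ℝ) → ℝ, IsKernel φ δ → ContDiff ℝ j (mollify φ g) ∧
      ∀ i ≤ j, ∀ x, ‖iteratedFDeriv ℝ i (mollify φ g - g) x‖ ≤ ε := by
  induction j with
  | zero =>
    intro E _ _ _ g hg hp ε hε
    have hc : Continuous g := hg.continuous
    obtain ⟨δ, hδ, h⟩ := hp.uniform hc hε
    refine ⟨δ, hδ, fun φ hφ => ⟨?_, fun i hi x => ?_⟩⟩
    · exact contDiff_zero.2 (continuous_mollify hφ hc hp)
    · obtain rfl : i = 0 := by omega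
      rw [norm_iteratedFDeriv_zero]
      exact mollify_close hφ hc h x
  | succ j ih =>
    intro E _ _ _ g hg hp ε hε
    have hc : Continuous g := hg.continuous
    have hg1 : ContDiff ℝ 1 g := hg.of_le (by exact_mod_cast Nat.le_add_left 1 j)
    have hg' : ContDiff ℝ j (fderiv ℝ g) := hg.fderiv_right (by norm_cast)
    obtain ⟨δ, hδ, h⟩ := hp.uniform hc hε
    obtain ⟨δ', hδ', h'⟩ := ih hg' hp.fderiv hε
    refine ⟨min δ δ', lt_min hδ hδ', fun φ hφ => ?_⟩
    have hφ1 := hφ.mono (min_le_left δ δ')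
    obtain ⟨h2, h3⟩ := h' φ (hφ.mono (min_le_right δ δ'))
    have hd : ∀ x, HasFDerivAt (mollify φ g) (mollify φ (fderiv ℝ g) x) x :=
      hasFDerivAt_mollify hφ hg1 hp
    have hfd : fderiv ℝ (mollify φ g) = mollify φ (fderiv ℝ g) := funext fun x => (hd x).fderiv
    refine ⟨?_, fun i hi x => ?_⟩
    · have : ((j + 1 : ℕ) : WithTop ℕ∞) = (j : WithTop ℕ∞) + 1 := by norm_cast
      rw [this, contDiff_succ_iff_fderiv, hfd]
      exact ⟨fun x => (hd x).differentiableAt, by simp, h2⟩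
    · rcases i with _ | i
      · rw [norm_iteratedFDeriv_zero]
        exact mollify_close hφ1 hc h x
      · rw [← norm_iteratedFDeriv_fderiv]
        have : fderiv ℝ (mollify φ g - g) = mollify φ (fderiv ℝ g) - fderiv ℝ g := by
          funext x
          rw [fderiv_sub (hd x).differentiableAt
            (hg1.differentiable (by simp)).differentiableAt, hfd]
          rfl
        rw [this]
        exact h3 i (by omega) x

lemma exists_smooth_kernel {δ : ℝ} (hδ : 0 < δ) :
    ∃ φ : (Fin d → ℝ) → ℝ, IsKernel φ δ ∧ ContDiff ℝ ∞ φ := by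
  let f : ContDiffBump (0 : Fin d → ℝ) := ⟨δ / 4, δ / 2, by positivity, by linarith⟩
  refine ⟨f.normed volume, ⟨f.continuous_normed, fun y => f.nonneg_normed y, f.integral_normed,
    f.hasCompactSupport_normed, fun y hy => ?_⟩, f.contDiff_normed⟩
  have : y ∈ Function.support (f.normed volume) := hy
  rw [f.support_normed_eq] at this
  have h := mem_ball_zero_iff.1 this
  have : f.rOut = δ / 2 := rfl
  linarith

lemma IsPeriodic.mollify (hg : IsPeriodic g) (φ : (Fin d → ℝ) → ℝ) :
    IsPeriodic (mollify φ g) := by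
  intro x m
  unfold MeanField.mollify
  congr 1
  funext y
  rw [show x + (fun k => (m k : ℝ)) - y = (x - y) + fun k => (m k : ℝ) by abel, hg]

/-- Smooth functions are dense in `C^r`. -/
lemma exists_smooth_close {r : ℕ} (f : Cr d r) {ε : ℝ} (hε : 0 < ε) :
    ∃ φ : Smooth d, ‖φ.toCr r - f‖ < ε := by
  have hp : IsPeriodic fun x : Fin d → ℝ => f (proj x) := fun x m => by simp only [proj_add_int]
  have hε' : 0 < ε / (2 * (r + 1)) := by positivity
  obtain ⟨δ, hδ, h⟩ := mollify_approx r f.isCn hp hε'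
  obtain ⟨φ, hφ, hφs⟩ := exists_smooth_kernel (d := d) hδ
  obtain ⟨h1, h2⟩ := h φ hφ
  have hsm : ContDiff ℝ ∞ (MeanField.mollify φ fun x : Fin d → ℝ => f (proj x)) := by
    exact hφ.compact.contDiff_convolution_left (ContinuousLinearMap.lsmul ℝ ℝ) hφs
      (μ := volume) (g := fun x : Fin d → ℝ => f (proj x))
      (f.continuous.comp continuous_proj).locallyIntegrable
  obtain ⟨s, hs⟩ := exists_descend (hp.mollify φ)
  let S : Smooth d := ⟨s, by unfold IsCn; simp_rw [hs]; exact hsm⟩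
  refine ⟨S, ?_⟩
  have : ‖S.toCr r - f‖ ≤ (r + 1) * (ε / (2 * (r + 1))) := by
    rw [Cr.norm_def]
    unfold crNorm
    have : ((r + 1 : ℕ) : ℝ) * (ε / (2 * (r + 1))) = (r + 1) * (ε / (2 * (r + 1))) := by
      push_cast; ring
    rw [← this, ← nsmul_eq_mul]
    refine (Finset.sum_le_card_nsmul _ _ (ε / (2 * (r + 1))) fun j hj => ?_).trans
      (by rw [Finset.card_range])
    refine ciSup_le fun x => ?_
    have he : (fun y : Fin d → ℝ => (S.toCr r - f : Cr d r) (proj y)) =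
        MeanField.mollify φ (fun x : Fin d → ℝ => f (proj x)) - fun x : Fin d → ℝ => f (proj x) := by
      funext y
      have : (S.toCr r - f : Cr d r) (proj y) = s (proj y) - f (proj y) := rfl
      rw [this, hs]; rfl
    rw [he]
    exact h2 j (Nat.lt_succ_iff.1 (Finset.mem_range.1 hj)) x
  refine this.trans_lt ?_
  have : (r + 1 : ℝ) * (ε / (2 * (r + 1))) = ε / 2 := by field_simp
  linarith

lemma dense_smooth (d r : ℕ) : DenseRange (fun φ : Smooth d => φ.toCr r) := by
  intro f
  rw [Metric.mem_closure_iff]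
  intro ε hε
  obtain ⟨φ, hφ⟩ := exists_smooth_close f hε
  exact ⟨_, ⟨φ, rfl⟩, by rw [dist_comm, dist_eq_norm]; exact hφ⟩

lemma Cr.abs_le_norm {r : ℕ} (f : Cr d r) (z : Torus d) : |f z| ≤ ‖f‖ := by
  obtain ⟨x, rfl⟩ := proj_surjective z
  rw [Cr.norm_def]
  unfold crNorm
  refine le_trans ?_ (Finset.single_le_sum (f := fun j => ⨆ x : Fin d → ℝ,
    ‖iteratedFDeriv ℝ j (fun y : Fin d → ℝ => f (proj y)) x‖)
    (fun j _ => Real.iSup_nonneg fun x => norm_nonneg _) (Finset.mem_range.2 (Nat.succ_pos r)))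
  have := le_ciSup (f.bdd (j := 0) (by simp)) x
  rwa [norm_iteratedFDeriv_zero] at this

/-- Smooth functions are uniformly dense in the continuous functions. -/
lemma exists_smooth_unif {f : Torus d → ℝ} (hf : Continuous f) {ε : ℝ} (hε : 0 < ε) :
    ∃ φ : Smooth d, ∀ x, |φ x - f x| < ε := by
  let f' : Cr d 0 := ⟨f, by
    have h : ContDiff ℝ ((0 : ℕ) : WithTop ℕ∞) (fun x : Fin d → ℝ => f (proj x)) :=
      contDiff_zero.2 (hf.comp continuous_proj)
    exact h⟩
  obtain ⟨φ, hφ⟩ := exists_smooth_close f' hε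
  exact ⟨φ, fun x => ((φ.toCr 0 - f').abs_le_norm x).trans_lt hφ⟩

end Mollification

section CoupledDerivative

variable {d : ℕ}

lemma Smooth.partialDeriv_proj (φ : Smooth d) (k : Fin d) (x : Fin d → ℝ) :
    φ.partialDeriv k (proj x) =
      _root_.fderiv ℝ (fun y : Fin d → ℝ => φ (proj y)) x (Pi.single k 1) :=
  (φ.hasDerivAt_line x k).deriv

/-- The derivative of `φ ∘ T_c` with respect to the parameter `c`. -/
lemma hasDerivAt_comp_coupled (F : CoupledSystem d) (ν : ℝ) (φ : Smooth d) (x : Torus d) (c : ℝ) :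
    HasDerivAt (fun c => φ (F.coupled ν c x))
      (ν * ∑ k, F.β k x * φ.partialDeriv k (F.coupled ν c x)) c := by
  obtain ⟨z, hz⟩ := proj_surjective (F.T x)
  have he : ∀ c, F.coupled ν c x = proj (z + fun k => ν * F.β k x * c) := fun c => by
    rw [proj_add, hz]; rfl
  have hφ : ContDiff ℝ ∞ (fun y : Fin d → ℝ => φ (proj y)) := φ.2
  have h1 : HasFDerivAt (fun y : Fin d → ℝ => φ (proj y)) _ (z + fun k => ν * F.β k x * c) :=
    ((hφ.differentiable (by simp)).differentiableAt).hasFDerivAt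
  have h2 : HasDerivAt (fun c : ℝ => z + fun k => ν * F.β k x * c) (fun k => ν * F.β k x) c := by
    refine HasDerivAt.const_add z (hasDerivAt_pi.2 fun k => ?_)
    simpa using (hasDerivAt_id c).const_mul (ν * F.β k x)
  have h3 := h1.comp_hasDerivAt c h2
  have he' : (fun c => φ (F.coupled ν c x)) =
      (fun y : Fin d → ℝ => φ (proj y)) ∘ fun c : ℝ => z + fun k => ν * F.β k x * c := by
    funext c; simp [he]
  rw [he']
  refine h3.congr_deriv ?_
  rw [he]
  have h4 : (fun k => ν * F.β k x) = ∑ k, (ν * F.β k x) • (Pi.single k (1 : ℝ) : Fin d → ℝ) := by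
    funext j
    simp [Finset.sum_apply, Pi.single_apply]
  rw [h4, map_sum, Finset.mul_sum]
  refine Finset.sum_congr rfl fun k _ => ?_
  rw [map_smul, Smooth.partialDeriv_proj, smul_eq_mul]
  ring

lemma continuous_coupled (F : CoupledSystem d) (ν c : ℝ) : Continuous (F.coupled ν c) :=
  (F.coupled_smooth ν c).continuous

/-- The derivative of `∫ f φ ∘ T_c` with respect to `c`. -/
lemma hasDerivAt_integral_coupled (F : CoupledSystem d) (ν : ℝ) (φ : Smooth d) {f : Torus d → ℝ}
    (hf : Continuous f) (c : ℝ) :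
    HasDerivAt (fun c => ∫ x, f x * φ (F.coupled ν c x))
      (∫ x, f x * (ν * ∑ k, F.β k x * φ.partialDeriv k (F.coupled ν c x))) c := by
  obtain ⟨Mf, hMf0, hMf⟩ := exists_bound hf
  choose Mb hMb0 hMb using fun k => exists_bound (F.β k).continuous
  choose Mp hMp0 hMp using fun k => exists_bound (φ.partialDeriv k).continuous
  refine (hasDerivAt_integral_of_dominated_loc_of_deriv_le (s := univ)
    (μ := (volume : Measure (Torus d))) (F := fun c x => f x * φ (F.coupled ν c x))
    (F' := fun c x => f x * (ν * ∑ k, F.β k x * φ.partialDeriv k (F.coupled ν c x))) (x₀ := c)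
    (bound := fun _ => Mf * (|ν| * ∑ k, Mb k * Mp k)) univ_mem
    (Eventually.of_forall fun c => ?_) ?_ ?_ (ae_of_all _ fun x c _ => ?_)
    (integrable_const _) (ae_of_all _ fun x c _ => ?_)).2
  · exact (hf.mul (φ.continuous.comp (continuous_coupled F ν c))).aestronglyMeasurable
  · exact integrable_of_continuous (hf.mul (φ.continuous.comp (continuous_coupled F ν c))) _
  · refine (hf.mul (continuous_const.mul (continuous_finsetSum _ fun k _ => ?_))).aestronglyMeasurable
    exact (F.β k).continuous.mul ((φ.partialDeriv k).continuous.comp (continuous_coupled F ν c))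
  · rw [norm_mul, norm_mul, Real.norm_eq_abs ν]
    refine mul_le_mul (hMf x) (mul_le_mul_of_nonneg_left ?_ (abs_nonneg _)) (by positivity) hMf0
    refine (norm_sum_le _ _).trans (Finset.sum_le_sum fun k _ => ?_)
    rw [norm_mul]
    exact mul_le_mul (hMb k x) (hMp k _) (norm_nonneg _) (hMb0 k)
  · exact (hasDerivAt_comp_coupled F ν φ x c).const_mul (f x)

end CoupledDerivative

/-! ### Dependence of the transfer operators on the coupling parameter -/

section Abstract

variable {E E' E'' P Q : Type*} [NormedAddCommGroup E] [NormedSpace ℝ E]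
  [NormedAddCommGroup E'] [NormedSpace ℝ E'] [NormedAddCommGroup E''] [NormedSpace ℝ E'']

/-- A weakly differentiable family of operators is Lipschitz if its derivative is bounded. -/
lemma lipschitz_of_weak_deriv (J : P → E →L[ℝ] ℝ)
    (hJ : ∀ (b : E) (M : ℝ), 0 ≤ M → (∀ φ, |J φ b| ≤ M * ‖J φ‖) → ‖b‖ ≤ M)
    (e : Q → E') (he : DenseRange e) (ι : E' →L[ℝ] E) (L : ℝ → E →L[ℝ] E) (W : ℝ → E' →L[ℝ] E)
    {R : Set ℝ} (hR : Convex ℝ R) {C : ℝ} (hC : 0 ≤ C) (hW : ∀ c ∈ R, ∀ b, ‖W c b‖ ≤ C * ‖b‖)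
    (hd : ∀ φ f, ∀ c ∈ R, HasDerivWithinAt (fun c => J φ (L c (ι (e f)))) (J φ (W c (e f))) R c)
    {c c' : ℝ} (hc : c ∈ R) (hc' : c' ∈ R) (b : E') :
    ‖L c (ι b) - L c' (ι b)‖ ≤ C * |c - c'| * ‖b‖ := by
  refine he.induction_on (p := fun b => ‖L c (ι b) - L c' (ι b)‖ ≤ C * |c - c'| * ‖b‖) b
    (isClosed_le (by fun_prop) (by fun_prop)) fun f => ?_
  refine hJ _ _ (by positivity) fun φ => ?_
  rw [map_sub, ← Real.norm_eq_abs]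
  have hb : ∀ s ∈ R, ‖J φ (W s (e f))‖ ≤ ‖J φ‖ * (C * ‖e f‖) := fun s hs =>
    ((J φ).le_opNorm _).trans (mul_le_mul_of_nonneg_left (hW s hs _) (norm_nonneg _))
  have h1 := hR.norm_image_sub_le_of_norm_hasDerivWithin_le (fun s hs => hd φ f s hs) hb hc' hc
  exact h1.trans_eq (by rw [Real.norm_eq_abs]; ring)

/-- Second order estimate for a weakly differentiable family of operators with Lipschitz
derivative. -/
lemma diff_of_weak_deriv (J : P → E →L[ℝ] ℝ)
    (hJ : ∀ (b : E) (M : ℝ), 0 ≤ M → (∀ φ, |J φ b| ≤ M * ‖J φ‖) → ‖b‖ ≤ M)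
    (e : Q → E'') (he : DenseRange e) (ι : E' →L[ℝ] E) (ι' : E'' →L[ℝ] E') (L : ℝ → E →L[ℝ] E)
    (W : ℝ → E' →L[ℝ] E)
    {R : Set ℝ} (hR : Convex ℝ R) {C : ℝ} (hC : 0 ≤ C)
    (hW : ∀ c ∈ R, ∀ c' ∈ R, ∀ b, ‖W c (ι' b) - W c' (ι' b)‖ ≤ C * |c - c'| * ‖b‖)
    (hd : ∀ φ f, ∀ c ∈ R, HasDerivWithinAt (fun c => J φ (L c (ι (ι' (e f)))))
      (J φ (W c (ι' (e f)))) R c)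
    {c c' : ℝ} (hc : c ∈ R) (hc' : c' ∈ R) (b : E'') :
    ‖L c (ι (ι' b)) - L c' (ι (ι' b)) - (c - c') • W c' (ι' b)‖ ≤ C * |c - c'| ^ 2 * ‖b‖ := by
  refine he.induction_on (p := fun b => ‖L c (ι (ι' b)) - L c' (ι (ι' b)) - (c - c') • W c' (ι' b)‖
    ≤ C * |c - c'| ^ 2 * ‖b‖) b (isClosed_le (by fun_prop) (by fun_prop)) fun f => ?_
  refine hJ _ _ (by positivity) fun φ => ?_
  rw [← Real.norm_eq_abs]
  have hsub : uIcc c' c ⊆ R := by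
    rw [← segment_eq_uIcc]
    exact hR.segment_subset hc' hc
  have hd' : ∀ s ∈ uIcc c' c, HasDerivWithinAt
      (fun s => J φ (L s (ι (ι' (e f)))) - s * J φ (W c' (ι' (e f))))
      (J φ (W s (ι' (e f))) - 1 * J φ (W c' (ι' (e f)))) (uIcc c' c) s := fun s hs =>
    ((hd φ f s (hsub hs)).mono hsub).sub ((hasDerivWithinAt_id s _).mul_const _)
  have hb : ∀ s ∈ uIcc c' c, ‖J φ (W s (ι' (e f))) - 1 * J φ (W c' (ι' (e f)))‖ ≤
      ‖J φ‖ * (C * |c - c'| * ‖e f‖) := fun s hs => by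
    rw [one_mul, ← map_sub]
    refine ((J φ).le_opNorm _).trans (mul_le_mul_of_nonneg_left ?_ (norm_nonneg _))
    refine (hW s (hsub hs) c' hc' _).trans ?_
    have : |s - c'| ≤ |c - c'| := abs_sub_left_of_mem_uIcc hs
    gcongr
  have h1 := (convex_uIcc c' c).norm_image_sub_le_of_norm_hasDerivWithin_le hd' hb
    left_mem_uIcc right_mem_uIcc
  calc _ = _ := by congr 1; rw [map_sub, map_sub, map_smul, smul_eq_mul]; ring
    _ ≤ _ := h1
    _ = _ := by rw [Real.norm_eq_abs]; ring

/-- A vector is controlled by the values of a family of functionals that is dense in the dual. -/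
lemma norm_le_of_dense_dual (J : P → E →L[ℝ] ℝ) (hJ : DenseRange J) (b : E) (M : ℝ) (hM : 0 ≤ M)
    (h : ∀ φ, |J φ b| ≤ M * ‖J φ‖) : ‖b‖ ≤ M := by
  refine NormedSpace.norm_le_dual_bound ℝ b hM fun f => ?_
  refine hJ.induction_on (p := fun f : E →L[ℝ] ℝ => ‖f b‖ ≤ M * ‖f‖) f
    (isClosed_le (by fun_prop) (by fun_prop)) fun φ => ?_
  exact h φ

end Abstract

/-- The product `L (c (n-1)) ⋯ L (c 0)`. -/
def iter {E : Type*} [NormedAddCommGroup E] [NormedSpace ℝ E] (L : ℝ → E →L[ℝ] E) (c : ℕ → ℝ) :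
    ℕ → E →L[ℝ] E
  | 0 => ContinuousLinearMap.id ℝ E
  | n + 1 => (L (c n)).comp (iter L c n)

/-- The functional analytic data of a mean field coupled system: four spaces `E0 ⊃ E1 ⊃ E2 ⊃ E3`,
the transfer operators `L c` of the maps `T_c`, with `c` in the set `R` of the possible means, the
derivatives `W c = ∂_c L c`, the functionals `a = ∫ α ·` and `I = ∫ ·`, and the estimates that the
dynamics of `f ↦ L (a f) f` depends on. -/
structure Core (E0 E1 E2 E3 : Type*) [NormedAddCommGroup E0] [NormedSpace ℝ E0]
    [NormedAddCommGroup E1] [NormedSpace ℝ E1] [NormedAddCommGroup E2] [NormedSpace ℝ E2]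
    [NormedAddCommGroup E3] [NormedSpace ℝ E3] where
  i1 : E1 →L[ℝ] E0
  i2 : E2 →L[ℝ] E1
  i3 : E3 →L[ℝ] E2
  inj1 : Function.Injective i1
  inj2 : Function.Injective i2
  inj3 : Function.Injective i3
  nle2 : ∀ b, ‖i2 b‖ ≤ ‖b‖
  nle3 : ∀ b, ‖i3 b‖ ≤ ‖b‖
  dns2 : DenseRange i2
  cpt3 : IsCompact (closure (i3 '' Metric.ball 0 1))
  R : Set ℝ
  L0 : ℝ → E0 →L[ℝ] E0
  L1 : ℝ → E1 →L[ℝ] E1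
  L2 : ℝ → E2 →L[ℝ] E2
  L3 : ℝ → E3 →L[ℝ] E3
  commL1 : ∀ c b, i1 (L1 c b) = L0 c (i1 b)
  commL2 : ∀ c b, i2 (L2 c b) = L1 c (i2 b)
  commL3 : ∀ c b, i3 (L3 c b) = L2 c (i3 b)
  W1 : ℝ → E1 →L[ℝ] E0
  W2 : ℝ → E2 →L[ℝ] E1
  W3 : ℝ → E3 →L[ℝ] E2
  commW2 : ∀ c b, i1 (W2 c b) = W1 c (i2 b)
  commW3 : ∀ c b, i2 (W3 c b) = W2 c (i3 b)
  a : E0 →L[ℝ] ℝ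
  I : E0 →L[ℝ] ℝ
  I_L : ∀ c ∈ R, ∀ b, I (L0 c b) = I b
  I_W : ∀ c ∈ R, ∀ b, I (W1 c b) = 0
  C : ℝ
  one_le_C : 1 ≤ C
  θ : ℝ
  θ_pos : 0 < θ
  θ_lt : θ < 1
  bd1 : ∀ c : ℕ → ℝ, (∀ n, c n ∈ R) → ∀ n b, ‖iter L1 c n b‖ ≤ C * ‖b‖
  bd2 : ∀ c : ℕ → ℝ, (∀ n, c n ∈ R) → ∀ n b, ‖iter L2 c n b‖ ≤ C * ‖b‖
  bd3 : ∀ c : ℕ → ℝ, (∀ n, c n ∈ R) → ∀ n b, ‖iter L3 c n b‖ ≤ C * ‖b‖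
  ct1 : ∀ c : ℕ → ℝ, (∀ n, c n ∈ R) → ∀ n b, I (i1 b) = 0 → ‖iter L1 c n b‖ ≤ C * θ ^ n * ‖b‖
  ct3 : ∀ c : ℕ → ℝ, (∀ n, c n ∈ R) → ∀ n b, I (i1 (i2 (i3 b))) = 0 →
    ‖iter L3 c n b‖ ≤ C * θ ^ n * ‖b‖
  bdW2 : ∀ c ∈ R, ∀ b, ‖W2 c b‖ ≤ C * ‖b‖
  bdW3 : ∀ c ∈ R, ∀ b, ‖W3 c b‖ ≤ C * ‖b‖
  lip0 : ∀ c ∈ R, ∀ c' ∈ R, ∀ b, ‖L0 c (i1 b) - L0 c' (i1 b)‖ ≤ C * |c - c'| * ‖b‖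
  lip1 : ∀ c ∈ R, ∀ c' ∈ R, ∀ b, ‖L1 c (i2 b) - L1 c' (i2 b)‖ ≤ C * |c - c'| * ‖b‖
  lip2 : ∀ c ∈ R, ∀ c' ∈ R, ∀ b, ‖L2 c (i3 b) - L2 c' (i3 b)‖ ≤ C * |c - c'| * ‖b‖
  lipW1 : ∀ c ∈ R, ∀ c' ∈ R, ∀ b, ‖W1 c (i2 b) - W1 c' (i2 b)‖ ≤ C * |c - c'| * ‖b‖
  lipW2 : ∀ c ∈ R, ∀ c' ∈ R, ∀ b, ‖W2 c (i3 b) - W2 c' (i3 b)‖ ≤ C * |c - c'| * ‖b‖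
  diff1 : ∀ c ∈ R, ∀ c' ∈ R, ∀ b,
    ‖L1 c (i2 (i3 b)) - L1 c' (i2 (i3 b)) - (c - c') • W2 c' (i3 b)‖ ≤ C * |c - c'| ^ 2 * ‖b‖

namespace CoupledSystem

variable {d : ℕ} (F : CoupledSystem d)

lemma convex_range_meanα : Convex ℝ (range F.meanα) := by
  rintro _ ⟨μ, rfl⟩ _ ⟨μ', rfl⟩ s t hs ht hst
  let κ : Measure (Torus d) := ENNReal.ofReal s • (μ : Measure (Torus d)) +
    ENNReal.ofReal t • (μ' : Measure (Torus d))
  have hκ : IsProbabilityMeasure κ := ⟨by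
    simp only [κ, Measure.add_apply, Measure.smul_apply, measure_univ, smul_eq_mul, mul_one]
    rw [← ENNReal.ofReal_add hs ht, hst, ENNReal.ofReal_one]⟩
  refine ⟨⟨κ, hκ⟩, ?_⟩
  have hi : ∀ (ρ : Measure (Torus d)) [IsFiniteMeasure ρ] (s : ℝ),
      Integrable F.α (ENNReal.ofReal s • ρ) :=
    fun ρ _ s => (integrable_of_continuous F.α.continuous ρ).smul_measure ENNReal.ofReal_ne_top
  simp only [meanα]
  change ∫ x, F.α x ∂κ = _
  rw [integral_add_measure (hi _ s) (hi _ t), integral_smul_measure, integral_smul_measure,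
    ENNReal.toReal_ofReal hs, ENNReal.toReal_ofReal ht]

end CoupledSystem

namespace BanachScale

variable {d r : ℕ} {𝒯 : Set (CrMap d r)} {B : Fin 4 → Type*}
  [∀ i, NormedAddCommGroup (B i)] [∀ i, NormedSpace ℝ (B i)] (X : BanachScale r 𝒯 B)

lemma dense_dual_smooth (i : Fin 4) :
    DenseRange (fun φ : Smooth d => (X.J i).flip (φ.toCr r)) :=
  (X.dense_dual i).comp (dense_smooth d r) (X.J i).flip.continuous

lemma ext_smooth {i : Fin 4} {b b' : B i}
    (h : ∀ φ : Smooth d, X.J i b (φ.toCr r) = X.J i b' (φ.toCr r)) : b = b' := by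
  refine X.J_injective i (ContinuousLinearMap.ext fun f => ?_)
  exact (dense_smooth d r).induction_on (p := fun f => X.J i b f = X.J i b' f) f
    (isClosed_eq (by fun_prop) (by fun_prop)) h

open Classical in
/-- The transfer operator of `T_c`, with the value `0` if `T_c ∉ 𝒯`. -/
noncomputable def Lc (F : CoupledSystem d) (ν c : ℝ) (i : Fin 4) : B i →L[ℝ] B i :=
  if h : F.coupledMap r ν c ∈ 𝒯 then X.L ⟨_, h⟩ i else 0

/-- The derivative `b ↦ -ν div(ℒ (β b))` of `c ↦ ℒ b`, where `ℒ` is the transfer operator of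
`T_c`. -/
noncomputable def Wc (F : CoupledSystem d) (ν c : ℝ) (i : Fin 3) : B i.succ →L[ℝ] B i.castSucc :=
  -(ν • ∑ k, (X.D k i).comp ((X.Lc F ν c i.succ).comp (X.mul (F.β k) i.succ)))

variable {X} {F : CoupledSystem d} {ν : ℝ}

lemma Wc_apply (c : ℝ) (i : Fin 3) (b : B i.succ) : X.Wc F ν c i b =
    -(ν • ∑ k, X.D k i (X.Lc F ν c i.succ (X.mul (F.β k) i.succ b))) := by
  simp [Wc]

lemma J_Lc {c : ℝ} (hc : F.coupledMap r ν c ∈ 𝒯) (i : Fin 4) (b : B i) (φ : Cr d r) :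
    X.J i (X.Lc F ν c i b) φ = X.J i b (CrMap.pullback (F.coupledMap r ν c) φ) := by
  rw [Lc, dif_pos hc, X.J_L]

lemma incl_Lc (c : ℝ) (i : Fin 3) (b : B i.succ) :
    X.incl i (X.Lc F ν c i.succ b) = X.Lc F ν c i.castSucc (X.incl i b) := by
  by_cases hc : F.coupledMap r ν c ∈ 𝒯
  · refine X.J_injective _ (ContinuousLinearMap.ext fun φ => ?_)
    rw [X.J_incl, J_Lc hc, J_Lc hc, X.J_incl]
  · simp [Lc, dif_neg hc]

lemma incl_mul (g : Smooth d) (i : Fin 3) (b : B i.succ) :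
    X.incl i (X.mul g i.succ b) = X.mul g i.castSucc (X.incl i b) := by
  refine X.J_injective _ (ContinuousLinearMap.ext fun φ => ?_)
  rw [X.J_incl, X.J_mul, X.J_mul, X.J_incl]

lemma incl_emb (i : Fin 3) (f : Cr d r) : X.incl i (X.emb i.succ f) = X.emb i.castSucc f := by
  refine X.J_injective _ (ContinuousLinearMap.ext fun φ => ?_)
  rw [X.J_incl, X.J_emb, X.J_emb]

lemma incl_injective (i : Fin 3) : Function.Injective (X.incl i) := fun b b' h =>
  X.J_injective _ (by rw [← X.J_incl, ← X.J_incl, h])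

variable (X) in
lemma dense_incl (i : Fin 3) : DenseRange (X.incl i) := by
  have h : X.incl i ∘ X.emb i.succ = X.emb i.castSucc := funext fun f => incl_emb i f
  exact DenseRange.of_comp (h ▸ X.dense_emb i.castSucc)

lemma incl_D (k : Fin d) (i : Fin 2) (b : B i.succ.succ) :
    X.incl i.castSucc (X.D k i.succ b) = X.D k i.castSucc (X.incl i.succ b) := by
  refine X.ext_smooth fun φ => ?_
  rw [X.J_D k i.castSucc (X.incl i.succ b) φ, X.J_incl i.castSucc (X.D k i.succ b)]
  refine (X.J_D k i.succ b φ).trans ?_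
  rw [← X.J_incl i.succ b]
  rfl

lemma incl_Wc (c : ℝ) (i : Fin 2) (b : B i.succ.succ) :
    X.incl i.castSucc (X.Wc F ν c i.succ b) = X.Wc F ν c i.castSucc (X.incl i.succ b) := by
  rw [Wc_apply, Wc_apply, map_neg]
  congr 1
  refine (map_smul (X.incl i.castSucc) ν _).trans (congrArg _ ((map_sum (X.incl i.castSucc) _ _).trans
    (Finset.sum_congr rfl fun k _ => (X.incl_D k i _).trans (congrArg _
      ((incl_Lc c i.succ _).trans (congrArg _ (incl_mul (F.β k) i.succ b)))))))

lemma J_Wc {c : ℝ} (hc : F.coupledMap r ν c ∈ 𝒯) (i : Fin 3) (b : B i.succ) (φ : Smooth d) :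
    X.J i.castSucc (X.Wc F ν c i b) (φ.toCr r) = ν * ∑ k, X.J i.succ b ((F.β k).mulCr
      (CrMap.pullback (F.coupledMap r ν c) ((φ.partialDeriv k).toCr r))) := by
  rw [Wc_apply]
  simp only [map_neg, map_smul, map_sum, neg_apply, smul_apply, sum_apply,
    X.J_D, J_Lc hc, X.J_mul,
    smul_eq_mul, Finset.sum_neg_distrib, mul_neg, neg_neg]

lemma hasDerivWithinAt_J_Lc {R : Set ℝ} (hR : ∀ c ∈ R, F.coupledMap r ν c ∈ 𝒯) (i : Fin 3)
    (φ : Smooth d) (f : Cr d r) {c : ℝ} (hc : c ∈ R) :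
    HasDerivWithinAt
      (fun c => (X.J i.castSucc).flip (φ.toCr r) (X.Lc F ν c i.castSucc (X.incl i (X.emb i.succ f))))
      ((X.J i.castSucc).flip (φ.toCr r) (X.Wc F ν c i (X.emb i.succ f))) R c := by
  have h1 := (hasDerivAt_integral_coupled F ν φ f.continuous c).hasDerivWithinAt (s := R)
  have hf : ∀ c ∈ R, (X.J i.castSucc).flip (φ.toCr r)
      (X.Lc F ν c i.castSucc (X.incl i (X.emb i.succ f))) = ∫ x, f x * φ (F.coupled ν c x) := by
    intro c hc
    rw [ContinuousLinearMap.flip_apply, J_Lc (hR c hc), incl_emb, X.J_emb]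
    rfl
  refine (h1.congr hf (hf c hc)).congr_deriv ?_
  rw [ContinuousLinearMap.flip_apply, J_Wc (hR c hc)]
  simp_rw [X.J_emb]
  have hi : ∀ k, Integrable fun x => f x * (F.β k x * φ.partialDeriv k (F.coupled ν c x)) :=
    fun k => integrable_of_continuous (f.continuous.mul ((F.β k).continuous.mul
      ((φ.partialDeriv k).continuous.comp (continuous_coupled F ν c)))) _
  have h2 : ∀ x, f x * (ν * ∑ k, F.β k x * φ.partialDeriv k (F.coupled ν c x)) =
      ν * ∑ k, f x * (F.β k x * φ.partialDeriv k (F.coupled ν c x)) := fun x => by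
    rw [← Finset.mul_sum]; ring
  simp_rw [h2]
  rw [integral_const_mul, integral_finsetSum _ fun k _ => hi k]
  rfl

lemma iter_Lc_eq {R : Set ℝ} (hR : ∀ c ∈ R, F.coupledMap r ν c ∈ 𝒯) (i : Fin 4) (c : ℕ → ℝ)
    (hc : ∀ n, c n ∈ R) (n : ℕ) :
    ∃ l : List 𝒯, l.length = n ∧ iter (fun c => X.Lc F ν c i) c n = X.Lprod l i := by
  induction n with
  | zero => exact ⟨[], rfl, rfl⟩
  | succ n ih =>
    obtain ⟨l, hl, h⟩ := ih
    refine ⟨⟨_, hR _ (hc n)⟩ :: l, by simp [hl], ?_⟩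
    rw [iter, h, Lc, dif_pos (hR _ (hc n)), Lprod, Lprod, List.map_cons, List.prod_cons]
    rfl

lemma bound_iter (hX : X.Admissible) {R : Set ℝ} (hR : ∀ c ∈ R, F.coupledMap r ν c ∈ 𝒯) :
    ∃ C θ : ℝ, 1 ≤ C ∧ 0 < θ ∧ θ < 1 ∧
      (∀ (i : Fin 4) (c : ℕ → ℝ), (∀ n, c n ∈ R) → ∀ n b,
        ‖iter (fun c => X.Lc F ν c i) c n b‖ ≤ C * ‖b‖) ∧
      (∀ (i : Fin 3) (c : ℕ → ℝ), (∀ n, c n ∈ R) → ∀ n b, X.integral i.succ b = 0 →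
        ‖iter (fun c => X.Lc F ν c i.succ) c n b‖ ≤ C * θ ^ n * ‖b‖) := by
  obtain ⟨K, Cs, θ, cbar, chat, nbar, hK, hCs, hθ0, hθ1, -, -, h0, hLY, hct⟩ := hX.bounds
  have hb : ∀ (i : Fin 4) (c : ℕ → ℝ), (∀ n, c n ∈ R) → ∀ n b,
      ‖iter (fun c => X.Lc F ν c i) c n b‖ ≤ (Cs + K) * ‖b‖ := by
    intro i c hc n b
    obtain ⟨l, hl, h⟩ := X.iter_Lc_eq hR i c hc n
    rw [h]
    induction i using Fin.cases with
    | zero => exact (h0 l b).trans (by gcongr; linarith)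
    | succ i =>
      refine (hLY l i b).trans ?_
      have h1 : θ ^ l.length ≤ 1 := pow_le_one₀ hθ0.le hθ1.le
      have h2 := X.norm_incl_le i b
      have h3 : Cs * θ ^ l.length * ‖b‖ ≤ Cs * 1 * ‖b‖ := by gcongr
      have h4 : K * ‖X.incl i b‖ ≤ K * ‖b‖ := by gcongr
      linarith
  have hq : 0 < θ ^ nbar := pow_pos hθ0 _
  have hq1 : θ ^ nbar ≤ 1 := pow_le_one₀ hθ0.le hθ1.le
  have hge : Cs + K ≤ (Cs + K) / θ ^ nbar := by rw [le_div_iff₀ hq]; nlinarith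
  refine ⟨(Cs + K) / θ ^ nbar, θ, by linarith, hθ0, hθ1, fun i c hc n b => ?_,
    fun i c hc n b hI => ?_⟩
  · exact (hb i c hc n b).trans (by gcongr)
  · by_cases hn : nbar ≤ n
    · obtain ⟨l, hl, h⟩ := X.iter_Lc_eq hR i.succ c hc n
      obtain ⟨q, hq', h'⟩ := hct l (hl ▸ hn) i
      rw [h]
      refine (h' b hI).trans ?_
      rw [hl] at hq'
      have : θ ^ n ≤ (Cs + K) / θ ^ nbar * θ ^ n :=
        le_mul_of_one_le_left (pow_pos hθ0 _).le (by linarith)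
      exact mul_le_mul_of_nonneg_right (hq'.le.trans this) (norm_nonneg _)
    · refine (hb i.succ c hc n b).trans ?_
      have : Cs + K ≤ (Cs + K) / θ ^ nbar * θ ^ n := by
        rw [div_mul_eq_mul_div, le_div_iff₀ hq]
        have := pow_le_pow_of_le_one hθ0.le hθ1.le (not_le.1 hn).le
        nlinarith
      gcongr

lemma bound_Wc {R : Set ℝ} {C : ℝ} (hC : 0 ≤ C)
    (hL : ∀ (i : Fin 4), ∀ c ∈ R, ∀ b, ‖X.Lc F ν c i b‖ ≤ C * ‖b‖) :
    ∃ C' : ℝ, 0 ≤ C' ∧ ∀ (i : Fin 3), ∀ c ∈ R, ∀ b, ‖X.Wc F ν c i b‖ ≤ C' * ‖b‖ := by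
  let K : Fin 3 → ℝ := fun i => |ν| * ∑ k, ‖X.D k i‖ * (C * ‖X.mul (F.β k) i.succ‖)
  have hK : ∀ i, 0 ≤ K i := fun i => by positivity
  refine ⟨∑ i, K i, Finset.sum_nonneg fun i _ => hK i, fun i c hc b => ?_⟩
  have h1 : ‖X.Wc F ν c i b‖ ≤ K i * ‖b‖ := by
    rw [Wc_apply, norm_neg, norm_smul, Real.norm_eq_abs, mul_assoc, Finset.sum_mul]
    refine mul_le_mul_of_nonneg_left ((norm_sum_le _ _).trans
      (Finset.sum_le_sum fun k _ => ?_)) (abs_nonneg _)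
    have := (hL _ c hc _).trans (mul_le_mul_of_nonneg_left ((X.mul (F.β k) i.succ).le_opNorm b) hC)
    rw [mul_assoc, mul_assoc]
    exact (X.D k i).le_opNorm_of_le this
  exact h1.trans (mul_le_mul_of_nonneg_right
    (Finset.single_le_sum (fun i _ => hK i) (Finset.mem_univ i)) (norm_nonneg _))

lemma lip_Wc {R : Set ℝ} {C : ℝ} (hC : 0 ≤ C)
    (hL : ∀ (i : Fin 3), ∀ c ∈ R, ∀ c' ∈ R, ∀ b, ‖X.Lc F ν c i.castSucc (X.incl i b) -
      X.Lc F ν c' i.castSucc (X.incl i b)‖ ≤ C * |c - c'| * ‖b‖) :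
    ∃ C' : ℝ, 0 ≤ C' ∧ ∀ (i : Fin 2), ∀ c ∈ R, ∀ c' ∈ R, ∀ b,
      ‖X.Wc F ν c i.castSucc (X.incl i.succ b) - X.Wc F ν c' i.castSucc (X.incl i.succ b)‖ ≤
        C' * |c - c'| * ‖b‖ := by
  let K : Fin 2 → ℝ := fun i => |ν| * ∑ k, ‖X.D k i.castSucc‖ * (C * ‖X.mul (F.β k) i.succ.succ‖)
  have hK : ∀ i, 0 ≤ K i := fun i => by positivity
  refine ⟨∑ i, K i, Finset.sum_nonneg fun i _ => hK i, fun i c hc c' hc' b => ?_⟩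
  have h1 : ‖X.Wc F ν c i.castSucc (X.incl i.succ b) - X.Wc F ν c' i.castSucc (X.incl i.succ b)‖ ≤
      K i * |c - c'| * ‖b‖ := by
    have e : X.Wc F ν c i.castSucc (X.incl i.succ b) - X.Wc F ν c' i.castSucc (X.incl i.succ b) =
        -(ν • ∑ k, X.D k i.castSucc (X.Lc F ν c i.castSucc.succ (X.mul (F.β k) i.castSucc.succ
            (X.incl i.succ b)) - X.Lc F ν c' i.castSucc.succ (X.mul (F.β k) i.castSucc.succ
            (X.incl i.succ b)))) := by
      simp only [map_sub, Finset.sum_sub_distrib, smul_sub]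
      rw [neg_sub']
      exact congrArg₂ (· - ·) (Wc_apply c i.castSucc _) (Wc_apply c' i.castSucc _)
    rw [e, norm_neg, norm_smul, Real.norm_eq_abs, mul_assoc, mul_assoc, Finset.sum_mul]
    refine mul_le_mul_of_nonneg_left ((norm_sum_le _ _).trans
      (Finset.sum_le_sum fun k _ => ?_)) (abs_nonneg _)
    have h2 := hL i.succ c hc c' hc' (X.mul (F.β k) i.succ.succ b)
    rw [incl_mul] at h2
    rw [mul_assoc]
    refine (X.D k i.castSucc).le_opNorm_of_le (h2.trans ?_)
    have h3 := (X.mul (F.β k) i.succ.succ).le_opNorm b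
    calc _ ≤ C * |c - c'| * (‖X.mul (F.β k) i.succ.succ‖ * ‖b‖) := by gcongr
      _ = _ := by ring
  refine h1.trans ?_
  have := Finset.single_le_sum (fun i _ => hK i) (Finset.mem_univ i)
  gcongr

variable (X) in
/-- The estimates of a `Core` for the operators of the scale, with constants `C` and `θ`. -/
structure CoreBounds (F : CoupledSystem d) (ν : ℝ) (R : Set ℝ) (C θ : ℝ) : Prop where
  one_le : 1 ≤ C
  pos : 0 < θ
  lt : θ < 1
  bd : ∀ (i : Fin 4) (c : ℕ → ℝ), (∀ n, c n ∈ R) → ∀ n b,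
    ‖iter (fun c => X.Lc F ν c i) c n b‖ ≤ C * ‖b‖
  ct : ∀ (i : Fin 3) (c : ℕ → ℝ), (∀ n, c n ∈ R) → ∀ n b, X.integral i.succ b = 0 →
    ‖iter (fun c => X.Lc F ν c i.succ) c n b‖ ≤ C * θ ^ n * ‖b‖
  bdW : ∀ (i : Fin 3), ∀ c ∈ R, ∀ b, ‖X.Wc F ν c i b‖ ≤ C * ‖b‖
  lip : ∀ (i : Fin 3), ∀ c ∈ R, ∀ c' ∈ R, ∀ b, ‖X.Lc F ν c i.castSucc (X.incl i b) -
    X.Lc F ν c' i.castSucc (X.incl i b)‖ ≤ C * |c - c'| * ‖b‖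
  lipW : ∀ (i : Fin 2), ∀ c ∈ R, ∀ c' ∈ R, ∀ b,
    ‖X.Wc F ν c i.castSucc (X.incl i.succ b) - X.Wc F ν c' i.castSucc (X.incl i.succ b)‖ ≤
      C * |c - c'| * ‖b‖
  diff : ∀ (i : Fin 2), ∀ c ∈ R, ∀ c' ∈ R, ∀ b,
    ‖X.Lc F ν c i.castSucc.castSucc (X.incl i.castSucc (X.incl i.succ b)) -
      X.Lc F ν c' i.castSucc.castSucc (X.incl i.castSucc (X.incl i.succ b)) -
      (c - c') • X.Wc F ν c' i.castSucc (X.incl i.succ b)‖ ≤ C * |c - c'| ^ 2 * ‖b‖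

lemma exists_coreBounds (hX : X.Admissible) {R : Set ℝ} (hconv : Convex ℝ R)
    (hR : ∀ c ∈ R, F.coupledMap r ν c ∈ 𝒯) : ∃ C θ : ℝ, X.CoreBounds F ν R C θ := by
  obtain ⟨C, θ, hC, hθ0, hθ1, hbd, hct⟩ := bound_iter hX hR
  obtain ⟨C', hC', hW⟩ := bound_Wc (X := X) (F := F) (ν := ν) (R := R) (C := C) (by linarith)
    fun i c hc b => hbd i (fun _ => c) (fun _ => hc) 1 b
  have hlip : ∀ (i : Fin 3), ∀ c ∈ R, ∀ c' ∈ R, ∀ b, ‖X.Lc F ν c i.castSucc (X.incl i b) -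
      X.Lc F ν c' i.castSucc (X.incl i b)‖ ≤ C' * |c - c'| * ‖b‖ := fun i c hc c' hc' b =>
    lipschitz_of_weak_deriv (fun φ : Smooth d => (X.J i.castSucc).flip (φ.toCr r))
      (norm_le_of_dense_dual _ (X.dense_dual_smooth _)) (X.emb i.succ) (X.dense_emb _) (X.incl i)
      (fun c => X.Lc F ν c i.castSucc) (fun c => X.Wc F ν c i) hconv hC' (hW i)
      (fun φ f c hc => hasDerivWithinAt_J_Lc hR i φ f hc) hc hc' b
  obtain ⟨C2, hC2, hlW⟩ := lip_Wc hC' hlip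
  have hdiff : ∀ (i : Fin 2), ∀ c ∈ R, ∀ c' ∈ R, ∀ b,
      ‖X.Lc F ν c i.castSucc.castSucc (X.incl i.castSucc (X.incl i.succ b)) -
        X.Lc F ν c' i.castSucc.castSucc (X.incl i.castSucc (X.incl i.succ b)) -
        (c - c') • X.Wc F ν c' i.castSucc (X.incl i.succ b)‖ ≤ C2 * |c - c'| ^ 2 * ‖b‖ :=
    fun i c hc c' hc' b =>
    diff_of_weak_deriv (fun φ : Smooth d => (X.J i.castSucc.castSucc).flip (φ.toCr r))
      (norm_le_of_dense_dual _ (X.dense_dual_smooth _)) (X.emb i.succ.succ) (X.dense_emb _)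
      (X.incl i.castSucc) (X.incl i.succ)
      (fun c => X.Lc F ν c i.castSucc.castSucc) (fun c => X.Wc F ν c i.castSucc) hconv hC2 (hlW i)
      (fun φ f c hc => by
        have h1 := hasDerivWithinAt_J_Lc (X := X) hR i.castSucc φ f hc
        rwa [show X.emb i.castSucc.succ f = _ from (incl_emb i.succ f).symm] at h1) hc hc' b
  refine ⟨C + C' + C2, θ, by linarith, hθ0, hθ1, fun i c hc n b => (hbd i c hc n b).trans ?_,
    fun i c hc n b hI => (hct i c hc n b hI).trans ?_, fun i c hc b => (hW i c hc b).trans ?_,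
    fun i c hc c' hc' b => (hlip i c hc c' hc' b).trans ?_,
    fun i c hc c' hc' b => (hlW i c hc c' hc' b).trans ?_,
    fun i c hc c' hc' b => (hdiff i c hc c' hc' b).trans ?_⟩ <;> gcongr <;> linarith

lemma integral_Lc {c : ℝ} (hc : F.coupledMap r ν c ∈ 𝒯) (i : Fin 4) (b : B i) :
    X.integral i (X.Lc F ν c i b) = X.integral i b := by
  rw [integral, ContinuousLinearMap.flip_apply, J_Lc hc]
  rfl

lemma integral_Wc {c : ℝ} (hc : F.coupledMap r ν c ∈ 𝒯) (i : Fin 3) (b : B i.succ) :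
    X.integral i.castSucc (X.Wc F ν c i b) = 0 := by
  let one : Smooth d := ⟨fun _ => 1, contDiff_const⟩
  refine (J_Wc hc i b one).trans ?_
  have h3 : ∀ k, (F.β k).mulCr (CrMap.pullback (F.coupledMap r ν c)
      ((one.partialDeriv k).toCr r)) = 0 := fun k => Subtype.ext (funext fun x => by
    change F.β k x * deriv (fun t : ℝ => (1 : ℝ)) 0 = 0
    simp)
  simp [h3]

lemma J_incl3 (b : B 3) (φ : Cr d r) : X.J 0 (X.incl 0 (X.incl 1 (X.incl 2 b))) φ = X.J 3 b φ :=
  congrArg (fun u => u φ)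
    ((X.J_incl 0 (X.incl 1 (X.incl 2 b))).trans ((X.J_incl 1 (X.incl 2 b)).trans (X.J_incl 2 b)))

variable (X) in
/-- The `Core` of a mean field coupled system on a scale of Banach spaces. -/
noncomputable def core (hX : X.Admissible) (F : CoupledSystem d) (ν : ℝ)
    (hR : ∀ c ∈ range F.meanα, F.coupledMap r ν c ∈ 𝒯) : Core (B 0) (B 1) (B 2) (B 3) :=
  have hb := Classical.choose_spec (Classical.choose_spec
    (exists_coreBounds hX F.convex_range_meanα hR))
  { i1 := X.incl 0
    i2 := X.incl 1
    i3 := X.incl 2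
    inj1 := incl_injective 0
    inj2 := incl_injective 1
    inj3 := incl_injective 2
    nle2 := X.norm_incl_le 1
    nle3 := X.norm_incl_le 2
    dns2 := dense_incl X 1
    cpt3 := hX.compact_incl 2
    R := range F.meanα
    L0 := fun c => X.Lc F ν c 0
    L1 := fun c => X.Lc F ν c 1
    L2 := fun c => X.Lc F ν c 2
    L3 := fun c => X.Lc F ν c 3
    commL1 := fun c b => incl_Lc c 0 b
    commL2 := fun c b => incl_Lc c 1 b
    commL3 := fun c b => incl_Lc c 2 b
    W1 := fun c => X.Wc F ν c 0
    W2 := fun c => X.Wc F ν c 1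
    W3 := fun c => X.Wc F ν c 2
    commW2 := fun c b => incl_Wc c 0 b
    commW3 := fun c b => incl_Wc c 1 b
    a := X.pair F.α 0
    I := X.integral 0
    I_L := fun c hc b => integral_Lc (hR c hc) 0 b
    I_W := fun c hc b => integral_Wc (hR c hc) 0 b
    C := Classical.choose (exists_coreBounds hX F.convex_range_meanα hR)
    one_le_C := hb.one_le
    θ := Classical.choose (Classical.choose_spec (exists_coreBounds hX F.convex_range_meanα hR))
    θ_pos := hb.pos
    θ_lt := hb.lt
    bd1 := hb.bd 1
    bd2 := hb.bd 2
    bd3 := hb.bd 3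
    ct1 := fun c hc n b h => hb.ct 0 c hc n b
      ((congrArg (fun u => u (oneCr d r)) (X.J_incl 0 b)).symm.trans h)
    ct3 := fun c hc n b h => hb.ct 2 c hc n b ((J_incl3 b _).symm.trans h)
    bdW2 := hb.bdW 1
    bdW3 := hb.bdW 2
    lip0 := hb.lip 0
    lip1 := hb.lip 1
    lip2 := hb.lip 2
    lipW1 := hb.lipW 0
    lipW2 := hb.lipW 1
    diff1 := hb.diff 1 }

end BanachScale

variable {E0 E1 E2 E3 : Type*} [NormedAddCommGroup E0] [NormedSpace ℝ E0]
  [NormedAddCommGroup E1] [NormedSpace ℝ E1] [NormedAddCommGroup E2] [NormedSpace ℝ E2]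
  [NormedAddCommGroup E3] [NormedSpace ℝ E3] {G : Core E0 E1 E2 E3} {h : E3}
  {d r : ℕ} {𝒯 : Set (CrMap d r)} {B : Fin 4 → Type u}
  [∀ i, NormedAddCommGroup (B i)] [∀ i, NormedSpace ℝ (B i)] {X : BanachScale r 𝒯 B}
  {F : CoupledSystem d} {ν : ℝ} {hX : X.Admissible}
  {hR : ∀ c ∈ range F.meanα, F.coupledMap r ν c ∈ 𝒯}
  {μ : ProbabilityMeasure (Torus d)} {h₃ : B 3}

/-! ### Orbits of the nonlinear transfer operator -/

section Iter

variable {E E' : Type*} [NormedAddCommGroup E] [NormedSpace ℝ E] [NormedAddCommGroup E']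
  [NormedSpace ℝ E']

lemma iter_succ (L : ℝ → E →L[ℝ] E) (c : ℕ → ℝ) (n : ℕ) (b : E) :
    iter L c (n + 1) b = L (c n) (iter L c n b) := rfl

lemma iter_const (L : ℝ → E →L[ℝ] E) (c : ℝ) (n : ℕ) : iter L (fun _ => c) n = L c ^ n := by
  induction n with
  | zero => rfl
  | succ n ih => rw [iter, ih, pow_succ']; rfl

lemma iter_succ_left (L : ℝ → E →L[ℝ] E) (c : ℕ → ℝ) (n : ℕ) (b : E) :
    iter L c (n + 1) b = iter L (fun k => c (k + 1)) n (L (c 0) b) := by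
  induction n with
  | zero => rfl
  | succ n ih => rw [iter_succ, ih, iter_succ]

lemma iter_comm (ι : E' →L[ℝ] E) (L : ℝ → E →L[ℝ] E) (L' : ℝ → E' →L[ℝ] E')
    (h : ∀ c b, ι (L' c b) = L c (ι b)) (c : ℕ → ℝ) (n : ℕ) (b : E') :
    ι (iter L' c n b) = iter L c n (ι b) := by
  induction n with
  | zero => rfl
  | succ n ih => rw [iter_succ, h, ih, iter_succ]

end Iter

namespace Core

variable (G)

lemma C_pos : 0 < G.C := one_pos.trans_le G.one_le_C

/-- The functional `a` on `E1`. -/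
def a1 : E1 →L[ℝ] ℝ := G.a.comp G.i1

/-- The functional `a` on `E2`. -/
def a2 : E2 →L[ℝ] ℝ := G.a1.comp G.i2

/-- The functional `a` on `E3`. -/
def a3 : E3 →L[ℝ] ℝ := G.a2.comp G.i3

/-- The integral on `E1`. -/
def I1 : E1 →L[ℝ] ℝ := G.I.comp G.i1

/-- The integral on `E2`. -/
def I2 : E2 →L[ℝ] ℝ := G.I1.comp G.i2

/-- The integral on `E3`. -/
def I3 : E3 →L[ℝ] ℝ := G.I2.comp G.i3

lemma I1_L {c : ℝ} (hc : c ∈ G.R) (b : E1) : G.I1 (G.L1 c b) = G.I1 b := by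
  change G.I (G.i1 (G.L1 c b)) = _
  rw [G.commL1, G.I_L c hc]; rfl

lemma I2_L {c : ℝ} (hc : c ∈ G.R) (b : E2) : G.I2 (G.L2 c b) = G.I2 b := by
  change G.I1 (G.i2 (G.L2 c b)) = _
  rw [G.commL2, G.I1_L hc]; rfl

lemma I3_L {c : ℝ} (hc : c ∈ G.R) (b : E3) : G.I3 (G.L3 c b) = G.I3 b := by
  change G.I2 (G.i3 (G.L3 c b)) = _
  rw [G.commL3, G.I2_L hc]; rfl

lemma I1_W {c : ℝ} (hc : c ∈ G.R) (b : E2) : G.I1 (G.W2 c b) = 0 := by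
  change G.I (G.i1 (G.W2 c b)) = _
  rw [G.commW2, G.I_W c hc]

lemma I2_W {c : ℝ} (hc : c ∈ G.R) (b : E3) : G.I2 (G.W3 c b) = 0 := by
  change G.I1 (G.i2 (G.W3 c b)) = _
  rw [G.commW3, G.I1_W hc]

lemma bdL1 {c : ℝ} (hc : c ∈ G.R) (b : E1) : ‖G.L1 c b‖ ≤ G.C * ‖b‖ :=
  G.bd1 (fun _ => c) (fun _ => hc) 1 b

lemma bdL2 {c : ℝ} (hc : c ∈ G.R) (b : E2) : ‖G.L2 c b‖ ≤ G.C * ‖b‖ :=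
  G.bd2 (fun _ => c) (fun _ => hc) 1 b

lemma pow_L1_le {c : ℝ} (hc : c ∈ G.R) (n : ℕ) (b : E1) : ‖(G.L1 c ^ n) b‖ ≤ G.C * ‖b‖ := by
  rw [← iter_const]; exact G.bd1 _ (fun _ => hc) n b

lemma pow_L1_contr {c : ℝ} (hc : c ∈ G.R) (n : ℕ) {b : E1} (hb : G.I1 b = 0) :
    ‖(G.L1 c ^ n) b‖ ≤ G.C * G.θ ^ n * ‖b‖ := by
  rw [← iter_const]; exact G.ct1 _ (fun _ => hc) n b hb

lemma pow_L3_contr {c : ℝ} (hc : c ∈ G.R) (n : ℕ) {b : E3} (hb : G.I3 b = 0) :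
    ‖(G.L3 c ^ n) b‖ ≤ G.C * G.θ ^ n * ‖b‖ := by
  rw [← iter_const]; exact G.ct3 _ (fun _ => hc) n b hb

/-- `b` is an orbit of `f ↦ L (a f) f`, of elements with integral `1`. -/
structure IsOrbit (b : ℕ → E3) : Prop where
  mem : ∀ n, G.a3 (b n) ∈ G.R
  step : ∀ n, b (n + 1) = G.L3 (G.a3 (b n)) (b n)
  int_one : ∀ n, G.I3 (b n) = 1

variable {G}

lemma IsOrbit.eq_iter {b : ℕ → E3} (hb : G.IsOrbit b) (n : ℕ) :
    b n = iter G.L3 (fun k => G.a3 (b k)) n (b 0) := by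
  induction n with
  | zero => rfl
  | succ n ih => rw [iter_succ, ← ih, hb.step]

lemma IsOrbit.shift {b : ℕ → E3} (hb : G.IsOrbit b) (N : ℕ) : G.IsOrbit fun n => b (N + n) :=
  ⟨fun _ => hb.mem _, fun _ => hb.step _, fun _ => hb.int_one _⟩

lemma IsOrbit.norm_le {b : ℕ → E3} (hb : G.IsOrbit b) (n : ℕ) : ‖b n‖ ≤ G.C * ‖b 0‖ := by
  rw [hb.eq_iter n]
  exact G.bd3 _ (fun n => hb.mem n) n _

lemma summable_of_contr [CompleteSpace E1] {c : ℝ} (hc : c ∈ G.R) {w : E1} (hw : G.I1 w = 0)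
    {s : ℕ → ℝ} {M : ℝ} (hs : ∀ n, |s n| ≤ M) : Summable fun n => s n • (G.L1 c ^ n) w := by
  have hM : 0 ≤ M := (abs_nonneg _).trans (hs 0)
  refine Summable.of_norm_bounded (g := fun n => M * (G.C * G.θ ^ n * ‖w‖)) ?_ fun n => ?_
  · exact (((summable_geometric_of_lt_one G.θ_pos.le G.θ_lt).mul_left _).mul_right _).mul_left _
  · rw [norm_smul]
    exact mul_le_mul (hs n) (G.pow_L1_contr hc n hw) (norm_nonneg _) hM

lemma eq_zero_of_fixed {c : ℝ} (hc : c ∈ G.R) {x : E1} (hx : G.I1 x = 0) (h : G.L1 c x = x) :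
    x = 0 := by
  have hp : ∀ n, (G.L1 c ^ n) x = x := fun n => by
    induction n with
    | zero => rfl
    | succ n ih => rw [pow_succ']; change G.L1 c ((G.L1 c ^ n) x) = x; rw [ih, h]
  have h1 : ∀ n : ℕ, ‖x‖ ≤ G.C * G.θ ^ n * ‖x‖ := fun n => by
    have := G.pow_L1_contr hc n hx
    rwa [hp] at this
  have h2 : Tendsto (fun n : ℕ => G.C * G.θ ^ n * ‖x‖) atTop (𝓝 (G.C * 0 * ‖x‖)) :=
    ((tendsto_pow_atTop_nhds_zero_of_lt_one G.θ_pos.le G.θ_lt).const_mul _).mul_const _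
  have h3 := ge_of_tendsto' h2 h1
  simpa using h3

/-- The equation `Θ - L Θ = w` has a solution with zero integral, given by a Neumann series. -/
lemma hasSum_theta [CompleteSpace E1] {c : ℝ} (hc : c ∈ G.R) {w : E1} (hw : G.I1 w = 0) :
    G.I1 (∑' n, (G.L1 c ^ n) w) = 0 ∧
      (∑' n, (G.L1 c ^ n) w) - G.L1 c (∑' n, (G.L1 c ^ n) w) = w := by
  have hs : Summable fun n => (G.L1 c ^ n) w := by
    simpa using summable_of_contr hc hw (s := fun _ => 1) (M := 1) (by simp)
  constructor
  · rw [G.I1.map_tsum hs]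
    have : ∀ n, G.I1 ((G.L1 c ^ n) w) = 0 := fun n => by
      induction n with
      | zero => exact hw
      | succ n ih =>
        rw [pow_succ']; change G.I1 (G.L1 c ((G.L1 c ^ n) w)) = 0
        rw [G.I1_L hc, ih]
    simp_rw [this, tsum_zero]
  · rw [(G.L1 c).map_tsum hs, hs.tsum_eq_zero_add]
    have : ∀ n, (G.L1 c) ((G.L1 c ^ n) w) = (G.L1 c ^ (n + 1)) w := fun n => by rw [pow_succ']; rfl
    simp_rw [this]
    exact add_sub_cancel_right _ _

lemma theta_unique {c : ℝ} (hc : c ∈ G.R) {w x y : E1} (hx : G.I1 x = 0)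
    (hx' : x - G.L1 c x = w) (hy : G.I1 y = 0) (hy' : y - G.L1 c y = w) : x = y := by
  refine sub_eq_zero.1 (eq_zero_of_fixed hc (x := x - y) (by rw [map_sub, hx, hy, sub_zero]) ?_)
  rw [map_sub, ← sub_eq_zero]
  have := sub_eq_zero.2 (hx'.trans hy'.symm)
  rw [← neg_eq_zero, ← this]
  abel

/-- The transfer operator with parameter `c ∈ R` has a fixed point with integral `1` in `E3`. -/
lemma exists_fixed [CompleteSpace E3] {c : ℝ} (hc : c ∈ G.R) {e : E3} (he : G.I3 e = 1) :
    ∃ h : E3, G.L3 c h = h ∧ G.I3 h = 1 := by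
  have hI : G.I3 (G.L3 c e - e) = 0 := by rw [map_sub, G.I3_L hc, sub_self]
  have hstep : ∀ n : ℕ, (G.L3 c ^ (n + 1)) e - (G.L3 c ^ n) e = (G.L3 c ^ n) (G.L3 c e - e) := by
    intro n
    rw [map_sub, pow_succ]; rfl
  have hcau : CauchySeq fun n : ℕ => (G.L3 c ^ n) e := by
    refine cauchySeq_of_le_geometric G.θ (G.C * ‖G.L3 c e - e‖) G.θ_lt fun n => ?_
    rw [dist_comm, dist_eq_norm, hstep]
    refine (G.pow_L3_contr hc n hI).trans (le_of_eq (by ring))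
  obtain ⟨h, hh⟩ := cauchySeq_tendsto_of_complete hcau
  refine ⟨h, ?_, ?_⟩
  · have h1 : Tendsto (fun n : ℕ => (G.L3 c ^ (n + 1)) e) atTop (𝓝 h) :=
      hh.comp (tendsto_add_atTop_nat 1)
    have h2 : Tendsto (fun n : ℕ => G.L3 c ((G.L3 c ^ n) e)) atTop (𝓝 (G.L3 c h)) :=
      ((G.L3 c).continuous.tendsto h).comp hh
    refine tendsto_nhds_unique h2 (h1.congr fun n => ?_)
    rw [pow_succ']; rfl
  · have h1 : Tendsto (fun n : ℕ => G.I3 ((G.L3 c ^ n) e)) atTop (𝓝 (G.I3 h)) :=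
      (G.I3.continuous.tendsto h).comp hh
    have h2 : ∀ n : ℕ, G.I3 ((G.L3 c ^ n) e) = 1 := fun n => by
      induction n with
      | zero => exact he
      | succ n ih =>
        rw [pow_succ']; change G.I3 (G.L3 c ((G.L3 c ^ n) e)) = 1
        rw [G.I3_L hc, ih]
    simp_rw [h2] at h1
    exact tendsto_nhds_unique h1 tendsto_const_nhds

/-- Strong continuity of `c ↦ L c` on `E1`. -/
lemma continuousOn_L1 (b : E1) : ContinuousOn (fun c => G.L1 c b) G.R := by
  intro c hc
  rw [Metric.continuousWithinAt_iff]
  intro ε hε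
  have hC := G.C_pos
  obtain ⟨b', hb'⟩ := G.dns2.exists_dist_lt b (ε := ε / (4 * G.C)) (by positivity)
  have hq : 0 < ε / (2 * (G.C * (‖b'‖ + 1))) := by positivity
  refine ⟨_, hq, fun {c'} hc' hcc => ?_⟩
  rw [dist_eq_norm] at hb' ⊢
  have e : G.L1 c' b - G.L1 c b = G.L1 c' (b - G.i2 b') - G.L1 c (b - G.i2 b') +
      (G.L1 c' (G.i2 b') - G.L1 c (G.i2 b')) := by simp only [map_sub]; abel
  rw [e]
  have h1 := G.bdL1 hc' (b - G.i2 b')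
  have h2 := G.bdL1 hc (b - G.i2 b')
  have h3 := G.lip1 c' hc' c hc b'
  rw [Real.dist_eq] at hcc
  have h4 : G.C * ‖b - G.i2 b'‖ < ε / 4 := by
    calc G.C * ‖b - G.i2 b'‖ < G.C * (ε / (4 * G.C)) := by gcongr
      _ = ε / 4 := by field_simp
  have h5 : G.C * |c' - c| * ‖b'‖ ≤ ε / 2 := by
    calc G.C * |c' - c| * ‖b'‖ ≤ G.C * (ε / (2 * (G.C * (‖b'‖ + 1)))) * (‖b'‖ + 1) := by
          gcongr; linarith
      _ = ε / 2 := by field_simp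
  refine (norm_add_le _ _).trans_lt ?_
  have := norm_sub_le (G.L1 c' (b - G.i2 b')) (G.L1 c (b - G.i2 b'))
  linarith

/-- The derivative of `t ↦ L (c + t a(φ)) (h + t φ)` at `t = 0`. -/
lemma tendsto_gateaux {h : E3} (hc : G.a3 h ∈ G.R) (φ : E1) {S : Set ℝ}
    (hS : ∀ t ∈ S, t ≠ 0 ∧ G.a3 h + t * G.a1 φ ∈ G.R) :
    Tendsto (fun t : ℝ => t⁻¹ • (G.L1 (G.a3 h + t * G.a1 φ) (G.i2 (G.i3 h) + t • φ) -
      G.L1 (G.a3 h) (G.i2 (G.i3 h)))) (𝓝[S] 0)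
      (𝓝 (G.L1 (G.a3 h) φ + G.a1 φ • G.i2 (G.W3 (G.a3 h) h))) := by
  set c := G.a3 h
  have hct : Tendsto (fun t : ℝ => c + t * G.a1 φ) (𝓝[S] 0) (𝓝[G.R] c) := by
    refine tendsto_nhdsWithin_iff.2 ⟨?_, eventually_nhdsWithin_of_forall fun t ht => (hS t ht).2⟩
    have : Tendsto (fun t : ℝ => c + t * G.a1 φ) (𝓝 0) (𝓝 (c + 0 * G.a1 φ)) :=
      (by fun_prop : Continuous fun t : ℝ => c + t * G.a1 φ).tendsto 0
    rw [zero_mul, add_zero] at this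
    exact this.mono_left nhdsWithin_le_nhds
  have h1 : Tendsto (fun t : ℝ => G.L1 (c + t * G.a1 φ) φ) (𝓝[S] 0) (𝓝 (G.L1 c φ)) :=
    (continuousOn_L1 φ c hc).tendsto.comp hct
  have h2 : Tendsto (fun t : ℝ => t⁻¹ • (G.L1 (c + t * G.a1 φ) (G.i2 (G.i3 h)) -
      G.L1 c (G.i2 (G.i3 h))) - G.a1 φ • G.i2 (G.W3 c h)) (𝓝[S] 0) (𝓝 0) := by
    refine squeeze_zero_norm' (a := fun t : ℝ => G.C * |G.a1 φ| ^ 2 * ‖h‖ * |t|) ?_ ?_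
    · refine eventually_nhdsWithin_of_forall fun t ht => ?_
      obtain ⟨ht0, htR⟩ := hS t ht
      have h3 := G.diff1 _ htR _ hc h
      rw [add_sub_cancel_left] at h3
      have e : t⁻¹ • (G.L1 (c + t * G.a1 φ) (G.i2 (G.i3 h)) - G.L1 c (G.i2 (G.i3 h))) -
          G.a1 φ • G.i2 (G.W3 c h) = t⁻¹ • (G.L1 (c + t * G.a1 φ) (G.i2 (G.i3 h)) -
            G.L1 c (G.i2 (G.i3 h)) - (t * G.a1 φ) • G.W2 c (G.i3 h)) := by
        rw [smul_sub t⁻¹ (_ - _), smul_smul, inv_mul_cancel_left₀ ht0, G.commW3]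
      rw [e, norm_smul, norm_inv, Real.norm_eq_abs]
      have ht : 0 < |t| := abs_pos.2 ht0
      rw [inv_mul_le_iff₀ ht]
      refine h3.trans (le_of_eq ?_)
      rw [abs_mul]; ring
    · have : Tendsto (fun t : ℝ => G.C * |G.a1 φ| ^ 2 * ‖h‖ * |t|) (𝓝 0)
          (𝓝 (G.C * |G.a1 φ| ^ 2 * ‖h‖ * |0|)) := (by fun_prop : Continuous _).tendsto 0
      rw [abs_zero, mul_zero] at this
      exact this.mono_left nhdsWithin_le_nhds
  have h3 := (h1.add h2).add_const (G.a1 φ • G.i2 (G.W3 c h))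
  rw [add_zero] at h3
  refine h3.congr' (eventually_nhdsWithin_of_forall fun t ht => ?_)
  obtain ⟨ht0, -⟩ := hS t ht
  simp only [map_add, map_smul]
  rw [add_sub_right_comm, smul_add, smul_smul, inv_mul_cancel₀ ht0, one_smul]
  abel

/-- The linearization `φ ↦ L φ + a(φ) W h` at `h`, on `E1`. -/
noncomputable def lin (G : Core E0 E1 E2 E3) (h : E3) : E1 →L[ℝ] E1 :=
  G.L1 (G.a3 h) + G.a1.smulRight (G.i2 (G.W3 (G.a3 h) h))

lemma lin_apply (h : E3) (φ : E1) :
    G.lin h φ = G.L1 (G.a3 h) φ + G.a1 φ • G.i2 (G.W3 (G.a3 h) h) := rfl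

/-- The coefficients `a (L ^ j W h)` of the renewal equation. -/
noncomputable def coef (G : Core E0 E1 E2 E3) (h : E3) (j : ℕ) : ℝ :=
  G.a1 ((G.L1 (G.a3 h) ^ j) (G.i2 (G.W3 (G.a3 h) h)))

lemma abs_coef_le {h : E3} (hc : G.a3 h ∈ G.R) :
    ∃ M, 0 ≤ M ∧ ∀ j, |G.coef h j| ≤ M * G.θ ^ j := by
  have hw : G.I1 (G.i2 (G.W3 (G.a3 h) h)) = 0 := G.I2_W hc h
  refine ⟨‖G.a1‖ * (G.C * ‖G.i2 (G.W3 (G.a3 h) h)‖), by have := G.C_pos; positivity, fun j => ?_⟩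
  refine (G.a1.le_opNorm _).trans ?_
  rw [mul_assoc]
  refine mul_le_mul_of_nonneg_left ((G.pow_L1_contr hc j hw).trans (le_of_eq (by ring)))
    (norm_nonneg _)

end Core

/-! ### Reciprocals of power series -/

/-- The sum of the power series with coefficients `f`. -/
noncomputable def ser (f : ℕ → ℂ) (z : ℂ) : ℂ := ∑' l, f l * z ^ l

/-- The `k`-th Laurent coefficient of `1 / ser f` on the circle of radius `r`. -/
noncomputable def lau (f : ℕ → ℂ) (r : ℝ) (k : ℤ) : ℂ :=
  (2 * Real.pi * Complex.I : ℂ)⁻¹ • ∮ z in C(0, r), z ^ (-k - 1) / ser f z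

section Laurent

variable {f : ℕ → ℂ} {r : ℝ}

lemma summable_ser (hf : Summable fun l => ‖f l‖ * r ^ l) {z : ℂ} (hz : ‖z‖ ≤ r) :
    Summable fun l => f l * z ^ l := by
  refine Summable.of_norm_bounded hf fun l => ?_
  rw [norm_mul, norm_pow]
  gcongr

lemma continuousOn_ser (hf : Summable fun l => ‖f l‖ * r ^ l) :
    ContinuousOn (ser f) (Metric.closedBall 0 r) := by
  refine continuousOn_tsum (fun l => by fun_prop) hf fun l z hz => ?_
  rw [norm_mul, norm_pow]
  have : ‖z‖ ≤ r := by simpa using hz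
  gcongr

lemma differentiableOn_ser (hf : Summable fun l => ‖f l‖ * r ^ l) :
    DifferentiableOn ℂ (ser f) (Metric.ball 0 r) := by
  refine Complex.differentiableOn_tsum_of_summable_norm hf (fun l => by fun_prop)
    Metric.isOpen_ball fun l z hz => ?_
  rw [norm_mul, norm_pow]
  have : ‖z‖ ≤ r := (mem_ball_zero_iff.1 hz).le
  gcongr

lemma exists_lower_bound (hr : 0 < r) (hf : Summable fun l => ‖f l‖ * r ^ l)
    (h0 : ∀ z : ℂ, ‖z‖ = r → ser f z ≠ 0) :
    ∃ m, 0 < m ∧ ∀ z : ℂ, ‖z‖ = r → m ≤ ‖ser f z‖ := by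
  have hne : (Metric.sphere (0 : ℂ) r).Nonempty := ⟨(r : ℂ), by simp [abs_of_pos hr]⟩
  obtain ⟨z, hz, hmin⟩ := (isCompact_sphere (0 : ℂ) r).exists_isMinOn hne
    ((continuousOn_ser hf).mono Metric.sphere_subset_closedBall).norm
  exact ⟨_, norm_pos_iff.2 (h0 z (by simpa using hz)), fun w hw => hmin (by simpa using hw)⟩

lemma norm_lau_le (hr : 0 < r) {m : ℝ} (hm : 0 < m)
    (h0 : ∀ z : ℂ, ‖z‖ = r → m ≤ ‖ser f z‖) (k : ℤ) : ‖lau f r k‖ ≤ m⁻¹ * r ^ (-k) := by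
  have := circleIntegral.norm_two_pi_i_inv_smul_integral_le_of_norm_le_const (c := (0 : ℂ)) hr.le
    (f := fun z => z ^ (-k - 1) / ser f z) (C := r ^ (-k - 1) * m⁻¹) (fun z hz => by
      have hz : ‖z‖ = r := by simpa using hz
      rw [norm_div, norm_zpow, hz, div_eq_mul_inv]
      have := h0 z hz
      gcongr)
  refine this.trans (le_of_eq ?_)
  rw [zpow_sub₀ hr.ne', zpow_one]
  field_simp

lemma hasSum_lau (hr : 0 < r) (hf : Summable fun l => ‖f l‖ * r ^ l)
    (h0 : ∀ z : ℂ, ‖z‖ = r → ser f z ≠ 0) (k : ℤ) :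
    HasSum (fun l : ℕ => f l * lau f r (k - l)) (if k = 0 then 1 else 0) := by
  obtain ⟨m, hm, hmin⟩ := exists_lower_bound hr hf h0
  have hcz : ∀ t, ‖circleMap 0 r t‖ = r := fun t => by simp [abs_of_pos hr]
  have hcne : ∀ t, circleMap 0 r t ≠ 0 := fun t => by rw [← norm_pos_iff, hcz]; exact hr
  have hcont : Continuous fun t : ℝ => ser f (circleMap 0 r t) :=
    (continuousOn_ser hf).comp_continuous (continuous_circleMap 0 r) fun t => by simp [hcz]
  have hcu : ∀ j : ℤ, Continuous fun t : ℝ =>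
      deriv (circleMap 0 r) t • (circleMap 0 r t ^ j / ser f (circleMap 0 r t)) := fun j => by
    simp only [deriv_circleMap]
    exact ((continuous_circleMap 0 r).mul continuous_const).smul
      (((continuous_circleMap 0 r).zpow₀ j fun t => Or.inl (hcne t)).div₀ hcont fun t =>
        h0 _ (hcz t))
  have key : HasSum (fun l : ℕ => ∫ t in (0 : ℝ)..2 * Real.pi, deriv (circleMap 0 r) t •
      (f l * (circleMap 0 r t ^ (-(k - l) - 1) / ser f (circleMap 0 r t))))
      (∫ t in (0 : ℝ)..2 * Real.pi, deriv (circleMap 0 r) t • (circleMap 0 r t ^ (-k - 1))) := by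
    have hsum : Summable fun l : ℕ => r * (‖f l‖ * r ^ l * (r ^ (-k - 1) * m⁻¹)) :=
      (hf.mul_right _).mul_left _
    refine intervalIntegral.hasSum_integral_of_dominated_convergence
      (fun l _ => r * (‖f l‖ * r ^ l * (r ^ (-k - 1) * m⁻¹))) (fun l => ?_)
      (fun l => ae_of_all _ fun t _ => ?_) (ae_of_all _ fun t _ => hsum)
      intervalIntegrable_const (ae_of_all _ fun t _ => ?_)
    · have := (hcu (-(k - l) - 1)).const_smul (f l)
      refine Continuous.aestronglyMeasurable (this.congr fun t => ?_)
      simp only [Pi.smul_apply, smul_eq_mul]; ring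
    · rw [deriv_circleMap, norm_smul, norm_mul, norm_mul, norm_div, norm_zpow, hcz,
        Complex.norm_I, mul_one, mul_assoc (‖f l‖)]
      have h1 : r ^ (-(k - (l : ℤ)) - 1) = r ^ l * r ^ (-k - 1) := by
        rw [← zpow_natCast r l, ← zpow_add₀ hr.ne']; congr 1; ring
      rw [h1, div_eq_mul_inv, mul_assoc (r ^ l)]
      have := hmin _ (hcz t)
      gcongr
    · have h1 : HasSum (fun l => f l * circleMap 0 r t ^ l) (ser f (circleMap 0 r t)) :=
        (summable_ser hf (hcz t).le).hasSum
      have h2 := (h1.mul_right (circleMap 0 r t ^ (-k - 1) / ser f (circleMap 0 r t))).const_smul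
        (deriv (circleMap 0 r) t)
      rw [mul_div_cancel₀ _ (h0 _ (hcz t))] at h2
      refine h2.congr_fun fun l => ?_
      have : circleMap 0 r t ^ (-(k - (l : ℤ)) - 1) =
          circleMap 0 r t ^ l * circleMap 0 r t ^ (-k - 1) := by
        rw [← zpow_natCast, ← zpow_add₀ (hcne t)]; congr 1; ring
      rw [this]
      congr 1
      ring
  have key2 := key.const_smul (2 * Real.pi * Complex.I : ℂ)⁻¹
  convert key2 using 1
  · funext l
    unfold lau circleIntegral
    rw [smul_eq_mul, smul_eq_mul, ← mul_assoc, mul_comm (f l), mul_assoc,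
      ← intervalIntegral.integral_const_mul]
    congr 2
    funext t
    simp only [smul_eq_mul]; ring
  · change _ = (2 * Real.pi * Complex.I : ℂ)⁻¹ • ∮ z in C(0, r), z ^ (-k - 1)
    split_ifs with hk
    · have := circleIntegral.integral_sub_center_inv (0 : ℂ) hr.ne'
      simp only [sub_zero] at this
      simp only [hk, neg_zero, zero_sub, zpow_neg_one, this, smul_eq_mul]
      rw [inv_mul_cancel₀]
      simp [Real.pi_ne_zero]
    · have := circleIntegral.integral_sub_zpow_of_ne (n := -k - 1) (by omega) (0 : ℂ) 0 r
      simp only [sub_zero] at this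
      simp [this]

lemma lau_eq_zero (hr : 0 < r) (hf : Summable fun l => ‖f l‖ * r ^ l)
    (h0 : ∀ z : ℂ, ‖z‖ ≤ r → ser f z ≠ 0) {k : ℤ} (hk : k < 0) : lau f r k = 0 := by
  obtain ⟨j, hj⟩ : ∃ j : ℕ, -k - 1 = j := ⟨(-k - 1).toNat, by omega⟩
  unfold lau
  rw [hj]
  simp_rw [zpow_natCast]
  rw [Complex.circleIntegral_eq_zero_of_differentiable_on_off_countable hr.le countable_empty,
    smul_zero]
  · refine ContinuousOn.div (by fun_prop) (continuousOn_ser hf) fun z hz => h0 z (by simpa using hz)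
  · intro z hz
    have hz' : z ∈ Metric.ball (0 : ℂ) r := hz.1
    refine DifferentiableAt.div (by fun_prop)
      ((differentiableOn_ser hf).differentiableAt (Metric.isOpen_ball.mem_nhds hz'))
      (h0 z (mem_ball_zero_iff.1 hz').le)

lemma lau_eq_of_annulus {r1 : ℝ} (hr : 0 < r) (hrr : r ≤ r1)
    (hf : Summable fun l => ‖f l‖ * r1 ^ l)
    (h0 : ∀ z : ℂ, r ≤ ‖z‖ → ‖z‖ ≤ r1 → ser f z ≠ 0) (k : ℤ) : lau f r1 k = lau f r k := by
  unfold lau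
  congr 1
  have hne : ∀ z : ℂ, r ≤ ‖z‖ → z ≠ 0 := fun z hz => norm_pos_iff.1 (hr.trans_le hz)
  refine Complex.circleIntegral_eq_of_differentiable_on_annulus_off_countable hr hrr
    countable_empty ?_ ?_
  · refine ContinuousOn.div ?_ ((continuousOn_ser hf).mono sdiff_subset) ?_
    · intro z hz
      have : r ≤ ‖z‖ := by simpa using hz.2
      exact (continuousAt_zpow₀ z _ (Or.inl (hne z this))).continuousWithinAt
    · intro z hz
      exact h0 z (by simpa using hz.2) (by simpa using hz.1)
  · intro z hz
    have h1 : ‖z‖ < r1 := by simpa using hz.1.1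
    have h2 : r < ‖z‖ := by simpa using hz.1.2
    exact DifferentiableAt.div (differentiableAt_zpow.2 (Or.inl (hne z h2.le)))
      ((differentiableOn_ser hf).differentiableAt (Metric.isOpen_ball.mem_nhds (by simpa using h1)))
      (h0 z h2.le h1.le)

/-- A power series without zeros on the closed unit disc, with radius of convergence greater than
`1`, has no zeros on a larger disc. -/
lemma exists_radius_ne_zero {R : ℝ} (hR : 1 < R) (hf : Summable fun l => ‖f l‖ * R ^ l)
    (h0 : ∀ z : ℂ, ‖z‖ ≤ 1 → ser f z ≠ 0) :
    ∃ r, 1 < r ∧ r ≤ R ∧ ∀ z : ℂ, ‖z‖ ≤ r → ser f z ≠ 0 := by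
  have hc := continuousOn_ser hf
  set Z : Set ℂ := Metric.closedBall 0 R ∩ ser f ⁻¹' {0} with hZ
  have hZc : IsCompact Z := (isCompact_closedBall (0 : ℂ) R).of_isClosed_subset
    (hc.preimage_isClosed_of_isClosed Metric.isClosed_closedBall isClosed_singleton)
    inter_subset_left
  by_cases hne : Z.Nonempty
  · obtain ⟨w, hw, hmin⟩ := hZc.exists_isMinOn hne continuous_norm.continuousOn
    have hw1 : 1 < ‖w‖ := by
      by_contra h
      exact h0 w (not_lt.1 h) hw.2
    have hwR : ‖w‖ ≤ R := by simpa using hw.1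
    refine ⟨(1 + ‖w‖) / 2, by linarith, by linarith, fun z hz hz0 => ?_⟩
    have : ‖w‖ ≤ ‖z‖ := hmin (⟨by simpa using (by linarith : ‖z‖ ≤ R), hz0⟩ : z ∈ Z)
    linarith
  · exact ⟨R, hR, le_rfl, fun z hz hz0 => hne ⟨z, by simpa using hz, hz0⟩⟩

/-- Between two radii inside the disc of convergence there is an annulus without zeros. -/
lemma exists_annulus_ne_zero (hf : Summable fun l => ‖f l‖ * r ^ l) (hf0 : f 0 ≠ 0) {s : ℝ}
    (hs : 0 ≤ s) (hsr : s < r) : ∃ ρ2 ρ1, s < ρ2 ∧ ρ2 < ρ1 ∧ ρ1 < r ∧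
      ∀ z : ℂ, ρ2 ≤ ‖z‖ → ‖z‖ ≤ ρ1 → ser f z ≠ 0 := by
  have hr : 0 < r := hs.trans_lt hsr
  obtain ⟨r', hsr', hr'⟩ := exists_between hsr
  have hc : ContinuousOn (ser f) (Metric.closedBall 0 r') :=
    (continuousOn_ser hf).mono (Metric.closedBall_subset_closedBall hr'.le)
  set Z : Set ℂ := Metric.closedBall 0 r' ∩ ser f ⁻¹' {0}
  have hZc : IsCompact Z := (isCompact_closedBall (0 : ℂ) r').of_isClosed_subset
    (hc.preimage_isClosed_of_isClosed Metric.isClosed_closedBall isClosed_singleton)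
    inter_subset_left
  have hfin : Z.Finite := by
    by_contra hinf
    obtain ⟨x, hx, hacc⟩ := Set.Infinite.exists_accPt_of_subset_isCompact hinf hZc Subset.rfl
    have h2 := ((differentiableOn_ser hf).analyticOnNhd
      Metric.isOpen_ball).eqOn_zero_of_preconnected_of_frequently_eq_zero
      (convex_ball (0 : ℂ) r).isPreconnected (Metric.closedBall_subset_ball hr' hx.1)
      ((accPt_iff_frequently_nhdsNE.1 hacc).mono fun z hz => hz.2) (Metric.mem_ball_self hr)
    rw [ser, tsum_eq_single 0 fun l hl => by simp [hl]] at h2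
    exact hf0 (by simpa using h2)
  obtain ⟨a, b, hab, hsub⟩ := (isOpen_Ioo.inter (hfin.image _).isClosed.isOpen_compl
    : IsOpen (Ioo s r' ∩ (norm '' Z)ᶜ)).exists_Ioo_subset
    ((Ioo_infinite hsr').sdiff (hfin.image _)).nonempty
  obtain ⟨u, hau, hub⟩ := exists_between hab
  obtain ⟨t, hut, htb⟩ := exists_between hub
  refine ⟨u, t, (hsub ⟨hau, hub⟩).1.1, hut, (hsub ⟨hau.trans hut, htb⟩).1.2.trans hr',
    fun z h1 h2 hz0 => ?_⟩
  have h3 := hsub ⟨hau.trans_le h1, h2.trans_lt htb⟩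
  exact h3.2 ⟨z, ⟨by simpa using h3.1.2.le, hz0⟩, rfl⟩

end Laurent

section Renewal

/-- The coefficients of `1 - ∑ c_j z^(j+1)`. -/
def charCoef (c : ℕ → ℝ) : ℕ → ℂ
  | 0 => 1
  | j + 1 => -(c j : ℂ)

lemma summable_charCoef {c : ℕ → ℝ} {M θ r : ℝ} (hθ : 0 ≤ θ) (hc : ∀ j, |c j| ≤ M * θ ^ j)
    (hr : 0 ≤ r) (hrθ : r * θ < 1) : Summable fun l => ‖charCoef c l‖ * r ^ l := by
  rw [← summable_nat_add_iff 1]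
  refine Summable.of_nonneg_of_le (fun j => by positivity) (fun j => ?_)
    ((summable_geometric_of_lt_one (by positivity) hrθ).mul_left (M * r))
  rw [charCoef, norm_neg, Complex.norm_real, Real.norm_eq_abs, mul_pow]
  calc |c j| * r ^ (j + 1) ≤ M * θ ^ j * r ^ (j + 1) := by have := hc j; gcongr
    _ = _ := by ring

/-- A sequence with exponentially small coefficients times `n + 1` is still exponentially small. -/
lemma exists_succ_mul_pow_le {σ : ℝ} (h0 : 0 < σ) (h1 : σ < 1) :
    ∃ ρ K : ℝ, σ < ρ ∧ ρ < 1 ∧ 0 < K ∧ ∀ n : ℕ, (n + 1 : ℝ) * σ ^ n ≤ K * ρ ^ n := by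
  obtain ⟨ρ, hσρ, hρ1⟩ := exists_between h1
  have hρ : 0 < ρ := h0.trans hσρ
  have hq : σ / ρ < 1 := (div_lt_one hρ).2 hσρ
  have ht : Tendsto (fun n : ℕ => (n : ℝ) * (σ / ρ) ^ n) atTop (𝓝 0) :=
    tendsto_self_mul_const_pow_of_lt_one (by positivity) hq
  obtain ⟨K, hK⟩ := ht.bddAbove_range
  refine ⟨ρ, |K| + 1, hσρ, hρ1, by positivity, fun n => ?_⟩
  have h2 : (n : ℝ) * (σ / ρ) ^ n ≤ K := hK ⟨n, rfl⟩
  have h3 : (σ / ρ) ^ n ≤ 1 := pow_le_one₀ (by positivity) hq.le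
  have h4 : (n + 1 : ℝ) * σ ^ n = ((n : ℝ) * (σ / ρ) ^ n + (σ / ρ) ^ n) * ρ ^ n := by
    rw [div_pow]; field_simp
  rw [h4]
  have := le_abs_self K
  gcongr
  linarith

/-- The solutions of a renewal equation with exponentially small data are exponentially small, if
the characteristic function `1 - ∑ c_j z^(j+1)` has no zeros in the closed unit disc. -/
lemma renewal_decay {c : ℕ → ℝ} {M θ : ℝ} (hθ : 0 < θ) (hθ1 : θ < 1)
    (hc : ∀ j, |c j| ≤ M * θ ^ j) (h0 : ∀ z : ℂ, ‖z‖ ≤ 1 → ser (charCoef c) z ≠ 0) :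
    ∃ ρ K : ℝ, θ < ρ ∧ ρ < 1 ∧ 0 < K ∧ ∀ (y A : ℕ → ℝ) (M' : ℝ),
      (∀ n, y n = A n + ∑ p ∈ Finset.HasAntidiagonal.antidiagonal n,
        (if p.1 = 0 then 0 else c (p.1 - 1)) * y p.2) →
      (∀ n, |A n| ≤ M' * θ ^ n) → ∀ n, |y n| ≤ K * M' * ρ ^ n := by
  obtain ⟨R, hR1, hRθ⟩ : ∃ R, 1 < R ∧ R < 1 / θ := exists_between ((one_lt_div hθ).2 hθ1)
  have hfR := summable_charCoef hθ.le hc (r := R) (by linarith) (by rwa [lt_div_iff₀ hθ] at hRθ)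
  obtain ⟨r, hr1, hrR, hr⟩ := exists_radius_ne_zero hR1 hfR h0
  have hr0 : 0 < r := by linarith
  have hf := summable_charCoef hθ.le hc (r := r) hr0.le (by rw [lt_div_iff₀ hθ] at hRθ; nlinarith)
  have hne : ∀ z : ℂ, ‖z‖ = r → ser (charCoef c) z ≠ 0 := fun z hz => hr z hz.le
  obtain ⟨m, hm, hmin⟩ := exists_lower_bound hr0 hf hne
  set σ := max (1 / r) θ
  have hσ0 : 0 < σ := hθ.trans_le (le_max_right _ _)
  have hσ1 : σ < 1 := max_lt ((div_lt_one hr0).2 hr1) hθ1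
  obtain ⟨ρ, K, hσρ, hρ1, hK, hρ⟩ := exists_succ_mul_pow_le hσ0 hσ1
  refine ⟨ρ, m⁻¹ * K, (le_max_right _ _).trans_lt hσρ, hρ1, by positivity, fun y A M' hy hA n => ?_⟩
  set g : ℕ → ℂ := fun k => lau (charCoef c) r k
  have hgf : PowerSeries.mk g * PowerSeries.mk (charCoef c) = 1 := by
    rw [mul_comm]
    ext k
    rw [PowerSeries.coeff_mul, PowerSeries.coeff_one]
    have h1 := hasSum_lau hr0 hf hne k
    have h2 : ∀ l ∉ Finset.range (k + 1), charCoef c l * lau (charCoef c) r ((k : ℤ) - l) = 0 :=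
      fun l hl => by rw [lau_eq_zero hr0 hf hr (by simp at hl; omega), mul_zero]
    have h3 := h1.unique (hasSum_sum_of_ne_finset_zero h2)
    rw [Finset.Nat.sum_antidiagonal_eq_sum_range_succ_mk]
    simp only [PowerSeries.coeff_mk]
    simp only [Nat.cast_eq_zero] at h3
    rw [h3]
    refine Finset.sum_congr rfl fun l hl => ?_
    push_cast [g, Nat.lt_succ_iff.1 (Finset.mem_range.1 hl)]
    rfl
  have hfy : PowerSeries.mk (charCoef c) * PowerSeries.mk (fun n => (y n : ℂ)) =
      PowerSeries.mk fun n => (A n : ℂ) := by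
    ext k
    rw [PowerSeries.coeff_mul, PowerSeries.coeff_mk]
    have h1 : (A k : ℂ) = y k - ∑ p ∈ Finset.HasAntidiagonal.antidiagonal k,
        (((if p.1 = 0 then 0 else c (p.1 - 1)) * y p.2 : ℝ) : ℂ) := by
      rw [← Complex.ofReal_sum, ← Complex.ofReal_sub, hy k, add_sub_cancel_right]
    have h2 : (y k : ℂ) = ∑ p ∈ Finset.HasAntidiagonal.antidiagonal k, if p.1 = 0 then (y p.2 : ℂ) else 0 := by
      rw [Finset.Nat.sum_antidiagonal_eq_sum_range_succ_mk, Finset.sum_range_succ']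
      simp
    rw [h1, h2, ← Finset.sum_sub_distrib]
    refine Finset.sum_congr rfl fun p _ => ?_
    rcases p with ⟨_ | i, j⟩ <;> simp [charCoef]
  have hyn := congrArg (PowerSeries.coeff n) (congrArg (PowerSeries.mk g * ·) hfy)
  simp only [← mul_assoc, hgf, one_mul] at hyn
  rw [PowerSeries.coeff_mul, PowerSeries.coeff_mk] at hyn
  have hM' : 0 ≤ M' := by have := (abs_nonneg _).trans (hA 0); simpa using this
  rw [← Real.norm_eq_abs, ← Complex.norm_real, hyn]
  refine (norm_sum_le _ _).trans ?_
  have h6 : ∀ p ∈ Finset.HasAntidiagonal.antidiagonal n, ‖(PowerSeries.coeff p.1) (PowerSeries.mk g) *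
      (PowerSeries.coeff p.2) (PowerSeries.mk fun n => (A n : ℂ))‖ ≤ m⁻¹ * M' * σ ^ n := by
    intro p hp
    rw [PowerSeries.coeff_mk, PowerSeries.coeff_mk, norm_mul, Complex.norm_real, Real.norm_eq_abs,
      ← Finset.HasAntidiagonal.mem_antidiagonal.1 hp, pow_add]
    have e1 : ‖g p.1‖ ≤ m⁻¹ * σ ^ p.1 := by
      refine (norm_lau_le hr0 hm hmin _).trans ?_
      rw [zpow_neg, zpow_natCast, ← inv_pow]
      have : r⁻¹ ≤ σ := one_div r ▸ le_max_left _ _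
      gcongr
    have e2 : |A p.2| ≤ M' * σ ^ p.2 := by
      refine (hA _).trans ?_
      have : θ ≤ σ := le_max_right _ _
      gcongr
    calc ‖g p.1‖ * |A p.2| ≤ (m⁻¹ * σ ^ p.1) * (M' * σ ^ p.2) := by gcongr
      _ = _ := by ring
  refine (Finset.sum_le_card_nsmul _ _ _ h6).trans ?_
  rw [Finset.Nat.card_antidiagonal, nsmul_eq_mul]
  calc ((n + 1 : ℕ) : ℝ) * (m⁻¹ * M' * σ ^ n) = m⁻¹ * M' * ((n + 1 : ℝ) * σ ^ n) := by
        push_cast; ring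
    _ ≤ m⁻¹ * M' * (K * ρ ^ n) := by have := hρ n; gcongr
    _ = _ := by ring

end Renewal

/-! ### The spectrum of the linearization -/

section Complexify

variable {E : Type*} [NormedAddCommGroup E] [NormedSpace ℝ E]

lemma complexShift_apply (A : E →L[ℝ] E) (z : ℂ) (x : E × E) : complexShift A z x =
    (z.re • x.1 - z.im • x.2 - A x.1, z.im • x.1 + z.re • x.2 - A x.2) := rfl

/-- Multiplication by a complex number on the complexification `E × E` of `E`. -/
noncomputable def cmul (z : ℂ) : (E × E) →L[ℝ] (E × E) := complexShift 0 z

lemma cmul_apply (z : ℂ) (x : E × E) :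
    cmul z x = (z.re • x.1 - z.im • x.2, z.im • x.1 + z.re • x.2) := by
  simp [cmul, complexShift_apply]

lemma cmul_mul (z w : ℂ) : (cmul z * cmul w : (E × E) →L[ℝ] (E × E)) = cmul (z * w) := by
  refine ContinuousLinearMap.ext fun x => ?_
  change cmul z (cmul w x) = _
  simp only [cmul_apply, Complex.mul_re, Complex.mul_im]
  ext
  · simp only; module
  · simp only; module

lemma cmul_one : (cmul 1 : (E × E) →L[ℝ] (E × E)) = 1 := by
  refine ContinuousLinearMap.ext fun x => ?_
  rw [cmul_apply]; simp

lemma cmul_pow (z : ℂ) (n : ℕ) : (cmul z ^ n : (E × E) →L[ℝ] (E × E)) = cmul (z ^ n) := by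
  induction n with
  | zero => rw [pow_zero, pow_zero, cmul_one]
  | succ n ih => rw [pow_succ, ih, cmul_mul, ← pow_succ]

lemma norm_cmul_le (z : ℂ) (x : E × E) : ‖cmul z x‖ ≤ 2 * ‖z‖ * ‖x‖ := by
  rw [cmul_apply]
  have h1 : |z.re| ≤ ‖z‖ := Complex.abs_re_le_norm z
  have h2 : |z.im| ≤ ‖z‖ := Complex.abs_im_le_norm z
  have h3 : ‖x.1‖ ≤ ‖x‖ := norm_fst_le x
  have h4 : ‖x.2‖ ≤ ‖x‖ := norm_snd_le x
  have e : ∀ (s t : ℝ) (u v : E), |s| ≤ ‖z‖ → |t| ≤ ‖z‖ → ‖u‖ ≤ ‖x‖ → ‖v‖ ≤ ‖x‖ →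
      ‖s • u‖ + ‖t • v‖ ≤ 2 * ‖z‖ * ‖x‖ := fun s t u v hs ht hu hv => by
    rw [norm_smul, norm_smul, Real.norm_eq_abs, Real.norm_eq_abs]
    have := mul_le_mul hs hu (norm_nonneg _) (norm_nonneg _)
    have := mul_le_mul ht hv (norm_nonneg _) (norm_nonneg _)
    linarith
  exact norm_prod_le_iff.2 ⟨(norm_sub_le _ _).trans (e _ _ _ _ h1 h2 h3 h4),
    (norm_add_le _ _).trans (e _ _ _ _ h2 h1 h3 h4)⟩

/-- `z - A` is invertible on the complexification for `|z| > 1` if `A` is power bounded. -/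
lemma isUnit_complexShift [CompleteSpace E] {A : E →L[ℝ] E} {C : ℝ}
    (hA : ∀ n b, ‖(A ^ n) b‖ ≤ C * ‖b‖) {z : ℂ} (hz : 1 < ‖z‖) : IsUnit (complexShift A z) := by
  have hz0 : z ≠ 0 := norm_pos_iff.1 (one_pos.trans hz)
  set P : (E × E) →L[ℝ] (E × E) := A.prodMap A with hP
  have hcomm : ∀ w : ℂ, Commute (cmul w) P := fun w => by
    refine ContinuousLinearMap.ext fun x => ?_
    change cmul w (P x) = P (cmul w x)
    rw [cmul_apply, cmul_apply]
    change _ = (A (w.re • x.1 - w.im • x.2), A (w.im • x.1 + w.re • x.2))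
    rw [map_sub, map_add, map_smul, map_smul, map_smul, map_smul]
    rfl
  set x : (E × E) →L[ℝ] (E × E) := cmul z⁻¹ * P with hx
  have hPn : ∀ n (y : E × E), (P ^ n) y = ((A ^ n) y.1, (A ^ n) y.2) := fun n y => by
    induction n with
    | zero => rfl
    | succ n ih =>
      rw [pow_succ', pow_succ']
      change P ((P ^ n) y) = _
      rw [ih]
      rfl
  have hC : 0 ≤ C ∨ ∀ b : E, b = 0 := by
    by_cases h : ∃ b : E, b ≠ 0
    · obtain ⟨b, hb⟩ := h
      have := (norm_nonneg _).trans (hA 0 b)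
      exact Or.inl (nonneg_of_mul_nonneg_left this (norm_pos_iff.2 hb))
    · exact Or.inr fun b => by_contra fun hb => h ⟨b, hb⟩
  have hxn : ∀ n, ‖x ^ n‖ ≤ 2 * ‖z‖⁻¹ ^ n * |C| := fun n => by
    refine ContinuousLinearMap.opNorm_le_bound _ (by positivity) fun y => ?_
    rw [hx, (hcomm _).mul_pow, cmul_pow]
    change ‖cmul (z⁻¹ ^ n) ((P ^ n) y)‖ ≤ _
    refine (norm_cmul_le _ _).trans ?_
    rw [norm_pow, norm_inv, mul_assoc (2 * ‖z‖⁻¹ ^ n)]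
    refine mul_le_mul_of_nonneg_left ?_ (by positivity)
    rw [hPn]
    refine norm_prod_le_iff.2 ⟨(hA n _).trans ?_, (hA n _).trans ?_⟩
    · exact mul_le_mul (le_abs_self C) (norm_fst_le y) (norm_nonneg _) (abs_nonneg _)
    · exact mul_le_mul (le_abs_self C) (norm_snd_le y) (norm_nonneg _) (abs_nonneg _)
  have ht : Tendsto (fun n : ℕ => 2 * ‖z‖⁻¹ ^ n * |C|) atTop (𝓝 (2 * 0 * |C|)) :=
    ((tendsto_pow_atTop_nhds_zero_of_lt_one (by positivity) (inv_lt_one_of_one_lt₀ hz)).const_mul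
      2).mul_const _
  rw [mul_zero, zero_mul] at ht
  obtain ⟨n, hn⟩ := (ht.eventually (gt_mem_nhds one_pos)).exists
  have h1 : IsUnit (1 - x ^ n) := isUnit_one_sub_of_norm_lt_one ((hxn n).trans_lt hn)
  rw [← mul_neg_geom_sum] at h1
  have h2 : Commute (1 - x) (∑ i ∈ Finset.range n, x ^ i) := by
    refine Commute.sum_right _ _ _ fun i _ => ?_
    exact ((Commute.one_left x).sub_left (Commute.refl x)).pow_right i
  have h3 : IsUnit (1 - x) := (h2.isUnit_mul_iff.1 h1).1
  have h4 : IsUnit (cmul z : (E × E) →L[ℝ] (E × E)) :=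
    ⟨⟨cmul z, cmul z⁻¹, by rw [cmul_mul, mul_inv_cancel₀ hz0, cmul_one],
      by rw [cmul_mul, inv_mul_cancel₀ hz0, cmul_one]⟩, rfl⟩
  have h5 : complexShift A z = cmul z * (1 - x) := by
    rw [mul_sub, mul_one, hx, ← mul_assoc, cmul_mul, mul_inv_cancel₀ hz0, cmul_one, one_mul]
    refine ContinuousLinearMap.ext fun y => ?_
    change _ = cmul z y - P y
    rw [complexShift_apply, cmul_apply]
    rfl
  rw [h5]
  exact h4.mul h3

end Complexify

namespace Core

/-- The direction `W h` of the rank one part of the linearization at `h`. -/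
noncomputable def dirW (G : Core E0 E1 E2 E3) (h : E3) : E1 := G.i2 (G.W3 (G.a3 h) h)

lemma I1_dirW {h : E3} (hc : G.a3 h ∈ G.R) : G.I1 (G.dirW h) = 0 := G.I2_W hc h

/-- The solution `v` of `(z - L) v = W h` on the complexification, for `|z| ≥ 1`, and the value of
the functional `a` at `v`. -/
lemma exists_resolvent [CompleteSpace E1] {h : E3} (hc : G.a3 h ∈ G.R) {z : ℂ} (hz : 1 ≤ ‖z‖) :
    ∃ v : E1 × E1, complexShift (G.L1 (G.a3 h)) z v = (G.dirW h, 0) ∧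
      (G.a1 v.1 : ℂ) + G.a1 v.2 * Complex.I = 1 - ser (charCoef (G.coef h)) z⁻¹ := by
  have hz0 : z ≠ 0 := norm_pos_iff.1 (one_pos.trans_le hz)
  set L := G.L1 (G.a3 h)
  set w := G.dirW h
  set s : ℕ → ℂ := fun n => z⁻¹ ^ (n + 1) with hs
  have hsn : ∀ n, ‖s n‖ ≤ 1 := fun n => by
    rw [hs]; simp only
    rw [norm_pow, norm_inv]
    exact pow_le_one₀ (by positivity) (inv_le_one_of_one_le₀ hz)
  have h1 : Summable fun n => (s n).re • (L ^ n) w :=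
    summable_of_contr hc (I1_dirW hc) fun n => (Complex.abs_re_le_norm _).trans (hsn n)
  have h2 : Summable fun n => (s n).im • (L ^ n) w :=
    summable_of_contr hc (I1_dirW hc) fun n => (Complex.abs_im_le_norm _).trans (hsn n)
  have hL : ∀ n, L ((L ^ n) w) = (L ^ (n + 1)) w := fun n => by rw [pow_succ']; rfl
  have hs0 : z * s 0 = 1 := by simp [hs, hz0]
  have hs1 : ∀ n, z * s (n + 1) = s n := fun n => by
    simp only [hs]; rw [pow_succ' _ (n + 1), mul_inv_cancel_left₀ hz0]
  have hre : ∀ n, z.re * (s n).re - z.im * (s n).im = (z * s n).re := fun n =>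
    (Complex.mul_re _ _).symm
  have him : ∀ n, z.im * (s n).re + z.re * (s n).im = (z * s n).im := fun n => by
    rw [Complex.mul_im]; ring
  refine ⟨(∑' n, (s n).re • (L ^ n) w, ∑' n, (s n).im • (L ^ n) w), ?_, ?_⟩
  · rw [complexShift_apply]
    refine Prod.ext ?_ ?_
    · simp only
      rw [← h1.tsum_const_smul, ← h2.tsum_const_smul,
        ← (h1.const_smul z.re).tsum_sub (h2.const_smul z.im), L.map_tsum h1]
      have e : ∀ n, z.re • (s n).re • (L ^ n) w - z.im • (s n).im • (L ^ n) w =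
          (z * s n).re • (L ^ n) w := fun n => by
        rw [smul_smul, smul_smul, ← sub_smul, hre]
      have hsum : Summable fun n => (z * s n).re • (L ^ n) w :=
        ((h1.const_smul z.re).sub (h2.const_smul z.im)).congr e
      simp_rw [e]
      rw [hsum.tsum_eq_zero_add, hs0]
      simp_rw [hs1, map_smul, hL]
      simp
    · simp only
      rw [← h1.tsum_const_smul, ← h2.tsum_const_smul,
        ← (h1.const_smul z.im).tsum_add (h2.const_smul z.re), L.map_tsum h2]
      have e : ∀ n, z.im • (s n).re • (L ^ n) w + z.re • (s n).im • (L ^ n) w =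
          (z * s n).im • (L ^ n) w := fun n => by
        rw [smul_smul, smul_smul, ← add_smul, him]
      have hsum : Summable fun n => (z * s n).im • (L ^ n) w :=
        ((h1.const_smul z.im).add (h2.const_smul z.re)).congr e
      simp_rw [e]
      rw [hsum.tsum_eq_zero_add, hs0]
      simp_rw [hs1, map_smul, hL]
      simp
  · simp only
    rw [G.a1.map_tsum h1, G.a1.map_tsum h2]
    obtain ⟨M, hM0, hM⟩ := G.abs_coef_le hc
    have hz1 : ‖z⁻¹‖ ≤ 1 := by rw [norm_inv]; exact inv_le_one_of_one_le₀ hz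
    have hf : Summable fun l => charCoef (G.coef h) l * z⁻¹ ^ l :=
      summable_ser (r := 1) (summable_charCoef G.θ_pos.le hM zero_le_one
        (by rw [one_mul]; exact G.θ_lt)) hz1
    have e1 : ser (charCoef (G.coef h)) z⁻¹ = 1 - ∑' n, s n * G.coef h n := by
      unfold ser
      rw [hf.tsum_eq_zero_add, pow_zero, mul_one, charCoef, sub_eq_add_neg, ← tsum_neg]
      congr 1
      refine tsum_congr fun n => ?_
      simp only [charCoef, hs]; ring
    rw [e1, sub_sub_cancel]
    have e2 : Summable fun n => s n * G.coef h n := by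
      have := (summable_nat_add_iff 1).2 hf
      refine this.neg.congr fun n => ?_
      simp only [charCoef, hs]; ring
    refine Complex.ext ?_ ?_
    · rw [Complex.re_tsum e2]
      simp [coef, dirW, L, w]
    · rw [Complex.im_tsum e2]
      simp [coef, dirW, L, w]

lemma complexShift_lin (h : E3) (z : ℂ) (x : E1 × E1) : complexShift (G.lin h) z x =
    complexShift (G.L1 (G.a3 h)) z x - (G.a1 x.1 • G.dirW h, G.a1 x.2 • G.dirW h) := by
  rw [complexShift_apply, complexShift_apply]
  rw [lin_apply, lin_apply, Prod.mk_sub_mk]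
  exact Prod.ext (sub_add_eq_sub_sub _ _ _) (sub_add_eq_sub_sub _ _ _)

/-- The zeros `1 / z` of the characteristic function, with `|z| ≥ 1`, give eigenvalues. -/
lemma mem_spectrum_of_ser_eq_zero [CompleteSpace E1] {h : E3} (hc : G.a3 h ∈ G.R) {z : ℂ}
    (hz : 1 ≤ ‖z‖) (h0 : ser (charCoef (G.coef h)) z⁻¹ = 0) :
    z ∈ complexSpectrum (G.lin h) := by
  obtain ⟨v, hv, ha⟩ := G.exists_resolvent hc hz
  rw [h0, sub_zero] at ha
  have h1 : G.a1 v.1 = 1 := by have := congrArg Complex.re ha; simpa using this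
  have h2 : G.a1 v.2 = 0 := by have := congrArg Complex.im ha; simpa using this
  intro hu
  have h3 : complexShift (G.lin h) z v = 0 := by rw [complexShift_lin, hv, h1, h2]; simp
  obtain ⟨u, hu⟩ := hu
  have h4 : v = 0 := by
    have : (↑u⁻¹ * (u : (E1 × E1) →L[ℝ] (E1 × E1))) v = v := by rw [u.inv_mul]; rfl
    rw [← this]
    change (↑u⁻¹ : (E1 × E1) →L[ℝ] (E1 × E1)) ((u : (E1 × E1) →L[ℝ] (E1 × E1)) v) = 0
    rw [hu, h3, map_zero]
  rw [h4] at h1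
  simp at h1

/-- The points `z` of the spectrum with `|z| > 1` come from zeros of the characteristic function. -/
lemma ser_eq_zero_of_mem_spectrum [CompleteSpace E1] {h : E3} (hc : G.a3 h ∈ G.R) {z : ℂ}
    (hz : 1 < ‖z‖) (hs : z ∈ complexSpectrum (G.lin h)) :
    ser (charCoef (G.coef h)) z⁻¹ = 0 := by
  by_contra h0
  apply hs
  obtain ⟨v, hv, ha⟩ := G.exists_resolvent hc hz.le
  set f := ser (charCoef (G.coef h)) z⁻¹
  set U := complexShift (G.L1 (G.a3 h)) z with hU
  have hunit : IsUnit U := isUnit_complexShift (fun n b => G.pow_L1_le hc n b) hz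
  have hbij : Function.Bijective U := ContinuousLinearMap.isUnit_iff_bijective.1 hunit
  let A : E1 × E1 → ℂ := fun x => (G.a1 x.1 : ℂ) + G.a1 x.2 * Complex.I
  have hAadd : ∀ x y, A (x + y) = A x + A y := fun x y => by
    simp only [A, Prod.fst_add, Prod.snd_add, map_add, Complex.ofReal_add]; ring
  have hAm : ∀ s x, A (cmul s x) = s * A x := fun s x => by
    simp only [A, cmul_apply, map_sub, map_add, map_smul, smul_eq_mul]
    apply Complex.ext
    · simp
    · simp; ring
  have hUm : ∀ s x, U (cmul s x) = cmul s (U x) := fun s x => by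
    simp only [hU, complexShift_apply, cmul_apply, map_sub, map_add, map_smul]
    refine Prod.ext ?_ ?_
    · simp only; module
    · simp only; module
  have hV : ∀ x, complexShift (G.lin h) z x = U x - U (cmul (A x) v) := fun x => by
    rw [complexShift_lin, hUm, hv, cmul_apply, ← hU]
    simp [A]
  rw [ContinuousLinearMap.isUnit_iff_bijective]
  constructor
  · rw [injective_iff_map_eq_zero]
    intro x hx
    rw [hV, sub_eq_zero] at hx
    have h1 : x = cmul (A x) v := hbij.1 hx
    have h2 : A x = A x * (1 - f) := by
      conv_lhs => rw [h1, hAm]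
      rw [← ha]
    have h3 : A x = 0 := by
      have : A x * f = 0 := by linear_combination h2
      exact (mul_eq_zero.1 this).resolve_right h0
    rw [h1, h3, cmul_apply]
    simp
  · intro y
    obtain ⟨x0, hx0⟩ := hbij.2 y
    refine ⟨x0 + cmul (A x0 / f) v, ?_⟩
    have h1 : A (x0 + cmul (A x0 / f) v) = A x0 / f := by
      rw [hAadd, hAm]
      change _ + _ * ((G.a1 v.1 : ℂ) + G.a1 v.2 * Complex.I) = _
      rw [ha]; field_simp; ring
    rw [hV, h1, map_add, hx0, add_sub_cancel_right]

/-- The value of the characteristic function at `1`. -/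
lemma ser_one [CompleteSpace E1] {h : E3} (hc : G.a3 h ∈ G.R) :
    ser (charCoef (G.coef h)) 1 = 1 - G.a1 (∑' n, (G.L1 (G.a3 h) ^ n) (G.dirW h)) := by
  have hs : Summable fun n => (G.L1 (G.a3 h) ^ n) (G.dirW h) := by
    simpa using summable_of_contr hc (I1_dirW hc) (s := fun _ => 1) (M := 1) (by simp)
  obtain ⟨M, hM0, hM⟩ := G.abs_coef_le hc
  have hf : Summable fun l => charCoef (G.coef h) l * 1 ^ l :=
    summable_ser (r := 1) (summable_charCoef G.θ_pos.le hM zero_le_one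
      (by rw [one_mul]; exact G.θ_lt)) (by simp)
  unfold ser
  rw [hf.tsum_eq_zero_add, G.a1.map_tsum hs, Complex.ofReal_tsum, sub_eq_add_neg, ← tsum_neg]
  simp [charCoef, coef, dirW]

/-! ### Stability of the fixed point under the spectral condition -/

/-- The powers of the linearization, by Duhamel's formula. -/
lemma lin_pow_succ (h : E3) (φ : E1) (n : ℕ) :
    (G.lin h ^ (n + 1)) φ = (G.L1 (G.a3 h) ^ (n + 1)) φ +
      ∑ p ∈ Finset.HasAntidiagonal.antidiagonal n,
        G.a1 ((G.lin h ^ p.2) φ) • (G.L1 (G.a3 h) ^ p.1) (G.dirW h) := by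
  induction n with
  | zero => simp [lin_apply, dirW]
  | succ n ih =>
    have e : (G.lin h ^ (n + 1 + 1)) φ = G.lin h ((G.lin h ^ (n + 1)) φ) := by
      rw [pow_succ' _ (n + 1)]; rfl
    have e' : ∀ k (v : E1), (G.L1 (G.a3 h) ^ (k + 1)) v = G.L1 (G.a3 h) ((G.L1 (G.a3 h) ^ k) v) :=
      fun k v => by rw [pow_succ']; rfl
    rw [e, Finset.Nat.sum_antidiagonal_succ, lin_apply]
    nth_rewrite 1 [ih]
    rw [map_add, map_sum]
    simp only [map_smul, e', pow_zero, one_apply_eq_self, dirW]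
    abel

/-- Exponential decay of the powers of the linearization on elements with zero integral. -/
lemma exists_lin_pow_le {h : E3} (hc : G.a3 h ∈ G.R)
    (h0 : ∀ z : ℂ, ‖z‖ ≤ 1 → ser (charCoef (G.coef h)) z ≠ 0) :
    ∃ ρ K : ℝ, 0 < ρ ∧ ρ < 1 ∧ 1 ≤ K ∧ ∀ n (φ : E1), G.I1 φ = 0 →
      ‖(G.lin h ^ n) φ‖ ≤ K * ρ ^ n * ‖φ‖ := by
  obtain ⟨M, -, hM⟩ := G.abs_coef_le hc
  obtain ⟨ρ, K, hθρ, hρ1, hK, hren⟩ := renewal_decay G.θ_pos G.θ_lt hM h0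
  have hρ : 0 < ρ := G.θ_pos.trans hθρ
  have hC := G.C_pos
  obtain ⟨ρ', K', hρρ', hρ'1, hK', hsucc⟩ := exists_succ_mul_pow_le hρ hρ1
  have hρ' : 0 < ρ' := hρ.trans hρρ'
  have hy : ∀ (φ : E1), G.I1 φ = 0 → ∀ n, |G.a1 ((G.lin h ^ n) φ)| ≤
      K * (‖G.a1‖ * (G.C * ‖φ‖)) * ρ ^ n := fun φ hφ => by
    refine hren (fun n => G.a1 ((G.lin h ^ n) φ)) (fun n => G.a1 ((G.L1 (G.a3 h) ^ n) φ)) _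
      (fun n => ?_) fun n => ?_
    · cases n with
      | zero => simp
      | succ n =>
        rw [lin_pow_succ, map_add, map_sum, Finset.Nat.sum_antidiagonal_succ]
        simp [coef, dirW, mul_comm]
    · refine (G.a1.le_opNorm _).trans ?_
      rw [mul_assoc]
      exact mul_le_mul_of_nonneg_left ((G.pow_L1_contr hc n hφ).trans (le_of_eq (by ring)))
        (norm_nonneg _)
  set Q : ℝ := K * (‖G.a1‖ * G.C) * (G.C * ‖G.dirW h‖) with hQ
  have hQ0 : 0 ≤ Q := by positivity
  refine ⟨ρ', 1 + G.C + Q * K' / ρ', hρ', hρ'1, ?_, fun n φ hφ => ?_⟩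
  · have : 0 ≤ Q * K' / ρ' := by positivity
    linarith
  cases n with
  | zero =>
    have : 0 ≤ Q * K' / ρ' := by positivity
    simp only [pow_zero, mul_one, one_apply_eq_self]
    nlinarith [norm_nonneg φ]
  | succ n =>
    rw [lin_pow_succ]
    have h1 : ‖(G.L1 (G.a3 h) ^ (n + 1)) φ‖ ≤ G.C * ρ' ^ (n + 1) * ‖φ‖ :=
      (G.pow_L1_contr hc _ hφ).trans (by
        have := pow_le_pow_left₀ G.θ_pos.le (hθρ.trans hρρ').le (n + 1)
        gcongr)
    have h2 : ‖∑ p ∈ Finset.HasAntidiagonal.antidiagonal n,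
        G.a1 ((G.lin h ^ p.2) φ) • (G.L1 (G.a3 h) ^ p.1) (G.dirW h)‖ ≤
        ((n + 1 : ℝ) * ρ ^ n) * (Q * ‖φ‖) := by
      refine (norm_sum_le_of_le (f := fun p : ℕ × ℕ => G.a1 ((G.lin h ^ p.2) φ) •
        (G.L1 (G.a3 h) ^ p.1) (G.dirW h)) (n := fun _ => ρ ^ n * (Q * ‖φ‖)) _ fun p hp => ?_).trans ?_
      · rw [norm_smul]
        have hp' : p.1 + p.2 = n := Finset.HasAntidiagonal.mem_antidiagonal.1 hp
        have h3 := hy φ hφ p.2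
        have h4 := G.pow_L1_contr hc p.1 (I1_dirW hc)
        have h5 := pow_le_pow_left₀ G.θ_pos.le hθρ.le p.1
        calc ‖G.a1 ((G.lin h ^ p.2) φ)‖ * ‖(G.L1 (G.a3 h) ^ p.1) (G.dirW h)‖ ≤
              (K * (‖G.a1‖ * (G.C * ‖φ‖)) * ρ ^ p.2) * (G.C * ρ ^ p.1 * ‖G.dirW h‖) := by
              refine mul_le_mul h3 (h4.trans ?_) (norm_nonneg _) (by positivity)
              gcongr
          _ = ρ ^ n * (Q * ‖φ‖) := by rw [← hp', pow_add, hQ]; ring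
      · rw [Finset.sum_const, Finset.Nat.card_antidiagonal, nsmul_eq_mul]
        push_cast
        exact le_of_eq (by ring)
    have h3 := hsucc n
    have h4 : K' * ρ' ^ n = K' / ρ' * ρ' ^ (n + 1) := by rw [pow_succ]; field_simp
    have h5 : 0 ≤ Q * ‖φ‖ := by positivity
    have h6 := mul_le_mul_of_nonneg_right h3 h5
    have h7 : 0 ≤ ρ' ^ (n + 1) * ‖φ‖ := by positivity
    rw [h4] at h6
    calc _ ≤ _ := norm_add_le _ _
      _ ≤ G.C * ρ' ^ (n + 1) * ‖φ‖ + K' / ρ' * ρ' ^ (n + 1) * (Q * ‖φ‖) := by linarith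
      _ ≤ (1 + G.C + Q * K' / ρ') * ρ' ^ (n + 1) * ‖φ‖ := by
        have : (1 + G.C + Q * K' / ρ') * ρ' ^ (n + 1) * ‖φ‖ = ρ' ^ (n + 1) * ‖φ‖ +
          (G.C * ρ' ^ (n + 1) * ‖φ‖ + K' / ρ' * ρ' ^ (n + 1) * (Q * ‖φ‖)) := by ring
        linarith

/-- On bounded subsets of `E3`, smallness in `E1` implies smallness in `E2`, by compactness. -/
lemma exists_small (G : Core E0 E1 E2 E3) (M : ℝ) {η : ℝ} (hη : 0 < η) :
    ∃ δ > 0, ∀ x : E3, ‖x‖ ≤ M → ‖G.i2 (G.i3 x)‖ < δ → ‖G.i3 x‖ < η := by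
  set Q : ℝ := |M| + 1
  have hQ : 0 < Q := by positivity
  set S := closure (G.i3 '' Metric.ball 0 1) ∩ {y | η / Q ≤ ‖y‖}
  have hS : IsCompact S := G.cpt3.inter_right (isClosed_le continuous_const continuous_norm)
  have key : ∃ δ > 0, ∀ y ∈ S, δ ≤ ‖G.i2 y‖ := by
    rcases S.eq_empty_or_nonempty with h | h
    · exact ⟨1, one_pos, by simp [h]⟩
    · obtain ⟨y, hy, hmin⟩ := hS.exists_isMinOn h (f := fun y => ‖G.i2 y‖) (by fun_prop)
      refine ⟨‖G.i2 y‖, norm_pos_iff.2 fun h0 => ?_, fun z hz => hmin hz⟩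
      have : y = 0 := G.inj2 (by rw [h0, map_zero])
      have hy2 : η / Q ≤ ‖y‖ := hy.2
      rw [this, norm_zero] at hy2
      exact absurd hy2 (not_le.2 (by positivity))
  obtain ⟨δ, hδ, hmin⟩ := key
  refine ⟨δ * Q, by positivity, fun x hx hxδ => not_le.1 fun hle => ?_⟩
  have e : ∀ v : E2, ‖Q⁻¹ • v‖ = ‖v‖ / Q := fun v => by
    rw [norm_smul, norm_inv, Real.norm_eq_abs, abs_of_pos hQ]; ring
  have h1 : G.i3 (Q⁻¹ • x) ∈ S := by
    refine ⟨subset_closure ⟨_, ?_, rfl⟩, ?_⟩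
    · rw [mem_ball_zero_iff, norm_smul, norm_inv, Real.norm_eq_abs, abs_of_pos hQ,
        inv_mul_lt_iff₀ hQ, mul_one]
      exact (hx.trans (le_abs_self M)).trans_lt (lt_add_one _)
    · change η / Q ≤ ‖G.i3 (Q⁻¹ • x)‖
      rw [map_smul, e]
      gcongr
  have h2 := hmin _ h1
  rw [map_smul, map_smul, norm_smul, norm_inv, Real.norm_eq_abs, abs_of_pos hQ,
    le_inv_mul_iff₀ hQ] at h2
  linarith

/-- One step of an orbit near a fixed point, compared with the linearization. -/
lemma IsOrbit.norm_step_sub_le {b : ℕ → E3} (hb : G.IsOrbit b) {h : E3} (hc : G.a3 h ∈ G.R)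
    (hfix : G.L3 (G.a3 h) h = h) (n : ℕ) :
    ‖G.i2 (G.i3 (b (n + 1) - h)) - G.lin h (G.i2 (G.i3 (b n - h)))‖ ≤
      G.C * |G.a1 (G.i2 (G.i3 (b n - h)))| *
        (|G.a1 (G.i2 (G.i3 (b n - h)))| * ‖h‖ + ‖G.i3 (b n - h)‖) := by
  set c := G.a3 h with hcdef
  set c' := G.a3 (b n) with hc'
  have e1 : G.a1 (G.i2 (G.i3 (b n - h))) = c' - c := G.a3.map_sub _ _
  have e2 : G.i2 (G.i3 (b (n + 1) - h)) - G.lin h (G.i2 (G.i3 (b n - h))) =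
      (G.L1 c' (G.i2 (G.i3 h)) - G.L1 c (G.i2 (G.i3 h)) - (c' - c) • G.W2 c (G.i3 h)) +
      (G.L1 c' (G.i2 (G.i3 (b n - h))) - G.L1 c (G.i2 (G.i3 (b n - h)))) := by
    have h1 : b (n + 1) - h = G.L3 c' (b n) - G.L3 c h := by rw [hfix, hb.step]
    rw [h1, lin_apply, e1]
    simp only [map_sub, G.commL3, G.commL2, G.commW3]
    abel
  rw [e2, e1]
  refine (norm_add_le _ _).trans ((add_le_add (G.diff1 c' (hb.mem n) c hc h)
    (G.lip1 c' (hb.mem n) c hc _)).trans (le_of_eq ?_))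
  ring

/-- If the characteristic function has no zero in the closed unit disc, then a fixed point attracts
the orbits that are bounded in `E3` and start close to it in `E1`. -/
lemma exists_attraction {h : E3} (hc : G.a3 h ∈ G.R) (hfix : G.L3 (G.a3 h) h = h)
    (hI : G.I3 h = 1) (h0 : ∀ z : ℂ, ‖z‖ ≤ 1 → ser (charCoef (G.coef h)) z ≠ 0) (M : ℝ) :
    ∃ δ > 0, ∃ K σ : ℝ, 0 < σ ∧ σ < 1 ∧ ∀ b : ℕ → E3, G.IsOrbit b → (∀ n, ‖b n‖ ≤ M) →
      ‖G.i2 (G.i3 (b 0 - h))‖ < δ → ∀ n, ‖G.i2 (G.i3 (b n - h))‖ ≤ K * σ ^ n := by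
  obtain ⟨ρ, K, hρ, hρ1, hK, hdec⟩ := exists_lin_pow_le hc h0
  have hK0 : 0 < K := one_pos.trans_le hK
  have hC := G.C_pos
  set ε : ℝ := (1 - ρ) / (2 * K) with hε
  have hε0 : 0 < ε := div_pos (by linarith) (by positivity)
  set P : ℝ := G.C * (‖G.a1‖ + 1) with hP
  have hP0 : 0 < P := by positivity
  obtain ⟨δ1, hδ1, hEh⟩ := G.exists_small (M + ‖h‖) (η := ε / (2 * P)) (by positivity)
  set δ2 : ℝ := ε / (2 * P * ((‖G.a1‖ + 1) * (‖h‖ + 1))) with hδ2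
  have hδ20 : 0 < δ2 := by positivity
  set σ : ℝ := ρ + K * ε with hσ
  have hσ1 : σ < 1 := by
    have : K * ε = (1 - ρ) / 2 := by rw [hε]; field_simp
    rw [hσ, this]; linarith
  have hσ0 : 0 < σ := by positivity
  set δ : ℝ := min δ1 δ2 / K with hδ
  have hδ0 : 0 < δ := by positivity
  refine ⟨δ, hδ0, K * δ, σ, hσ0, hσ1, fun b hb hbM hb0 n => ?_⟩
  set x : ℕ → E1 := fun n => G.i2 (G.i3 (b n - h)) with hx
  -- the remainder is small as long as the orbit is close to the fixed point
  have hrem : ∀ n, ‖x n‖ < min δ1 δ2 → ‖x (n + 1) - G.lin h (x n)‖ ≤ ε * ‖x n‖ := fun n hn => by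
    have h1 := hb.norm_step_sub_le hc hfix n
    have h2 := hEh (b n - h) ((norm_sub_le _ _).trans (by have := hbM n; linarith))
      (hn.trans_le (min_le_left _ _))
    have h3 : |G.a1 (x n)| ≤ (‖G.a1‖ + 1) * ‖x n‖ := (G.a1.le_opNorm _).trans (by gcongr; linarith)
    have h4 : |G.a1 (x n)| * ‖h‖ ≤ ε / (2 * P) := by
      have h5 := (hn.trans_le (min_le_right _ _)).le
      calc |G.a1 (x n)| * ‖h‖ ≤ (‖G.a1‖ + 1) * δ2 * (‖h‖ + 1) := by
            refine mul_le_mul (h3.trans ?_) (by linarith) (norm_nonneg _) (by positivity)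
            gcongr
        _ = ε / (2 * P) := by rw [hδ2]; field_simp
    calc _ ≤ _ := h1
      _ ≤ G.C * ((‖G.a1‖ + 1) * ‖x n‖) * (ε / (2 * P) + ε / (2 * P)) := by
        refine mul_le_mul ?_ (add_le_add h4 h2.le) (by positivity) (by positivity)
        exact mul_le_mul_of_nonneg_left h3 hC.le
      _ = ε * ‖x n‖ := by rw [hP]; field_simp; ring
  have hIx : ∀ n, G.I1 (x n) = 0 := fun n => by
    change G.I3 (b n - h) = 0
    rw [map_sub, hb.int_one, hI, sub_self]
  have hIlin : ∀ v, G.I1 v = 0 → G.I1 (G.lin h v) = 0 := fun v hv => by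
    rw [lin_apply, map_add, G.I1_L hc, hv, map_smul, show G.I1 (G.i2 (G.W3 (G.a3 h) h)) = 0 from
      G.I2_W hc h, smul_zero, zero_add]
  have key : ∀ n k, ‖(G.lin h ^ k) (x n)‖ ≤ ρ ^ k * (K * σ ^ n * ‖x 0‖) := by
    intro n
    induction n with
    | zero => exact fun k => (hdec k _ (hIx 0)).trans (le_of_eq (by ring))
    | succ n ih =>
      intro k
      have hxn : ‖x n‖ ≤ K * σ ^ n * ‖x 0‖ := by simpa using ih 0
      have hxn' : ‖x n‖ < min δ1 δ2 := by
        refine hxn.trans_lt ?_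
        calc K * σ ^ n * ‖x 0‖ ≤ K * 1 * ‖x 0‖ := by
              gcongr; exact pow_le_one₀ hσ0.le hσ1.le
          _ < K * 1 * δ := by gcongr
          _ = min δ1 δ2 := by rw [hδ]; field_simp
      have h1 := hrem n hxn'
      have h2 : G.I1 (x (n + 1) - G.lin h (x n)) = 0 := by
        rw [map_sub, hIx, hIlin _ (hIx n), sub_zero]
      have e : (G.lin h ^ k) (x (n + 1)) =
          (G.lin h ^ (k + 1)) (x n) + (G.lin h ^ k) (x (n + 1) - G.lin h (x n)) := by
        rw [map_sub, pow_succ]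
        change _ = (G.lin h ^ k) (G.lin h (x n)) + _
        abel
      rw [e]
      calc _ ≤ _ := norm_add_le _ _
        _ ≤ ρ ^ (k + 1) * (K * σ ^ n * ‖x 0‖) + K * ρ ^ k * (ε * (K * σ ^ n * ‖x 0‖)) := by
          refine add_le_add (ih _) ((hdec k _ h2).trans ?_)
          gcongr
          exact h1.trans (by gcongr)
        _ = ρ ^ k * (K * σ ^ (n + 1) * ‖x 0‖) := by rw [hσ]; ring
  have h1 := key n 0
  simp only [pow_zero, one_mul, one_apply_eq_self] at h1
  refine h1.trans ?_
  rw [mul_right_comm]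
  gcongr

end Core

/-! ### Probability measures in the scale of Banach spaces -/

namespace CompatibleMetric

variable {Y : Type*} [TopologicalSpace Y] (dw : CompatibleMetric Y)

lemma dist_nonneg (x y : Y) : 0 ≤ dw.dist x y := by
  have h := dw.dist_triangle x y x
  rw [dw.dist_self, dw.dist_comm y x] at h
  linarith

lemma tendsto_iff {ι : Type*} {l : Filter ι} {u : ι → Y} {x : Y} :
    Tendsto u l (𝓝 x) ↔ ∀ ε > 0, ∀ᶠ i in l, dw.dist (u i) x < ε := by
  rw [(dw.nhds_basis x).tendsto_right_iff]; rfl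

lemma tendsto_of_dist {ι : Type*} {l : Filter ι} {u : ι → Y} {x : Y}
    (h : Tendsto (fun i => dw.dist (u i) x) l (𝓝 0)) : Tendsto u l (𝓝 x) :=
  dw.tendsto_iff.2 fun _ hε => h.eventually (gt_mem_nhds hε)

end CompatibleMetric

lemma tendsto_measure_of_smooth {ι : Type*} {l : Filter ι}
    {μ : ι → ProbabilityMeasure (Torus d)} {μ' : ProbabilityMeasure (Torus d)}
    (h : ∀ φ : Smooth d, Tendsto (fun i => ∫ x, φ x ∂(μ i)) l
      (𝓝 (∫ x, φ x ∂μ'))) : Tendsto μ l (𝓝 μ') := by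
  rw [ProbabilityMeasure.tendsto_iff_forall_integral_tendsto]
  intro f
  rw [Metric.tendsto_nhds]
  intro ε hε
  obtain ⟨φ, hφ⟩ := exists_smooth_unif f.continuous (ε := ε / 3) (by positivity)
  have e : ∀ κ : ProbabilityMeasure (Torus d), |∫ x, f x ∂κ -
      ∫ x, φ x ∂κ| ≤ ε / 3 := fun κ => by
    rw [← integral_sub (integrable_of_continuous f.continuous (κ : Measure (Torus d)))
      (integrable_of_continuous φ.continuous (κ : Measure (Torus d))), ← Real.norm_eq_abs]
    refine (norm_integral_le_of_norm_le_const (μ := (κ : Measure (Torus d))) (C := ε / 3)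
      (ae_of_all _ fun x => ?_)).trans ?_
    · rw [Real.norm_eq_abs, abs_sub_comm]; exact (hφ x).le
    · simp
  filter_upwards [(Metric.tendsto_nhds.1 (h φ)) (ε / 3) (by positivity)] with i hi
  rw [Real.dist_eq] at hi ⊢
  have h1 := abs_le.1 (e (μ i))
  have h2 := abs_le.1 (e μ')
  have h3 := abs_lt.1 hi
  rw [abs_lt]
  constructor <;> linarith

lemma measureReal_univ_torus (d : ℕ) : (volume : Measure (Torus d)).real univ = 1 := by
  have h : IsProbabilityMeasure (volume : Measure UnitAddCircle) :=
    ⟨by rw [AddCircle.measure_univ, ENNReal.ofReal_one]⟩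
  have : IsProbabilityMeasure (volume : Measure (Torus d)) :=
    inferInstanceAs (IsProbabilityMeasure
      (Measure.pi fun _ : Fin d => (volume : Measure UnitAddCircle)))
  exact probReal_univ

lemma HasDensity.integral_eq {ρ : Torus d → ℝ}
    (h : HasDensity μ ρ) (hρ : Continuous ρ) (h0 : ∀ x, 0 ≤ ρ x) (φ : Torus d → ℝ) :
    ∫ x, φ x ∂μ = ∫ x, ρ x * φ x := by
  rw [h, integral_withDensity_eq_integral_toReal_smul hρ.measurable.ennreal_ofReal
    (ae_of_all _ fun x => ENNReal.ofReal_lt_top)]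
  simp only [ENNReal.toReal_ofReal (h0 _), smul_eq_mul]

lemma HasDensity.integral_one {ρ : Torus d → ℝ}
    (h : HasDensity μ ρ) (hρ : Continuous ρ) (h0 : ∀ x, 0 ≤ ρ x) : ∫ x, ρ x = 1 := by
  have := h.integral_eq hρ h0 fun _ => 1
  simpa using this.symm

lemma exists_hasDensity {ρ : Torus d → ℝ} (hρ : Continuous ρ) (h0 : ∀ x, 0 ≤ ρ x)
    (h1 : ∫ x, ρ x = 1) : ∃ μ : ProbabilityMeasure (Torus d), HasDensity μ ρ := by
  refine ⟨⟨(volume : Measure (Torus d)).withDensity (fun x => ENNReal.ofReal (ρ x)), ⟨?_⟩⟩, rfl⟩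
  rw [withDensity_apply _ MeasurableSet.univ, Measure.restrict_univ,
    ← ofReal_integral_eq_lintegral_ofReal (integrable_of_continuous hρ _) (ae_of_all _ h0), h1,
    ENNReal.ofReal_one]

namespace CoupledSystem

variable (F)

lemma integral_push (ν : ℝ) (μ : ProbabilityMeasure (Torus d)) {φ : Torus d → ℝ}
    (hφ : Continuous φ) : ∫ x, φ x ∂(F.push ν μ : Measure (Torus d)) =
      ∫ x, φ (F.coupled ν (F.meanα μ) x) ∂μ := by
  have : (F.push ν μ : Measure (Torus d)) =
      Measure.map (F.coupled ν (F.meanα μ)) (μ : Measure (Torus d)) := rfl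
  rw [this, integral_map (continuous_coupled F ν _).aemeasurable hφ.aestronglyMeasurable]

end CoupledSystem

namespace BanachScale

lemma Represents.integral {i : Fin 4} {b : B i}
    (h : X.Represents i b μ) : X.integral i b = 1 :=
  (h (oneCr d r)).trans (by
    change ∫ x, (1 : ℝ) ∂(μ : Measure (Torus d)) = 1
    simp)

lemma Represents.pair {i : Fin 4} {b : B i}
    (h : X.Represents i b μ) : X.pair F.α i b = F.meanα μ := h (F.α.toCr r)

lemma Represents.incl {i : Fin 3} {b : B i.succ}
    (h : X.Represents i.succ b μ) : X.Represents i.castSucc (X.incl i b) μ := fun φ => by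
  rw [X.J_incl, h φ]

lemma Represents.incl2 {b : B 3}
    (h : X.Represents 3 b μ) : X.Represents 2 (X.incl 2 b) μ := Represents.incl (i := 2) h

lemma Represents.incl1 {b : B 2}
    (h : X.Represents 2 b μ) : X.Represents 1 (X.incl 1 b) μ := Represents.incl (i := 1) h

lemma Represents.eq {i : Fin 4} {b b' : B i}
    (h : X.Represents i b μ) (h' : X.Represents i b' μ) : b = b' :=
  X.J_injective i (DFunLike.ext _ _ fun φ => (h φ).trans (h' φ).symm)

lemma Represents.push {i : Fin 4} {b : B i}
    (h : X.Represents i b μ) (hμ : F.coupledMap r ν (F.meanα μ) ∈ 𝒯) :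
    X.Represents i (X.Lc F ν (F.meanα μ) i b) (F.push ν μ) := fun φ => by
  rw [J_Lc hμ, h, F.integral_push ν μ φ.continuous]
  rfl

lemma represents_emb {i : Fin 4} {f : Cr d r}
    (hμ : HasDensity μ f) (h0 : ∀ x, 0 ≤ f x) : X.Represents i (X.emb i f) μ := fun φ => by
  rw [X.J_emb, hμ.integral_eq f.continuous h0]

end BanachScale

/-- The orbit of `b` under `f ↦ L (a f) f`. -/
noncomputable def Core.orb (G : Core E0 E1 E2 E3) (b : E3) (n : ℕ) : E3 :=
  (fun f => G.L3 (G.a3 f) f)^[n] b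

lemma Core.orb_succ (G : Core E0 E1 E2 E3) (b : E3) (n : ℕ) :
    G.orb b (n + 1) = G.L3 (G.a3 (G.orb b n)) (G.orb b n) :=
  Function.iterate_succ_apply' _ _ _

namespace BanachScale

lemma core_a1 (b : B 1) : (X.core hX F ν hR).a1 b = X.pair F.α 1 b :=
  congrArg (fun u => u (F.α.toCr r)) (X.J_incl 0 b)

lemma core_a3 (b : B 3) : (X.core hX F ν hR).a3 b = X.pair F.α 3 b :=
  J_incl3 b _

lemma core_I1 (b : B 1) : (X.core hX F ν hR).I1 b = X.integral 1 b :=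
  congrArg (fun u => u (oneCr d r)) (X.J_incl 0 b)

lemma core_I3 (b : B 3) : (X.core hX F ν hR).I3 b = X.integral 3 b :=
  J_incl3 b _

lemma Represents.orb {b : B 3} (h : X.Represents 3 b μ)
    (n : ℕ) : X.Represents 3 ((X.core hX F ν hR).orb b n) ((F.push ν)^[n] μ) := by
  induction n with
  | zero => exact h
  | succ n ih =>
    rw [Core.orb_succ, Function.iterate_succ_apply', core_a3, ih.pair]
    exact ih.push (hR _ ⟨_, rfl⟩)

lemma Represents.isOrbit {b : B 3} (h : X.Represents 3 b μ) :
    (X.core hX F ν hR).IsOrbit ((X.core hX F ν hR).orb b) :=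
  ⟨fun n => by rw [core_a3, (h.orb n).pair]; exact ⟨_, rfl⟩, fun n => Core.orb_succ _ _ _,
    fun n => by rw [core_I3, (h.orb n).integral]⟩

/-- Bounded sequences in `B_3` of probability measures that converge weakly have a subsequence
that converges in `B_2` to the weak limit. -/
lemma exists_subseq_tendsto (hX : X.Admissible) {b : ℕ → B 3} {M : ℝ} (hM : ∀ n, ‖b n‖ ≤ M)
    {μ : ℕ → ProbabilityMeasure (Torus d)} (hb : ∀ n, X.Represents 3 (b n) (μ n))
    {μ' : ProbabilityMeasure (Torus d)} (hμ : Tendsto μ atTop (𝓝 μ')) :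
    ∃ (x : B 2) (ns : ℕ → ℕ), StrictMono ns ∧ X.Represents 2 x μ' ∧
      Tendsto (fun n => X.incl 2 (b (ns n))) atTop (𝓝 x) := by
  set Q : ℝ := |M| + 1
  have hQ : 0 < Q := by positivity
  have hmem : ∀ n, X.incl 2 (Q⁻¹ • b n) ∈ closure (X.incl 2 '' Metric.ball 0 1) := fun n => by
    refine subset_closure ⟨_, ?_, rfl⟩
    rw [mem_ball_zero_iff, norm_smul, norm_inv, Real.norm_eq_abs, abs_of_pos hQ,
      inv_mul_lt_iff₀ hQ, mul_one]
    exact ((hM n).trans (le_abs_self M)).trans_lt (lt_add_one _)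
  obtain ⟨y, -, ns, hns, hy⟩ := (hX.compact_incl 2).tendsto_subseq hmem
  have hx : Tendsto (fun n => X.incl 2 (b (ns n))) atTop (𝓝 (Q • y)) := by
    refine (hy.const_smul Q).congr fun n => ?_
    simp only [Function.comp_apply, map_smul, smul_smul, mul_inv_cancel₀ hQ.ne', one_smul]
  refine ⟨Q • y, ns, hns, fun φ => ?_, hx⟩
  have h1 : Tendsto (fun n => X.J 2 (X.incl 2 (b (ns n))) φ) atTop (𝓝 (X.J 2 (Q • y) φ)) :=
    ((by fun_prop : Continuous fun x : B 2 => X.J 2 x φ).tendsto _).comp hx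
  have h2 : Tendsto (fun n => ∫ x, φ x ∂(μ (ns n))) atTop
      (𝓝 (∫ x, φ x ∂μ')) :=
    ((ProbabilityMeasure.tendsto_iff_forall_integral_tendsto.1 hμ)
      (BoundedContinuousFunction.mkOfCompact ⟨φ, φ.continuous⟩)).comp hns.tendsto_atTop
  refine tendsto_nhds_unique h1 (h2.congr fun n => ?_)
  exact ((hb (ns n)).incl2 φ).symm

/-- Elements of a bounded subset of `B_3` that are weakly close to `h` are close to it in `B_2`. -/
lemma exists_close_of_dist (hX : X.Admissible)
    (dw : CompatibleMetric (ProbabilityMeasure (Torus d)))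
    {h : ProbabilityMeasure (Torus d)} (hh : X.Represents 3 h₃ h) (M : ℝ) {η : ℝ} (hη : 0 < η) :
    ∃ δ > 0, ∀ (b : B 3) (μ : ProbabilityMeasure (Torus d)), X.Represents 3 b μ → ‖b‖ ≤ M →
      dw.dist μ h < δ → ‖X.incl 2 (b - h₃)‖ < η := by
  by_contra! hcon
  choose b μ hb hM hd hle using fun n : ℕ => hcon (1 / ((n : ℝ) + 1)) (by positivity)
  have hμ : Tendsto μ atTop (𝓝 h) := dw.tendsto_of_dist <|
    squeeze_zero (fun n => dw.dist_nonneg _ _) (fun n => (hd n).le)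
      tendsto_one_div_add_atTop_nhds_zero_nat
  obtain ⟨x, ns, -, hx, hlim⟩ := exists_subseq_tendsto hX hM hb hμ
  have : x = X.incl 2 h₃ := hx.eq hh.incl2
  have h1 := tendsto_iff_norm_sub_tendsto_zero.1 hlim
  have h2 : η ≤ 0 := ge_of_tendsto' h1 fun n => by
    rw [this]
    exact (hle (ns n)).trans (le_of_eq (congrArg _ (map_sub (X.incl 2) _ _)))
  linarith

/-- Probability measures that are close in `B_1` are weakly close. -/
lemma exists_dist_lt (dw : CompatibleMetric (ProbabilityMeasure (Torus d)))
    {h : ProbabilityMeasure (Torus d)} (hh : X.Represents 3 h₃ h) {ε : ℝ} (hε : 0 < ε) :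
    ∃ δ > 0, ∀ (b : B 3) (μ : ProbabilityMeasure (Torus d)), X.Represents 3 b μ →
      ‖X.incl 1 (X.incl 2 (b - h₃))‖ < δ → dw.dist μ h < ε := by
  by_contra! hcon
  choose b μ hb hd hle using fun n : ℕ => hcon (1 / ((n : ℝ) + 1)) (by positivity)
  have h0 : Tendsto (fun n => ‖X.incl 1 (X.incl 2 (b n - h₃))‖) atTop (𝓝 0) :=
    squeeze_zero (fun n => norm_nonneg _) (fun n => (hd n).le)
      tendsto_one_div_add_atTop_nhds_zero_nat
  have h1 : Tendsto (fun n => X.incl 1 (X.incl 2 (b n))) atTop (𝓝 (X.incl 1 (X.incl 2 h₃))) := by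
    rw [tendsto_iff_norm_sub_tendsto_zero]
    simpa only [map_sub] using h0
  have hμ : Tendsto μ atTop (𝓝 h) := tendsto_measure_of_smooth fun φ => by
    have h2 := ((by fun_prop : Continuous fun x : B 1 => X.J 1 x (φ.toCr r)).tendsto _).comp h1
    have h3 : ∀ (b : B 3) (μ : ProbabilityMeasure (Torus d)), X.Represents 3 b μ →
        X.J 1 (X.incl 1 (X.incl 2 b)) (φ.toCr r) = ∫ x, φ x ∂μ :=
      fun b μ hb => hb.incl2.incl1 (φ.toCr r)
    rw [h3 _ _ hh] at h2
    exact h2.congr fun n => h3 _ _ (hb n)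
  obtain ⟨n, hn⟩ := (dw.tendsto_iff.1 hμ ε hε).exists
  exact absurd hn (not_lt.2 (hle n))

/-- A visible measure is in `B_3`. -/
lemma exists_represents [CompleteSpace (B 3)] (hX : X.Admissible)
    (hR : ∀ c ∈ range F.meanα, F.coupledMap r ν c ∈ 𝒯)
    (dw : CompatibleMetric (ProbabilityMeasure (Torus d))) {h : ProbabilityMeasure (Torus d)}
    (hvis : IsVisible dw F ν h) : ∃ h₃ : B 3, X.Represents 3 h₃ h := by
  obtain ⟨hinv, g, μ, hg0, hμ, hlim⟩ := hvis
  set G := X.core hX F ν hR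
  have hrep : X.Represents 3 (X.emb 3 (g.toCr r)) μ := represents_emb (f := g.toCr r) hμ hg0
  have horb : G.IsOrbit (G.orb (X.emb 3 (g.toCr r))) := hrep.isOrbit
  obtain ⟨x, ns, -, hx, -⟩ := exists_subseq_tendsto hX horb.norm_le (fun n => hrep.orb n)
    (dw.tendsto_of_dist hlim)
  have hc : F.meanα h ∈ G.R := ⟨h, rfl⟩
  obtain ⟨h₃, hfix, hI⟩ := G.exists_fixed hc (e := X.emb 3 (oneCr d r)) (by
    rw [core_I3]
    refine (X.J_emb 3 _ _).trans ?_
    change ∫ x : Torus d, (1 : ℝ) * 1 = 1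
    simp [measureReal_univ_torus])
  have h1 : X.Represents 1 (X.incl 1 x) h := hx.incl1
  have h2 : X.Lc F ν (F.meanα h) 1 (X.incl 1 x) = X.incl 1 x := by
    have := h1.push (F := F) (ν := ν) (hR _ ⟨h, rfl⟩)
    rw [hinv] at this
    exact this.eq h1
  have h3 : X.incl 1 x - X.incl 1 (X.incl 2 h₃) = 0 := by
    refine G.eq_zero_of_fixed hc ?_ ?_
    · rw [map_sub, core_I1, h1.integral]
      exact sub_eq_zero.2 hI.symm
    · rw [map_sub]
      refine congrArg₂ _ h2 ?_
      have := congrArg (fun y => X.incl 1 (X.incl 2 y)) hfix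
      exact (G.commL2 _ _).symm.trans ((congrArg _ (G.commL3 _ _).symm).trans this)
  refine ⟨h₃, fun φ => ?_⟩
  have h4 := h1 φ
  rw [sub_eq_zero.1 h3] at h4
  rw [← h4]
  exact (congrArg (fun u => u φ) ((X.J_incl 1 (X.incl 2 h₃)).trans (X.J_incl 2 h₃))).symm

/-- The invariance of `h`, as an equation in `B_3`. -/
lemma Represents.fixed {h : ProbabilityMeasure (Torus d)}
    (hh : X.Represents 3 h₃ h) (hinv : F.IsInvariant ν h) :
    (X.core hX F ν hR).L3 ((X.core hX F ν hR).a3 h₃) h₃ = h₃ := by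
  rw [core_a3, hh.pair]
  have := hh.push (F := F) (ν := ν) (hR _ ⟨h, rfl⟩)
  rw [hinv] at this
  exact this.eq hh

lemma dirW_eq {h : ProbabilityMeasure (Torus d)} (hh : X.Represents 3 h₃ h)
    (hS : F.coupledMap r ν (F.meanα h) ∈ 𝒯) :
    (X.core hX F ν hR).dirW h₃ = -(ν • X.divL1 F.β ⟨_, hS⟩ h₃) := by
  have e : (X.core hX F ν hR).dirW h₃ = X.incl 1 (X.Wc F ν ((X.core hX F ν hR).a3 h₃) 2 h₃) := rfl
  rw [e, core_a3, hh.pair (F := F), Wc_apply, Lc, dif_pos hS, map_neg, map_smul]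
  rfl

lemma linearized_eq {h : ProbabilityMeasure (Torus d)} (hh : X.Represents 3 h₃ h)
    (hS : F.coupledMap r ν (F.meanα h) ∈ 𝒯) :
    X.linearized F ν ⟨_, hS⟩ h₃ = (X.core hX F ν hR).lin h₃ := by
  refine DFunLike.ext _ _ fun φ => ?_
  have e : (X.core hX F ν hR).lin h₃ φ = (X.core hX F ν hR).L1 ((X.core hX F ν hR).a3 h₃) φ +
    (X.core hX F ν hR).a1 φ • (X.core hX F ν hR).dirW h₃ := rfl
  rw [e, dirW_eq hh hS, core_a3, hh.pair (F := F), core_a1, smul_neg, smul_comm, ← sub_eq_add_neg]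
  change _ = X.Lc F ν (F.meanα h) 1 φ - _
  rw [Lc, dif_pos hS]
  rfl

end BanachScale

/-- Inside the range of the means of `α`, one can move from any point to at least one side, unless
`α` is constant. -/
lemma CoupledSystem.zero_mem_closure (F : CoupledSystem d)
    (μ : ProbabilityMeasure (Torus d)) {s : ℝ} (hs : s ≠ 0) (hα : ∃ x, F.α x ≠ F.meanα μ) :
    (0 : ℝ) ∈ closure {t : ℝ | t ≠ 0 ∧ F.meanα μ + t * s ∈ range F.meanα} := by
  obtain ⟨x, hx⟩ := hα
  have hδ : F.α x ∈ range F.meanα := by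
    refine ⟨⟨Measure.dirac x, inferInstance⟩, ?_⟩
    change ∫ y, F.α y ∂(Measure.dirac x) = _
    rw [integral_dirac]
  set e : ℝ := (F.α x - F.meanα μ) / s
  have he : e ≠ 0 := div_ne_zero (sub_ne_zero.2 hx) hs
  rw [mem_closure_iff_seq_limit]
  refine ⟨fun n => 1 / ((n : ℝ) + 1) * e, fun n => ⟨mul_ne_zero (by positivity) he, ?_⟩, ?_⟩
  · have h1 : (1 : ℝ) / (n + 1) ≤ 1 := by
      rw [div_le_one (by positivity)]; linarith [(Nat.cast_nonneg n : (0 : ℝ) ≤ n)]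
    have := F.convex_range_meanα ⟨μ, rfl⟩ hδ (a := 1 - 1 / ((n : ℝ) + 1)) (b := 1 / ((n : ℝ) + 1))
      (by linarith) (by positivity) (by ring)
    convert this using 1
    simp only [e, smul_eq_mul]
    field_simp
    ring
  · have := (tendsto_one_div_add_atTop_nhds_zero_nat (𝕜 := ℝ)).mul_const e
    rwa [zero_mul] at this

namespace BanachScale

lemma pair_of_const (i : Fin 4) {c : ℝ} (hα : ∀ x, F.α x = c) (b : B i) :
    X.pair F.α i b = c * X.integral i b := by
  have : F.α.toCr r = c • oneCr d r := Subtype.ext (funext fun x => by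
    change F.α x = c * 1
    rw [hα, mul_one])
  rw [pair, this, integral, ContinuousLinearMap.flip_apply, ContinuousLinearMap.flip_apply,
    map_smul, smul_eq_mul]

lemma hasGateauxDifferential_aux (hX : X.Admissible)
    (hR : ∀ c ∈ range F.meanα, F.coupledMap r ν c ∈ 𝒯)
    {h : ProbabilityMeasure (Torus d)} (hh : X.Represents 3 h₃ h) {x : B 1} (hx : x = X.incl 1 (X.incl 2 h₃)) :
    HasGateauxDifferential (X.nonlinear F ν) (X.nonlinearDomain F) {φ | X.integral 1 φ = 0}
      ((X.core hX F ν hR).lin h₃) x := by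
  have h1 : X.Represents 1 x h := hx ▸ hh.incl2.incl1
  refine ⟨⟨h1.integral, h, h1.pair⟩, fun φ hφ => ?_⟩
  have hφ : X.integral 1 φ = 0 := hφ
  set S : Set ℝ := {t : ℝ | t ≠ 0 ∧ x + t • φ ∈ X.nonlinearDomain F} with hS
  have hpair : ∀ t : ℝ, X.pair F.α 1 (x + t • φ) =
      F.meanα h + t * X.pair F.α 1 φ := fun t => by
    rw [map_add, map_smul, h1.pair, smul_eq_mul]
  have hSe : S = {t : ℝ | t ≠ 0 ∧ F.meanα h + t * X.pair F.α 1 φ ∈ range F.meanα} := by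
    ext t
    refine and_congr_right fun _ => ?_
    change _ ∧ _ ↔ _
    rw [map_add, map_smul, h1.integral, hφ, smul_zero, add_zero, hpair]
    exact ⟨fun ⟨_, μ, hμ⟩ => ⟨μ, hμ.symm⟩, fun ⟨μ, hμ⟩ => ⟨rfl, μ, hμ.symm⟩⟩
  constructor
  · rw [← mem_closure_iff_nhdsWithin_neBot, hSe]
    by_cases hs : X.pair F.α 1 φ = 0
    · have : {t : ℝ | t ≠ 0 ∧ F.meanα h + t * X.pair F.α 1 φ ∈ range F.meanα} = {0}ᶜ := by
        ext t; simp [hs]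
      rw [this, closure_compl_singleton]
      trivial
    · refine F.zero_mem_closure h hs ?_
      by_contra! hα
      rw [pair_of_const 1 hα, hφ, mul_zero] at hs
      exact hs rfl
  · have ha3 : (X.core hX F ν hR).a3 h₃ = F.meanα h := (core_a3 h₃).trans hh.pair
    have key := (X.core hX F ν hR).tendsto_gateaux (h := h₃) (by rw [ha3]; exact ⟨h, rfl⟩) φ
      (S := S) (fun t ht => by
        rw [hSe] at ht
        rw [ha3, core_a1]; exact ht)
    refine key.congr' (eventually_nhdsWithin_of_forall fun t ht => ?_)
    have hn : ∀ f : B 1, X.nonlinear F ν f = X.Lc F ν (X.pair F.α 1 f) 1 f := fun f => by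
      rw [nonlinear, Lc]
      by_cases hf : F.coupledMap r ν (X.pair F.α 1 f) ∈ 𝒯
      · rw [dif_pos hf, dif_pos hf]
      · rw [dif_neg hf, dif_neg hf]; rfl
    beta_reduce
    rw [hn (x + t • φ), hn x, hpair, h1.pair, ha3, core_a1, hx]
    rfl

lemma hasGateauxDifferential (hX : X.Admissible)
    (hR : ∀ c ∈ range F.meanα, F.coupledMap r ν c ∈ 𝒯)
    {h : ProbabilityMeasure (Torus d)} (hh : X.Represents 3 h₃ h) :
    HasGateauxDifferential (X.nonlinear F ν) (X.nonlinearDomain F) {φ | X.integral 1 φ = 0}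
      ((X.core hX F ν hR).lin h₃) (X.incl 1 (X.incl 2 h₃)) :=
  hasGateauxDifferential_aux hX hR hh rfl

end BanachScale

/-! ### Physical measures from the spectral condition -/

lemma Core.IsOrbit.norm_sub_le {b b' : ℕ → E3}
    (hb : G.IsOrbit b) (hb' : G.IsOrbit b') {M : ℝ} (hM : ∀ n, ‖b n‖ ≤ M) (n : ℕ) :
    ‖G.i3 (b' n - b n)‖ ≤ (G.C * (1 + ‖G.a2‖ * M)) ^ n * ‖b' 0 - b 0‖ := by
  have hC := G.C_pos
  have hM0 : 0 ≤ M := (norm_nonneg _).trans (hM 0)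
  induction n with
  | zero => rw [pow_zero, one_mul]; exact G.nle3 _
  | succ n ih =>
    set c := G.a3 (b n)
    set c' := G.a3 (b' n)
    have e1 : c' - c = G.a2 (G.i3 (b' n - b n)) := (G.a3.map_sub _ _).symm
    have e : G.i3 (b' (n + 1) - b (n + 1)) = G.L2 c' (G.i3 (b' n - b n)) +
        (G.L2 c' (G.i3 (b n)) - G.L2 c (G.i3 (b n))) := by
      rw [hb.step, hb'.step, map_sub, G.commL3, G.commL3, map_sub, map_sub]; abel
    have h1 : |c' - c| ≤ ‖G.a2‖ * ‖G.i3 (b' n - b n)‖ := by rw [e1]; exact G.a2.le_opNorm _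
    rw [e]
    calc _ ≤ _ := norm_add_le _ _
      _ ≤ G.C * ‖G.i3 (b' n - b n)‖ + G.C * (‖G.a2‖ * ‖G.i3 (b' n - b n)‖) * M := by
        refine add_le_add (G.bdL2 (hb'.mem n) _) ((G.lip2 _ (hb'.mem n) _ (hb.mem n) _).trans ?_)
        have := hM n
        gcongr
      _ = G.C * (1 + ‖G.a2‖ * M) * ‖G.i3 (b' n - b n)‖ := by ring
      _ ≤ G.C * (1 + ‖G.a2‖ * M) * ((G.C * (1 + ‖G.a2‖ * M)) ^ n * ‖b' 0 - b 0‖) := by gcongr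
      _ = _ := by rw [pow_succ]; ring

lemma crNorm_eq (k : ℕ) (f g : Smooth d) :
    crNorm k (fun x => f x - g x) = ‖f.toCr k - g.toCr k‖ := rfl

/-- The normalization of a smooth density close to a probability density is close to it. -/
lemma norm_normalize_sub_le {g g' : Smooth d} (hg : ∫ x, g x = 1) {ε : ℝ}
    (hε : ε ≤ 1 / 2) (h : crNorm r (fun x => g' x - g x) < ε) :
    1 / 2 ≤ ∫ x, g' x ∧ ‖(∫ x, g' x)⁻¹ • g'.toCr r - g.toCr r‖ ≤ 2 * ε * (1 + ‖g.toCr r‖) := by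
  rw [crNorm_eq] at h
  have h1 : |(∫ x, g' x) - ∫ x, g x| ≤ ε := by
    rw [← integral_sub (integrable_of_continuous g'.continuous _)
      (integrable_of_continuous g.continuous _), ← Real.norm_eq_abs]
    refine (norm_integral_le_of_norm_le_const (C := ε) (ae_of_all _ fun x => ?_)).trans ?_
    · exact ((g'.toCr r - g.toCr r).abs_le_norm x).trans h.le
    · rw [measureReal_univ_torus, mul_one]
  rw [hg] at h1
  set t := ∫ x, g' x
  have ht : 1 / 2 ≤ t := by have := abs_le.1 h1; linarith
  have ht0 : 0 < t := by linarith
  have hti : t⁻¹ ≤ 2 := by rw [inv_le_comm₀ ht0 (by norm_num)]; linarith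
  refine ⟨ht, ?_⟩
  have e : t⁻¹ • g'.toCr r - g.toCr r =
      t⁻¹ • (g'.toCr r - g.toCr r) + (t⁻¹ * (1 - t)) • g.toCr r := by
    rw [mul_sub, mul_one, inv_mul_cancel₀ ht0.ne', sub_smul, one_smul, smul_sub]; abel
  rw [e]
  refine (norm_add_le _ _).trans ?_
  rw [norm_smul, norm_smul, norm_mul, norm_inv, Real.norm_eq_abs, Real.norm_eq_abs,
    abs_of_pos ht0, abs_sub_comm]
  have h2 : t⁻¹ * ‖g'.toCr r - g.toCr r‖ ≤ 2 * ε := by gcongr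
  have h3 : t⁻¹ * |t - 1| * ‖g.toCr r‖ ≤ 2 * ε * ‖g.toCr r‖ := by gcongr
  linarith

lemma isOpenFamily_ball (k : ℕ) (g : Smooth d) (ε : ℝ) :
    IsOpenFamily {g' : Smooth d | g' ∈ nonnegSmooth d ∧ crNorm k (fun x => g' x - g x) < ε} := by
  refine ⟨fun g' hg' => hg'.1, fun g' hg' => ⟨k, ε - crNorm k (fun x => g' x - g x),
    sub_pos.2 hg'.2, fun f hf hfg => ⟨hf, ?_⟩⟩⟩
  rw [crNorm_eq] at hfg ⊢
  rw [crNorm_eq] at hfg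
  have := norm_sub_le_norm_sub_add_norm_sub (f.toCr k) (g'.toCr k) (g.toCr k)
  linarith

namespace BanachScale

lemma represents_normalized (i : Fin 4) {g : Smooth d}
    (h0 : ∀ x, 0 ≤ g x) (ht : 0 < ∫ x, g x) (hμ : HasDensity μ (fun x => g x / ∫ y, g y)) :
    X.Represents i (X.emb i ((∫ x, g x)⁻¹ • g.toCr r)) μ := by
  have e : (((∫ x, g x)⁻¹ • g.toCr r : Cr d r) : Torus d → ℝ) = fun x => g x / ∫ y, g y := by
    funext x
    change (∫ x, g x)⁻¹ * g x = _
    rw [div_eq_mul_inv, mul_comm]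
  refine represents_emb ?_ fun x => ?_
  · rw [e]; exact hμ
  · rw [e]; exact div_nonneg (h0 x) ht.le

/-- If the characteristic function has no zero in the closed unit disc, then a visible measure is
physical: it attracts a neighbourhood of any smooth density that it attracts. -/
lemma isPhysical_of_ser_ne_zero (hX : X.Admissible)
    (hR : ∀ c ∈ range F.meanα, F.coupledMap r ν c ∈ 𝒯)
    (dw : CompatibleMetric (ProbabilityMeasure (Torus d))) {h : ProbabilityMeasure (Torus d)}
    (hvis : IsVisible dw F ν h) (hh : X.Represents 3 h₃ h)
    (h0 : ∀ z : ℂ, ‖z‖ ≤ 1 → ser (charCoef ((X.core hX F ν hR).coef h₃)) z ≠ 0) :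
    IsPhysical dw F ν h := by
  obtain ⟨hinv, g, μ, hg0, hμ, hlim⟩ := hvis
  refine ⟨hinv, ?_⟩
  set G := X.core hX F ν hR with hG
  have hcR : G.a3 h₃ ∈ G.R := by rw [core_a3, hh.pair]; exact ⟨h, rfl⟩
  have hg1 : ∫ x, g x = 1 := hμ.integral_one g.continuous hg0
  have hrep : X.Represents 3 (X.emb 3 (g.toCr r)) μ := represents_emb (f := g.toCr r) hμ hg0
  set e0 : B 3 := X.emb 3 (g.toCr r) with he0
  have horb : G.IsOrbit (G.orb e0) := hrep.isOrbit
  have hCpos := G.C_pos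
  set M : ℝ := G.C * (‖X.emb 3‖ * (‖g.toCr r‖ + (1 + ‖g.toCr r‖))) with hM
  have hemb0 : ‖e0‖ ≤ ‖X.emb 3‖ * ‖g.toCr r‖ := (X.emb 3).le_opNorm _
  have hMorb : ∀ n, ‖G.orb e0 n‖ ≤ M := fun n => (horb.norm_le n).trans (by
    rw [hM]
    refine mul_le_mul_of_nonneg_left (hemb0.trans ?_) hCpos.le
    gcongr
    have := norm_nonneg (g.toCr r)
    linarith)
  obtain ⟨δ, hδ, K, σ, hσ0, hσ1, hatt⟩ := Core.exists_attraction hcR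
    (hh.fixed hinv) ((core_I3 h₃).trans hh.integral) h0 M
  -- the orbit of the visible density enters the basin at some time `N`
  obtain ⟨δ1, hδ1, hclose⟩ := exists_close_of_dist hX dw hh M (half_pos hδ)
  obtain ⟨N, hN⟩ := (hlim.eventually (gt_mem_nhds hδ1)).exists
  have hN2 : ‖G.i3 (G.orb e0 N - h₃)‖ < δ / 2 := hclose _ _ (hrep.orb N) (hMorb N) hN
  set Q : ℝ := (G.C * (1 + ‖G.a2‖ * M)) ^ N with hQ
  have hM0 : 0 ≤ M := (norm_nonneg _).trans (hMorb 0)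
  have hQ0 : 0 ≤ Q := by positivity
  set P : ℝ := (Q + 1) * ((‖X.emb 3‖ + 1) * (2 * (1 + ‖g.toCr r‖))) with hP
  have hP0 : 0 < P := by positivity
  set ε : ℝ := min (1 / 2) (δ / (2 * P)) with hε
  have hε0 : 0 < ε := by positivity
  have hε2 : ε ≤ 1 / 2 := min_le_left _ _
  refine ⟨{g' | g' ∈ nonnegSmooth d ∧ crNorm r (fun x => g' x - g x) < ε}, ⟨g, ⟨hg0, ?_⟩, ?_⟩,
    isOpenFamily_ball r g ε, ?_⟩
  · by_contra! hz
    rw [integral_congr_ae (ae_of_all _ hz), integral_zero] at hg1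
    exact zero_ne_one hg1
  · rw [crNorm_eq, sub_self, norm_zero]
    exact hε0
  -- uniform exponential convergence in `B_1` of the orbits of nearby densities
  have huni : ∀ μ' ∈ normalizedMeasures
      {g' : Smooth d | g' ∈ nonnegSmooth d ∧ crNorm r (fun x => g' x - g x) < ε},
      ∃ b : B 3, X.Represents 3 b μ' ∧ ∀ n, ‖G.i2 (G.i3 (G.orb b (N + n) - h₃))‖ ≤ K * σ ^ n := by
    rintro μ' ⟨g', ⟨hg', hgε⟩, hμ'⟩
    obtain ⟨ht, hn⟩ := norm_normalize_sub_le hg1 hε2 hgε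
    have hrep' := represents_normalized (X := X) 3 hg'.1 (by linarith) hμ'
    set b : B 3 := X.emb 3 ((∫ x, g' x)⁻¹ • g'.toCr r) with hb
    have horb' : G.IsOrbit (G.orb b) := hrep'.isOrbit
    have hbe : ‖b - e0‖ ≤ ‖X.emb 3‖ * (2 * ε * (1 + ‖g.toCr r‖)) := by
      rw [hb, he0, ← map_sub]
      exact ((X.emb 3).le_opNorm _).trans (by gcongr)
    have hMorb' : ∀ n, ‖G.orb b n‖ ≤ M := fun n => (horb'.norm_le n).trans (by
      rw [hM]
      refine mul_le_mul_of_nonneg_left ?_ hCpos.le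
      change ‖b‖ ≤ _
      have h1 : ‖b‖ ≤ ‖b - e0‖ + ‖e0‖ := by simpa using norm_add_le (b - e0) e0
      have h2 : ‖X.emb 3‖ * (2 * ε * (1 + ‖g.toCr r‖)) ≤ ‖X.emb 3‖ * (1 + ‖g.toCr r‖) := by
        gcongr
        have : 0 ≤ 1 + ‖g.toCr r‖ := by positivity
        nlinarith
      rw [mul_add]
      linarith)
    refine ⟨b, hrep', hatt _ (horb'.shift N) (fun n => hMorb' _) ?_⟩
    have h1 := horb.norm_sub_le horb' hMorb N
    have h2 : G.orb b N - h₃ = (G.orb b N - G.orb e0 N) + (G.orb e0 N - h₃) := by abel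
    refine (G.nle2 _).trans_lt ?_
    have h3 : Q * ‖b - e0‖ ≤ δ / 2 := by
      calc Q * ‖b - e0‖ ≤ (Q + 1) * ((‖X.emb 3‖ + 1) * (2 * (δ / (2 * P)) * (1 + ‖g.toCr r‖))) := by
            refine mul_le_mul (by linarith) (hbe.trans ?_) (norm_nonneg _) (by positivity)
            gcongr
            · linarith
            · exact min_le_right _ _
        _ = δ / 2 := by rw [hP]; field_simp
    calc ‖G.i3 (G.orb b (N + 0) - h₃)‖ = ‖G.i3 (G.orb b N - G.orb e0 N) + G.i3 (G.orb e0 N - h₃)‖ := by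
          rw [add_zero, h2, map_add]
      _ ≤ _ := norm_add_le _ _
      _ < δ := by
        have : ‖G.i3 (G.orb b N - G.orb e0 N)‖ ≤ δ / 2 := h1.trans h3
        linarith
  rw [ENNReal.tendsto_nhds_zero]
  intro η hη
  obtain ⟨η', hη', hη'η⟩ : ∃ η' : ℝ, 0 < η' ∧ ENNReal.ofReal η' ≤ η := by
    by_cases htop : η = ⊤
    · exact ⟨1, one_pos, htop ▸ le_top⟩
    · exact ⟨η.toReal, ENNReal.toReal_pos hη.ne' htop, (ENNReal.ofReal_toReal htop).le⟩
  obtain ⟨δ', hδ', hdist⟩ := exists_dist_lt dw hh hη'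
  have hlim2 : Tendsto (fun n : ℕ => K * σ ^ n) atTop (𝓝 0) := by
    simpa using (tendsto_pow_atTop_nhds_zero_of_lt_one hσ0.le hσ1).const_mul K
  obtain ⟨N', hN'⟩ := eventually_atTop.1 (hlim2.eventually (gt_mem_nhds hδ'))
  filter_upwards [eventually_ge_atTop (N + N')] with n hn
  refine iSup₂_le fun μ' hμ' => ?_
  obtain ⟨b, hb, hdec⟩ := huni μ' hμ'
  obtain ⟨k, rfl⟩ : ∃ k, n = N + k := ⟨n - N, by omega⟩
  refine (ENNReal.ofReal_le_ofReal ?_).trans hη'η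
  exact (hdist _ _ (hb.orb (N + k)) ((hdec k).trans_lt (hN' k (by omega)))).le

/-- The spectral condition, in terms of the characteristic function. -/
lemma ser_ne_zero_of_spectrum [CompleteSpace E1] 
    (hc : G.a3 h ∈ G.R) {κ : ℝ} (hκ1 : κ < 1)
    (hσ : ∀ z ∈ complexSpectrum (G.lin h), z ≠ 1 → ‖z‖ < κ)
    (hΞ : G.a1 (∑' n, (G.L1 (G.a3 h) ^ n) (G.dirW h)) ≠ 1) (z : ℂ) (hz : ‖z‖ ≤ 1) :
    ser (charCoef (G.coef h)) z ≠ 0 := by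
  intro h0
  by_cases h1 : z = 1
  · rw [h1, Core.ser_one hc, sub_eq_zero] at h0
    exact hΞ (by exact_mod_cast h0.symm)
  by_cases hz0 : z = 0
  · rw [hz0] at h0
    unfold ser at h0
    rw [tsum_eq_single 0 (fun n hn => by simp [hn])] at h0
    simp [charCoef] at h0
  have hn : 1 ≤ ‖z⁻¹‖ := by rw [norm_inv]; exact (one_le_inv₀ (norm_pos_iff.2 hz0)).2 hz
  have := hσ z⁻¹ (Core.mem_spectrum_of_ser_eq_zero hc hn (by rwa [inv_inv]))
    (fun h => h1 (by rw [← inv_inv z, h, inv_one]))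
  linarith

end BanachScale

/-! ### Perturbed dual renewal equations -/

open scoped BoundedContinuousFunction

section DualSequence

/-- A kernel that is summable, uniformly in the row, gives a bounded operator on the bounded
continuous families of sequences. -/
lemma exists_kernelOp {Y : Type*} [TopologicalSpace Y] (κ : Y → ℕ → ℕ → ℂ) (σ : ℕ → ℕ → ℕ)
    (hκ : ∀ k j, Continuous fun y => κ y k j) (g : ℕ → ℕ → ℝ) (hg : ∀ y k j, ‖κ y k j‖ ≤ g k j)
    {G : ℝ} (hG : 0 ≤ G) (hgs : ∀ k, Summable (g k)) (hgG : ∀ k, ∑' j, g k j ≤ G) :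
    ∃ K : (Y × ℕ →ᵇ ℂ) →L[ℂ] (Y × ℕ →ᵇ ℂ), ‖K‖ ≤ G ∧
      ∀ x y k, K x (y, k) = ∑' j, κ y k j * x (y, σ k j) := by
  have hle : ∀ (x : Y × ℕ →ᵇ ℂ) y k j, ‖κ y k j * x (y, σ k j)‖ ≤ g k j * ‖x‖ := fun x y k j => by
    rw [norm_mul]
    exact mul_le_mul (hg y k j) (x.norm_coe_le_norm _) (norm_nonneg _)
      ((norm_nonneg _).trans (hg y k j))
  have hs : ∀ (x : Y × ℕ →ᵇ ℂ) y k, Summable fun j => κ y k j * x (y, σ k j) := fun x y k =>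
    Summable.of_norm_bounded ((hgs k).mul_right _) (hle x y k)
  have hb : ∀ (x : Y × ℕ →ᵇ ℂ) (p : Y × ℕ), ‖∑' j, κ p.1 p.2 j * x (p.1, σ p.2 j)‖ ≤ G * ‖x‖ := by
    intro x p
    refine (tsum_of_norm_bounded ((hgs p.2).mul_right _).hasSum (hle x p.1 p.2)).trans ?_
    rw [tsum_mul_right]
    exact mul_le_mul_of_nonneg_right (hgG _) (norm_nonneg _)
  have hc : ∀ x : Y × ℕ →ᵇ ℂ, Continuous fun p : Y × ℕ => ∑' j, κ p.1 p.2 j * x (p.1, σ p.2 j) := by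
    intro x
    rw [continuous_prod_of_discrete_right]
    intro k
    refine continuous_tsum (fun j => (hκ k j).mul (x.continuous.comp (by fun_prop)))
      ((hgs k).mul_right ‖x‖) fun j y => hle x y k j
  refine ⟨LinearMap.mkContinuous (σ := RingHom.id ℂ)
    { toFun := fun x => BoundedContinuousFunction.ofNormedAddCommGroup _ (hc x) (G * ‖x‖) (hb x)
      map_add' := fun x x' => ?_
      map_smul' := fun a x => ?_ } G fun x => ?_, LinearMap.mkContinuous_norm_le _ hG _,
      fun x y k => rfl⟩
  · ext p
    change ∑' j, κ p.1 p.2 j * (x (p.1, σ p.2 j) + x' (p.1, σ p.2 j)) = _ + _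
    simp_rw [mul_add]
    exact (hs x p.1 p.2).tsum_add (hs x' p.1 p.2)
  · ext p
    change ∑' j, κ p.1 p.2 j * (a * x (p.1, σ p.2 j)) = a * ∑' j, κ p.1 p.2 j * x (p.1, σ p.2 j)
    rw [← tsum_mul_left]
    exact tsum_congr fun j => by ring
  · exact BoundedContinuousFunction.norm_ofNormedAddCommGroup_le (hc x) (by positivity) (hb x)

/-- A two sided geometric bound, summed along a row. -/
lemma tsum_two_sided {D : ℝ} {p q : ℝ} (hp0 : 0 ≤ p) (hp : p < 1) (hq0 : 0 ≤ q) (hq : q < 1)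
    (u : ℤ → ℝ) (hu0 : ∀ i, 0 ≤ u i) (hu : ∀ i : ℕ, u i ≤ D * p ^ i)
    (hu' : ∀ i : ℕ, u (-i) ≤ D * q ^ i) (k : ℕ) :
    Summable (fun j : ℕ => u ((j : ℤ) - k)) ∧
      ∑' j : ℕ, u ((j : ℤ) - k) ≤ D * (1 - p)⁻¹ + D * (1 - q)⁻¹ := by
  have hs1 : Summable fun i : ℕ => u i := Summable.of_nonneg_of_le (fun i => hu0 _) hu
    ((summable_geometric_of_lt_one hp0 hp).mul_left D)
  have hs2 : Summable fun i : ℕ => u (-i) := Summable.of_nonneg_of_le (fun i => hu0 _) hu'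
    ((summable_geometric_of_lt_one hq0 hq).mul_left D)
  have e : ∀ j : ℕ, u (((j + k : ℕ) : ℤ) - k) = u j := fun j => by congr 1; push_cast; ring
  have hs : Summable (fun j : ℕ => u ((j : ℤ) - k)) := by
    rw [← summable_nat_add_iff k]
    exact hs1.congr fun j => (e j).symm
  refine ⟨hs, ?_⟩
  rw [← hs.sum_add_tsum_nat_add k, add_comm]
  simp_rw [e]
  refine add_le_add ?_ ?_
  · rw [← tsum_geometric_of_lt_one hp0 hp, ← tsum_mul_left]
    exact hs1.tsum_le_tsum hu ((summable_geometric_of_lt_one hp0 hp).mul_left D)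
  · have h1 : ∑ j ∈ Finset.range k, u ((j : ℤ) - k) ≤ ∑ i ∈ Finset.range (k + 1), u (-(i : ℤ)) := by
      rw [← Finset.sum_range_reflect, Finset.sum_range_succ']
      refine le_add_of_le_of_nonneg (Finset.sum_le_sum fun i hi => le_of_eq ?_) (hu0 _)
      congr 1
      have := Finset.mem_range.1 hi
      omega
    refine h1.trans ((hs2.sum_le_tsum _ fun i _ => hu0 _).trans ?_)
    rw [← tsum_geometric_of_lt_one hq0 hq, ← tsum_mul_left]
    exact hs2.tsum_le_tsum hu' ((summable_geometric_of_lt_one hq0 hq).mul_left D)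

/-- A sequence `d` with `f * d = δ` gives a right inverse of the transpose of the convolution with
`f`. -/
lemma hasSum_conv {f : ℕ → ℂ} {d : ℤ → ℂ} {N : ℝ} (hf : Summable fun l => ‖f l‖)
    (hd : ∀ k : ℤ, HasSum (fun l : ℕ => f l * d (k - l)) (if k = 0 then 1 else 0)) (R : ℕ → ℂ)
    (hs : ∀ k : ℕ, Summable fun j : ℕ => ‖d ((j : ℤ) - k) * R j‖)
    (hn : ∀ k : ℕ, ∑' j : ℕ, ‖d ((j : ℤ) - k) * R j‖ ≤ N) (k : ℕ) :
    HasSum (fun l => f l * ∑' j : ℕ, d ((j : ℤ) - ((k + l : ℕ) : ℤ)) * R j) (R k) := by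
  have hF : Summable fun p : ℕ × ℕ => f p.1 * (d ((p.2 : ℤ) - ((k + p.1 : ℕ) : ℤ)) * R p.2) := by
    refine Summable.of_norm ((summable_prod_of_nonneg fun _ => norm_nonneg _).2 ⟨fun l => ?_, ?_⟩)
    · simp_rw [norm_mul (f l)]
      exact (hs (k + l)).mul_left _
    · refine Summable.of_nonneg_of_le (fun l => tsum_nonneg fun _ => norm_nonneg _) (fun l => ?_)
        (hf.mul_right N)
      simp_rw [norm_mul (f l)]
      rw [tsum_mul_left]
      gcongr
      exact hn (k + l)
  have h1 := hF.hasSum.prod_fiberwise fun l => (hF.prod_factor l).hasSum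
  simp_rw [tsum_mul_left] at h1
  have h2 := ((Equiv.prodComm ℕ ℕ).hasSum_iff.2 hF.hasSum).prod_fiberwise fun j =>
    ((hd ((j : ℤ) - k)).mul_right (R j)).congr_fun fun l => by
      change f l * (d ((j : ℤ) - ((k + l : ℕ) : ℤ)) * R j) = _
      rw [mul_assoc, Nat.cast_add, sub_add_eq_sub_sub]
  have h3 := h2.unique (hasSum_single k fun j hj => by rw [if_neg (by omega), zero_mul])
  rwa [h3, sub_self, if_pos rfl, one_mul] at h1

/-- If `ser f` has a zero `w` in the unit disc and no zeros near the unit circle, then small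
perturbations of the equations `∑ l, f l * x (k + l) = 0` have bounded solutions close to `w ^ k`;
they depend continuously on the perturbation. -/
lemma exists_dual_solution {f : ℕ → ℂ} {ρ1 ρ2 : ℝ} (hρ20 : 0 < ρ2) (hρ2 : ρ2 < 1) (hρ1 : 1 < ρ1)
    (hf : Summable fun l => ‖f l‖ * ρ1 ^ l)
    (hne : ∀ z : ℂ, ρ2 ≤ ‖z‖ → ‖z‖ ≤ ρ1 → ser f z ≠ 0) {w : ℂ} (hw : ‖w‖ ≤ 1)
    (hfw : ser f w = 0) : ∃ η : ℝ, 0 < η ∧ ∀ (Y : Type v) [TopologicalSpace Y] (E : Y → ℕ → ℕ → ℂ)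
      (g : ℕ → ℝ), (∀ k j, Continuous fun y => E y k j) → (∀ y k j, ‖E y k j‖ ≤ g j) → Summable g →
      ∑' j, g j ≤ η → ∃ x : Y × ℕ →ᵇ ℂ, ‖x‖ ≤ 3 / 2 ∧ (∀ y k, ‖x (y, k) - w ^ k‖ ≤ 1 / 2) ∧
        ∀ y k, HasSum (fun l => f l * x (y, k + l)) (∑' j, E y k j * x (y, k + 1 + j)) := by
  have hρ10 : 0 < ρ1 := one_pos.trans hρ1
  have hfs : ∀ t, 0 ≤ t → t ≤ ρ1 → Summable fun l => ‖f l‖ * t ^ l := fun t ht0 ht1 =>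
    Summable.of_nonneg_of_le (fun l => by positivity) (fun l => by gcongr) hf
  have hf1 : Summable fun l => ‖f l‖ := by simpa using hfs 1 zero_le_one hρ1.le
  have hne1 : ∀ z : ℂ, ‖z‖ = ρ1 → ser f z ≠ 0 := fun z hz => hne z (by linarith) hz.le
  obtain ⟨m1, hm1, hb1⟩ := exists_lower_bound hρ10 hf hne1
  obtain ⟨m2, hm2, hb2⟩ := exists_lower_bound hρ20 (hfs ρ2 hρ20.le (by linarith))
    fun z hz => hne z hz.ge (by linarith)
  set d : ℤ → ℂ := lau f ρ1 with hd
  have hd2 : d = lau f ρ2 := funext fun k => lau_eq_of_annulus hρ20 (by linarith) hf hne k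
  -- the Laurent coefficients decay in both directions
  set B : ℝ := m1⁻¹ + m2⁻¹ with hB
  have hB0 : 0 < B := by positivity
  have hrow := tsum_two_sided (D := B) (inv_nonneg.2 hρ10.le) (inv_lt_one_of_one_lt₀ hρ1) hρ20.le hρ2
    (fun i => ‖d i‖) (fun i => norm_nonneg _) (fun i => (norm_lau_le hρ10 hm1 hb1 i).trans (by
      rw [zpow_neg, zpow_natCast, inv_pow]
      gcongr; exact le_add_of_nonneg_right (by positivity))) fun i => by
      rw [hd2]
      refine (norm_lau_le hρ20 hm2 hb2 (-i)).trans ?_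
      rw [neg_neg, zpow_natCast]
      gcongr; exact le_add_of_nonneg_left (by positivity)
  set DQ : ℝ := B * (1 - ρ1⁻¹)⁻¹ + B * (1 - ρ2)⁻¹
  have hDQ0 : 0 < DQ := by
    have := inv_lt_one_of_one_lt₀ hρ1
    have h1 : 0 < 1 - ρ1⁻¹ := by linarith
    have h2 : 0 < 1 - ρ2 := by linarith
    positivity
  refine ⟨(3 * DQ)⁻¹, by positivity, fun Y _ E g hE hEg hg hgη => ?_⟩
  obtain ⟨Q, hQn, hQ⟩ := exists_kernelOp (Y := Y) (fun _ k j => d ((j : ℤ) - k)) (fun _ j => j)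
    (fun k j => continuous_const) (fun k j => ‖d ((j : ℤ) - k)‖) (fun y k j => le_rfl) hDQ0.le
    (fun k => (hrow k).1) fun k => (hrow k).2
  obtain ⟨Δ, hΔn, hΔ⟩ := exists_kernelOp E (fun k j => k + 1 + j) hE (fun _ => g) hEg
    (by positivity) (fun _ => hg) fun _ => hgη
  set P := Q.comp Δ
  have hPn : ‖P‖ ≤ 1 / 3 := by
    refine (ContinuousLinearMap.opNorm_comp_le _ _).trans ?_
    calc ‖Q‖ * ‖Δ‖ ≤ DQ * (3 * DQ)⁻¹ := by gcongr
      _ = 1 / 3 := by field_simp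
  let V : Y × ℕ →ᵇ ℂ := BoundedContinuousFunction.ofNormedAddCommGroup (fun p : Y × ℕ => w ^ p.2)
    ((continuous_of_discreteTopology (f := fun k : ℕ => w ^ k)).comp continuous_snd) 1 fun p => by
      rw [norm_pow]
      exact pow_le_one₀ (norm_nonneg _) hw
  have hVn : ‖V‖ ≤ 1 := BoundedContinuousFunction.norm_ofNormedAddCommGroup_le _ zero_le_one _
  let U := Units.oneSub P (hPn.trans_lt (by norm_num))
  set x : Y × ℕ →ᵇ ℂ := (↑(U⁻¹) : (Y × ℕ →ᵇ ℂ) →L[ℂ] (Y × ℕ →ᵇ ℂ)) V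
  have hfix : x = V + Q (Δ x) := sub_eq_iff_eq_add.1
    (congrArg (fun T : (Y × ℕ →ᵇ ℂ) →L[ℂ] (Y × ℕ →ᵇ ℂ) => T V) U.mul_inv : x - Q (Δ x) = V)
  have hPx : ‖Q (Δ x)‖ ≤ 1 / 3 * ‖x‖ := P.le_of_opNorm_le hPn x
  have hxn : ‖x‖ ≤ 3 / 2 := by
    have h1 : ‖x‖ ≤ ‖V‖ + ‖Q (Δ x)‖ := by
      conv_lhs => rw [hfix]
      exact norm_add_le _ _
    linarith
  have hxv : ∀ y k, x (y, k) = w ^ k + Q (Δ x) (y, k) := fun y k =>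
    congrArg (fun u : Y × ℕ →ᵇ ℂ => u (y, k)) hfix
  refine ⟨x, hxn, fun y k => ?_, fun y k => ?_⟩
  · rw [hxv, add_sub_cancel_left]
    exact ((Q (Δ x)).norm_coe_le_norm _).trans (by linarith)
  · rw [← hΔ]
    have hle : ∀ k j : ℕ, ‖d ((j : ℤ) - k) * Δ x (y, j)‖ ≤ ‖d ((j : ℤ) - k)‖ * ‖Δ x‖ := fun k j => by
      rw [norm_mul]
      gcongr; exact (Δ x).norm_coe_le_norm _
    have hs := fun k => Summable.of_nonneg_of_le (fun j => norm_nonneg _) (hle k)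
      ((hrow k).1.mul_right ‖Δ x‖)
    have h2 := hasSum_conv hf1 (hasSum_lau hρ10 hf hne1) (fun j => Δ x (y, j)) hs (fun k =>
      ((hs k).tsum_le_tsum (hle k) ((hrow k).1.mul_right ‖Δ x‖)).trans (c := DQ * ‖Δ x‖) (by
        rw [tsum_mul_right]; gcongr; exact (hrow k).2)) k
    have h1 := (summable_ser hf (z := w) (by linarith)).hasSum.mul_left (w ^ k)
    rw [show ∑' l, f l * w ^ l = 0 from hfw, mul_zero] at h1
    rw [← zero_add (Δ x (y, k))]
    refine (h1.add h2).congr_fun fun l => ?_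
    rw [hxv, hQ, pow_add]; ring

/-- If the characteristic function of a renewal equation has a zero `w` in the unit disc, then the
dual of a small perturbation of the equation has a solution that decays geometrically, close to
`w ^ k`; it depends continuously on the perturbation. -/
lemma exists_dual_sequence {coef : ℕ → ℝ} {M θ : ℝ} (hθ0 : 0 ≤ θ) (hθ1 : θ < 1)
    (hc : ∀ j, |coef j| ≤ M * θ ^ j) {w : ℂ} (hw : ‖w‖ < 1) (hfw : ser (charCoef coef) w = 0) :
    ∃ ρ A η : ℝ, 0 < ρ ∧ ρ < 1 ∧ 0 < η ∧ ∀ (Y : Type v) [TopologicalSpace Y] (D : Y → ℕ → ℕ → ℝ),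
      (∀ k j, Continuous fun y => D y k j) → (∀ y k j, |D y k j - coef j| ≤ η) →
      ∃ s : Y → ℕ → ℝ, (∀ k, Continuous fun y => s y k) ∧ (∀ y k, |s y k| ≤ A * ρ ^ k) ∧
        (∀ y, 1 / 2 ≤ s y 0) ∧ ∀ y k, HasSum (fun j => s y (k + 1 + j) * D y k j) (s y k) := by
  set f := charCoef coef with hf
  have hf1 : Summable fun l => ‖f l‖ * 1 ^ l :=
    summable_charCoef hθ0 hc zero_le_one (by rwa [one_mul])
  obtain ⟨ρ2, ρ1, hwρ, hρ21, hρ1, hne⟩ := exists_annulus_ne_zero hf1 (by simp [hf, charCoef])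
    (norm_nonneg w) hw
  obtain ⟨ρ, hρ2, hρ1'⟩ := exists_between hρ21
  have hρ20 : 0 < ρ2 := (norm_nonneg w).trans_lt hwρ
  have hρ0 : 0 < ρ := hρ20.trans hρ2
  have hρ10 : 0 < ρ1 := hρ0.trans hρ1'
  have hρlt : ρ < 1 := hρ1'.trans hρ1
  have hρC : (ρ : ℂ) ≠ 0 := by exact_mod_cast hρ0.ne'
  have hnρ : ‖(ρ : ℂ)‖ = ρ := by rw [Complex.norm_real, Real.norm_of_nonneg hρ0.le]
  -- the equation for the sequences with the weight `ρ ^ k`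
  have hser : ∀ z, ser (fun l => f l * ρ ^ l) z = ser f (ρ * z) := fun z =>
    tsum_congr fun l => by rw [mul_pow]; ring
  have hnz : ∀ z : ℂ, ‖(ρ : ℂ) * z‖ = ‖z‖ * ρ := fun z => by rw [norm_mul, hnρ, mul_comm]
  obtain ⟨η, hη, H⟩ := exists_dual_solution.{v} (f := fun l => f l * ρ ^ l) (ρ1 := ρ1 / ρ)
    (ρ2 := ρ2 / ρ) (w := w / ρ) (by positivity) ((div_lt_one hρ0).2 hρ2) ((one_lt_div hρ0).2 hρ1')
    (Summable.of_nonneg_of_le (fun l => by positivity) (fun l => by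
      rw [norm_mul, norm_pow, hnρ, mul_assoc, ← mul_pow, mul_div_cancel₀ _ hρ0.ne']
      gcongr) hf1)
    (fun z h1 h2 => by
      rw [hser]
      exact hne _ (by rwa [hnz, ← div_le_iff₀ hρ0]) (by rwa [hnz, ← le_div_iff₀ hρ0]))
    (by rw [norm_div, hnρ, div_le_one hρ0]; linarith) (by rw [hser, mul_div_cancel₀ _ hρC, hfw])
  refine ⟨ρ, 3 / 2, η * (1 - ρ), hρ0, hρlt, mul_pos hη (by linarith), fun Y _ D hD hDη => ?_⟩
  set E : Y → ℕ → ℕ → ℂ := fun y k j => ((D y k j - coef j : ℝ) : ℂ) * ρ ^ (j + 1) with hE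
  have hg := (summable_geometric_of_lt_one hρ0.le hρlt).mul_left (η * (1 - ρ))
  have hEg : ∀ y k j, ‖E y k j‖ ≤ η * (1 - ρ) * ρ ^ j := fun y k j => by
    rw [norm_mul, norm_pow, hnρ, Complex.norm_real]
    exact mul_le_mul (hDη y k j) (pow_le_pow_of_le_one hρ0.le hρlt.le j.le_succ) (by positivity)
      (by nlinarith)
  obtain ⟨x, hxn, hx0, hx⟩ := H Y E _ (fun k j => by have := hD k j; fun_prop) hEg hg (by
    rw [tsum_mul_left, tsum_geometric_of_lt_one hρ0.le hρlt, mul_assoc,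
      mul_inv_cancel₀ (by linarith), mul_one])
  refine ⟨fun y k => ((ρ : ℂ) ^ k * x (y, k)).re, fun k => by fun_prop, fun y k => ?_, fun y => ?_,
    fun y k => ?_⟩
  · refine (Complex.abs_re_le_norm _).trans ?_
    rw [norm_mul, norm_pow, hnρ, mul_comm]
    gcongr
    exact (x.norm_coe_le_norm _).trans hxn
  · have h1 := (abs_le.1 ((Complex.abs_re_le_norm _).trans (hx0 y 0))).1
    simp only [pow_zero, Complex.sub_re, Complex.one_re, one_mul] at h1 ⊢
    linarith
  · have h1 : Summable fun j => E y k j * x (y, k + 1 + j) :=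
      Summable.of_norm_bounded (hg.mul_right (3 / 2)) fun j => by
        rw [norm_mul]
        exact mul_le_mul (hEg y k j) ((x.norm_coe_le_norm _).trans hxn) (norm_nonneg _)
          ((norm_nonneg _).trans (hEg y k j))
    have h2 := (h1.hasSum.sub ((hasSum_nat_add_iff' 1).2 (hx y k))).mul_left ((ρ : ℂ) ^ k)
    rw [sub_sub_cancel, Finset.sum_range_one, pow_zero, mul_one, add_zero, hf, charCoef, one_mul] at h2
    refine (Complex.reCLM.hasSum h2).congr_fun fun j => (Complex.re_mul_ofReal _ _).symm.trans ?_
    change _ = Complex.re _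
    rw [charCoef, show k + (j + 1) = k + 1 + j by ring]
    congr 1
    push_cast [hE]; ring

end DualSequence

/-! ### Families of orbits and their tangents -/

section ParamComp

variable {E E' E'' P : Type*} [NormedAddCommGroup E] [NormedSpace ℝ E] [NormedAddCommGroup E']
  [NormedSpace ℝ E'] [NormedAddCommGroup E''] [NormedSpace ℝ E''] [TopologicalSpace P]

/-- The functionals on `E'` can be approximated by functionals that are bounded for the weaker
norm of `E''`. -/
def DualApprox (ι : E' →L[ℝ] E'') : Prop :=
  ∀ (F : E' →L[ℝ] ℝ) (ε : ℝ), 0 < ε → ∃ F' : E'' →L[ℝ] ℝ, ‖F - F'.comp ι‖ ≤ ε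

lemma DualApprox.exists_norm_le {ι : E' →L[ℝ] E''} (hι : DualApprox ι) (F : E' →L[ℝ] ℝ) {ε : ℝ}
    (hε : 0 < ε) : ∃ C, (∀ x, ‖F x‖ ≤ ε * ‖x‖ + C * ‖ι x‖) ∧
      ∀ A : E →L[ℝ] E', ‖F.comp A‖ ≤ ε * ‖A‖ + C * ‖ι.comp A‖ := by
  obtain ⟨F', hF'⟩ := hι F ε hε
  refine ⟨‖F'‖, fun x => ?_, fun A => ?_⟩
  · rw [show F x = (F - F'.comp ι) x + F' (ι x) by simp]
    exact norm_add_le_of_le ((F - F'.comp ι).le_of_opNorm_le hF' x) (F'.le_opNorm _)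
  · rw [show F.comp A = (F - F'.comp ι).comp A + F'.comp (ι.comp A) by ext; simp]
    exact norm_add_le_of_le (((F - F'.comp ι).opNorm_comp_le A).trans (by gcongr))
      (F'.opNorm_comp_le _)

lemma isLittleO_of_norm_le {P V W W' : Type*} [Norm V] [NormedAddCommGroup W]
    [NormedAddCommGroup W'] {T : W → V} {ι : W → W'}
    (hT : ∀ ε : ℝ, 0 < ε → ∃ C, ∀ x, ‖T x‖ ≤ ε * ‖x‖ + C * ‖ι x‖) {l : Filter P} {x : P → W}
    {g : P → ℝ} (h : x =O[l] g) (h' : (fun p => ι (x p)) =o[l] g) : (fun p => T (x p)) =o[l] g := by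
  obtain ⟨K, hK, hx⟩ := h.exists_pos
  refine Asymptotics.isLittleO_iff.2 fun ε hε => ?_
  obtain ⟨C, hC⟩ := hT (ε / (2 * K)) (by positivity)
  filter_upwards [hx.bound, (h'.norm_left.const_mul_left C).bound (half_pos hε)] with p h1 h2
  calc _ ≤ ε / (2 * K) * (K * ‖g p‖) + ε / 2 * ‖g p‖ :=
      (hC _).trans (add_le_add (by gcongr) ((le_abs_self _).trans h2))
    _ = _ := by field_simp; ring

/-- A functional composed with operators that are continuous for a weak norm of the target is norm
continuous. -/
lemma DualApprox.continuousOn_comp {ι : E' →L[ℝ] E''} (hι : DualApprox ι) {s : Set P}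
    {A : P → E →L[ℝ] E'} {K : ℝ} (hA : ∀ p ∈ s, ‖A p‖ ≤ K)
    (hA' : ContinuousOn (fun p => ι.comp (A p)) s) {F : P → E' →L[ℝ] ℝ} (hF : ContinuousOn F s) :
    ContinuousOn (fun p => (F p).comp (A p)) s := by
  intro p hp
  have h1 := isLittleO_of_norm_le (T := (F p).comp) (ι := ι.comp)
    (fun ε hε => (hι.exists_norm_le (F p) hε).imp fun C h => h.2)
    (l := 𝓝[s] p) (x := fun q => A q - A p) (g := fun _ => 1)
    (.of_bound (K + K) (eventually_nhdsWithin_of_forall fun q hq => by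
      rw [norm_one, mul_one]; exact norm_sub_le_of_le (hA q hq) (hA p hp)))
    ((Asymptotics.isLittleO_one_iff ℝ).2 (by
      have := (hA' p hp).sub_const (ι.comp (A p))
      rw [sub_self] at this
      exact this.congr fun q => (ι.comp_sub (A q) (A p)).symm))
  have h2 : Tendsto (fun q => (F q - F p).comp (A q)) (𝓝[s] p) (𝓝 0) := by
    have := (tendsto_iff_norm_sub_tendsto_zero.1 (hF p hp)).mul_const K
    rw [zero_mul] at this
    refine squeeze_zero_norm' (eventually_nhdsWithin_of_forall fun q hq => ?_) this
    exact ((F q - F p).opNorm_comp_le _).trans (by gcongr; exact hA q hq)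
  have := (((Asymptotics.isLittleO_one_iff ℝ).1 h1).add h2).add_const ((F p).comp (A p))
  rw [add_zero, zero_add] at this
  refine this.congr fun q => DFunLike.ext _ _ fun x => ?_
  change F p (A q x - A p x) + (F q (A q x) - F p (A q x)) + F p (A p x) = F q (A q x)
  rw [map_sub]; ring

lemma continuousOn_comp_param {ι : E' →L[ℝ] E''} (hι : DualApprox ι) {T : ℝ → E →L[ℝ] E'}
    {R : Set ℝ} {C : ℝ} (hC : 0 < C) (hb : ∀ c ∈ R, ∀ x, ‖T c x‖ ≤ C * ‖x‖)
    (hl : ∀ c ∈ R, ∀ c' ∈ R, ∀ x, ‖ι (T c x) - ι (T c' x)‖ ≤ C * |c - c'| * ‖x‖) {s : Set P}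
    {F : P → E' →L[ℝ] ℝ} (hF : ContinuousOn F s) {c : P → ℝ} (hc : ContinuousOn c s)
    (hcR : MapsTo c s R) : ContinuousOn (fun p => (F p).comp (T (c p))) s := by
  refine hι.continuousOn_comp
    (fun p hp => ContinuousLinearMap.opNorm_le_bound _ hC.le (hb _ (hcR hp))) ?_ hF
  have : LipschitzOnWith ⟨C, hC.le⟩ (fun c => ι.comp (T c)) R :=
    LipschitzOnWith.of_dist_le_mul fun c hc c' hc' => by
      rw [dist_eq_norm]
      exact ContinuousLinearMap.opNorm_le_bound _ (by positivity) (hl c hc c' hc')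
  exact this.continuousOn.comp hc hcR

/-- Joint continuity of `T c x` at points where it is Lipschitz in `c`. -/
lemma continuousOn_apply_of_lip {V W : Type*} [SeminormedAddCommGroup V] [SeminormedAddCommGroup W]
    {T : ℝ → W → V} {R : Set ℝ} {C : ℝ} (hb : ∀ c ∈ R, ∀ x y, ‖T c x - T c y‖ ≤ C * ‖x - y‖)
    {s : Set P} {A : P → W} (hA : ContinuousOn A s) {c : P → ℝ} (hc : ContinuousOn c s)
    (hcR : MapsTo c s R) {D : P → ℝ}
    (hl : ∀ p ∈ s, ∀ c ∈ R, ∀ c' ∈ R, ‖T c (A p) - T c' (A p)‖ ≤ C * |c - c'| * D p) :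
    ContinuousOn (fun p => T (c p) (A p)) s := by
  intro p hp
  refine tendsto_iff_norm_sub_tendsto_zero.2 (squeeze_zero' (.of_forall fun _ => norm_nonneg _)
    (g := fun q => C * ‖A q - A p‖ + C * |c q - c p| * D p)
    (eventually_nhdsWithin_of_forall fun q hq => ?_) ?_)
  · rw [← sub_add_sub_cancel _ (T (c q) (A p))]
    exact norm_add_le_of_le (hb _ (hcR hq) _ _) (hl p hp _ (hcR hq) _ (hcR hp))
  · simpa using ((tendsto_iff_norm_sub_tendsto_zero.1 (hA p hp)).const_mul C).add
      (((tendsto_iff_norm_sub_tendsto_zero.1 (hc p hp)).const_mul C).mul_const (D p))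

lemma continuousOn_comp_iter {ι : E' →L[ℝ] E''} (hι : DualApprox ι) {T : ℝ → E' →L[ℝ] E'}
    {R : Set ℝ} {C : ℝ} (hC : 0 < C) (hb : ∀ c ∈ R, ∀ x, ‖T c x‖ ≤ C * ‖x‖)
    (hl : ∀ c ∈ R, ∀ c' ∈ R, ∀ x, ‖ι (T c x) - ι (T c' x)‖ ≤ C * |c - c'| * ‖x‖) {s : Set P}
    {c : P → ℕ → ℝ} (hc : ∀ n, ContinuousOn (fun p => c p n) s) (hcR : ∀ p ∈ s, ∀ n, c p n ∈ R)
    (n : ℕ) : ∀ {F : P → E' →L[ℝ] ℝ}, ContinuousOn F s →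
      ContinuousOn (fun p => (F p).comp (iter T (c p) n)) s := by
  induction n with
  | zero => exact fun hF => hF
  | succ n ih =>
    intro F hF
    exact ih (continuousOn_comp_param hι hC hb hl hF (hc n) fun p hp => hcR p hp n)

end ParamComp

namespace Core

/-- An open family of orbits, parametrized affinely by the initial element `β + e y`, `y ∈ U`, and
attracted by `h` uniformly for the norm of `E2`. The initial elements can be moved in all zero
average directions: this is `dense`. -/
structure Family (G : Core E0 E1 E2 E3) (h : E3) (Y : Type*) [NormedAddCommGroup Y]
    [NormedSpace ℝ Y] where
  e : Y →L[ℝ] E3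
  β : E3
  U : Set Y
  isOpen : IsOpen U
  nonempty : U.Nonempty
  M : ℝ
  orbit : ∀ y ∈ U, G.IsOrbit (G.orb (β + e y))
  norm_le : ∀ y ∈ U, ∀ n, ‖G.orb (β + e y) n‖ ≤ M
  I_e : ∀ y, G.I3 (e y) = 0
  dense : ∀ F : E2 →L[ℝ] ℝ, (∀ y, F (G.i3 (e y)) = 0) → ∃ q : ℝ, F = q • G.I2
  attract : ∀ ε > 0, ∃ N, ∀ n ≥ N, ∀ y ∈ U, ‖G.i3 (G.orb (β + e y) n - h)‖ ≤ ε

namespace Family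

variable {Y : Type v} [NormedAddCommGroup Y] [NormedSpace ℝ Y] (Φ : G.Family h Y)

/-- The orbit with parameter `y`. -/
noncomputable def b (y : Y) (n : ℕ) : E3 := G.orb (Φ.β + Φ.e y) n

/-- The means `a (b n)` along the orbit with parameter `y`. -/
noncomputable def c (y : Y) (n : ℕ) : ℝ := G.a3 (Φ.b y n)

variable {Φ}

lemma c_mem {y : Y} (hy : y ∈ Φ.U) (n : ℕ) : Φ.c y n ∈ G.R := (Φ.orbit y hy).mem n

lemma b_succ (y : Y) (n : ℕ) : Φ.b y (n + 1) = G.L3 (Φ.c y n) (Φ.b y n) := G.orb_succ _ n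

lemma norm_b_le {y : Y} (hy : y ∈ Φ.U) (n : ℕ) : ‖Φ.b y n‖ ≤ Φ.M := Φ.norm_le y hy n

lemma M_nonneg : 0 ≤ Φ.M := by
  obtain ⟨y, hy⟩ := Φ.nonempty
  exact (norm_nonneg _).trans (Φ.norm_le y hy 0)

lemma I3_b {y : Y} (hy : y ∈ Φ.U) (n : ℕ) : G.I3 (Φ.b y n) = 1 := (Φ.orbit y hy).int_one n

lemma c_sub (y y' : Y) (n : ℕ) : Φ.c y' n - Φ.c y n = G.a2 (G.i3 (Φ.b y' n - Φ.b y n)) := by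
  rw [c, c, ← map_sub]; rfl

lemma b_zero_sub (y y' : Y) : Φ.b y' 0 - Φ.b y 0 = Φ.e (y' - y) := by
  change Φ.β + Φ.e y' - (Φ.β + Φ.e y) = _
  rw [map_sub]; abel

/-- The orbits depend Lipschitz continuously on the parameter, for the norm of `E2`. -/
lemma exists_lip_b (n : ℕ) : ∃ K, 0 ≤ K ∧ ∀ y ∈ Φ.U, ∀ y' ∈ Φ.U,
    ‖G.i3 (Φ.b y' n - Φ.b y n)‖ ≤ K * ‖y' - y‖ := by
  have hM := Φ.M_nonneg
  have hC := G.C_pos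
  refine ⟨(G.C * (1 + ‖G.a2‖ * Φ.M)) ^ n * ‖Φ.e‖, by positivity, fun y hy y' hy' => ?_⟩
  refine ((Φ.orbit y hy).norm_sub_le (Φ.orbit y' hy') (Φ.norm_le y hy) n).trans ?_
  rw [mul_assoc, show G.orb (Φ.β + Φ.e y') 0 - G.orb (Φ.β + Φ.e y) 0 = _ from b_zero_sub y y']
  gcongr
  exact Φ.e.le_opNorm _

lemma continuousOn_b (n : ℕ) : ContinuousOn (fun y => G.i3 (Φ.b y n)) Φ.U := by
  obtain ⟨K, hK, h⟩ := Φ.exists_lip_b n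
  refine LipschitzOnWith.continuousOn (K := ⟨K, hK⟩) (LipschitzOnWith.of_dist_le_mul
    fun y' hy' y hy => ?_)
  rw [dist_eq_norm, dist_eq_norm, ← map_sub]
  exact h y hy y' hy'

lemma continuousOn_c (n : ℕ) : ContinuousOn (fun y => Φ.c y n) Φ.U :=
  G.a2.continuous.comp_continuousOn (Φ.continuousOn_b n)

variable (Φ)

/-- The tangent map of the orbits: `tan y n v` is the derivative of `b y n` in the direction
`v`. -/
noncomputable def tan (y : Y) : ℕ → Y →L[ℝ] E2
  | 0 => G.i3.comp Φ.e
  | n + 1 => (G.L2 (Φ.c y n)).comp (tan y n) +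
      (G.a2.comp (tan y n)).smulRight (G.W3 (Φ.c y n) (Φ.b y n))

/-- The pull back of a functional along one step of the tangent dynamics. -/
noncomputable def back (y : Y) (n : ℕ) (F : E2 →L[ℝ] ℝ) : E2 →L[ℝ] ℝ :=
  F.comp (G.L2 (Φ.c y n)) + F (G.W3 (Φ.c y n) (Φ.b y n)) • G.a2

variable {Φ}

lemma tan_succ (y : Y) (n : ℕ) (v : Y) : Φ.tan y (n + 1) v = G.L2 (Φ.c y n) (Φ.tan y n v) +
    G.a2 (Φ.tan y n v) • G.W3 (Φ.c y n) (Φ.b y n) := rfl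

lemma comp_tan_succ (y : Y) (n : ℕ) (F : E2 →L[ℝ] ℝ) :
    F.comp (Φ.tan y (n + 1)) = (Φ.back y n F).comp (Φ.tan y n) := by
  refine DFunLike.ext _ _ fun v => ?_
  change F (Φ.tan y (n + 1) v) = F (G.L2 _ (Φ.tan y n v)) + F _ * G.a2 (Φ.tan y n v)
  rw [tan_succ, map_add, map_smul, smul_eq_mul, mul_comm]

lemma exists_norm_tan_le (n : ℕ) : ∃ K, ∀ y ∈ Φ.U, ‖Φ.tan y n‖ ≤ K := by
  have hC := G.C_pos
  induction n with
  | zero => exact ⟨‖G.i3.comp Φ.e‖, fun y _ => le_rfl⟩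
  | succ n ih =>
    obtain ⟨K, h⟩ := ih
    refine ⟨G.C * K + ‖G.a2‖ * K * (G.C * Φ.M), fun y hy => norm_add_le_of_le
      ((ContinuousLinearMap.opNorm_comp_le _ _).trans (mul_le_mul
        (ContinuousLinearMap.opNorm_le_bound _ hC.le (G.bdL2 (c_mem hy n))) (h y hy)
        (norm_nonneg _) hC.le)) ?_⟩
    rw [ContinuousLinearMap.norm_smulRight_apply]
    have := (norm_nonneg _).trans (h y hy)
    gcongr
    · exact (G.a2.opNorm_comp_le _).trans (by gcongr; exact h y hy)
    · exact (G.bdW3 _ (c_mem hy n) _).trans (by gcongr; exact norm_b_le hy n)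

lemma continuousOn_i2_tan (n : ℕ) : ContinuousOn (fun y => G.i2.comp (Φ.tan y n)) Φ.U := by
  have hC := G.C_pos
  induction n with
  | zero => exact continuousOn_const (c := G.i2.comp (G.i3.comp Φ.e))
  | succ n ih =>
    have hcR : MapsTo (fun y => Φ.c y n) Φ.U G.R := fun y hy => c_mem hy n
    have h1 : ContinuousOn (fun y => (G.L1 (Φ.c y n)).comp (G.i2.comp (Φ.tan y n))) Φ.U :=
      continuousOn_apply_of_lip (T := fun c => (G.L1 c).comp)
      (fun c hc x y => by
        rw [← ContinuousLinearMap.comp_sub]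
        refine ((G.L1 c).opNorm_comp_le _).trans ?_
        gcongr; exact ContinuousLinearMap.opNorm_le_bound _ hC.le (G.bdL1 hc))
      ih (continuousOn_c n) hcR (D := fun y => ‖Φ.tan y n‖)
      fun y hy c hc c' hc' => ContinuousLinearMap.opNorm_le_bound
        ((G.L1 c).comp (G.i2.comp (Φ.tan y n)) - (G.L1 c').comp (G.i2.comp (Φ.tan y n)))
        (by positivity) fun v => (G.lip1 c hc c' hc' _).trans
        (by rw [mul_assoc _ ‖_‖]; gcongr; exact (Φ.tan y n).le_opNorm v)
    have h2 := continuousOn_apply_of_lip (T := fun c => G.W2 c)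
      (fun c hc x y => by rw [← map_sub]; exact G.bdW2 c hc _) (continuousOn_b n) (continuousOn_c n) hcR
      fun y hy c hc c' hc' => G.lipW2 c hc c' hc' (Φ.b y n)
    refine (h1.add (isBoundedBilinearMap_smulRight.continuous.comp_continuousOn
      ((continuousOn_const (c := G.a1)).clm_comp ih |>.prodMk h2))).congr
      fun y hy => DFunLike.ext _ _ fun v => ?_
    change G.i2 (Φ.tan y (n + 1) v) = _
    rw [tan_succ, map_add, map_smul, G.commL2, G.commW3]
    rfl

/-- The tangent map is the derivative, with a quadratic remainder for the norm of `E1`. -/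
lemma exists_quad_tan (n : ℕ) : ∃ K, 0 ≤ K ∧ ∀ y ∈ Φ.U, ∀ y' ∈ Φ.U,
    ‖G.i2 (G.i3 (Φ.b y' n - Φ.b y n)) - G.i2 (Φ.tan y n (y' - y))‖ ≤ K * ‖y' - y‖ ^ 2 := by
  have hM := Φ.M_nonneg
  have hC := G.C_pos
  induction n with
  | zero =>
    refine ⟨0, le_rfl, fun y _ y' _ => le_of_eq ?_⟩
    rw [b_zero_sub, zero_mul]
    exact norm_eq_zero.2 (sub_self _)
  | succ n ih =>
    obtain ⟨K, hK, h⟩ := ih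
    obtain ⟨K2, hK2, h2⟩ := Φ.exists_lip_b n
    refine ⟨G.C * K + G.C * (‖G.a2‖ * K2) * K2 + G.C * (‖G.a2‖ * K2) ^ 2 * Φ.M +
      ‖G.a1‖ * K * (G.C * Φ.M), by positivity, fun y hy y' hy' => ?_⟩
    set τ := Φ.tan y n (y' - y) with hτ
    set δ := Φ.b y' n - Φ.b y n with hδ
    have hcR := c_mem hy n
    have hcR' := c_mem hy' n
    have hcc : |Φ.c y' n - Φ.c y n| ≤ ‖G.a2‖ * K2 * ‖y' - y‖ := by
      rw [c_sub, mul_assoc]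
      exact (G.a2.le_opNorm _).trans (by gcongr; exact h2 y hy y' hy')
    rw [show G.i2 (G.i3 (Φ.b y' (n + 1) - Φ.b y (n + 1))) - G.i2 (Φ.tan y (n + 1) (y' - y)) =
        G.L1 (Φ.c y n) (G.i2 (G.i3 δ) - G.i2 τ) +
        (G.L1 (Φ.c y' n) (G.i2 (G.i3 δ)) - G.L1 (Φ.c y n) (G.i2 (G.i3 δ))) +
        (G.L1 (Φ.c y' n) (G.i2 (G.i3 (Φ.b y n))) - G.L1 (Φ.c y n) (G.i2 (G.i3 (Φ.b y n))) -
          (Φ.c y' n - Φ.c y n) • G.W2 (Φ.c y n) (G.i3 (Φ.b y n))) +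
        G.a1 (G.i2 (G.i3 δ) - G.i2 τ) • G.W2 (Φ.c y n) (G.i3 (Φ.b y n)) by
      have h3 : ∀ x, G.a2 x = G.a1 (G.i2 x) := fun _ => rfl
      rw [tan_succ, b_succ, b_succ, c_sub, hδ, ← hτ]
      simp only [map_add, map_sub, map_smul, G.commL2, G.commL3, G.commW3, h3]
      module]
    refine (norm_add₄_le.trans (add_le_add (add_le_add (add_le_add
      ((G.bdL1 hcR _).trans (c := G.C * (K * ‖y' - y‖ ^ 2)) ?_) ((G.lip1 _ hcR' _ hcR _).trans
        (c := G.C * (‖G.a2‖ * K2 * ‖y' - y‖) * (K2 * ‖y' - y‖)) ?_))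
      ((G.diff1 _ hcR' _ hcR _).trans (c := G.C * (‖G.a2‖ * K2 * ‖y' - y‖) ^ 2 * Φ.M) ?_))
      ((norm_smul_le _ _).trans (c := (‖G.a1‖ * (K * ‖y' - y‖ ^ 2)) * (G.C * Φ.M)) ?_))).trans
      (le_of_eq (by ring))
    · gcongr; exact h y hy y' hy'
    · gcongr; exact h2 y hy y' hy'
    · gcongr; exact norm_b_le hy n
    · gcongr
      · exact (G.a1.le_opNorm _).trans (by gcongr; exact h y hy y' hy')
      · refine (G.bdW2 _ hcR _).trans ?_
        gcongr; exact (G.nle3 _).trans (norm_b_le hy n)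

/-- The derivatives of the functionals of the orbits are norm continuous in the parameter. -/
lemma continuousOn_comp_tan (hD : DualApprox G.i2) {s : Set Y} (hs : s ⊆ Φ.U)
    {F : Y → E2 →L[ℝ] ℝ} (hF : ContinuousOn F s) (n : ℕ) :
    ContinuousOn (fun y => (F y).comp (Φ.tan y n)) s :=
  have ⟨_, hK⟩ := Φ.exists_norm_tan_le n
  hD.continuousOn_comp (fun y hy => hK y (hs hy)) ((continuousOn_i2_tan n).mono hs) hF

lemma hasFDerivAt_b (hD : DualApprox G.i2) (F : E2 →L[ℝ] ℝ) (n : ℕ) {y : Y} (hy : y ∈ Φ.U) :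
    HasFDerivAt (fun y => F (G.i3 (Φ.b y n))) (F.comp (Φ.tan y n)) y := by
  obtain ⟨K2, hK2, h2⟩ := Φ.exists_lip_b n
  obtain ⟨K, hK, h⟩ := Φ.exists_quad_tan n
  have hU := Φ.isOpen.mem_nhds hy
  rw [hasFDerivAt_iff_isLittleO, ← Asymptotics.isLittleO_norm_right]
  refine (isLittleO_of_norm_le (T := F) (ι := G.i2)
    (fun ε hε => (hD.exists_norm_le (E := Y) F hε).imp fun C h => h.1)
    (x := fun q => G.i3 (Φ.b q n - Φ.b y n) - Φ.tan y n (q - y)) ?_ ?_).congr_left fun q => ?_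
  · refine .of_bound (K2 + ‖Φ.tan y n‖) (mem_of_superset hU fun q hq => ?_)
    simpa [add_mul] using norm_sub_le_of_le (h2 y hy q hq) ((Φ.tan y n).le_opNorm (q - y))
  · refine Asymptotics.IsBigO.trans_isLittleO (g := fun q => ‖q - y‖ ^ 2)
      (.of_bound K (mem_of_superset hU fun q hq => ?_)) ?_
    · simpa using h y hy q hq
    · simpa using Asymptotics.isLittleO_pow_sub_sub y one_lt_two
  · simp only [map_sub]; rfl

lemma hasFDerivAt_c (hD : DualApprox G.i2) (n : ℕ) {y : Y} (hy : y ∈ Φ.U) :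
    HasFDerivAt (fun y => Φ.c y n) (G.a2.comp (Φ.tan y n)) y :=
  hasFDerivAt_b hD G.a2 n hy

end Family

end Core

variable {Y : Type v} [NormedAddCommGroup Y] [NormedSpace ℝ Y] {Φ : G.Family h Y}

/-! ### The degenerate relation along attracted orbits -/

/-- The sequences of `exists_dual_sequence`, for kernels that are close to the unperturbed one from
the index `N` on only: below `N` the equation is solved backwards. -/
lemma exists_dual_sequence_from {coef : ℕ → ℝ} {M θ : ℝ} (hθ0 : 0 ≤ θ) (hθ1 : θ < 1)
    (hc : ∀ j, |coef j| ≤ M * θ ^ j) {w : ℂ} (hw : ‖w‖ < 1) (hfw : ser (charCoef coef) w = 0) :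
    ∃ ρ η : ℝ, 0 < ρ ∧ ρ < 1 ∧ 0 < η ∧ ∀ (P : Type v) [TopologicalSpace P] (B : ℝ) (N : ℕ)
      (D : P → ℕ → ℕ → ℝ), (∀ k j, Continuous fun p => D p k j) → (∀ p k j, |D p k j| ≤ B) →
      (∀ p, ∀ k ≥ N, ∀ j, |D p k j - coef j| ≤ η) →
      ∃ (A : ℝ) (s : P → ℕ → ℝ), (∀ k, Continuous fun p => s p k) ∧
        (∀ p k, |s p k| ≤ A * ρ ^ k) ∧ (∀ p, 1 / 2 ≤ s p N) ∧
        ∀ p k, HasSum (fun j => s p (k + 1 + j) * D p k j) (s p k) := by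
  obtain ⟨ρ, A, η, hρ0, hρ1, hη, H⟩ := exists_dual_sequence.{v} hθ0 hθ1 hc hw hfw
  refine ⟨ρ, η, hρ0, hρ1, hη, fun P _ B N => ?_⟩
  induction N with
  | zero =>
    intro D hD _ hη
    obtain ⟨s, h⟩ := H P D hD fun p k j => hη p k (Nat.zero_le _) j
    exact ⟨A, s, h⟩
  | succ N ih =>
    intro D hD hB hη
    obtain ⟨A, s, hs, hA, hN, hsum⟩ := ih (fun p k j => D p (k + 1) j) (fun k j => hD (k + 1) j)
      (fun p k j => hB p (k + 1) j) fun p k hk j => hη p (k + 1) (by omega) j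
    have hg : Summable fun j : ℕ => A * ρ ^ j * B :=
      ((summable_geometric_of_lt_one hρ0.le hρ1).mul_left A).mul_right B
    have hle : ∀ p j, ‖s p j * D p 0 j‖ ≤ A * ρ ^ j * B := fun p j => by
      rw [norm_mul]
      exact mul_le_mul (hA p j) (hB p 0 j) (norm_nonneg _) ((abs_nonneg _).trans (hA p j))
    have hB0 : 0 ≤ |∑' j : ℕ, A * ρ ^ j * B| := abs_nonneg _
    refine ⟨|A| / ρ + |∑' j : ℕ, A * ρ ^ j * B|, fun p k => Nat.casesOn k (∑' j, s p j * D p 0 j) (s p),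
      fun k => ?_, fun p k => ?_, fun p => hN p, fun p k => ?_⟩
    · cases k with
      | zero => exact continuous_tsum (fun j => (hs j).mul (hD 0 j)) hg fun j p => hle p j
      | succ k => exact hs k
    · cases k with
      | zero =>
        rw [pow_zero, mul_one]
        exact (tsum_of_norm_bounded hg.hasSum (hle p)).trans ((le_abs_self _).trans
          (le_add_of_nonneg_left (by positivity)))
      | succ k =>
        calc _ ≤ A * ρ ^ k := hA p k
          _ ≤ |A| * ρ ^ k := by gcongr; exact le_abs_self A
          _ = |A| / ρ * ρ ^ (k + 1) := by field_simp; ring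
          _ ≤ _ := by gcongr; exact le_add_of_nonneg_right hB0
    · cases k with
      | zero =>
        refine (Summable.of_norm_bounded hg (hle p)).hasSum.congr_fun fun j => ?_
        rw [show 0 + 1 + j = j + 1 by ring]
      | succ k =>
        refine (hsum p k).congr_fun fun j => ?_
        rw [show k + 1 + 1 + j = (k + 1 + j) + 1 by ring]

namespace Core

variable (G)

/-- The functional `∑ n, s n • a (L (c (n - 1)) ⋯ L (c 0) ·)`. -/
noncomputable def serFun (s c : ℕ → ℝ) : E1 →L[ℝ] ℝ := ∑' n, s n • G.a1.comp (iter G.L1 c n)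

variable {G}

lemma norm_a_iter_le {c : ℕ → ℝ} (hc : ∀ n, c n ∈ G.R) (n : ℕ) :
    ‖G.a1.comp (iter G.L1 c n)‖ ≤ ‖G.a1‖ * G.C := by
  have := G.C_pos
  refine (ContinuousLinearMap.opNorm_comp_le _ _).trans ?_
  gcongr
  exact ContinuousLinearMap.opNorm_le_bound _ this.le (G.bd1 c hc n)

lemma norm_serTerm_le {s c : ℕ → ℝ} (hc : ∀ n, c n ∈ G.R) {A ρ : ℝ}
    (hs : ∀ n, |s n| ≤ A * ρ ^ n) (n : ℕ) :
    ‖s n • G.a1.comp (iter G.L1 c n)‖ ≤ A * ρ ^ n * (‖G.a1‖ * G.C) := by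
  rw [norm_smul]
  exact mul_le_mul (hs n) (norm_a_iter_le hc n) (norm_nonneg _) ((abs_nonneg _).trans (hs n))

lemma summable_bound {A ρ : ℝ} (hρ0 : 0 ≤ ρ) (hρ1 : ρ < 1) :
    Summable fun n : ℕ => A * ρ ^ n * (‖G.a1‖ * G.C) :=
  ((summable_geometric_of_lt_one hρ0 hρ1).mul_left _).mul_right _

lemma summable_serFun {s c : ℕ → ℝ} (hc : ∀ n, c n ∈ G.R) {A ρ : ℝ} (hρ0 : 0 ≤ ρ) (hρ1 : ρ < 1)
    (hs : ∀ n, |s n| ≤ A * ρ ^ n) : Summable fun n => s n • G.a1.comp (iter G.L1 c n) :=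
  Summable.of_norm_bounded (summable_bound hρ0 hρ1) (norm_serTerm_le hc hs)

lemma hasSum_serFun {s c : ℕ → ℝ} (hc : ∀ n, c n ∈ G.R) {A ρ : ℝ} (hρ0 : 0 ≤ ρ) (hρ1 : ρ < 1)
    (hs : ∀ n, |s n| ≤ A * ρ ^ n) (x : E1) :
    HasSum (fun n => s n * G.a1 (iter G.L1 c n x)) (G.serFun s c x) := by
  simpa [serFun] using (ContinuousLinearMap.apply ℝ ℝ x).hasSum (summable_serFun hc hρ0 hρ1 hs).hasSum

lemma serFun_eq {s c : ℕ → ℝ} (hc : ∀ n, c n ∈ G.R) {A ρ : ℝ} (hρ0 : 0 ≤ ρ) (hρ1 : ρ < 1)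
    (hs : ∀ n, |s n| ≤ A * ρ ^ n) (x : E1) :
    G.serFun s c x = s 0 * G.a1 x +
      G.serFun (fun n => s (n + 1)) (fun n => c (n + 1)) (G.L1 (c 0) x) := by
  have h := hasSum_serFun hc hρ0 hρ1 hs x
  have h' := hasSum_serFun (s := fun n => s (n + 1)) (c := fun n => c (n + 1)) (A := A * ρ)
    (fun n => hc (n + 1)) hρ0 hρ1 (fun n => (hs (n + 1)).trans (le_of_eq (by ring)))
    (G.L1 (c 0) x)
  rw [← h.tsum_eq, h.summable.tsum_eq_zero_add, ← h'.tsum_eq]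
  simp_rw [iter_succ_left]
  rfl

lemma abs_serFun_le {s c : ℕ → ℝ} (hc : ∀ n, c n ∈ G.R) {A ρ : ℝ} (hρ0 : 0 ≤ ρ) (hρ1 : ρ < 1)
    (hs : ∀ n, |s n| ≤ A * ρ ^ n) (x : E1) :
    |G.serFun s c x| ≤ A * (1 - ρ)⁻¹ * (‖G.a1‖ * G.C) * ‖x‖ := by
  have h := tsum_of_norm_bounded (summable_bound (G := G) (A := A) hρ0 hρ1).hasSum
    (norm_serTerm_le hc hs)
  rw [tsum_mul_right, tsum_mul_left, tsum_geometric_of_lt_one hρ0 hρ1] at h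
  exact ((G.serFun s c).le_opNorm x).trans (mul_le_mul_of_nonneg_right h (norm_nonneg _))

/-- The series are norm continuous functions of parameters. -/
lemma continuousOn_serFun (hD : DualApprox G.i1) {P : Type*} [TopologicalSpace P] {u : Set P}
    {s c : P → ℕ → ℝ} (hc : ∀ p ∈ u, ∀ n, c p n ∈ G.R) {A ρ : ℝ} (hρ0 : 0 ≤ ρ) (hρ1 : ρ < 1)
    (hs : ∀ p ∈ u, ∀ n, |s p n| ≤ A * ρ ^ n) (hcs : ∀ n, ContinuousOn (fun p => s p n) u)
    (hcc : ∀ n, ContinuousOn (fun p => c p n) u) :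
    ContinuousOn (fun p => G.serFun (s p) (c p)) u := by
  refine continuousOn_tsum (fun n => (hcs n).smul ?_) (summable_bound (G := G) (A := A) hρ0 hρ1)
    fun n p hp => norm_serTerm_le (hc p hp) (hs p hp) n
  refine continuousOn_comp_iter hD G.C_pos (fun c hc => G.bdL1 hc) (fun c hc c' hc' x => ?_) hcc hc n
    continuousOn_const
  rw [G.commL1, G.commL1]
  exact G.lip0 c hc c' hc' x

open Classical in
/-- The divided difference of `c ↦ L c` on `E2`, with values in `E1`. -/
noncomputable def quot (G : Core E0 E1 E2 E3) (c c' : ℝ) : E2 →L[ℝ] E1 :=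
  if c = c' then G.W2 c else (c' - c)⁻¹ • ((G.L1 c').comp G.i2 - (G.L1 c).comp G.i2)

lemma quot_self (c : ℝ) : G.quot c c = G.W2 c := if_pos rfl

lemma smul_quot (c c' : ℝ) (x : E2) :
    (c' - c) • G.quot c c' x = G.L1 c' (G.i2 x) - G.L1 c (G.i2 x) := by
  by_cases h : c = c'
  · subst h; simp
  · rw [quot, if_neg h]
    change (c' - c) • (c' - c)⁻¹ • (G.L1 c' (G.i2 x) - G.L1 c (G.i2 x)) = _
    rw [smul_smul, mul_inv_cancel₀ (sub_ne_zero.2 (Ne.symm h)), one_smul]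

lemma norm_quot_le {c c' : ℝ} (hc : c ∈ G.R) (hc' : c' ∈ G.R) (x : E2) :
    ‖G.quot c c' x‖ ≤ G.C * ‖x‖ := by
  by_cases h : c = c'
  · subst h; rw [quot_self]; exact G.bdW2 c hc x
  · have h1 := G.lip1 c' hc' c hc x
    rw [← smul_quot, norm_smul, Real.norm_eq_abs, mul_comm G.C, mul_assoc] at h1
    exact le_of_mul_le_mul_left h1 (abs_pos.2 (sub_ne_zero.2 (Ne.symm h)))

lemma norm_quot_sub_le {c c' : ℝ} (hc : c ∈ G.R) (hc' : c' ∈ G.R) (b : E3) :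
    ‖G.quot c c' (G.i3 b) - G.W2 c (G.i3 b)‖ ≤ G.C * |c' - c| * ‖b‖ := by
  by_cases h : c = c'
  · subst h; rw [quot_self]; simp
  · have h1 := G.diff1 c' hc' c hc b
    rw [← smul_quot, ← smul_sub, norm_smul, Real.norm_eq_abs,
      show G.C * |c' - c| ^ 2 * ‖b‖ = |c' - c| * (G.C * |c' - c| * ‖b‖) by ring] at h1
    exact le_of_mul_le_mul_left h1 (abs_pos.2 (sub_ne_zero.2 (Ne.symm h)))

lemma continuousOn_quot (b : E3) :
    ContinuousOn (fun p : ℝ × ℝ => G.quot p.1 p.2 (G.i3 b)) (G.R ×ˢ G.R) := by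
  rintro ⟨c, c'⟩ hp
  by_cases h : c = c'
  · subst h
    refine tendsto_iff_norm_sub_tendsto_zero.2 (squeeze_zero' (.of_forall fun _ => norm_nonneg _)
      (g := fun p => G.C * |p.2 - p.1| * ‖b‖ + G.C * |p.1 - c| * ‖b‖)
      (eventually_nhdsWithin_of_forall fun p hq => ?_) (tendsto_nhdsWithin_of_tendsto_nhds
        ((by fun_prop : Continuous _).tendsto' _ _ (by simp))))
    change ‖_ - G.quot c c _‖ ≤ _
    rw [quot_self, ← sub_add_sub_cancel _ (G.W2 p.1 (G.i3 b))]
    exact norm_add_le_of_le (norm_quot_sub_le hq.1 hq.2 b) (G.lipW2 _ hq.1 _ hp.1 b)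
  · have hL := G.continuousOn_L1 (G.i2 (G.i3 b))
    refine ContinuousWithinAt.congr_of_eventuallyEq (f := fun p : ℝ × ℝ => (p.2 - p.1)⁻¹ •
      (G.L1 p.2 (G.i2 (G.i3 b)) - G.L1 p.1 (G.i2 (G.i3 b)))) (.smul (ContinuousWithinAt.inv₀
        (by fun_prop) (sub_ne_zero.2 (Ne.symm h))) ((hL.comp continuousOn_snd (fun p hp => hp.2) _ hp).sub
        (hL.comp continuousOn_fst (fun p hp => hp.1) _ hp))) ?_ ?_
    · filter_upwards [mem_nhdsWithin_of_mem_nhds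
        ((isOpen_ne_fun continuous_fst continuous_snd).mem_nhds h)] with p hp
      rw [quot, if_neg hp]; rfl
    · rw [quot, if_neg h]; rfl

/-- Iterates with parameters close to `c0` are close to the powers of `L c0`, uniformly in the
number of iterates: the errors are contracted. -/
lemma norm_iter_sub_pow_le {c0 : ℝ} (hc0 : c0 ∈ G.R) {ε K : ℝ} (j : ℕ) :
    ∀ (c : ℕ → ℝ) (x : E2), (∀ n, c n ∈ G.R) → (∀ n, |c n - c0| ≤ ε) →
      (∀ l : ℕ, ‖(G.L2 c0 ^ l) x‖ ≤ K) →
      ‖iter G.L1 c j (G.i2 x) - (G.L1 c0 ^ j) (G.i2 x)‖ ≤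
        G.C * G.C * ε * K * ∑ i ∈ Finset.range j, G.θ ^ i := by
  have hC := G.C_pos
  induction j with
  | zero => intro c x _ _ _; simp [iter]
  | succ j ih =>
    intro c x hc hε hx
    have h1 := G.ct1 (fun n => c (n + 1)) (fun n => hc (n + 1)) j
      (G.L1 (c 0) (G.i2 x) - G.L1 c0 (G.i2 x)) (by
        change G.I1 _ = 0
        rw [map_sub, G.I1_L (hc 0), G.I1_L hc0, sub_self])
    have h3 := ih (fun n => c (n + 1)) (G.L2 c0 x) (fun n => hc (n + 1)) (fun n => hε (n + 1))
      fun l => by rw [← mul_apply_eq_comp, ← pow_succ]; exact hx (l + 1)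
    rw [map_sub, G.commL2] at *
    rw [iter_succ_left, pow_succ, ← sub_add_sub_cancel _ (iter G.L1 (fun n => c (n + 1)) j
      (G.L1 c0 (G.i2 x))), Finset.sum_range_succ, mul_add, add_comm (_ * _)]
    refine norm_add_le_of_le (h1.trans ?_) h3
    have hε0 : 0 ≤ ε := (abs_nonneg _).trans (hε 0)
    calc _ ≤ G.C * G.θ ^ j * (G.C * ε * K) := by
          have := G.θ_pos
          gcongr
          exact (G.lip1 _ (hc 0) _ hc0 x).trans (by gcongr; exacts [hε 0, hx 0])
      _ = _ := by ring

namespace Family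

/-- The kernel of the renewal equation for the differences of two orbits. -/
noncomputable def ker (Φ : G.Family h Y) (y y' : Y) (k j : ℕ) : ℝ :=
  G.a1 (iter G.L1 (fun n => Φ.c y' (k + 1 + n)) j (G.quot (Φ.c y k) (Φ.c y' k) (G.i3 (Φ.b y k))))

lemma abs_ker_le {y y' : Y} (hy : y ∈ Φ.U) (hy' : y' ∈ Φ.U) (k j : ℕ) :
    |Φ.ker y y' k j| ≤ ‖G.a1‖ * (G.C * (G.C * Φ.M)) := by
  have hC := G.C_pos
  refine (G.a1.le_opNorm _).trans ?_
  gcongr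
  refine (G.bd1 _ (fun n => c_mem hy' _) j _).trans ?_
  gcongr
  refine (norm_quot_le (c_mem hy k) (c_mem hy' k) _).trans ?_
  gcongr
  exact (G.nle3 _).trans (norm_b_le hy k)

lemma continuousOn_ker (hD : DualApprox G.i1) (k j : ℕ) :
    ContinuousOn (fun p : Y × Y => Φ.ker p.1 p.2 k j) (Φ.U ×ˢ Φ.U) := by
  have hC := G.C_pos
  have hc : ∀ n, ContinuousOn (fun p : Y × Y => Φ.c p.2 n) (Φ.U ×ˢ Φ.U) := fun n =>
    (Φ.continuousOn_c n).comp continuousOn_snd fun p hp => hp.2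
  have hF : ContinuousOn (fun p : Y × Y => G.a1.comp (iter G.L1 (fun n => Φ.c p.2 (k + 1 + n)) j))
      (Φ.U ×ˢ Φ.U) := by
    refine continuousOn_comp_iter hD hC (fun c hc => G.bdL1 hc) (fun c hc c' hc' x => ?_)
      (fun n => hc _) (fun p hp n => c_mem hp.2 _) j continuousOn_const
    rw [G.commL1, G.commL1]
    exact G.lip0 c hc c' hc' x
  refine hF.clm_apply fun p hp => ?_
  have h4 := ((G.continuousOn_quot (Φ.b p.1 k)).comp (s := Φ.U ×ˢ Φ.U)
    (f := fun q : Y × Y => (Φ.c q.1 k, Φ.c q.2 k)) (.prodMk ((Φ.continuousOn_c k).comp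
      continuousOn_fst fun p hp => hp.1) (hc k)) fun q hq => ⟨c_mem hq.1 k, c_mem hq.2 k⟩) p hp
  have h6 := (tendsto_iff_norm_sub_tendsto_zero.1 (((Φ.continuousOn_b k).comp continuousOn_fst
    fun p (hp : p ∈ Φ.U ×ˢ Φ.U) => hp.1) p hp)).const_mul G.C
  rw [mul_zero] at h6
  have h7 := (squeeze_zero_norm' (eventually_nhdsWithin_of_forall fun q (hq : q ∈ Φ.U ×ˢ Φ.U) =>
    norm_quot_le (c_mem hq.1 k) (c_mem hq.2 k) (G.i3 (Φ.b q.1 k) - G.i3 (Φ.b p.1 k))) h6).add h4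
  rw [zero_add] at h7
  exact h7.congr fun q => by simp

/-- The kernels converge to the coefficients of the renewal equation at `h`. -/
lemma exists_ker_close (hc : G.a3 h ∈ G.R) {η : ℝ} (hη : 0 < η) :
    ∃ N, ∀ y ∈ Φ.U, ∀ y' ∈ Φ.U, ∀ k ≥ N, ∀ j, |Φ.ker y y' k j - G.coef h j| ≤ η := by
  have hC := G.C_pos
  have hM := Φ.M_nonneg
  have hθ : 0 < 1 - G.θ := by have := G.θ_lt; linarith
  set w : E2 := G.W3 (G.a3 h) h with hw
  set K1 : ℝ := G.C * (2 * ‖G.a2‖) * Φ.M + G.C + G.C * ‖G.a2‖ * ‖h‖ with hK1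
  set K2 : ℝ := G.C * G.C * ‖G.a2‖ * (G.C * ‖w‖) * (1 - G.θ)⁻¹
  set ε : ℝ := η / (‖G.a1‖ * (G.C * K1 + K2) + 1) with hε
  have hS : 0 < ‖G.a1‖ * (G.C * K1 + K2) + 1 := by positivity
  have hε0 : 0 < ε := by positivity
  obtain ⟨N, hN⟩ := Φ.attract ε hε0
  refine ⟨N, fun y hy y' hy' k hk j => ?_⟩
  have hcε : ∀ y ∈ Φ.U, ∀ n ≥ N, |Φ.c y n - G.a3 h| ≤ ‖G.a2‖ * ε := fun y hy n hn => by
    rw [show Φ.c y n - G.a3 h = G.a2 (G.i3 (Φ.b y n - h)) by rw [c, ← map_sub]; rfl]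
    exact (G.a2.le_opNorm _).trans (by gcongr; exact hN n hn y hy)
  have hcR := c_mem hy k
  set q := G.quot (Φ.c y k) (Φ.c y' k) (G.i3 (Φ.b y k)) with hq
  set c' : ℕ → ℝ := fun n => Φ.c y' (k + 1 + n)
  have hcc' : ∀ n, c' n ∈ G.R := fun n => c_mem hy' _
  have b1 : ‖q - G.i2 w‖ ≤ K1 * ε := by
    rw [show q - G.i2 w = (q - G.W2 (Φ.c y k) (G.i3 (Φ.b y k))) +
        G.W2 (Φ.c y k) (G.i3 (Φ.b y k - h)) +
        (G.W2 (Φ.c y k) (G.i3 h) - G.W2 (G.a3 h) (G.i3 h)) by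
      rw [hw, G.commW3, map_sub, map_sub]; abel]
    have h1 : |Φ.c y' k - Φ.c y k| ≤ 2 * ‖G.a2‖ * ε := by
      have := hcε y hy k hk
      have := hcε y' hy' k hk
      rw [abs_le] at *
      constructor <;> linarith
    have h4 := norm_b_le hy k
    calc _ ≤ G.C * (2 * ‖G.a2‖ * ε) * Φ.M + G.C * ε + G.C * (‖G.a2‖ * ε) * ‖h‖ :=
          norm_add₃_le.trans (add_le_add (add_le_add
            ((norm_quot_sub_le hcR (c_mem hy' k) _).trans (by gcongr))
            ((G.bdW2 _ hcR _).trans (by gcongr; exact hN k hk y hy)))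
            ((G.lipW2 _ hcR _ hc h).trans (by gcongr; exact hcε y hy k hk)))
      _ = _ := by rw [hK1]; ring
  have b2 : ‖iter G.L1 c' j (G.i2 w) - (G.L1 (G.a3 h) ^ j) (G.i2 w)‖ ≤ K2 * ε := by
    refine (norm_iter_sub_pow_le hc (K := G.C * ‖w‖) j c' w hcc'
      (fun n => hcε y' hy' _ (by omega)) fun l => ?_).trans ?_
    · rw [← iter_const]; exact G.bd2 _ (fun _ => hc) l w
    · calc _ ≤ G.C * G.C * (‖G.a2‖ * ε) * (G.C * ‖w‖) * (1 - G.θ)⁻¹ := by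
            gcongr
            rw [← tsum_geometric_of_lt_one G.θ_pos.le G.θ_lt]
            exact (summable_geometric_of_lt_one G.θ_pos.le G.θ_lt).sum_le_tsum _
              fun i _ => (pow_pos G.θ_pos i).le
        _ = _ := by ring
  rw [show Φ.ker y y' k j - G.coef h j = G.a1 (iter G.L1 c' j (q - G.i2 w) +
      (iter G.L1 c' j (G.i2 w) - (G.L1 (G.a3 h) ^ j) (G.i2 w))) by
    rw [map_sub (iter G.L1 c' j), map_add, map_sub, map_sub, sub_add_sub_cancel]; rfl]
  calc _ ≤ ‖G.a1‖ * (G.C * (K1 * ε) + K2 * ε) := (G.a1.le_opNorm _).trans (by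
        gcongr
        exact norm_add_le_of_le ((G.bd1 c' hcc' j _).trans (by gcongr)) b2)
    _ ≤ (‖G.a1‖ * (G.C * K1 + K2) + 1) * ε := by linarith
    _ = η := by rw [hε]; field_simp

/-- If the characteristic function has a zero in the open unit disc, then an attracted open family
satisfies a relation: a geometrically convergent combination of the functionals
`a ∘ L (c (n - 1)) ⋯ L (c 0)` is a multiple of the integral. The coefficients come from the dual
of the renewal equation for the difference of two orbits; this difference stays bounded, hence it
is annihilated by the combination. -/
lemma exists_relation (hD : DualApprox G.i1) (hc : G.a3 h ∈ G.R) {w : ℂ} (hw : ‖w‖ < 1)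
    (hfw : ser (charCoef (G.coef h)) w = 0) (Φ : G.Family h Y) :
    ∃ (A ρ : ℝ) (N : ℕ) (s : Y → ℕ → ℝ), 0 < ρ ∧ ρ < 1 ∧
      (∀ k, ContinuousOn (fun y => s y k) Φ.U) ∧ (∀ y ∈ Φ.U, ∀ k, |s y k| ≤ A * ρ ^ k) ∧
      (∀ y ∈ Φ.U, 1 / 2 ≤ s y N) ∧
      (∀ y ∈ Φ.U, ∃ q : ℝ, (G.serFun (s y) (Φ.c y)).comp G.i2 = q • G.I2) ∧
      ∀ y ∈ Φ.U, ∀ k, G.serFun (fun n => s y (k + 1 + n)) (fun n => Φ.c y (k + 1 + n))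
        (G.i2 (G.W3 (Φ.c y k) (Φ.b y k))) = s y k := by
  obtain ⟨M, -, hM⟩ := G.abs_coef_le hc
  obtain ⟨ρ, η, hρ0, hρ1, hη, H⟩ := exists_dual_sequence_from.{v} G.θ_pos.le G.θ_lt hM hw hfw
  obtain ⟨N, hN⟩ := Φ.exists_ker_close hc hη
  obtain ⟨A, s', hs', hA', hsN', hsum'⟩ := H (Φ.U ×ˢ Φ.U : Set (Y × Y)) (‖G.a1‖ * (G.C * (G.C * Φ.M))) N
    (fun p k j => Φ.ker p.1.1 p.1.2 k j)
    (fun k j => continuousOn_iff_continuous_domRestrict.1 (Φ.continuousOn_ker hD k j))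
    (fun p k j => abs_ker_le p.2.1 p.2.2 k j) fun p k hk j => hN _ p.2.1 _ p.2.2 k hk j
  obtain ⟨s, rfl⟩ : ∃ s : Y × Y → ℕ → ℝ, s' = fun p => s p.1 :=
    ⟨Function.extend Subtype.val s' 0,
      funext fun p => (Subtype.val_injective.extend_apply s' 0 p).symm⟩
  have hs : ∀ k, ContinuousOn (fun p => s p k) (Φ.U ×ˢ Φ.U) := fun k =>
    continuousOn_iff_continuous_domRestrict.2 (hs' k)
  have hA : ∀ p ∈ Φ.U ×ˢ Φ.U, ∀ k, |s p k| ≤ A * ρ ^ k := fun p hp => hA' ⟨p, hp⟩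
  have hAk : ∀ p ∈ Φ.U ×ˢ Φ.U, ∀ k n, |s p (k + n)| ≤ A * ρ ^ k * ρ ^ n := fun p hp k n =>
    (hA p hp _).trans (le_of_eq (by rw [pow_add]; ring))
  have hcR : ∀ p ∈ Φ.U ×ˢ Φ.U, ∀ k n, Φ.c p.2 (k + n) ∈ G.R := fun p hp k n => c_mem hp.2 _
  have hker : ∀ p ∈ Φ.U ×ˢ Φ.U, ∀ k, G.serFun (fun n => s p (k + 1 + n))
      (fun n => Φ.c p.2 (k + 1 + n)) (G.quot (Φ.c p.1 k) (Φ.c p.2 k) (G.i3 (Φ.b p.1 k))) = s p k :=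
    fun p hp k => (hasSum_serFun (hcR p hp (k + 1)) hρ0.le hρ1 (hAk p hp (k + 1)) _).unique
      (hsum' ⟨p, hp⟩ k)
  -- the combination annihilates the difference of the two orbits
  have hzero : ∀ p ∈ Φ.U ×ˢ Φ.U, G.serFun (s p) (Φ.c p.2) (G.i2 (G.i3 (Φ.e (p.2 - p.1)))) = 0 := by
    intro p hp
    set δ : ℕ → E1 := fun n => G.i2 (G.i3 (Φ.b p.2 n - Φ.b p.1 n)) with hδ
    set l : ℕ → ℝ := fun k => G.serFun (fun n => s p (k + n)) (fun n => Φ.c p.2 (k + n)) (δ k) with hl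
    have hstep : ∀ k, l k = l (k + 1) := by
      intro k
      have h2 : δ (k + 1) = G.L1 (Φ.c p.2 k) (δ k) + G.a1 (δ k) •
          G.quot (Φ.c p.1 k) (Φ.c p.2 k) (G.i3 (Φ.b p.1 k)) := by
        rw [show G.a1 (δ k) = Φ.c p.2 k - Φ.c p.1 k from (Φ.c_sub _ _ _).symm, smul_quot, hδ]
        simp only [b_succ, map_sub, G.commL3, G.commL2]
        abel
      simp only [hl]
      rw [serFun_eq (hcR p hp k) hρ0.le hρ1 (hAk p hp k) (δ k), h2, map_add, map_smul, hker p hp k,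
        smul_eq_mul, add_zero, mul_comm, add_comm]
      congr 3 <;> funext n <;> congr 1 <;> omega
    have hconst : ∀ k, l 0 = l k := fun k => by
      induction k with
      | zero => rfl
      | succ k ih => rw [ih, hstep]
    have hb : ∀ k, |l k| ≤ A * ρ ^ k * (1 - ρ)⁻¹ * (‖G.a1‖ * G.C) * (2 * Φ.M) := fun k => by
      refine (abs_serFun_le (hcR p hp k) hρ0.le hρ1 (hAk p hp k) _).trans ?_
      have hA0 : 0 ≤ A * ρ ^ k := (abs_nonneg _).trans (hA p hp k)
      have hρ' : 0 < 1 - ρ := by linarith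
      have := G.C_pos
      gcongr
      rw [two_mul]
      exact (G.nle2 _).trans ((G.nle3 _).trans (norm_sub_le_of_le (norm_b_le hp.2 k) (norm_b_le hp.1 k)))
    have hlim : Tendsto (fun k => A * ρ ^ k * (1 - ρ)⁻¹ * (‖G.a1‖ * G.C) * (2 * Φ.M)) atTop (𝓝 0) := by
      simpa using ((((tendsto_pow_atTop_nhds_zero_of_lt_one hρ0.le hρ1).const_mul A).mul_const
        ((1 - ρ)⁻¹)).mul_const (‖G.a1‖ * G.C)).mul_const (2 * Φ.M)
    have h1 := abs_nonpos_iff.1 (ge_of_tendsto' hlim fun k => hconst k ▸ hb k)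
    simpa only [← b_zero_sub, hl, hδ, zero_add] using h1
  have hcontF : ContinuousOn (fun p => G.serFun (s p) (Φ.c p.2)) (Φ.U ×ˢ Φ.U) :=
    continuousOn_serFun hD (fun p hp n => c_mem hp.2 n) hρ0.le hρ1 hA hs fun n =>
      (Φ.continuousOn_c n).comp continuousOn_snd fun p hp => hp.2
  -- restriction to the diagonal
  refine ⟨A, ρ, N, fun y => s (y, y), hρ0, hρ1, fun k => (hs k).comp (by fun_prop) fun y hy =>
    ⟨hy, hy⟩, fun y hy => hA _ ⟨hy, hy⟩, fun y hy => hsN' ⟨(y, y), hy, hy⟩,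
    fun y hy => Φ.dense _ fun v => ?_, fun y hy k => ?_⟩
  · have hγ : Tendsto (fun t : ℝ => (y, y + t • v)) (𝓝[≠] 0) (𝓝 (y, y)) :=
      ((by fun_prop : Continuous fun t : ℝ => (y, y + t • v)).tendsto' 0 _ (by simp)).mono_left
        nhdsWithin_le_nhds
    have hmem := hγ.eventually ((Φ.isOpen.prod Φ.isOpen).mem_nhds ⟨hy, hy⟩)
    have h2 := (((hcontF.clm_apply (continuousOn_const (c := G.i2 (G.i3 (Φ.e v))))) (y, y) ⟨hy, hy⟩).tendsto).comp
      (tendsto_nhdsWithin_iff.2 ⟨hγ, hmem⟩)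
    refine tendsto_nhds_unique h2 (tendsto_const_nhds.congr' ?_)
    filter_upwards [hmem, self_mem_nhdsWithin] with t ht ht0
    have h3 := hzero _ ht
    simp only [add_sub_cancel_left, map_smul, smul_eq_mul] at h3
    exact ((mul_eq_zero.1 h3).resolve_left ht0).symm
  · have := hker (y, y) ⟨hy, hy⟩ k
    rwa [quot_self, ← G.commW3] at this

end Family

/-! ### Extraction of a conormal functional -/

/-- A class of functionals which is stable under the dual transfer operators, on which these are
injective. For a scale of spaces of distributions, this will be the class of the functionals that
are bounded with respect to the total variation. -/
structure IsStable (G : Core E0 E1 E2 E3) (V : Submodule ℝ (E2 →L[ℝ] ℝ)) : Prop where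
  a_mem : G.a2 ∈ V
  I_mem : G.I2 ∈ V
  comp_mem : ∀ c ∈ G.R, ∀ F ∈ V, F.comp (G.L2 c) ∈ V
  ser_mem : ∀ (s c : ℕ → ℝ) (A ρ : ℝ), (∀ n, c n ∈ G.R) → 0 < ρ → ρ < 1 →
    (∀ n, |s n| ≤ A * ρ ^ n) → (G.serFun s c).comp G.i2 ∈ V
  eq_zero : ∀ c ∈ G.R, ∀ F ∈ V, F.comp (G.L2 c) = 0 → F = 0

variable {V : Submodule ℝ (E2 →L[ℝ] ℝ)}

lemma IsStable.eq_smul_I (hV : G.IsStable V) {c : ℝ} (hc : c ∈ G.R) {F : E2 →L[ℝ] ℝ}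
    (hF : F ∈ V) {q : ℝ} (h : F.comp (G.L2 c) = q • G.I2) : F = q • G.I2 := by
  refine sub_eq_zero.1 (hV.eq_zero c hc _ (V.sub_mem hF (V.smul_mem q hV.I_mem)) ?_)
  refine DFunLike.ext _ _ fun x => ?_
  change F (G.L2 c x) - q * G.I2 (G.L2 c x) = 0
  rw [G.I2_L hc, sub_eq_zero]
  exact congrArg (fun u => u x) h

namespace Family

/-- The functional `p y I + ∑ n, σ y n • a (L (c y (m + n)) ⋯ L (c y (m + 1)) ·)`. -/
noncomputable def conormal (Φ : G.Family h Y) (m : ℕ) (σ : Y → ℕ → ℝ) (p : Y → ℝ) (y : Y) :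
    E1 →L[ℝ] ℝ :=
  p y • G.I1 + G.serFun (σ y) fun n => Φ.c y (m + 1 + n)

/-- On an open set of parameters there is, at a fixed time `m`, a functional which annihilates the
range of the linearization of `f ↦ L (a f) f` at `b m`. It is the tail of a relation, divided by its
first coefficient that does not vanish identically. -/
lemma exists_conormal (hD : DualApprox G.i1) (hV : G.IsStable V) {A ρ : ℝ} {N : ℕ}
    {s : Y → ℕ → ℝ} (hρ0 : 0 < ρ) (hρ1 : ρ < 1) (hs : ∀ k, ContinuousOn (fun y => s y k) Φ.U)
    (hA : ∀ y ∈ Φ.U, ∀ k, |s y k| ≤ A * ρ ^ k) (hN : ∀ y ∈ Φ.U, 1 / 2 ≤ s y N)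
    (hq : ∀ y ∈ Φ.U, ∃ q : ℝ, (G.serFun (s y) (Φ.c y)).comp G.i2 = q • G.I2)
    (hW : ∀ y ∈ Φ.U, ∀ k, G.serFun (fun n => s y (k + 1 + n)) (fun n => Φ.c y (k + 1 + n))
        (G.i2 (G.W3 (Φ.c y k) (Φ.b y k))) = s y k) :
    ∃ (O : Set Y) (m : ℕ) (A' : ℝ) (σ : Y → ℕ → ℝ) (p : Y → ℝ), IsOpen O ∧ O.Nonempty ∧
      O ⊆ Φ.U ∧ (∀ y ∈ O, ∀ k, |σ y k| ≤ A' * ρ ^ k) ∧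
      ContinuousOn (Φ.conormal m σ p) O ∧ ∀ y ∈ O,
        (∀ x, Φ.conormal m σ p y (G.i2 (G.L2 (Φ.c y m) x)) = G.a2 x - Φ.c y m * G.I2 x) ∧
        Φ.conormal m σ p y (G.i2 (G.W3 (Φ.c y m) (Φ.b y m))) = -1 := by
  classical
  have hex : ∃ m, ∃ y ∈ Φ.U, s y m ≠ 0 := by
    obtain ⟨y, hy⟩ := Φ.nonempty
    exact ⟨N, y, hy, by have := hN y hy; linarith⟩
  set m := Nat.find hex with hm
  obtain ⟨y0, hy0, hs0⟩ := Nat.find_spec hex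
  have hlt : ∀ k < m, ∀ y ∈ Φ.U, s y k = 0 := fun k hk y hy => by
    by_contra h0
    exact Nat.find_min hex hk ⟨y, hy, h0⟩
  have hAk : ∀ y ∈ Φ.U, ∀ k n, |s y (k + n)| ≤ A * ρ ^ k * ρ ^ n := fun y hy k n =>
    (hA y hy _).trans (le_of_eq (by rw [pow_add]; ring))
  set δ := |s y0 m| / 2 with hδ
  have hδ0 : 0 < δ := half_pos (abs_pos.2 hs0)
  set O : Set Y := Φ.U ∩ {y | δ < |s y m|} with hO
  have hOU : O ⊆ Φ.U := inter_subset_left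
  have hOo : IsOpen O :=
    (continuous_abs.comp_continuousOn (hs m)).isOpen_inter_preimage Φ.isOpen isOpen_Ioi
  have hsm : ∀ y ∈ O, s y m ≠ 0 := fun y hy => abs_pos.1 (hδ0.trans hy.2)
  -- the relation can be shifted as long as its first coefficient vanishes
  have hpeel : ∀ y ∈ Φ.U, ∀ k ≤ m, ∃ q : ℝ,
      (G.serFun (fun n => s y (k + n)) (fun n => Φ.c y (k + n))).comp G.i2 = q • G.I2 := by
    intro y hy k
    induction k with
    | zero => intro _; simpa only [zero_add] using hq y hy
    | succ k ih =>
      intro hk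
      obtain ⟨q, hq⟩ := ih (by omega)
      refine ⟨q, hV.eq_smul_I (c_mem hy k) (hV.ser_mem _ _ _ ρ (fun n => c_mem hy _) hρ0 hρ1
        (hAk y hy (k + 1))) ?_⟩
      rw [← hq]
      refine DFunLike.ext _ _ fun x => ?_
      change G.serFun _ _ (G.i2 (G.L2 (Φ.c y k) x)) = G.serFun _ _ (G.i2 x)
      rw [serFun_eq (s := fun n => s y (k + n)) (fun n => c_mem hy _) hρ0.le hρ1 (hAk y hy k),
        G.commL2]
      simp only [add_zero]
      rw [hlt k (by omega) y hy, zero_mul, zero_add]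
      congr 3
      · funext n; congr 1; omega
      · funext n; congr 1; omega
  set σ : Y → ℕ → ℝ := fun y n => -(s y m)⁻¹ * s y (m + 1 + n) with hσ
  set S : Y → E1 →L[ℝ] ℝ := fun y => G.serFun (σ y) fun n => Φ.c y (m + 1 + n) with hS
  set p : Y → ℝ := fun y => -S y (G.i2 (G.i3 (Φ.b y (m + 1)))) with hp
  have hσA : ∀ y ∈ O, ∀ k, |σ y k| ≤ δ⁻¹ * (A * ρ ^ (m + 1)) * ρ ^ k := fun y hy k => by
    have h1 := hAk y (hOU hy) (m + 1) k
    have h2 : |s y m|⁻¹ ≤ δ⁻¹ := inv_anti₀ hδ0 (le_of_lt hy.2)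
    rw [hσ, abs_mul, abs_neg, abs_inv, mul_assoc δ⁻¹]
    exact mul_le_mul h2 h1 (abs_nonneg _) (by positivity)
  have hSser : ∀ y ∈ O, ∀ x, S y x = -(s y m)⁻¹ *
      G.serFun (fun n => s y (m + 1 + n)) (fun n => Φ.c y (m + 1 + n)) x := fun y hy x => by
    refine (hasSum_serFun (fun n => c_mem (hOU hy) _) hρ0.le hρ1 (hσA y hy) x).unique ?_
    refine ((hasSum_serFun (fun n => c_mem (hOU hy) _) hρ0.le hρ1 (hAk y (hOU hy) (m + 1))
      x).mul_left _).congr_fun fun n => ?_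
    rw [← mul_assoc]
  have hScont : ContinuousOn S O := by
    refine continuousOn_serFun hD (fun y hy n => c_mem (hOU hy) _) hρ0.le hρ1 hσA (fun n => ?_)
      fun n => (Φ.continuousOn_c _).mono hOU
    exact (((hs m).mono hOU).inv₀ hsm).neg.mul ((hs _).mono hOU)
  have hpcont : ContinuousOn p O := (hScont.clm_apply
    (G.i2.continuous.comp_continuousOn ((Φ.continuousOn_b (m + 1)).mono hOU))).neg
  refine ⟨O, m, _, σ, p, hOo, ⟨y0, hy0, half_lt_self (abs_pos.2 hs0)⟩, hOU, hσA, (hpcont.smul continuousOn_const).add hScont, fun y hy => ?_⟩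
  have hyU := hOU hy
  obtain ⟨q, hq⟩ := hpeel y hyU m le_rfl
  have hL : ∀ x, S y (G.i2 (G.L2 (Φ.c y m) x)) = G.a2 x - (s y m)⁻¹ * q * G.I2 x := fun x => by
    have h1 : G.serFun (fun n => s y (m + n)) (fun n => Φ.c y (m + n)) (G.i2 x) = q * G.I2 x :=
      congrArg (fun u => u x) hq
    rw [serFun_eq (s := fun n => s y (m + n)) (fun n => c_mem hyU _) hρ0.le hρ1 (hAk y hyU m)] at h1
    simp only [add_zero] at h1
    have e1 : (fun n => s y (m + (n + 1))) = fun n => s y (m + 1 + n) := by funext n; congr 1; omega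
    have e2 : (fun n => Φ.c y (m + (n + 1))) = fun n => Φ.c y (m + 1 + n) := by
      funext n; congr 1; omega
    rw [e1, e2] at h1
    have h2 : G.a1 (G.i2 x) = G.a2 x := rfl
    rw [hSser y hy, G.commL2]
    have h3 := hsm y hy
    rw [h2] at h1
    rw [mul_assoc, ← h1, mul_add, inv_mul_cancel_left₀ h3]
    ring
  have hpy : p y = (s y m)⁻¹ * q - Φ.c y m := by
    have h1 : S y (G.i2 (G.i3 (Φ.b y (m + 1)))) = Φ.c y m - (s y m)⁻¹ * q * 1 := by
      have h2 : G.I2 (G.i3 (Φ.b y m)) = 1 := I3_b hyU m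
      rw [b_succ, G.commL3, hL, h2]
      rfl
    rw [hp]
    change -S y _ = _
    rw [h1]; ring
  refine ⟨fun x => ?_, ?_⟩
  · change p y * G.I2 (G.L2 (Φ.c y m) x) + S y _ = _
    rw [hL, hpy, G.I2_L (c_mem hyU m)]
    ring
  · change p y * G.I2 (G.W3 (Φ.c y m) (Φ.b y m)) + S y _ = _
    rw [G.I2_W (c_mem hyU m), hSser y hy, hW y hyU m, mul_zero, zero_add, neg_mul,
      inv_mul_cancel₀ (hsm y hy)]

end Family

end Core

/-! ### Families of functionals of constant rank -/

section Rank

lemma exists_dual_vectors {E ι : Type*} [AddCommGroup E] [Module ℝ E] [Fintype ι] [DecidableEq ι]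
    {F : ι → E →ₗ[ℝ] ℝ} (hF : LinearIndependent ℝ F) :
    ∃ v : ι → E, ∀ i j, F i (v j) = if i = j then 1 else 0 := by
  have htop : LinearMap.range (LinearMap.pi F) = ⊤ := by
    by_contra hne
    obtain ⟨φ, hφ, hle⟩ := Submodule.exists_le_ker_of_lt_top _ (lt_top_iff_ne_top.2 hne)
    refine hφ (LinearMap.pi_ext' fun i => LinearMap.ext_ring ?_)
    have h1 : ∑ i, φ (Pi.single i 1) • F i = 0 := by
      refine LinearMap.ext fun x => ?_
      have h2 : φ (LinearMap.pi F x) = 0 := hle (LinearMap.mem_range_self _ x)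
      rw [LinearMap.pi_apply_eq_sum_univ φ] at h2
      have e : ∀ i : ι, (fun j => if i = j then (1 : ℝ) else 0) = Pi.single i 1 := fun i => by
        funext j; simp [Pi.single_apply, eq_comm]
      simp only [e] at h2
      simpa [mul_comm] using h2
    exact Fintype.linearIndependent_iff.1 hF _ h1 i
  have hs := LinearMap.range_eq_top.1 htop
  choose v hv using fun j : ι => hs (Pi.single j 1)
  exact ⟨v, fun i j => by rw [← LinearMap.pi_apply F, hv, Pi.single_apply]⟩

lemma exists_independent_subfamily {E ι : Type*} [NormedAddCommGroup E] [NormedSpace ℝ E]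
    (f : ι → E) : ∃ s : Set ι,
    Submodule.span ℝ (range fun j : s => f j) = Submodule.span ℝ (range f) ∧
      LinearIndependent ℝ fun j : s => f j := by
  obtain ⟨κ, a, ha, hs, hi⟩ := exists_linearIndependent' ℝ f
  refine ⟨range a, ?_, ?_⟩
  · rw [← hs]
    congr 1
    ext x
    constructor
    · rintro ⟨⟨_, k, rfl⟩, rfl⟩; exact ⟨k, rfl⟩
    · rintro ⟨k, rfl⟩; exact ⟨⟨_, k, rfl⟩, rfl⟩
  · exact (linearIndependent_equiv' (Equiv.ofInjective a ha) rfl).1 hi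

variable {E E' ι P : Type*} [NormedAddCommGroup E] [NormedSpace ℝ E] [NormedAddCommGroup E']
  [NormedSpace ℝ E'] [Fintype ι] [TopologicalSpace P]

lemma eventually_linearIndependent {f : P → ι → E} {y : P} (hf : ∀ j, ContinuousAt (fun p => f p j) y)
    (h : LinearIndependent ℝ (f y)) : ∀ᶠ p in 𝓝 y, LinearIndependent ℝ (f p) :=
  (continuousAt_pi.2 hf).eventually (isOpen_setOfPred_linearIndependent.mem_nhds h)

/-- The rank of a family of vectors is lower semicontinuous. -/
lemma eventually_finrank_le {f : P → ι → E} {y : P} (hf : ∀ j, ContinuousAt (fun p => f p j) y) :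
    ∀ᶠ p in 𝓝 y, Module.finrank ℝ (Submodule.span ℝ (range (f y))) ≤
      Module.finrank ℝ (Submodule.span ℝ (range (f p))) := by
  classical
  obtain ⟨s, hs, hi⟩ := exists_independent_subfamily (f y)
  filter_upwards [eventually_linearIndependent (f := fun p (j : s) => f p j) (fun j => hf j) hi]
    with p hp
  have := FiniteDimensional.span_of_finite ℝ (finite_range (f p))
  rw [← hs, finrank_span_eq_card hi, ← finrank_span_eq_card hp]
  exact Submodule.finrank_mono (Submodule.span_mono (range_comp_subset_range (Subtype.val : s → ι) (f p)))

lemma eventually_finrank_le' {O : Set P} (hO : IsOpen O) {f : P → ι → E}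
    (hf : ∀ j, ContinuousOn (fun y => f y j) O) {y : P} (hy : y ∈ O) :
    ∀ᶠ p in 𝓝 y, Module.finrank ℝ (Submodule.span ℝ (range (f y))) ≤
      Module.finrank ℝ (Submodule.span ℝ (range (f p))) :=
  eventually_finrank_le fun j => (hf j).continuousAt (hO.mem_nhds hy)

lemma finrank_le_card (f : ι → E) :
    Module.finrank ℝ (Submodule.span ℝ (range f)) ≤ Fintype.card ι :=
  finrank_range_le_card f

lemma span_eq_of_finrank_eq {f : ι → E} {s : Set ι} (hi : LinearIndependent ℝ fun j : s => f j)
    (hc : Module.finrank ℝ (Submodule.span ℝ (range f)) = Nat.card s) :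
    Submodule.span ℝ (range fun j : s => f j) = Submodule.span ℝ (range f) := by
  classical
  have := FiniteDimensional.span_of_finite ℝ (finite_range f)
  refine Submodule.eq_of_le_of_finrank_eq
    (Submodule.span_mono (range_comp_subset_range (Subtype.val : s → ι) f)) ?_
  rw [hc, finrank_span_eq_card hi, Nat.card_eq_fintype_card]

/-- A line in the kernel of a linear map on a finite dimensional space is the whole kernel if and
only if the rank is as large as possible. -/
lemma ker_eq_line_iff {f : ι → E} (T : E →ₗ[ℝ] E') {x : E} (hx : x ≠ 0)
    (hxf : x ∈ Submodule.span ℝ (range f)) (hT : T x = 0) :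
    (∀ z ∈ Submodule.span ℝ (range f), T z = 0 → ∃ q : ℝ, z = q • x) ↔
      Module.finrank ℝ (Submodule.span ℝ (range f)) =
        Module.finrank ℝ (Submodule.span ℝ (range fun j => T (f j))) + 1 := by
  set S := Submodule.span ℝ (range f) with hS
  set T' : S →ₗ[ℝ] E' := T.comp S.subtype with hT'
  have h1 : LinearMap.range T' = Submodule.span ℝ (range fun j => T (f j)) := by
    rw [hT', LinearMap.range_comp, Submodule.range_subtype, hS, Submodule.map_span, ← range_comp]
    rfl
  have : FiniteDimensional ℝ S := FiniteDimensional.span_of_finite ℝ (finite_range f)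
  have h2 := T'.finrank_range_add_finrank_ker
  rw [h1] at h2
  have hx0 : (⟨x, hxf⟩ : S) ≠ 0 := fun h => hx (congrArg Subtype.val h)
  have hle : Submodule.span ℝ {(⟨x, hxf⟩ : S)} ≤ LinearMap.ker T' := by
    rw [Submodule.span_singleton_le_iff_mem]; exact hT
  have h3 : (∀ z ∈ S, T z = 0 → ∃ q : ℝ, z = q • x) ↔
      LinearMap.ker T' = Submodule.span ℝ {(⟨x, hxf⟩ : S)} := by
    constructor
    · intro h
      refine le_antisymm (fun z hz => ?_) hle
      obtain ⟨q, hq⟩ := h z z.2 hz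
      exact Submodule.mem_span_singleton.2 ⟨q, Subtype.ext hq.symm⟩
    · intro h z hz hTz
      have : (⟨z, hz⟩ : S) ∈ LinearMap.ker T' := hTz
      rw [h, Submodule.mem_span_singleton] at this
      obtain ⟨q, hq⟩ := this
      exact ⟨q, (congrArg Subtype.val hq).symm⟩
  rw [h3]
  have h4 := finrank_span_singleton (K := ℝ) hx0
  constructor
  · intro h
    rw [h, h4] at h2
    exact h2.symm
  · intro h
    exact (Submodule.eq_of_le_of_finrank_eq hle (by omega)).symm

/-- Lower semicontinuous integer functions are constant on some open set. -/
lemma exists_open_constant {κ : Type*} (S : Finset κ) {ρ : κ → P → ℕ} {O : Set P} (hO : IsOpen O)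
    (hne : O.Nonempty) (hb : ∀ k ∈ S, ∃ N, ∀ y, ρ k y ≤ N)
    (hl : ∀ k ∈ S, ∀ y ∈ O, ∀ᶠ p in 𝓝 y, ρ k y ≤ ρ k p) :
    ∃ O' ⊆ O, IsOpen O' ∧ O'.Nonempty ∧ ∀ k ∈ S, ∀ y ∈ O', ∀ y' ∈ O', ρ k y = ρ k y' := by
  classical
  induction S using Finset.induction_on with
  | empty => exact ⟨O, le_rfl, hO, hne, by simp⟩
  | insert k S _ ih =>
    obtain ⟨O', hO', ho, ⟨y0, hy0⟩, hc⟩ := ih (fun k hk => hb k (Finset.mem_insert_of_mem hk))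
      fun k hk => hl k (Finset.mem_insert_of_mem hk)
    obtain ⟨N, hN⟩ := hb k (Finset.mem_insert_self _ _)
    obtain ⟨n, ⟨y, hy, hyn⟩, hmax⟩ : ∃ n, (∃ y ∈ O', ρ k y = n) ∧ ∀ y ∈ O', ρ k y ≤ n := by
      have hP : ∃ y ∈ O', ρ k y = ρ k y0 := ⟨y0, hy0, rfl⟩
      refine ⟨Nat.findGreatest (fun n => ∃ y ∈ O', ρ k y = n) N,
        Nat.findGreatest_spec (P := fun n => ∃ y ∈ O', ρ k y = n) (hN y0) hP, fun y hy => ?_⟩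
      exact Nat.le_findGreatest (hN y) ⟨y, hy, rfl⟩
    obtain ⟨u, hu, huo, hyu⟩ := eventually_nhds_iff.1 (hl k (Finset.mem_insert_self _ _) y (hO' hy))
    refine ⟨O' ∩ u, fun z hz => hO' hz.1, ho.inter huo, ⟨y, hy, hyu⟩, fun k' hk' => ?_⟩
    rcases Finset.mem_insert.1 hk' with rfl | hk'
    · have h1 : ∀ z ∈ O' ∩ u, ρ k' z = n := fun z hz => le_antisymm (hmax z hz.1) (hyn ▸ hu z hz.2)
      exact fun z hz z' hz' => (h1 z hz).trans (h1 z' hz').symm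
    · exact fun z hz z' hz' => hc k' hk' z hz.1 z' hz'.1

end Rank

/-! ### Curves in the level sets of functions of constant rank -/

section Curve

variable {Y ι : Type*} [NormedAddCommGroup Y] [NormedSpace ℝ Y] [Fintype ι] {O : Set Y}

/-- If the derivatives of finitely many functions are independent at `y`, one can move along a
`C^1` curve such that one of the functions is the parameter and the others are constant. -/
lemma exists_curve_independent {κ : Type*} [Fintype κ] [DecidableEq κ] (hO : IsOpen O)
    {f : κ → Y → ℝ} {f' : κ → Y → Y →L[ℝ] ℝ} (hf : ∀ j, ∀ y ∈ O, HasFDerivAt (f j) (f' j y) y)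
    (hc : ∀ j, ContinuousOn (f' j) O) {y : Y} (hy : y ∈ O)
    (hi : LinearIndependent ℝ fun j => f' j y) (k : κ) :
    ∃ γ : ℝ → Y, γ 0 = y ∧ (∀ᶠ t in 𝓝 (0 : ℝ), DifferentiableAt ℝ γ t) ∧
      ∀ᶠ t in 𝓝 (0 : ℝ), ∀ j, f j (γ t) = f j y + if j = k then t else 0 := by
  have hi' : LinearIndependent ℝ fun j => (f' j y : Y →ₗ[ℝ] ℝ) :=
    hi.map' (ContinuousLinearMap.coeLM ℝ) (LinearMap.ker_eq_bot.2 ContinuousLinearMap.coe_injective)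
  obtain ⟨v, hv⟩ := exists_dual_vectors hi'
  set l : (κ → ℝ) →L[ℝ] Y := ∑ j, (ContinuousLinearMap.proj (R := ℝ) (φ := fun _ : κ => ℝ) j).smulRight (v j)
    with hl
  have hlv : ∀ z, l z = ∑ j, z j • v j := fun z => by simp [hl]
  set Θ : (κ → ℝ) → κ → ℝ := fun z j => f j (y + l z) with hΘ
  set Θ' : (κ → ℝ) → (κ → ℝ) →L[ℝ] (κ → ℝ) := fun z =>
    ContinuousLinearMap.pi fun j => (f' j (y + l z)).comp l with hΘ'
  have hmap : Continuous fun z => y + l z := by fun_prop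
  have hu : (fun z => y + l z) ⁻¹' O ∈ 𝓝 (0 : κ → ℝ) :=
    (hO.preimage hmap).mem_nhds (by simpa using hy)
  have hd : ∀ z ∈ (fun z => y + l z) ⁻¹' O, HasFDerivAt Θ (Θ' z) z := fun z hz =>
    hasFDerivAt_pi.2 fun j => (hf j _ hz).comp z (l.hasFDerivAt.const_add y)
  have hC1 : ContDiffAt ℝ 1 Θ 0 := by
    refine contDiffAt_one_iff.2 ⟨Θ', _, hu, ?_, hd⟩
    refine continuousOn_clm_apply.2 fun w => continuousOn_pi.2 fun j => ?_
    exact ((hc j).comp hmap.continuousOn fun z hz => hz).clm_apply continuousOn_const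
  have hid : Θ' 0 = ContinuousLinearEquiv.refl ℝ (κ → ℝ) := by
    refine DFunLike.ext _ _ fun z => funext fun j => ?_
    change f' j (y + l 0) (l z) = z j
    rw [map_zero, add_zero, hlv, map_sum]
    simp only [map_smul, smul_eq_mul]
    have := hv j
    simp only [ContinuousLinearMap.coe_coe] at this
    simp [this]
  have hd0 : HasFDerivAt Θ (ContinuousLinearEquiv.refl ℝ (κ → ℝ) : (κ → ℝ) →L[ℝ] (κ → ℝ)) 0 :=
    hid ▸ hd 0 (mem_of_mem_nhds hu)
  set e := hC1.toOpenPartialHomeomorph Θ hd0 one_ne_zero with he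
  have hsymm : ContDiffAt ℝ 1 e.symm (Θ 0) := hC1.to_localInverse hd0 one_ne_zero
  have he0 : e.symm (Θ 0) = 0 := e.left_inv (hC1.mem_toOpenPartialHomeomorph_source hd0 one_ne_zero)
  set g : ℝ → κ → ℝ := fun t => Θ 0 + t • Pi.single k 1 with hg
  have hg0 : g 0 = Θ 0 := by simp [hg]
  have hgc : Tendsto g (𝓝 0) (𝓝 (Θ 0)) := by
    rw [← hg0]; exact (by fun_prop : Continuous g).tendsto 0
  refine ⟨fun t => y + l (e.symm (g t)), by simp [hg0, he0], ?_, ?_⟩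
  · have h1 : ∀ᶠ x in 𝓝 (Θ 0), DifferentiableAt ℝ e.symm x := by
      filter_upwards [hsymm.eventually (by simp)] with x hx
      exact hx.differentiableAt one_ne_zero
    filter_upwards [hgc.eventually h1] with t ht
    have hgd : DifferentiableAt ℝ g t := by fun_prop
    exact (l.differentiableAt.comp t (ht.comp t hgd)).const_add y
  · have h1 : ∀ᶠ x in 𝓝 (Θ 0), x ∈ e.target :=
      e.open_target.mem_nhds (hC1.image_mem_toOpenPartialHomeomorph_target hd0 one_ne_zero)
    filter_upwards [hgc.eventually h1] with t ht j
    have h2 : Θ (e.symm (g t)) = g t := e.right_inv ht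
    have h3 := congrFun h2 j
    change f j (y + l (e.symm (g t))) = _ at h3
    rw [h3]
    simp only [hg, hΘ, Pi.add_apply, Pi.smul_apply, map_zero, add_zero, Pi.single_apply, smul_eq_mul]
    split_ifs <;> simp

/-- In the level sets of functions whose derivatives have constant rank, one can move along a
curve that is parametrized by a function with an independent derivative. -/
lemma exists_curve (hO : IsOpen O)
    {f : ι → Y → ℝ} {f' : ι → Y → Y →L[ℝ] ℝ} (hf : ∀ j, ∀ y ∈ O, HasFDerivAt (f j) (f' j y) y)
    (hc : ∀ j, ContinuousOn (f' j) O)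
    (hr : ∀ y ∈ O, ∀ y' ∈ O, Module.finrank ℝ (Submodule.span ℝ (range fun j => f' j y)) =
      Module.finrank ℝ (Submodule.span ℝ (range fun j => f' j y')))
    {g : Y → ℝ} {g' : Y → Y →L[ℝ] ℝ} (hg : ∀ y ∈ O, HasFDerivAt g (g' y) y)
    (hgc : ContinuousOn g' O) {y : Y} (hy : y ∈ O)
    (hi : g' y ∉ Submodule.span ℝ (range fun j => f' j y)) :
    ∃ γ : ℝ → Y, γ 0 = y ∧ ContinuousAt γ 0 ∧
      ∀ᶠ t in 𝓝 (0 : ℝ), g (γ t) = g y + t ∧ ∀ j, f j (γ t) = f j y := by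
  classical
  obtain ⟨s, hs, hsi⟩ := exists_independent_subfamily fun j => f' j y
  set F : Option s → Y → ℝ := fun o => o.elim g fun j => f j with hF
  set F' : Option s → Y → Y →L[ℝ] ℝ := fun o => o.elim g' fun j => f' j with hF'
  have hi' : LinearIndependent ℝ fun o => F' o y := by
    refine linearIndependent_option.2 ⟨hsi, ?_⟩
    have : range ((fun o => F' o y) ∘ ((↑) : s → Option s)) = range fun j : s => f' j y := rfl
    rw [this, hs]
    exact hi
  obtain ⟨γ, hγ0, hγd, hγ⟩ := exists_curve_independent hO (f := F) (f' := F')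
    (fun o => by cases o with
      | none => exact hg
      | some j => exact hf j)
    (fun o => by cases o with
      | none => exact hgc
      | some j => exact hc j) hy hi' none
  have hγc : ContinuousAt γ 0 := (hγd.self_of_nhds).continuousAt
  refine ⟨γ, hγ0, hγc, ?_⟩
  -- the derivatives of the remaining functions vanish along the curve
  have hγ' : Tendsto γ (𝓝 0) (𝓝 y) := by
    have := hγc.tendsto
    rwa [hγ0] at this
  have hsi' := hγ'.eventually (eventually_linearIndependent (f := fun p (j : s) => f' j p)
    (fun j => (hc j).continuousAt (hO.mem_nhds hy)) hsi)
  have hev : ∀ᶠ t in 𝓝 (0 : ℝ), γ t ∈ O ∧ ∀ j, HasDerivAt (fun t => f j (γ t)) 0 t := by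
    have h1 := hγ'.eventually (hO.mem_nhds hy)
    filter_upwards [h1, hγd, hsi', hγ.eventually_nhds] with t ht hd hind heq
    refine ⟨ht, fun j => ?_⟩
    have hd' : ∀ j, HasDerivAt (fun t => f j (γ t)) (f' j (γ t) (deriv γ t)) t := fun j =>
      (hf j _ ht).comp_hasDerivAt t hd.hasDerivAt
    have hz : ∀ j : s, f' j (γ t) (deriv γ t) = 0 := fun j => by
      refine (hd' j).unique ((hasDerivAt_const t (f j y)).congr_of_eventuallyEq ?_)
      filter_upwards [heq] with u hu
      have := hu (some j)
      simpa [hF] using this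
    have hspan : Submodule.span ℝ (range fun j : s => f' j (γ t)) =
        Submodule.span ℝ (range fun j => f' j (γ t)) := by
      refine span_eq_of_finrank_eq (f := fun j => f' j (γ t)) hind ?_
      rw [hr _ ht y hy, ← hs, finrank_span_eq_card hsi, Nat.card_eq_fintype_card]
    have hmem : f' j (γ t) ∈ Submodule.span ℝ (range fun j : s => f' j (γ t)) := by
      rw [hspan]; exact Submodule.subset_span ⟨j, rfl⟩
    have hz' : f' j (γ t) (deriv γ t) = 0 := by
      refine Submodule.span_induction (p := fun F _ => F (deriv γ t) = 0) ?_ rfl ?_ ?_ hmem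
      · rintro _ ⟨j, rfl⟩; exact hz j
      · intro F1 F2 _ _ h1 h2
        change F1 _ + F2 _ = 0
        rw [h1, h2, add_zero]
      · intro q F _ h
        change q * F _ = 0
        rw [h, mul_zero]
    rw [← hz']
    exact hd' j
  obtain ⟨δ, hδ, hball⟩ := Metric.eventually_nhds_iff_ball.1 (hev.and hγ)
  filter_upwards [Metric.ball_mem_nhds (0 : ℝ) hδ] with t ht
  refine ⟨by simpa [hF] using (hball t ht).2 none, fun j => ?_⟩
  have h1 := (convex_ball (0 : ℝ) δ).norm_image_sub_le_of_norm_hasDerivWithin_le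
    (f := fun t => f j (γ t)) (f' := fun _ => 0) (C := 0)
    (fun x hx => ((hball x hx).1.2 j).hasDerivWithinAt) (by simp)
    (Metric.mem_ball_self hδ) ht
  rw [zero_mul] at h1
  have h2 := sub_eq_zero.1 (norm_le_zero_iff.1 h1)
  rw [h2, hγ0]

/-- A function that vanishes on the level set of `f` has a derivative proportional to the one of
`f`, at a regular point of `f`. -/
lemma exists_multiplier (hO : IsOpen O) {f g : Y → ℝ} {f' g' : Y → Y →L[ℝ] ℝ}
    (hf : ∀ y ∈ O, HasFDerivAt f (f' y) y) (hfc : ContinuousOn f' O)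
    (hg : ∀ y ∈ O, HasFDerivAt g (g' y) y) (hgc : ContinuousOn g' O) {y : Y} (hy : y ∈ O)
    (h0 : f' y ≠ 0) (hfg : ∀ y' ∈ O, f y' = f y → g y' = 0) : ∃ q : ℝ, g' y = q • f' y := by
  have hopen : IsOpen (O ∩ {y | f' y ≠ 0}) := hfc.isOpen_inter_preimage hO isOpen_compl_singleton
  by_contra hcon
  obtain ⟨γ, hγ0, hγc, hγ⟩ := exists_curve (ι := Unit) hopen (f := fun _ => f) (f' := fun _ => f')
    (fun _ y hy => hf y hy.1) (fun _ => hfc.mono inter_subset_left)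
    (fun y hy y' hy' => by
      change Module.finrank ℝ (Submodule.span ℝ (range fun _ : Unit => f' y)) =
        Module.finrank ℝ (Submodule.span ℝ (range fun _ : Unit => f' y'))
      rw [range_const, range_const, finrank_span_singleton hy.2, finrank_span_singleton hy'.2])
    (fun y hy => hg y hy.1) (hgc.mono inter_subset_left) ⟨hy, h0⟩ (by
      rw [range_const, Submodule.mem_span_singleton]
      rintro ⟨q, hq⟩
      exact hcon ⟨q, hq.symm⟩)
  have hγ' : ∀ᶠ t in 𝓝 (0 : ℝ), γ t ∈ O := hγc.eventually (by rw [hγ0]; exact hO.mem_nhds hy)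
  have h1 : ∀ᶠ t in 𝓝 (0 : ℝ), t = 0 := by
    filter_upwards [hγ, hγ'] with t ht htO
    have h2 := hfg _ htO (ht.2 ())
    rwa [ht.1, hfg y hy rfl, zero_add] at h2
  obtain ⟨δ, hδ, hball⟩ := Metric.eventually_nhds_iff_ball.1 h1
  have := hball (δ / 2) (by rw [mem_ball_zero_iff, Real.norm_of_nonneg (by linarith)]; linarith)
  linarith

end Curve

/-! ### Curves of conormal functionals -/

namespace Core

/-- The functionals that are bounded by the total variation, where `TV b s` means that the total
variation of `b` is at most `s`. -/
def bounded (G : Core E0 E1 E2 E3) (TV : E3 → ℝ → Prop) : Submodule ℝ (E2 →L[ℝ] ℝ) where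
  carrier := {F | ∃ C, ∀ b s, TV b s → |F (G.i3 b)| ≤ C * s}
  add_mem' := by
    rintro F F' ⟨C, h⟩ ⟨C', h'⟩
    refine ⟨C + C', fun b s hb => ?_⟩
    change |F (G.i3 b) + F' (G.i3 b)| ≤ _
    rw [add_mul]
    exact (abs_add_le _ _).trans (add_le_add (h b s hb) (h' b s hb))
  zero_mem' := ⟨0, fun b s _ => by simp⟩
  smul_mem' := by
    rintro q F ⟨C, h⟩
    refine ⟨|q| * C, fun b s hb => ?_⟩
    change |q * F (G.i3 b)| ≤ _
    rw [abs_mul, mul_assoc]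
    exact mul_le_mul_of_nonneg_left (h b s hb) (abs_nonneg _)

/-- At `c` there is a differentiable curve of bounded solutions `K t` of
`K t ∘ L (c + t) = a - (c + t) I`, whose derivative at `0` is proportional to `K 0`. -/
def HasCurve (G : Core E0 E1 E2 E3) (TV : E3 → ℝ → Prop) (c : ℝ) : Prop :=
  ∃ (K : ℝ → E2 →L[ℝ] ℝ) (l : ℝ),
    (∀ᶠ t in 𝓝 (0 : ℝ), c + t ∈ G.R ∧ K t ∈ G.bounded TV ∧
      ∀ x, K t (G.L2 (c + t) x) = G.a2 x - (c + t) * G.I2 x) ∧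
    ∀ ε > 0, ∀ᶠ t in 𝓝 (0 : ℝ), ∀ b s, TV b s →
      |K t (G.i3 b) - (1 + l * t) * K 0 (G.i3 b)| ≤ ε * |t| * s

/-- The weak derivative of `c ↦ L c b` is `W c b`. -/
lemma hasDerivAt_weak (hD : DualApprox G.i2) {c : ℝ} (hR : G.R ∈ 𝓝 c) (F : E2 →L[ℝ] ℝ) (e : E3) :
    HasDerivAt (fun c => F (G.L2 c (G.i3 e))) (F (G.W3 c e)) c := by
  have hc := mem_of_mem_nhds hR
  rw [hasDerivAt_iff_isLittleO, ← Asymptotics.isLittleO_norm_right]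
  refine (isLittleO_of_norm_le (T := F) (ι := G.i2)
    (fun ε hε => (hD.exists_norm_le (E := ℝ) F hε).imp fun C h => h.1)
    (x := fun q => G.L2 q (G.i3 e) - G.L2 c (G.i3 e) - (q - c) • G.W3 c e) ?_ ?_).congr_left
    fun q => ?_
  · refine .of_bound (G.C * ‖e‖ + ‖G.W3 c e‖) (mem_of_superset hR fun q hq => ?_)
    refine (norm_sub_le_of_le (G.lip2 q hq c hc e) (norm_smul_le _ _)).trans (le_of_eq ?_)
    rw [norm_norm, Real.norm_eq_abs]; ring
  · refine Asymptotics.IsBigO.trans_isLittleO (g := fun q => ‖q - c‖ ^ 2)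
      (.of_bound (G.C * ‖e‖) (mem_of_superset hR fun q hq => ?_))
      (by simpa using Asymptotics.isLittleO_pow_sub_sub c one_lt_two)
    change ‖G.i2 _‖ ≤ _
    rw [map_sub, map_sub, map_smul, G.commL2, G.commL2, G.commW3, norm_pow, norm_norm, mul_right_comm]
    exact G.diff1 q hq c hc e
  · rw [map_sub, map_sub, map_smul]

variable {TV : E3 → ℝ → Prop}

/-- Solutions of `κ t ∘ L (c + t) = a - (c + t) I` in a fixed finite dimensional space are
differentiable in `t`. -/
lemma exists_deriv_conormal (hD : DualApprox G.i2) (hV : G.IsStable (G.bounded TV))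
    (hTV : ∀ b s, TV b s → 0 ≤ s) (hd : ∀ F : E2 →L[ℝ] ℝ, F.comp G.i3 = 0 → F = 0)
    {ι : Type*} [Fintype ι] {f : ι → E2 →L[ℝ] ℝ} (hf : ∀ j, f j ∈ G.bounded TV) {c : ℝ}
    {κ : ℝ → E2 →L[ℝ] ℝ} (hκ : ∀ᶠ t in 𝓝 (0 : ℝ), c + t ∈ G.R ∧
      κ t ∈ Submodule.span ℝ (range f) ∧ ∀ x, κ t (G.L2 (c + t) x) = G.a2 x - (c + t) * G.I2 x) :
    ∃ D ∈ Submodule.span ℝ (range f),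
      (∀ e, D (G.L2 c (G.i3 e)) = -G.I3 e - κ 0 (G.W3 c e)) ∧
      ∀ ε > 0, ∀ᶠ t in 𝓝 (0 : ℝ), ∀ b s, TV b s →
        |κ t (G.i3 b) - κ 0 (G.i3 b) - t * D (G.i3 b)| ≤ ε * |t| * s := by
  classical
  obtain ⟨S, hS, hSi⟩ := exists_independent_subfamily f
  obtain ⟨hc, -, -⟩ := hκ.self_of_nhds
  have hR : G.R ∈ 𝓝 c := by
    simpa using (tendsto_sub_nhds_zero_iff.2 (tendsto_id (x := 𝓝 c))).eventually
      (hκ.mono fun t h => h.1)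
  rw [add_zero] at hc
  -- test vectors
  have hind : LinearIndependent ℝ fun j : S => ((f j).comp ((G.L2 c).comp G.i3) : E3 →ₗ[ℝ] ℝ) := by
    rw [Fintype.linearIndependent_iff]
    intro g hg
    refine Fintype.linearIndependent_iff.1 hSi g ?_
    refine hV.eq_zero c hc _ (Submodule.sum_mem _ fun j _ => Submodule.smul_mem _ _ (hf j)) ?_
    refine hd _ (DFunLike.ext _ _ fun x => ?_)
    have := congrArg (fun u : E3 →ₗ[ℝ] ℝ => u x) hg
    simpa using this
  obtain ⟨e, he⟩ := exists_dual_vectors hind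
  replace he : ∀ i j : S, f i (G.L2 c (G.i3 (e j))) = if i = j then 1 else 0 := fun i j => he i j
  -- the coordinates of `κ t` solve a linear system, which is the identity at `0`
  set x : ℝ → S → ℝ := fun t j => κ t (G.L2 c (G.i3 (e j))) with hx
  have hexp : ∀ t, κ t ∈ Submodule.span ℝ (range f) → ∀ v, κ t v = ∑ j, x t j * f j v := by
    intro t ht v
    rw [← hS] at ht
    obtain ⟨g, hg⟩ := (Submodule.mem_span_range_iff_exists_fun ℝ).1 ht
    simp [hx, ← hg, he]
  have hder : ∀ j v, HasDerivAt (fun t => f j (G.L2 (c + t) (G.i3 v))) (f j (G.W3 c v)) 0 :=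
    fun j v => HasDerivAt.comp_const_add c 0 (by rw [add_zero]; exact hasDerivAt_weak hD hR (f j) v)
  have hdet : ∀ M : ℝ → Matrix S S ℝ, (∀ i j, DifferentiableAt ℝ (fun t => M t i j) 0) →
      DifferentiableAt ℝ (fun t => (M t).det) 0 := fun M hM => by
    simp only [Matrix.det_apply]
    fun_prop
  have hdiff : ∀ j, DifferentiableAt ℝ (fun t => x t j) 0 := fun j => by
    set A : ℝ → Matrix S S ℝ := fun t => .of fun i j => f j (G.L2 (c + t) (G.i3 (e i)))
    set y : ℝ → S → ℝ := fun t i => G.a2 (G.i3 (e i)) - (c + t) * G.I2 (G.i3 (e i))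
    have hA : ∀ i j, DifferentiableAt ℝ (fun t => A t i j) 0 := fun i j =>
      (hder j (e i)).differentiableAt
    have hA0 : (A 0).det ≠ 0 := by
      rw [show A 0 = 1 by ext i j; simp [A, he, Matrix.one_apply, eq_comm]]
      simp
    refine DifferentiableAt.congr_of_eventuallyEq (f := fun t => ((A t).updateCol j (y t)).det /
      (A t).det) (.div (hdet _ fun i k => ?_) (hdet A hA) hA0) ?_
    · by_cases hk : k = j
      · subst hk
        simp only [Matrix.updateCol_self, y]
        fun_prop
      · simpa [Matrix.updateCol_ne hk] using hA i k
    · filter_upwards [hκ, (hdet A hA).continuousAt.eventually_ne hA0] with t ht h0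
      have h1 : (A t).mulVec (x t) = y t := funext fun i => by
        refine Eq.trans ?_ (ht.2.2 _)
        rw [hexp t ht.2.1]
        exact Finset.sum_congr rfl fun j _ => mul_comm _ _
      rw [← Matrix.cramer_apply, Matrix.cramer_eq_adjugate_mulVec, ← h1, Matrix.mulVec_mulVec,
        Matrix.adjugate_mul, Matrix.smul_mulVec, Matrix.one_mulVec, eq_div_iff h0, mul_comm]
      rfl
  set D : E2 →L[ℝ] ℝ := ∑ j, deriv (fun t => x t j) 0 • f j with hDdef
  have hDv : ∀ v, D v = ∑ j, deriv (fun t => x t j) 0 * f j v := by simp [hDdef]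
  refine ⟨D, Submodule.sum_mem _ fun j _ => Submodule.smul_mem _ _ (Submodule.subset_span ⟨j, rfl⟩),
    fun v => ?_, fun ε hε => ?_⟩
  · have h1 : HasDerivAt (fun t => ∑ j, x t j * f j (G.L2 (c + t) (G.i3 v)))
        (D (G.L2 c (G.i3 v)) + κ 0 (G.W3 c v)) 0 := by
      rw [hDv, hexp 0 hκ.self_of_nhds.2.1, ← Finset.sum_add_distrib]
      simpa using HasDerivAt.fun_sum (u := Finset.univ) fun j _ => (hdiff j).hasDerivAt.mul (hder j v)
    have h2 : HasDerivAt (fun t => G.a2 (G.i3 v) - (c + t) * G.I2 (G.i3 v)) (-G.I3 v) 0 := by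
      simpa [I3] using (((hasDerivAt_id (0 : ℝ)).const_add c).mul_const (G.I2 (G.i3 v))).const_sub
        (G.a2 (G.i3 v))
    exact eq_sub_of_add_eq (h1.unique (h2.congr_of_eventuallyEq (hκ.mono fun t ht =>
      (hexp t ht.2.1 _).symm.trans (ht.2.2 _))))
  · choose Cf hCf using hf
    set N := ∑ j : S, |Cf j| with hN
    have hN0 : 0 ≤ N := Finset.sum_nonneg fun _ _ => abs_nonneg _
    have h1 : ∀ᶠ t in 𝓝 (0 : ℝ), ∀ j : S,
        ‖x t j - x 0 j - (t - 0) • deriv (fun t => x t j) 0‖ ≤ ε / (N + 1) * ‖t - 0‖ :=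
      eventually_all.2 fun j => (hasDerivAt_iff_isLittleO.1 (hdiff j).hasDerivAt).bound
        (by positivity)
    filter_upwards [h1, hκ] with t ht htκ b s hbs
    have hs := hTV b s hbs
    rw [hexp t htκ.2.1, hexp 0 hκ.self_of_nhds.2.1, hDv, Finset.mul_sum, ← Finset.sum_sub_distrib,
      ← Finset.sum_sub_distrib]
    calc _ ≤ ∑ j : S, ε / (N + 1) * |t| * (|Cf j| * s) := by
          refine (Finset.abs_sum_le_sum_abs _ _).trans (Finset.sum_le_sum fun j _ => ?_)
          have h2 := ht j
          rw [sub_zero, Real.norm_eq_abs, Real.norm_eq_abs, smul_eq_mul] at h2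
          rw [← mul_assoc, ← sub_mul, ← sub_mul, abs_mul]
          gcongr
          exact (hCf j b s hbs).trans (by gcongr; exact le_abs_self _)
      _ = ε * (N / (N + 1)) * |t| * s := by
          rw [← Finset.mul_sum, ← Finset.sum_mul, ← hN]; ring
      _ ≤ _ := by
          gcongr
          exact mul_le_of_le_one_right hε.le (div_le_one_of_le₀ (by linarith) (by linarith))

/-! ### Degenerate linearizations along the orbits -/

namespace Family

variable (Φ) (m : ℕ) (Q : Y → E2 →L[ℝ] ℝ)

/-- Generators of the space of the functionals at time `m - n` that is relevant for the tangent
dynamics up to time `m`: the functionals `a ∘ L ⋯ L` and `Q ∘ L ⋯ L`, and the integral. -/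
noncomputable def gen (y : Y) : (n : ℕ) → Fin (3 + n) → E2 →L[ℝ] ℝ
  | 0 => ![G.a2, Q y, G.I2]
  | n + 1 => Fin.cons (α := fun _ => E2 →L[ℝ] ℝ) G.a2
      fun j => (gen y n j).comp (G.L2 (Φ.c y (m - (n + 1))))

/-- The space spanned by the generators. -/
noncomputable def genSpan (y : Y) (n : ℕ) : Submodule ℝ (E2 →L[ℝ] ℝ) :=
  Submodule.span ℝ (range (Φ.gen m Q y n))

/-- The functionals in `genSpan` that annihilate the range of the tangent map are the multiples of
the integral. -/
def Nondeg (y : Y) (n : ℕ) : Prop :=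
  ∀ F ∈ Φ.genSpan m Q y n, F.comp (Φ.tan y (m - n)) = 0 → ∃ q : ℝ, F = q • G.I2

variable {Φ m Q}

lemma comp_mem_genSpan {y : Y} {n : ℕ} {F : E2 →L[ℝ] ℝ} (hF : F ∈ Φ.genSpan m Q y n) :
    F.comp (G.L2 (Φ.c y (m - (n + 1)))) ∈ Φ.genSpan m Q y (n + 1) := by
  refine Submodule.span_induction
    (p := fun F _ => F.comp (G.L2 (Φ.c y (m - (n + 1)))) ∈ Φ.genSpan m Q y (n + 1)) ?_ ?_ ?_ ?_ hF
  · rintro _ ⟨j, rfl⟩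
    exact Submodule.subset_span ⟨Fin.succ j, rfl⟩
  · rw [ContinuousLinearMap.zero_comp]; exact Submodule.zero_mem _
  · intro F F' _ _ h h'
    rw [ContinuousLinearMap.add_comp]; exact Submodule.add_mem _ h h'
  · intro q F _ h
    rw [ContinuousLinearMap.smul_comp]; exact Submodule.smul_mem _ q h

lemma a_mem_genSpan (y : Y) (n : ℕ) : G.a2 ∈ Φ.genSpan m Q y n := by
  cases n with
  | zero => exact Submodule.subset_span ⟨0, rfl⟩
  | succ n => exact Submodule.subset_span ⟨(0 : Fin (3 + n + 1)), rfl⟩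

lemma I_mem_genSpan {y : Y} (hy : y ∈ Φ.U) (n : ℕ) : G.I2 ∈ Φ.genSpan m Q y n := by
  induction n with
  | zero => exact Submodule.subset_span ⟨2, rfl⟩
  | succ n ih =>
    have h1 := comp_mem_genSpan ih
    rwa [show G.I2.comp (G.L2 (Φ.c y (m - (n + 1)))) = G.I2 from
      DFunLike.ext _ _ fun x => G.I2_L (c_mem hy _) x] at h1

lemma back_mem_genSpan {y : Y} {n : ℕ} {F : E2 →L[ℝ] ℝ} (hF : F ∈ Φ.genSpan m Q y n) :
    Φ.back y (m - (n + 1)) F ∈ Φ.genSpan m Q y (n + 1) :=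
  Submodule.add_mem _ (comp_mem_genSpan hF) (Submodule.smul_mem _ _ (a_mem_genSpan y _))

lemma gen_mem {V : Submodule ℝ (E2 →L[ℝ] ℝ)} (hV : G.IsStable V) {y : Y} (hy : y ∈ Φ.U)
    (hQ : Q y ∈ V) (n : ℕ) (j : Fin (3 + n)) : Φ.gen m Q y n j ∈ V := by
  induction n with
  | zero =>
    change ![G.a2, Q y, G.I2] j ∈ V
    change Fin 3 at j
    fin_cases j
    exacts [hV.a_mem, hQ, hV.I_mem]
  | succ n ih =>
    change Fin (3 + n + 1) at j
    refine Fin.cases ?_ (fun i => ?_) j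
    · exact hV.a_mem
    · exact hV.comp_mem _ (c_mem hy _) _ (ih i)

lemma continuousOn_gen (hD : DualApprox G.i2) {O : Set Y} (hO : O ⊆ Φ.U) (hQ : ContinuousOn Q O)
    (n : ℕ) (j : Fin (3 + n)) : ContinuousOn (fun y => Φ.gen m Q y n j) O := by
  induction n with
  | zero =>
    change Fin 3 at j
    fin_cases j
    exacts [continuousOn_const, hQ, continuousOn_const]
  | succ n ih =>
    change Fin (3 + n + 1) at j
    refine Fin.cases continuousOn_const (fun i => ?_) j
    refine continuousOn_comp_param hD G.C_pos (fun c hc => G.bdL2 hc) (fun c hc c' hc' x => ?_)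
      (ih i) ((Φ.continuousOn_c _).mono hO) fun y hy => c_mem (hO hy) _
    rw [G.commL2, G.commL2]
    exact G.lip1 c hc c' hc' x

lemma gen_congr {y y' : Y} {n : ℕ} (hQ : Q y = Q y')
    (hc : ∀ j < n, Φ.c y (m - (j + 1)) = Φ.c y' (m - (j + 1))) :
    Φ.gen m Q y n = Φ.gen m Q y' n := by
  induction n with
  | zero => rw [gen, gen, hQ]
  | succ n ih => rw [gen, gen, ih fun j hj => hc j (by omega), hc n (by omega)]

lemma I_comp_tan {y : Y} (hy : y ∈ Φ.U) (n : ℕ) : G.I2.comp (Φ.tan y n) = 0 := by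
  induction n with
  | zero => exact DFunLike.ext _ _ fun v => Φ.I_e v
  | succ n ih =>
    refine DFunLike.ext _ _ fun v => ?_
    change G.I2 (Φ.tan y (n + 1) v) = 0
    rw [tan_succ, map_add, map_smul, G.I2_L (c_mem hy n), G.I2_W (c_mem hy n), smul_zero, add_zero]
    exact congrArg (fun u => u v) ih

lemma I_ne_zero (Φ : G.Family h Y) : G.I2 ≠ 0 := by
  obtain ⟨y, hy⟩ := Φ.nonempty
  exact fun h0 => zero_ne_one (α := ℝ)
    ((congrArg (fun u => u (G.i3 (Φ.b y 0))) h0).symm.trans (I3_b hy 0))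

lemma eq_zero_of_comp_i3 (Φ : G.Family h Y) (F : E2 →L[ℝ] ℝ) (hF : F.comp G.i3 = 0) : F = 0 := by
  obtain ⟨q, rfl⟩ := Φ.dense F fun y => congrArg (fun u => u (Φ.e y)) hF
  obtain ⟨y, hy⟩ := Φ.nonempty
  have h2 : q * G.I2 (G.i3 (Φ.b y 0)) = 0 := congrArg (fun u => u (Φ.b y 0)) hF
  rw [show G.I2 (G.i3 (Φ.b y 0)) = 1 from I3_b hy 0, mul_one] at h2
  rw [h2, zero_smul]

lemma nondeg_zero (y : Y) : Φ.Nondeg m Q y m := by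
  intro F _ h0
  rw [Nat.sub_self] at h0
  exact Φ.dense F fun v => congrArg (fun u => u v) h0

/-- Functionals at time `m - j` can be pulled back to time `m - n`. -/
lemma exists_pull {y : Y} {j n : ℕ} (hjn : j ≤ n) (hn : n ≤ m) {F : E2 →L[ℝ] ℝ}
    (hF : F ∈ Φ.genSpan m Q y j) : ∃ P ∈ Φ.genSpan m Q y n,
      P.comp (Φ.tan y (m - n)) = F.comp (Φ.tan y (m - j)) := by
  induction n, hjn using Nat.le_induction with
  | base => exact ⟨F, hF, rfl⟩
  | succ n hjn ih =>
    obtain ⟨P, hP, h⟩ := ih (by omega)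
    refine ⟨_, back_mem_genSpan hP, ?_⟩
    rw [← comp_tan_succ, ← h, show m - (n + 1) + 1 = m - n by omega]

/-- The rank conditions that `Nondeg` depends on. -/
lemma nondeg_iff {y : Y} (hy : y ∈ Φ.U) (n : ℕ) : Φ.Nondeg m Q y n ↔
    Module.finrank ℝ (Φ.genSpan m Q y n) = Module.finrank ℝ (Submodule.span ℝ
      (range fun j => (Φ.gen m Q y n j).comp (Φ.tan y (m - n)))) + 1 := by
  let T : (E2 →L[ℝ] ℝ) →ₗ[ℝ] (Y →L[ℝ] ℝ) :=
    { toFun := fun F => F.comp (Φ.tan y (m - n))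
      map_add' := fun F F' => ContinuousLinearMap.add_comp _ _ _
      map_smul' := fun q F => ContinuousLinearMap.smul_comp _ _ _ }
  exact ker_eq_line_iff T (Φ.I_ne_zero) (I_mem_genSpan hy n) (I_comp_tan hy _)

/-- If the range of the tangent map is degenerate at time `i + 1` but not at time `i`, then a
functional annihilates the range of the linearization at `b i`. -/
lemma exists_normalized {TV : E3 → ℝ → Prop} (hV : G.IsStable (G.bounded TV)) {y : Y}
    (hy : y ∈ Φ.U) (hQ : Q y ∈ G.bounded TV) {n i : ℕ}
    (hi : m - (n + 1) = i) (hi' : m - n = i + 1) (h1 : Φ.Nondeg m Q y (n + 1))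
    (h0 : ¬ Φ.Nondeg m Q y n) : ∃ κ ∈ Φ.genSpan m Q y n,
      (∀ x, κ (G.L2 (Φ.c y i) x) = G.a2 x - Φ.c y i * G.I2 x) ∧
      κ (G.W3 (Φ.c y i) (Φ.b y i)) = -1 := by
  have hc := c_mem hy i
  simp only [Nondeg, hi'] at h0
  push Not at h0
  obtain ⟨F, hF, hF0, hFI⟩ := h0
  have hFV : F ∈ G.bounded TV :=
    Submodule.span_le.2 (by rintro _ ⟨j, rfl⟩; exact gen_mem hV hy hQ n j) hF
  obtain ⟨q, hq⟩ := h1 _ (back_mem_genSpan hF) (by rw [hi, ← comp_tan_succ, hF0])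
  rw [hi] at hq
  set w := F (G.W3 (Φ.c y i) (Φ.b y i)) with hw
  have hq' : ∀ x, F (G.L2 (Φ.c y i) x) + w * G.a2 x = q * G.I2 x := fun x =>
    congrArg (fun u => u x) hq
  have hw0 : w ≠ 0 := fun hw0 => hFI q (hV.eq_smul_I hc hFV
    (DFunLike.ext _ _ fun x => by simpa [hw0] using hq' x))
  refine ⟨-w⁻¹ • F + (w⁻¹ * q - Φ.c y i) • G.I2, Submodule.add_mem _ (Submodule.smul_mem _ _ hF)
    (Submodule.smul_mem _ _ (I_mem_genSpan hy n)), fun x => ?_, ?_⟩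
  · change -w⁻¹ * F (G.L2 (Φ.c y i) x) + (w⁻¹ * q - Φ.c y i) * G.I2 (G.L2 (Φ.c y i) x) = _
    rw [G.I2_L hc, eq_sub_of_add_eq (hq' x)]
    field_simp
    ring
  · change -w⁻¹ * w + (w⁻¹ * q - Φ.c y i) * G.I2 _ = _
    rw [G.I2_W hc]
    field_simp
    simp

/-- In the situation of `exists_normalized`, the mean at time `i` is not, to first order, a function
of the later ones. -/
lemma tan_notMem_span {TV : E3 → ℝ → Prop} (hV : G.IsStable (G.bounded TV)) {y : Y}
    (hy : y ∈ Φ.U) (hQ : Q y ∈ G.bounded TV) {n i : ℕ} (hn : n + 1 ≤ m)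
    (hi : m - (n + 1) = i) (h1 : Φ.Nondeg m Q y (n + 1)) {κ : E2 →L[ℝ] ℝ}
    (hκ : κ ∈ Φ.genSpan m Q y n)
    (hκL : ∀ x, κ (G.L2 (Φ.c y i) x) = G.a2 x - Φ.c y i * G.I2 x)
    (hκW : κ (G.W3 (Φ.c y i) (Φ.b y i)) = -1) :
    G.a2.comp (Φ.tan y i) ∉
      Submodule.span ℝ (range fun j : Fin (n + 1) => G.a2.comp (Φ.tan y (m - j))) := by
  intro hmem
  have hc := c_mem hy i
  obtain ⟨g, hg⟩ := (Submodule.mem_span_range_iff_exists_fun ℝ).1 hmem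
  choose P hP hPt using fun j : Fin (n + 1) => exists_pull (Φ := Φ) (Q := Q) (m := m) (y := y)
    (Nat.lt_succ_iff.1 j.2) (by omega : n ≤ m) (a_mem_genSpan (Φ := Φ) (Q := Q) y j)
  set F := ∑ j, g j • P j with hF
  have hFS : F ∈ Φ.genSpan m Q y n := Submodule.sum_mem _ fun j _ => Submodule.smul_mem _ _ (hP j)
  have hsub : ∀ F ∈ Φ.genSpan m Q y n, F ∈ G.bounded TV := fun F hF =>
    Submodule.span_le.2 (by rintro _ ⟨j, rfl⟩; exact gen_mem hV hy hQ n j) hF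
  have e1 : m - n = i + 1 := by omega
  have hFt : F.comp (Φ.tan y (i + 1)) = G.a2.comp (Φ.tan y i) := by
    rw [← hg, hF]
    refine DFunLike.ext _ _ fun v => ?_
    have h2 : ∀ j, P j (Φ.tan y (i + 1) v) = G.a2 (Φ.tan y (m - j) v) := fun j =>
      e1 ▸ congrArg (fun u => u v) (hPt j)
    simp [h2]
  have hmem2 : Φ.back y i F - G.a2 ∈ Φ.genSpan m Q y (n + 1) :=
    Submodule.sub_mem _ (hi ▸ back_mem_genSpan hFS) (a_mem_genSpan y _)
  obtain ⟨q, hq⟩ := h1 _ hmem2 (by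
    rw [hi, ContinuousLinearMap.sub_comp, ← comp_tan_succ, hFt, sub_self])
  set w := F (G.W3 (Φ.c y i) (Φ.b y i)) with hw
  have hq' : ∀ x, F (G.L2 (Φ.c y i) x) + w * G.a2 x - G.a2 x = q * G.I2 x := fun x =>
    congrArg (fun u => u x) hq
  have h3 := hV.eq_smul_I hc (F := F - (1 - w) • κ)
    (Submodule.sub_mem _ (hsub F hFS) (Submodule.smul_mem _ _ (hsub κ hκ)))
    (q := q + (1 - w) * Φ.c y i) (DFunLike.ext _ _ fun x => by
      change F (G.L2 (Φ.c y i) x) - (1 - w) * κ (G.L2 (Φ.c y i) x) = _ * G.I2 x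
      rw [hκL]
      linear_combination hq' x)
  have h4 : w - (1 - w) * κ (G.W3 (Φ.c y i) (Φ.b y i)) =
      (q + (1 - w) * Φ.c y i) * G.I2 (G.W3 (Φ.c y i) (Φ.b y i)) :=
    congrArg (fun u => u (G.W3 (Φ.c y i) (Φ.b y i))) h3
  rw [hκW, G.I2_W hc] at h4
  linarith

/-- If the linearizations along the orbits are degenerate before time `m`, then there are curves of
conormal functionals. -/
lemma exists_nondeg_or_curve {TV : E3 → ℝ → Prop} (hTV : ∀ b s, TV b s → 0 ≤ s)
    (hD : DualApprox G.i2) (hV : G.IsStable (G.bounded TV))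
    {O : Set Y} (hO : IsOpen O) (hne : O.Nonempty) (hOU : O ⊆ Φ.U) (hQc : ContinuousOn Q O)
    (hQV : ∀ y ∈ O, Q y ∈ G.bounded TV)
    (hQ : ∀ y ∈ O, ∀ y' ∈ O, Φ.c y m = Φ.c y' m → Q y = Q y') :
    ∃ O' ⊆ O, IsOpen O' ∧ O'.Nonempty ∧ ((∀ y ∈ O', Φ.Nondeg m Q y 0) ∨
      ∃ i, ∀ y ∈ O', G.a2.comp (Φ.tan y i) ≠ 0 ∧ G.HasCurve TV (Φ.c y i)) := by
  classical
  obtain ⟨O1, hO1, ho1, hne₁, hr1⟩ := exists_open_constant (Finset.range (m + 1)) hO hne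
    (ρ := fun n y => Module.finrank ℝ (Submodule.span ℝ (range (Φ.gen m Q y n))))
    (fun n _ => ⟨_, fun y => finrank_le_card _⟩)
    fun n _ _ => eventually_finrank_le' hO (continuousOn_gen hD hOU hQc n)
  obtain ⟨O2, hO2, ho2, hne₂, hr2⟩ := exists_open_constant (Finset.range (m + 1)) ho1 hne₁
    (ρ := fun n y => Module.finrank ℝ (Submodule.span ℝ
      (range fun j => (Φ.gen m Q y n j).comp (Φ.tan y (m - n)))))
    (fun n _ => ⟨_, fun y => finrank_le_card _⟩)
    fun n _ _ => eventually_finrank_le' ho1 fun j => continuousOn_comp_tan hD (hO1.trans hOU)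
      ((continuousOn_gen hD hOU hQc n j).mono hO1) _
  obtain ⟨O3, hO3, ho3, hne3, hr3⟩ := exists_open_constant (Finset.range (m + 1)) ho2 hne₂
    (ρ := fun n y => Module.finrank ℝ (Submodule.span ℝ
      (range fun j : Fin (n + 1) => G.a2.comp (Φ.tan y (m - j)))))
    (fun n _ => ⟨_, fun y => finrank_le_card _⟩)
    fun n _ _ => eventually_finrank_le' ho2 fun j => continuousOn_comp_tan hD
      ((hO2.trans hO1).trans hOU) continuousOn_const _
  have h3O : O3 ⊆ O := hO3.trans (hO2.trans hO1)
  have h3U : O3 ⊆ Φ.U := h3O.trans hOU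
  have hND : ∀ n ≤ m, ∀ y ∈ O3, ∀ y' ∈ O3, Φ.Nondeg m Q y n → Φ.Nondeg m Q y' n := by
    intro n hn y hy y' hy' hN
    have hn' := Finset.mem_range.2 (Nat.lt_succ_of_le hn)
    rw [nondeg_iff (h3U hy)] at hN
    rw [nondeg_iff (h3U hy'), genSpan, ← hr1 n hn' y (hO2 (hO3 hy)) y' (hO2 (hO3 hy')),
      ← hr2 n hn' y (hO3 hy) y' (hO3 hy')]
    exact hN
  refine ⟨O3, h3O, ho3, hne3, ?_⟩
  by_cases h0 : ∀ y ∈ O3, Φ.Nondeg m Q y 0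
  · exact Or.inl h0
  refine Or.inr ?_
  have hex : ∃ n, ∀ y ∈ O3, Φ.Nondeg m Q y n := ⟨m, fun y _ => nondeg_zero y⟩
  obtain ⟨n, hn⟩ : ∃ n, Nat.find hex = n + 1 :=
    Nat.exists_eq_succ_of_ne_zero fun h => h0 (h ▸ Nat.find_spec hex)
  have hle : n + 1 ≤ m := hn ▸ Nat.find_min' hex fun y _ => nondeg_zero y
  have hN1 : ∀ y ∈ O3, Φ.Nondeg m Q y (n + 1) := hn ▸ Nat.find_spec hex
  have hN0 : ∀ y ∈ O3, ¬ Φ.Nondeg m Q y n := fun y hy hN =>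
    Nat.find_min hex (by omega : n < Nat.find hex) fun y' hy' => hND n (by omega) y hy y' hy' hN
  obtain ⟨i, hi⟩ : ∃ i, m - (n + 1) = i := ⟨_, rfl⟩
  have hi' : m - n = i + 1 := by omega
  choose! κ hκS hκL hκW using fun y hy =>
    exists_normalized hV (h3U hy) (hQV y (h3O hy)) hi hi' (hN1 y hy) (hN0 y hy)
  have hsub : ∀ y ∈ O3, ∀ F ∈ Φ.genSpan m Q y n, F ∈ G.bounded TV := fun y hy F hF =>
    Submodule.span_le.2 (by rintro _ ⟨j, rfl⟩; exact gen_mem hV (h3U hy) (hQV y (h3O hy)) n j) hF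
  -- the functional depends on the mean at time `i` only
  have huniq : ∀ y ∈ O3, ∀ y' ∈ O3, Φ.c y' i = Φ.c y i → κ y' = κ y := fun y hy y' hy' hcc => by
    refine sub_eq_zero.1 (hV.eq_zero _ (c_mem (h3U hy) i) _ (Submodule.sub_mem _
      (hsub y' hy' _ (hκS y' hy')) (hsub y hy _ (hκS y hy))) (DFunLike.ext _ _ fun x => ?_))
    change κ y' (G.L2 (Φ.c y i) x) - κ y (G.L2 (Φ.c y i) x) = 0
    rw [hκL y hy, ← hcc, hκL y' hy', sub_self]
  refine ⟨i, fun y hy => ?_⟩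
  have hyU := h3U hy
  have hnot := tan_notMem_span hV hyU (hQV y (h3O hy)) hle hi (hN1 y hy) (hκS y hy) (hκL y hy)
    (hκW y hy)
  have hne : G.a2.comp (Φ.tan y i) ≠ 0 := fun h => hnot (h ▸ Submodule.zero_mem _)
  refine ⟨hne, ?_⟩
  have hctan : ∀ k, ContinuousOn (fun y => G.a2.comp (Φ.tan y k)) O3 := fun k =>
    continuousOn_comp_tan hD h3U continuousOn_const k
  obtain ⟨γ, hγ0, hγc, hγ⟩ := exists_curve ho3 (f := fun (j : Fin (n + 1)) y => Φ.c y (m - j))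
    (fun j y hy => hasFDerivAt_c hD _ (h3U hy)) (fun j => hctan _)
    (fun y hy y' hy' => hr3 n (Finset.mem_range.2 (by omega)) y hy y' hy')
    (g := fun y => Φ.c y i) (fun y hy => hasFDerivAt_c hD _ (h3U hy)) (hctan i) hy hnot
  have hγO : ∀ᶠ t in 𝓝 (0 : ℝ), γ t ∈ O3 := hγc.eventually (by rw [hγ0]; exact ho3.mem_nhds hy)
  set c := Φ.c y i with hc
  have hcR : c ∈ G.R := c_mem hyU i
  have hspan : ∀ᶠ t in 𝓝 (0 : ℝ), c + t ∈ G.R ∧ κ (γ t) ∈ Submodule.span ℝ (range (Φ.gen m Q y n)) ∧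
      ∀ x, κ (γ t) (G.L2 (c + t) x) = G.a2 x - (c + t) * G.I2 x := by
    filter_upwards [hγ, hγO] with t ht htO
    rw [← ht.1, gen_congr (hQ _ (h3O hy) _ (h3O htO) (ht.2 0).symm) fun j hj =>
      (ht.2 ⟨j + 1, by omega⟩).symm]
    exact ⟨c_mem (h3U htO) i, hκS _ htO, hκL _ htO⟩
  obtain ⟨D, hDS, hDL, hDε⟩ := exists_deriv_conormal hD hV hTV Φ.eq_zero_of_comp_i3
    (f := Φ.gen m Q y n) (gen_mem hV hyU (hQV y (h3O hy)) n) (κ := fun t => κ (γ t)) hspan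
  simp only [hγ0] at hDL hDε
  -- the derivative vanishes along the orbits with the same mean
  have hDb : ∀ y' ∈ O3, Φ.c y' i = c → (D.comp (G.L2 c)) (G.i3 (Φ.b y' i)) = 0 := by
    intro y' hy' hcc
    change D (G.L2 c (G.i3 (Φ.b y' i))) = 0
    have h2 := hκW y' hy'
    rw [huniq y hy y' hy' hcc, hcc] at h2
    rw [hDL, I3_b (h3U hy') i, h2]
    norm_num
  obtain ⟨q, hq⟩ := exists_multiplier ho3 (f := fun y => Φ.c y i)
    (g := fun y' => (D.comp (G.L2 c)) (G.i3 (Φ.b y' i)))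
    (fun y hy => hasFDerivAt_c hD _ (h3U hy)) (hctan i)
    (fun y hy => hasFDerivAt_b hD (D.comp (G.L2 c)) i (h3U hy))
    (continuousOn_comp_tan hD h3U continuousOn_const i) hy hne hDb
  have hmem : D.comp (G.L2 c) - q • G.a2 ∈ Φ.genSpan m Q y (n + 1) := by
    rw [hc, ← hi]
    exact Submodule.sub_mem _ (comp_mem_genSpan hDS) (Submodule.smul_mem _ _ (a_mem_genSpan y _))
  obtain ⟨q', hq'⟩ := hN1 y hy _ hmem (by
    rw [hi, ContinuousLinearMap.sub_comp, hq, ContinuousLinearMap.smul_comp, sub_self])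
  have hq'' : ∀ x, D (G.L2 c x) - q * G.a2 x = q' * G.I2 x := fun x => congrArg (fun u => u x) hq'
  have hqc : q' = -(q * c) := by
    have h2 := hq'' (G.i3 (Φ.b y i))
    rw [show D (G.L2 c (G.i3 (Φ.b y i))) = 0 from hDb y hy rfl,
      show G.a2 (G.i3 (Φ.b y i)) = c from rfl, show G.I2 (G.i3 (Φ.b y i)) = 1 from I3_b hyU i] at h2
    linarith
  have hDκ : D = q • κ y := by
    refine sub_eq_zero.1 (hV.eq_zero c hcR _ (Submodule.sub_mem _ (hsub y hy _ hDS)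
      (Submodule.smul_mem _ _ (hsub y hy _ (hκS y hy)))) (DFunLike.ext _ _ fun x => ?_))
    change D (G.L2 c x) - q * κ y (G.L2 c x) = 0
    rw [hκL y hy, ← hc]
    linear_combination hq'' x + G.I2 x * hqc
  refine ⟨fun t => κ (γ t), q, ?_, fun ε hε => ?_⟩
  · filter_upwards [hspan, hγO] with t ht htO
    exact ⟨ht.1, hsub _ htO _ (hκS _ htO), ht.2.2⟩
  · filter_upwards [hDε ε hε] with t ht b s hb
    have h2 := ht b s hb
    rw [hDκ] at h2
    change |κ (γ t) (G.i3 b) - κ y (G.i3 b) - t * (q * κ y (G.i3 b))| ≤ _ at h2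
    simp only [hγ0]
    rwa [show κ (γ t) (G.i3 b) - (1 + q * t) * κ y (G.i3 b) =
      κ (γ t) (G.i3 b) - κ y (G.i3 b) - t * (q * κ y (G.i3 b)) by ring]

end Family

end Core

/-! ### Monotonicity across critical values -/

lemma sub_le_of_regular_aux {c1 c2 : ℝ}
    {A : ℝ × (Fin d → ℝ) → ℝ} {F : ℝ × (Fin d → ℝ) → (Fin d → ℝ)} (hA : ContDiff ℝ 1 A)
    (hF : ContDiff ℝ 1 F) {Z : ℝ → Torus d → ℝ}
    (hZc : ∀ p, ContinuousOn (fun c => Z c p) (Icc c1 c2))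
    (hZ : ∀ c ∈ Icc c1 c2, Continuous (Z c))
    (hZA : ∀ c ∈ Icc c1 c2, ∀ x, Z c (proj (F (c, x))) = A (c, x))
    (hs : ∀ c ∈ Icc c1 c2, ∀ p, ∃ x, proj (F (c, x)) = p)
    (hreg : ∀ c ∈ Ioo c1 c2, ∀ x w, (∀ u, fderiv ℝ F (c, x) (0, u) = 0 → u = 0) →
      fderiv ℝ F (c, x) (1, w) = 0 → fderiv ℝ A (c, x) (1, w) < 0)
    (h12 : c1 ≤ c2) (p : Torus d) : Z c2 p ≤ Z c1 p := by
  by_contra! hlt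
  set Ψ : ℝ × (Fin d → ℝ) → ℝ × (Fin d → ℝ) := fun q => (A q, F q) with hΨ
  have hΨc : ContDiff ℝ 1 Ψ := hA.prodMk hF
  have hΨd : ∀ q, HasFDerivAt Ψ (fderiv ℝ Ψ q) q := fun q =>
    (hΨc.differentiable one_ne_zero q).hasFDerivAt
  have hΨ' : ∀ q, fderiv ℝ Ψ q = (fderiv ℝ A q).prod (fderiv ℝ F q) := fun q =>
    DifferentiableAt.fderiv_prodMk (hA.differentiable one_ne_zero q)
      (hF.differentiable one_ne_zero q)
  -- choice of a regular value
  set S : Set (ℝ × (Fin d → ℝ)) := {q | (fderiv ℝ Ψ q).det = 0} with hS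
  have hHaar : (volume : Measure (ℝ × (Fin d → ℝ))).IsAddHaarMeasure := by
    rw [Measure.volume_eq_prod]; infer_instance
  have hnull : volume (Ψ '' S) = 0 := addHaar_image_eq_zero_of_det_fderivWithin_eq_zero volume
    (fun q _ => (hΨd q).hasFDerivWithinAt) fun q hq => hq
  have hnull' : volume (⋃ n : Fin d → ℤ,
      (fun q : ℝ × (Fin d → ℝ) => q + (0, fun k => (n k : ℝ))) ⁻¹' (Ψ '' S)) = 0 :=
    measure_iUnion_null fun n => by exact (measure_preimage_add_right _ _ _).trans hnull
  set O : Set (ℝ × (Fin d → ℝ)) := {q | Z c1 (proj q.2) < q.1 ∧ q.1 < Z c2 (proj q.2)} with hO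
  have hc1 : c1 ∈ Icc c1 c2 := left_mem_Icc.2 h12
  have hc2 : c2 ∈ Icc c1 c2 := right_mem_Icc.2 h12
  have hOo : IsOpen O :=
    (isOpen_lt ((hZ c1 hc1).comp (continuous_proj.comp continuous_snd)) continuous_fst).inter
      (isOpen_lt continuous_fst ((hZ c2 hc2).comp (continuous_proj.comp continuous_snd)))
  have hOne : O.Nonempty := by
    obtain ⟨x, rfl⟩ := proj_surjective p
    obtain ⟨v, hv⟩ := exists_between hlt
    exact ⟨(v, x), hv⟩
  obtain ⟨⟨v, P⟩, hvO, hvS⟩ : ∃ q ∈ O, q ∉ ⋃ n : Fin d → ℤ,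
      (fun q : ℝ × (Fin d → ℝ) => q + (0, fun k => (n k : ℝ))) ⁻¹' (Ψ '' S) := by
    by_contra! hcon
    exact (hOo.measure_pos volume hOne).ne' (measure_mono_null hcon hnull')
  have hvreg : ∀ (n : Fin d → ℤ) q, Ψ q = (v, P + fun k => (n k : ℝ)) →
      (fderiv ℝ Ψ q).det ≠ 0 := fun n q hq h0 =>
    hvS (mem_iUnion.2 ⟨n, q, h0, by rw [hq]; simp⟩)
  -- the last parameter where the value `v` is taken
  set K : Set ℝ := {c ∈ Icc c1 c2 | Z c (proj P) ≤ v} with hK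
  have hKne : K.Nonempty := ⟨c1, hc1, le_of_lt hvO.1⟩
  have hKb : BddAbove K := ⟨c2, fun c hc => hc.1.2⟩
  set c := sSup K with hc
  have hKcl : IsClosed K := (hZc (proj P)).preimage_isClosed_of_isClosed isClosed_Icc isClosed_Iic
  have hcK : c ∈ K := hKcl.csSup_mem hKne hKb
  have hcJ := hcK.1
  have hgt : ∀ c' ∈ Icc c1 c2, c < c' → v < Z c' (proj P) := fun c' hc' hlt => by
    by_contra! hle
    exact absurd (le_csSup hKb ⟨hc', hle⟩) (not_le.2 hlt)
  have hcc2 : c < c2 := lt_of_le_of_ne hcJ.2 fun h => by grind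
  have hZcv : Z c (proj P) = v := by
    refine le_antisymm hcK.2 ?_
    have h1 : Tendsto (fun c' => Z c' (proj P)) (𝓝[Ioo c c2] c) (𝓝 (Z c (proj P))) :=
      (hZc (proj P) c hcJ).mono_left (nhdsWithin_mono _ fun x hx => ⟨hcJ.1.trans hx.1.le, hx.2.le⟩)
    have : (𝓝[Ioo c c2] c).NeBot := left_nhdsWithin_Ioo_neBot hcc2
    refine ge_of_tendsto h1 (eventually_nhdsWithin_of_forall fun x hx => ?_)
    exact (hgt x ⟨hcJ.1.trans hx.1.le, hx.2.le⟩ hx.1).le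
  have hcc1 : c1 < c := lt_of_le_of_ne hcJ.1 fun h => by grind
  -- the local inverse at the regular point
  obtain ⟨x, hx⟩ := hs c hcJ (proj P)
  obtain ⟨n, hn⟩ := proj_eq_iff.1 hx
  have hΨx : Ψ (c, x) = (v, P + fun k => (n k : ℝ)) := by grind
  set e' := (fderiv ℝ Ψ (c, x)).toContinuousLinearEquivOfDetNeZero (hvreg n _ hΨx) with he'
  have hd : HasFDerivAt Ψ (e' : (ℝ × (Fin d → ℝ)) →L[ℝ] (ℝ × (Fin d → ℝ))) (c, x) := by fun_prop
  have hC1 : ContDiffAt ℝ 1 Ψ (c, x) := hΨc.contDiffAt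
  set e := hC1.toOpenPartialHomeomorph Ψ hd one_ne_zero with he
  have hsymm : ContDiffAt ℝ 1 e.symm (Ψ (c, x)) := hC1.to_localInverse hd one_ne_zero
  have he0 : e.symm (Ψ (c, x)) = (c, x) :=
    e.left_inv (hC1.mem_toOpenPartialHomeomorph_source hd one_ne_zero)
  set g : ℝ → ℝ × (Fin d → ℝ) := fun t => Ψ (c, x) + t • ((1, 0) : ℝ × (Fin d → ℝ)) with hg
  have hg0 : g 0 = Ψ (c, x) := by simp [hg]
  have hgd : ∀ t, HasDerivAt g (1, 0) t := fun t => by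
    have := ((hasDerivAt_id t).smul_const ((1, 0) : ℝ × (Fin d → ℝ))).const_add (Ψ (c, x))
    rwa [one_smul] at this
  have hgc : Tendsto g (𝓝 0) (𝓝 (Ψ (c, x))) := by rw [← hg0]; exact (hgd 0).continuousAt
  set q : ℝ → ℝ × (Fin d → ℝ) := fun t => e.symm (g t) with hq
  have hq0 : q 0 = (c, x) := by rw [hq]; simp only [hg0, he0]
  have hqc : Tendsto q (𝓝 0) (𝓝 (c, x)) := by
    have := hsymm.continuousAt.tendsto.comp hgc
    rwa [he0] at this
  have h1 : ∀ᶠ t in 𝓝 (0 : ℝ), DifferentiableAt ℝ e.symm (g t) := hgc.eventually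
    ((hsymm.eventually (by simp)).mono fun x hx => hx.differentiableAt one_ne_zero)
  have h2 : ∀ᶠ t in 𝓝 (0 : ℝ), Ψ (q t) = g t :=
    (hgc.eventually (e.open_target.mem_nhds
      (hC1.image_mem_toOpenPartialHomeomorph_target hd one_ne_zero))).mono fun t => e.right_inv
  have h3 : ∀ᶠ t in 𝓝 (0 : ℝ), (fderiv ℝ Ψ (q t)).det ≠ 0 :=
    hqc.eventually ((ContinuousLinearMap.continuous_det.comp
      (hΨc.continuous_fderiv one_ne_zero)).continuousAt.eventually_ne (hvreg n _ hΨx))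
  have h4 : ∀ᶠ t in 𝓝 (0 : ℝ), (q t).1 ∈ Ioo c1 c2 :=
    (continuous_fst.tendsto _).comp hqc (Ioo_mem_nhds hcc1 hcc2)
  obtain ⟨δ, hδ, hball⟩ := Metric.eventually_nhds_iff_ball.1
    (((h1.and h2.eventually_nhds).and h3).and h4)
  have hderiv : ∀ t ∈ Metric.ball (0 : ℝ) δ, ∃ c', c' ≤ 0 ∧ HasDerivAt (fun t => (q t).1) c' t := by
    intro t ht
    obtain ⟨⟨⟨hdt, heq⟩, hdet⟩, hIoo⟩ := hball t ht
    have hqd : HasDerivAt q (fderiv ℝ e.symm (g t) (1, 0)) t :=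
      hdt.hasFDerivAt.comp_hasDerivAt t (hgd t)
    obtain ⟨⟨c', w⟩, hcw⟩ : ∃ z, z = fderiv ℝ e.symm (g t) (1, 0) := ⟨_, rfl⟩
    rw [← hcw] at hqd
    have hchain : fderiv ℝ Ψ (q t) (c', w) = (1, 0) :=
      ((hΨd (q t)).comp_hasDerivAt t hqd).unique ((hgd t).congr_of_eventuallyEq heq)
    have hinj : Function.Injective (fderiv ℝ Ψ (q t)) :=
      ((fderiv ℝ Ψ (q t)).toContinuousLinearEquivOfDetNeZero hdet).injective
    refine ⟨c', ?_, (hasFDerivAt_fst (𝕜 := ℝ) (p := q t)).comp_hasDerivAt t hqd⟩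
    by_contra! hpos
    rw [hΨ'] at hchain hinj
    have hA1 : fderiv ℝ A (q t) (c', w) = 1 := congrArg Prod.fst hchain
    have hF1 : fderiv ℝ F (q t) (c', w) = 0 := congrArg Prod.snd hchain
    have e1 : ((1 : ℝ), c'⁻¹ • w) = c'⁻¹ • (c', w) := by simp [inv_mul_cancel₀ hpos.ne']
    have h5 := hreg (q t).1 hIoo (q t).2 (c'⁻¹ • w) (fun u hu => by
      have h7 : (0, u) = fderiv ℝ A (q t) (0, u) • (c', w) := hinj (by
        rw [map_smul, hchain]
        exact Prod.ext (by simp) (by simpa using hu))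
      have h8 : 0 = fderiv ℝ A (q t) (0, u) * c' := congrArg Prod.fst h7
      rw [(mul_eq_zero.1 h8.symm).resolve_right hpos.ne', zero_smul] at h7
      exact congrArg Prod.snd h7)
      (by rw [e1, map_smul]; exact smul_eq_zero_of_right _ hF1)
    rw [e1, map_smul, smul_eq_mul, show fderiv ℝ A ((q t).1, (q t).2) (c', w) = 1 from hA1,
      mul_one] at h5
    exact absurd (inv_pos.2 hpos) (not_lt.2 h5.le)
  choose! c' hc'0 hc'd using hderiv
  have hanti : AntitoneOn (fun t => (q t).1) (Metric.ball (0 : ℝ) δ) := by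
    refine antitoneOn_of_deriv_nonpos (convex_ball _ _)
      (fun t ht => (hc'd t ht).continuousAt.continuousWithinAt)
      (fun t ht => (hc'd t (interior_subset ht)).differentiableAt.differentiableWithinAt)
      fun t ht => ?_
    rw [(hc'd t (interior_subset ht)).deriv]
    exact hc'0 t (interior_subset ht)
  have ht : -(δ / 2) ∈ Metric.ball (0 : ℝ) δ := by
    rw [mem_ball_zero_iff, norm_neg, Real.norm_of_nonneg (by linarith)]; linarith
  have hle : (q 0).1 ≤ (q (-(δ / 2))).1 := hanti ht (Metric.mem_ball_self hδ) (by linarith)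
  obtain ⟨⟨⟨-, heq⟩, -⟩, hIoo⟩ := hball _ ht
  have hval := heq.self_of_nhds
  obtain ⟨hv1, hv2⟩ : A (q (-(δ / 2))) = v - δ / 2 ∧ F (q (-(δ / 2))) = P + fun k => (n k : ℝ) := by
    simp only [hg, hΨx] at hval
    exact ⟨(congrArg Prod.fst hval).trans (by simp [sub_eq_add_neg]),
      (congrArg Prod.snd hval).trans (by simp)⟩
  have hZq := hZA (q (-(δ / 2))).1 ⟨hIoo.1.le, hIoo.2.le⟩ (q (-(δ / 2))).2
  rw [Prod.mk.eta, hv1, hv2, proj_add_int] at hZq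
  rw [hq0] at hle
  rcases hle.lt_or_eq with h | h
  · grind
  · simp only [← h, hZcv] at hZq
    linarith

/-- A family of functions `Z c` on the torus which is given implicitly by
`Z c (F (c, x)) = A (c, x)`, with `F (c, ·)` surjective, satisfies `∂_c Z ≤ C` if this holds at the
points where `F (c, ·)` is regular. The critical values need not have measure zero in a given
direction, but by Sard's theorem for `(A, F)` almost all values of `Z` are crossed transversally. -/
lemma sub_le_of_regular {c1 c2 : ℝ}
    {A : ℝ × (Fin d → ℝ) → ℝ} {F : ℝ × (Fin d → ℝ) → (Fin d → ℝ)} (hA : ContDiff ℝ 1 A)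
    (hF : ContDiff ℝ 1 F) {Z : ℝ → Torus d → ℝ}
    (hZc : ∀ p, ContinuousOn (fun c => Z c p) (Icc c1 c2))
    (hZ : ∀ c ∈ Icc c1 c2, Continuous (Z c))
    (hZA : ∀ c ∈ Icc c1 c2, ∀ x, Z c (proj (F (c, x))) = A (c, x))
    (hs : ∀ c ∈ Icc c1 c2, ∀ p, ∃ x, proj (F (c, x)) = p) {C : ℝ}
    (hreg : ∀ c ∈ Ioo c1 c2, ∀ x w, (∀ u, fderiv ℝ F (c, x) (0, u) = 0 → u = 0) →
      fderiv ℝ F (c, x) (1, w) = 0 → fderiv ℝ A (c, x) (1, w) ≤ C)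
    (h12 : c1 ≤ c2) (p : Torus d) : Z c2 p - Z c1 p ≤ C * (c2 - c1) := by
  have key : ∀ η : ℝ, 0 < η → Z c2 p - Z c1 p ≤ (C + η) * (c2 - c1) := by
    intro η hη
    have h1 := sub_le_of_regular_aux (A := fun q => A q - (C + η) * q.1)
      (hA.sub (contDiff_const.mul contDiff_fst)) hF
      (Z := fun c p => Z c p - (C + η) * c) (fun p => (hZc p).sub (by fun_prop))
      (fun c hc => (hZ c hc).sub continuous_const) (fun c hc x => by rw [hZA c hc]) hs
      (fun c hc x w hinj hker => by
        have h3 := (hA.differentiable one_ne_zero (c, x)).hasFDerivAt.sub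
          ((hasFDerivAt_fst (𝕜 := ℝ) (p := (c, x))).const_mul (C + η))
        rw [show fderiv ℝ (fun q : ℝ × (Fin d → ℝ) => A q - (C + η) * q.1) (c, x) = _ from h3.fderiv]
        change fderiv ℝ A (c, x) (1, w) - (C + η) * 1 < 0
        linarith [hreg c hc x w hinj hker]) h12 p
    linarith
  refine le_of_forall_pos_le_add fun ε hε => ?_
  have h1 := key (ε / (c2 - c1 + 1)) (div_pos hε (by linarith))
  have h2 : ε / (c2 - c1 + 1) * (c2 - c1) ≤ ε := by
    rw [div_mul_eq_mul_div, div_le_iff₀ (by linarith)]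
    nlinarith
  linarith

/-! ### Regular points of the coupled maps -/

section Volume

lemma volume_preimage_proj {A : Set (Torus d)} (hA : MeasurableSet A) :
    volume ((proj : (Fin d → ℝ) → Torus d) ⁻¹' A) = 0 ↔ volume A = 0 := by
  set D : Set (Fin d → ℝ) := univ.pi fun _ => Ioc 0 (0 + 1) with hD
  have hmp : MeasurePreserving (proj : (Fin d → ℝ) → Torus d) (volume.restrict D) volume := by
    have h := measurePreserving_pi _ _ fun _ : Fin d => UnitAddCircle.measurePreserving_mk 0
    have h' := Measure.restrict_pi_pi (fun _ : Fin d => (volume : Measure ℝ))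
      (fun _ => Ioc (0 : ℝ) (0 + 1))
    rwa [← h'] at h
  have hm : MeasurableSet ((proj : (Fin d → ℝ) → Torus d) ⁻¹' A) := continuous_proj.measurable hA
  have h1 : volume A = volume (proj ⁻¹' A ∩ D) := by
    rw [← hmp.measure_preimage hA.nullMeasurableSet, Measure.restrict_apply hm]
  refine ⟨fun h => h1.trans (measure_mono_null inter_subset_left h), fun h => ?_⟩
  have h2 : volume (⋃ n : Fin d → ℤ, (fun x : Fin d → ℝ => x + fun k => (n k : ℝ)) ⁻¹'
      (proj ⁻¹' A ∩ D)) = 0 := measure_iUnion_null fun n =>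
    (measure_preimage_add_right volume _ _).trans (h1.symm.trans h)
  refine measure_mono_null (fun x hx => ?_) h2
  refine mem_iUnion.2 ⟨fun k => 1 - ⌈x k⌉, ?_, ?_⟩
  · change proj _ ∈ A
    rw [proj_add_int]; exact hx
  · refine mem_univ_pi.2 fun k => ?_
    have h3 := Int.ceil_lt_add_one (x k)
    have h4 := Int.le_ceil (x k)
    simp only [Pi.add_apply, Int.cast_sub, Int.cast_one]
    exact ⟨by linarith, by linarith⟩

/-- There are smooth probability densities with support in a given open set. -/
lemma exists_density {O : Set (Torus d)} (hO : IsOpen O) {x : Torus d} (hx : x ∈ O) :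
    ∃ ψ : Smooth d, (∀ y, 0 ≤ ψ y) ∧ ∫ y, ψ y = 1 ∧ ∀ y, y ∉ O → ψ y = 0 := by
  obtain ⟨f, hf0, hf1, -⟩ := exists_continuous_zero_one_of_isClosed hO.isClosed_compl
    (isClosed_singleton (x := x)) (disjoint_singleton_right.2 fun h => h hx)
  obtain ⟨φ, hφ⟩ := exists_smooth_unif f.continuous (ε := 1 / 4) (by norm_num)
  let χ : Smooth d := ⟨fun y => Real.smoothTransition (φ y - 1 / 2),
    Real.smoothTransition.contDiff.comp (ContDiff.sub φ.2 contDiff_const)⟩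
  have hχ0 : ∀ y, 0 ≤ χ y := fun y => Real.smoothTransition.nonneg _
  have hχx : 0 < χ x := by
    refine Real.smoothTransition.pos_of_pos ?_
    have h1 := abs_lt.1 (hφ x)
    rw [hf1 rfl] at h1
    simp only [Pi.one_apply] at h1
    linarith [h1.1]
  have hχO : ∀ y, y ∉ O → χ y = 0 := fun y hy => by
    refine Real.smoothTransition.zero_of_nonpos ?_
    have h1 := abs_lt.1 (hφ y)
    rw [hf0 hy] at h1
    simp only [Pi.zero_apply] at h1
    linarith [h1.2]
  have hpos : 0 < ∫ y, χ y := χ.continuous.integral_pos_of_hasCompactSupport_nonneg_nonzero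
    (HasCompactSupport.of_compactSpace _) hχ0 hχx.ne'
  refine ⟨⟨fun y => (∫ y, χ y)⁻¹ * χ y, contDiff_const.mul χ.2⟩,
    fun y => mul_nonneg (inv_nonneg.2 hpos.le) (hχ0 y), ?_, fun y hy => ?_⟩
  · change ∫ y, (∫ y, χ y)⁻¹ * χ y = 1
    rw [integral_const_mul, inv_mul_cancel₀ hpos.ne']
  · change _ * χ y = 0
    rw [hχO y hy, mul_zero]

end Volume

namespace CoupledSystem

variable (F ν)

/-- A lift to `ℝ^d` of the coupled maps, jointly with the parameter. -/
noncomputable def lift (q : ℝ × (Fin d → ℝ)) : Fin d → ℝ :=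
  Classical.choose F.T_smooth q.2 + q.1 • fun k => ν * F.β k (proj q.2)

lemma contDiff_lift : ContDiff ℝ ∞ (F.lift ν) := by
  refine ((Classical.choose_spec F.T_smooth).1.comp contDiff_snd).add (contDiff_fst.smul
    (contDiff_pi.2 fun k => contDiff_const.mul ?_))
  have h : ContDiff ℝ ∞ fun x : Fin d → ℝ => F.β k (proj x) := (F.β k).2
  exact h.comp contDiff_snd

lemma proj_lift (c : ℝ) (x : Fin d → ℝ) : proj (F.lift ν (c, x)) = F.coupled ν c (proj x) := by
  rw [lift, proj_add, (Classical.choose_spec F.T_smooth).2, coupled]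
  congr 2
  funext k
  change c * (ν * _) = _
  ring

lemma hasFDerivAt_lift (q : ℝ × (Fin d → ℝ)) :
    HasFDerivAt (F.lift ν) (fderiv ℝ (F.lift ν) q) q :=
  ((F.contDiff_lift ν).differentiable (by simp) q).hasFDerivAt

/-- The derivative of the lift with respect to the space variable. -/
noncomputable def liftD (c : ℝ) (x : Fin d → ℝ) : (Fin d → ℝ) →L[ℝ] (Fin d → ℝ) :=
  (fderiv ℝ (F.lift ν) (c, x)).comp (ContinuousLinearMap.inr ℝ ℝ (Fin d → ℝ))

lemma contDiff_lift_snd (c : ℝ) : ContDiff ℝ ∞ fun x => F.lift ν (c, x) :=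
  (F.contDiff_lift ν).comp (contDiff_const.prodMk contDiff_id)

lemma hasFDerivAt_lift_snd (c : ℝ) (x : Fin d → ℝ) :
    HasFDerivAt (fun x => F.lift ν (c, x)) (F.liftD ν c x) x :=
  (F.hasFDerivAt_lift ν (c, x)).comp x (hasFDerivAt_prodMk_right c x)

/-- `x` is a regular point of the coupled map with parameter `c`. -/
def IsReg (c : ℝ) (x : Fin d → ℝ) : Prop := (F.liftD ν c x).det ≠ 0

variable {F ν}

lemma isReg_of_injective {c : ℝ} {x : Fin d → ℝ}
    (h : ∀ u, fderiv ℝ (F.lift ν) (c, x) (0, u) = 0 → u = 0) : F.IsReg ν c x := fun h0 =>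
  LinearMap.det_eq_zero_iff_ker_ne_bot.1 h0 ((Submodule.eq_bot_iff _).2 fun u hu => h u hu)

/-- The determinant of the derivative is a polynomial in `c`. -/
lemma eventually_isReg {c' : ℝ} {x : Fin d → ℝ} (h : F.IsReg ν c' x) (c : ℝ) :
    ∀ᶠ t in 𝓝[≠] (0 : ℝ), F.IsReg ν (c + t) x := by
  set G := Classical.choose F.T_smooth
  have hG : DifferentiableAt ℝ G x :=
    (Classical.choose_spec F.T_smooth).1.differentiable (by simp) x
  have hβ : DifferentiableAt ℝ (fun x : Fin d → ℝ => fun k => ν * F.β k (proj x)) x := by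
    have h1 : ContDiff ℝ ∞ (fun x : Fin d → ℝ => fun k => ν * F.β k (proj x)) :=
      contDiff_pi.2 fun k => contDiff_const.mul (F.β k).2
    exact h1.differentiable (by simp) x
  set A := fderiv ℝ G x
  set A' := fderiv ℝ (fun x : Fin d → ℝ => fun k => ν * F.β k (proj x)) x
  have hD : ∀ c, F.liftD ν c x = A + c • A' := fun c =>
    (F.hasFDerivAt_lift_snd ν c x).unique (hG.hasFDerivAt.add (hβ.hasFDerivAt.const_smul c))
  set p : Polynomial ℝ := Matrix.det ((LinearMap.toMatrix' A.toLinearMap).map Polynomial.C +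
    (Polynomial.X : Polynomial ℝ) • (LinearMap.toMatrix' A'.toLinearMap).map Polynomial.C)
  have hp : ∀ c, p.eval c = (F.liftD ν c x).det := fun c => by
    rw [hD, ContinuousLinearMap.det, ← LinearMap.det_toMatrix']
    change Polynomial.evalRingHom c p = _
    rw [RingHom.map_det]
    congr 1
    ext i j
    simp [RingHom.mapMatrix_apply]
    ring
  have hp0 : p ≠ 0 := fun h0 => h (by rw [← hp, h0, Polynomial.eval_zero])
  have hfin : ((p.roots.toFinset : Set ℝ) \ {c}).Finite := (Finset.finite_toSet _).subset sdiff_subset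
  have h1 : ∀ᶠ s in 𝓝 c, s ∉ (p.roots.toFinset : Set ℝ) \ {c} :=
    hfin.isClosed.isOpen_compl.mem_nhds fun h => h.2 rfl
  have h2 : Tendsto (fun t : ℝ => c + t) (𝓝 0) (𝓝 c) := by
    have h3 : Continuous fun t : ℝ => c + t := by fun_prop
    simpa using h3.tendsto 0
  filter_upwards [(h2.eventually h1).filter_mono nhdsWithin_le_nhds, self_mem_nhdsWithin] with t ht ht0
  intro hdet
  refine ht ⟨?_, fun h3 => ht0 (by simpa using h3)⟩
  rw [Finset.mem_coe, Multiset.mem_toFinset, Polynomial.mem_roots hp0, Polynomial.IsRoot, hp, hdet]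

lemma IsReg.hasStrictFDerivAt {c : ℝ} {x : Fin d → ℝ} (h : F.IsReg ν c x) :
    HasStrictFDerivAt (fun x => F.lift ν (c, x))
      (((F.liftD ν c x).toContinuousLinearEquivOfDetNeZero h : (Fin d → ℝ) ≃L[ℝ] (Fin d → ℝ)) :
        (Fin d → ℝ) →L[ℝ] (Fin d → ℝ)) x := by
  have h1 : HasStrictFDerivAt (fun x => F.lift ν (c, x)) (F.liftD ν c x) x :=
    (F.contDiff_lift_snd ν c).contDiffAt.hasStrictFDerivAt' (F.hasFDerivAt_lift_snd ν c x) (by simp)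
  have h2 := ContinuousLinearMap.coe_toContinuousLinearEquivOfDetNeZero (F.liftD ν c x) h
  exact h2.symm ▸ h1

/-- If `ζ ∘ T_c` is smooth, then `ζ` is strictly differentiable at the images of regular points. -/
lemma IsReg.exists_strict {c : ℝ} {x : Fin d → ℝ} (h : F.IsReg ν c x) (g : Smooth d)
    {ζ : Torus d → ℝ} (hζ : ∀ p, ζ (F.coupled ν c p) = g p) :
    ∃ H : (Fin d → ℝ) →L[ℝ] ℝ, HasStrictFDerivAt (fun q => ζ (proj q)) H (F.lift ν (c, x)) := by
  have hs := h.hasStrictFDerivAt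
  set Φ := HasStrictFDerivAt.localInverse (𝕜 := ℝ) (fun x => F.lift ν (c, x)) _ x hs
  have hg : ContDiff ℝ ∞ fun x : Fin d → ℝ => g (proj x) := g.2
  have h1 := (hg.contDiffAt (x := Φ (F.lift ν (c, x)))).hasStrictFDerivAt
    (show (∞ : WithTop ℕ∞) ≠ 0 by simp)
  have h2 := h1.comp (F.lift ν (c, x)) hs.to_localInverse
  refine ⟨_, h2.congr_of_eventuallyEq ?_⟩
  filter_upwards [hs.eventually_right_inverse] with q hq
  rw [← hζ, ← F.proj_lift, hq]

/-- The coupled map is non-singular near a regular point. -/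
lemma IsReg.exists_null {c : ℝ} {x : Fin d → ℝ} (h : F.IsReg ν c x) :
    ∃ O, IsOpen O ∧ x ∈ O ∧ ∀ A : Set (Torus d), MeasurableSet A → volume A = 0 →
      volume (O ∩ {y | F.coupled ν c (proj y) ∈ A}) = 0 := by
  have hC := ((F.contDiff_lift_snd ν c).contDiffAt (x := x)).of_le
    (show (1 : WithTop ℕ∞) ≤ ∞ by exact_mod_cast le_top)
  have hd := h.hasStrictFDerivAt.hasFDerivAt
  set e := hC.toOpenPartialHomeomorph _ hd one_ne_zero
  have hx : x ∈ e.source := hC.mem_toOpenPartialHomeomorph_source hd one_ne_zero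
  have hsymm : ContDiffAt ℝ 1 e.symm (e x) := hC.to_localInverse hd one_ne_zero
  have h1 : ∀ᶠ q in 𝓝 (e x), DifferentiableAt ℝ e.symm q :=
    (hsymm.eventually (by simp)).mono fun q hq => hq.differentiableAt one_ne_zero
  obtain ⟨V, hV, hVo, hxV⟩ := eventually_nhds_iff.1 h1
  refine ⟨e.source ∩ e ⁻¹' V, e.isOpen_inter_preimage hVo, ⟨hx, hxV⟩, fun A hA hA0 => ?_⟩
  have h2 : volume (e.symm '' (V ∩ proj ⁻¹' A)) = 0 :=
    addHaar_image_eq_zero_of_differentiableOn_of_addHaar_eq_zero volume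
      (fun q hq => (hV q hq.1).differentiableWithinAt)
      (measure_mono_null inter_subset_right ((volume_preimage_proj hA).2 hA0))
  refine measure_mono_null (fun y hy => ?_) h2
  refine ⟨e y, ⟨hy.1.2, ?_⟩, e.left_inv hy.1.1⟩
  have h3 : F.coupled ν c (proj y) ∈ A := hy.2
  rwa [← F.proj_lift] at h3

/-- The critical points, as a subset of the torus. -/
def crit (F : CoupledSystem d) (ν c : ℝ) : Set (Torus d) := proj '' {x | ¬ F.IsReg ν c x}

lemma isClosed_not_isReg (c : ℝ) : IsClosed {x | ¬ F.IsReg ν c x} := by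
  have h1 : Continuous fun x => (F.liftD ν c x).det := by
    have h2 : Continuous fun x : Fin d → ℝ => fderiv ℝ (F.lift ν) (c, x) :=
      ((F.contDiff_lift ν).continuous_fderiv (by simp)).comp (by fun_prop)
    exact ContinuousLinearMap.continuous_det.comp (h2.clm_comp continuous_const)
  have h3 : {x | ¬ F.IsReg ν c x} = {x | (F.liftD ν c x).det = 0} := ext fun x => not_not
  rw [h3]
  exact isClosed_eq h1 continuous_const

lemma measurableSet_image_crit (c : ℝ) : MeasurableSet (F.coupled ν c '' F.crit ν c) := by
  obtain ⟨K, hK, h⟩ := ((isSigmaCompact_univ.of_isClosed_subset (isClosed_not_isReg (F := F)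
    (ν := ν) c) (subset_univ _)).image continuous_proj).image (continuous_coupled F ν c)
  rw [crit, ← h]
  exact MeasurableSet.iUnion fun n => (hK n).measurableSet

/-- The critical values have measure zero. -/
lemma volume_image_crit (c : ℝ) : volume (F.coupled ν c '' F.crit ν c) = 0 := by
  rw [← volume_preimage_proj (measurableSet_image_crit c)]
  have h1 : volume ((fun x => F.lift ν (c, x)) '' {x | ¬ F.IsReg ν c x}) = 0 :=
    addHaar_image_eq_zero_of_det_fderivWithin_eq_zero volume
      (fun x _ => (F.hasFDerivAt_lift_snd ν c x).hasFDerivWithinAt) fun x hx => not_not.1 hx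
  have h2 : volume (⋃ n : Fin d → ℤ, (fun x : Fin d → ℝ => x + fun k => (n k : ℝ)) ⁻¹'
      ((fun x => F.lift ν (c, x)) '' {x | ¬ F.IsReg ν c x})) = 0 :=
    measure_iUnion_null fun n => (measure_preimage_add_right volume _ _).trans h1
  refine measure_mono_null (fun q hq => ?_) h2
  obtain ⟨_, ⟨x, hx, rfl⟩, hxq⟩ := hq
  rw [← F.proj_lift] at hxq
  obtain ⟨n, hn⟩ := proj_eq_iff.1 hxq
  exact mem_iUnion.2 ⟨n, x, hx, hn⟩

/-- A surjective coupled map does not map a null set and its complement to null sets. -/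
lemma absolutelyContinuous_map {c : ℝ} (hs : Function.Surjective (F.coupled ν c)) :
    (volume : Measure (Torus d)) ≪ volume.map (F.coupled ν c) := by
  have hm := (continuous_coupled F ν c).measurable
  refine Measure.AbsolutelyContinuous.mk fun A hA h0 => ?_
  rw [Measure.map_apply hm hA, ← volume_preimage_proj (hm hA)] at h0
  rw [← volume_preimage_proj hA]
  have h1 : volume ((fun x => F.lift ν (c, x)) '' (proj ⁻¹' (F.coupled ν c ⁻¹' A))) = 0 :=
    addHaar_image_eq_zero_of_differentiableOn_of_addHaar_eq_zero volume
      (fun x _ => (F.hasFDerivAt_lift_snd ν c x).differentiableAt.differentiableWithinAt) h0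
  have h2 : volume (⋃ n : Fin d → ℤ, (fun x : Fin d → ℝ => x + fun k => (n k : ℝ)) ⁻¹'
      ((fun x => F.lift ν (c, x)) '' (proj ⁻¹' (F.coupled ν c ⁻¹' A)))) = 0 :=
    measure_iUnion_null fun n => (measure_preimage_add_right volume _ _).trans h1
  refine measure_mono_null (fun q hq => ?_) h2
  obtain ⟨p, hp⟩ := hs (proj q)
  obtain ⟨x, rfl⟩ := proj_surjective p
  have hp' := hp
  rw [← F.proj_lift] at hp'
  obtain ⟨n, hn⟩ := proj_eq_iff.1 hp'
  refine mem_iUnion.2 ⟨n, x, ?_, hn⟩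
  change F.coupled ν c (proj x) ∈ A
  rw [hp]; exact hq

/-- Absolutely continuous measures have absolutely continuous preimages under surjective coupled
maps, which give no mass to the critical points. -/
lemma exists_map_eq {c : ℝ} (hs : Function.Surjective (F.coupled ν c)) {μ : Measure (Torus d)}
    [IsProbabilityMeasure μ] (hμ : μ ≪ volume) :
    ∃ μ' : Measure (Torus d), IsProbabilityMeasure μ' ∧ μ' ≪ volume ∧
      μ'.map (F.coupled ν c) = μ ∧ μ' (F.crit ν c) = 0 := by
  have hm := (continuous_coupled F ν c).measurable
  have : IsFiniteMeasure (volume.map (F.coupled ν c)) := Measure.isFiniteMeasure_map _ _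
  set k := μ.rnDeriv (volume.map (F.coupled ν c))
  have hk : Measurable k := Measure.measurable_rnDeriv _ _
  set μ' : Measure (Torus d) := volume.withDensity fun x => k (F.coupled ν c x)
  have hmap : μ'.map (F.coupled ν c) = μ := by
    rw [← Measure.withDensity_rnDeriv_eq μ _ (hμ.trans (absolutelyContinuous_map hs))]
    ext A hA
    rw [Measure.map_apply hm hA, withDensity_apply _ (hm hA), withDensity_apply _ hA,
      setLIntegral_map hA hk hm]
  refine ⟨μ', ⟨?_⟩, withDensity_absolutelyContinuous _ _, hmap, ?_⟩
  · have h1 := Measure.map_apply (μ := μ') hm MeasurableSet.univ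
    rw [hmap, measure_univ, preimage_univ] at h1
    exact h1.symm
  · refine measure_mono_null (subset_preimage_image (F.coupled ν c) _) ?_
    rw [← Measure.map_apply hm (measurableSet_image_crit c), hmap]
    exact hμ (volume_image_crit c)

end CoupledSystem

/-- Absolutely continuous measures are approximated by smooth densities in total variation. -/
lemma exists_smooth_approx {μ : Measure (Torus d)} [IsProbabilityMeasure μ]
    (hμ : μ ≪ volume) {ε : ℝ} (hε : 0 < ε) : ∃ ψ : Smooth d, ∀ (f : Torus d → ℝ) (M : ℝ),
      Continuous f → (∀ x, |f x| ≤ M) → |(∫ x, f x ∂μ) - ∫ x, ψ x * f x| ≤ ε * M := by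
  set k : Torus d → ℝ := fun x => (μ.rnDeriv volume x).toReal
  have hk : Integrable k := Measure.integrable_toReal_rnDeriv
  obtain ⟨g, hg, hgi⟩ := hk.exists_boundedContinuous_integral_sub_le (ε := ε / 2) (by positivity)
  obtain ⟨ψ, hψ⟩ := exists_smooth_unif g.continuous (ε := ε / 2) (by positivity)
  have hψi := integrable_of_continuous ψ.continuous (volume : Measure (Torus d))
  have h1 : ∫ x, |k x - ψ x| ≤ ε := by
    have h2 : ∫ x, (‖k x - g x‖ + ε / 2) ≤ ε := by
      have h5 := integral_add (hk.sub hgi).norm (integrable_const (ε / 2))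
      rw [integral_const, measureReal_univ_torus, one_smul] at h5
      refine h5.trans_le ?_
      change (∫ x, ‖k x - g x‖) + _ ≤ _
      linarith
    refine (integral_mono (hk.sub hψi).norm ((hk.sub hgi).norm.add (integrable_const _))
      fun x => ?_).trans h2
    have h3 := abs_sub_le (k x) (g x) (ψ x)
    have h4 := hψ x
    rw [abs_sub_comm] at h4
    change |k x - ψ x| ≤ |k x - g x| + ε / 2
    linarith
  refine ⟨ψ, fun f M hf hM => ?_⟩
  have hfk : Integrable fun x => k x * f x :=
    (hk.bdd_mul hf.aestronglyMeasurable (ae_of_all _ hM)).congr (ae_of_all _ fun x => mul_comm _ _)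
  rw [← integral_rnDeriv_smul hμ]
  change |(∫ x, k x * f x) - _| ≤ _
  have hψf : Integrable fun x => ψ x * f x := integrable_of_continuous (ψ.continuous.mul hf) _
  rw [← integral_sub hfk hψf, ← Real.norm_eq_abs]
  refine (norm_integral_le_integral_norm _).trans ?_
  refine (integral_mono (hfk.sub hψf).norm ((hk.sub hψi).norm.mul_const M) fun x => ?_).trans ?_
  · change |k x * f x - ψ x * f x| ≤ |k x - ψ x| * M
    rw [← sub_mul, abs_mul]
    exact mul_le_mul_of_nonneg_left (hM x) (abs_nonneg _)
  · rw [integral_mul_const]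
    have hM0 : 0 ≤ M := (abs_nonneg _).trans (hM 0)
    exact mul_le_mul_of_nonneg_right h1 hM0

namespace CoupledSystem

/-- The derivative of the function `α` in a direction, on the universal cover. -/
noncomputable def dα (F : CoupledSystem d) (x w : Fin d → ℝ) : ℝ :=
  fderiv ℝ (fun x : Fin d → ℝ => F.α (proj x)) x w

lemma hasFDerivAt_α (F : CoupledSystem d) (x : Fin d → ℝ) :
    HasFDerivAt (fun x : Fin d → ℝ => F.α (proj x)) (fderiv ℝ (fun x => F.α (proj x)) x) x := by
  have h : ContDiff ℝ ∞ fun x : Fin d → ℝ => F.α (proj x) := F.α.2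
  exact (h.differentiable (by simp) x).hasFDerivAt

lemma continuous_coupled_uncurry (F : CoupledSystem d) (ν : ℝ) :
    Continuous fun q : ℝ × Torus d => F.coupled ν q.1 q.2 := by
  refine (F.T_smooth.continuous.comp continuous_snd).add
    (continuous_proj.comp (continuous_pi fun k => ?_))
  exact (continuous_const.mul ((F.β k).continuous.comp continuous_snd)).mul continuous_fst

/-- Functions that are determined by `ζ c ∘ T_c = α - c` are continuous, jointly in `c`. -/
lemma continuousOn_of_comp_coupled {c1 c2 : ℝ}
    (hs : ∀ c ∈ Icc c1 c2, Function.Surjective (F.coupled ν c)) {ζ : ℝ → Torus d → ℝ}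
    (hζ : ∀ c ∈ Icc c1 c2, ∀ p, ζ c (F.coupled ν c p) = F.α p - c) :
    ContinuousOn (fun q : ℝ × Torus d => ζ q.1 q.2) (Icc c1 c2 ×ˢ univ) := by
  let Q : Icc c1 c2 × Torus d → Icc c1 c2 × Torus d := fun q => (q.1, F.coupled ν q.1 q.2)
  have hQ : Continuous Q := continuous_fst.prodMk ((F.continuous_coupled_uncurry ν).comp
    ((continuous_subtype_val.comp continuous_fst).prodMk continuous_snd))
  have hQs : Function.Surjective Q := fun q => by
    obtain ⟨p, hp⟩ := hs q.1 q.1.2 q.2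
    exact ⟨(q.1, p), Prod.ext rfl hp⟩
  have hcont : Continuous fun q : Icc c1 c2 × Torus d => ζ q.1 q.2 := by
    refine (hQ.isClosedMap.isQuotientMap hQ hQs).continuous_iff.2 ?_
    have : (fun q : Icc c1 c2 × Torus d => ζ q.1 q.2) ∘ Q = fun q => F.α q.2 - q.1 :=
      funext fun q => hζ q.1 q.1.2 q.2
    rw [this]
    exact (F.α.continuous.comp continuous_snd).sub (continuous_subtype_val.comp continuous_fst)
  rintro ⟨c, p⟩ ⟨hc, -⟩
  have hi : IsInducing fun q : Icc c1 c2 × Torus d => ((q.1 : ℝ), q.2) :=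
    IsInducing.subtypeVal.prodMap IsInducing.id
  have h2 : range (fun q : Icc c1 c2 × Torus d => ((q.1 : ℝ), q.2)) = Icc c1 c2 ×ˢ univ := by
    ext ⟨a, b⟩
    simp
  have h3 := hi.map_nhds_eq (⟨c, hc⟩, p)
  rw [h2] at h3
  rw [ContinuousWithinAt, ← h3]
  exact tendsto_map'_iff.2 (hcont.tendsto _)

/-- A bound at the regular points gives the dependence on `c` of the functions that are determined
by `ζ c ∘ T_c = α - c`. -/
lemma abs_sub_le_of_isReg {c1 c2 c0 l C : ℝ} (h12 : c1 ≤ c2)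
    (hs : ∀ c ∈ Icc c1 c2, Function.Surjective (F.coupled ν c)) {ζ : ℝ → Torus d → ℝ}
    (hζ : ∀ c ∈ Icc c1 c2, ∀ p, ζ c (F.coupled ν c p) = F.α p - c)
    (hl : ∀ c ∈ Icc c1 c2, |l * (c - c0)| ≤ 1)
    (hreg : ∀ c ∈ Ioo c1 c2, ∀ x w, F.IsReg ν c x → fderiv ℝ (F.lift ν) (c, x) (1, w) = 0 →
      |F.dα x w - 1 + l * (F.α (proj x) - c)| ≤ C) (p : Torus d) :
    |ζ c2 p * Real.exp (l * (c2 - c0)) - ζ c1 p * Real.exp (l * (c1 - c0))| ≤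
      3 * C * (c2 - c1) := by
  have hcont := continuousOn_of_comp_coupled hs hζ
  have key : ∀ s : ℝ, |s| = 1 → s * (ζ c2 p * Real.exp (l * (c2 - c0))) -
      s * (ζ c1 p * Real.exp (l * (c1 - c0))) ≤ 3 * C * (c2 - c1) := by
    intro s hs1
    have hα : ContDiff ℝ 1 fun x : Fin d → ℝ => F.α (proj x) :=
      ContDiff.of_le F.α.2 (by exact_mod_cast le_top)
    refine sub_le_of_regular
      (A := fun q => s * ((F.α (proj q.2) - q.1) * Real.exp (l * (q.1 - c0))))
      (F := F.lift ν) (Z := fun c p => s * (ζ c p * Real.exp (l * (c - c0))))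
      ?_ ((F.contDiff_lift ν).of_le (by exact_mod_cast le_top)) ?_ ?_ ?_ ?_ ?_ h12 p
    · have h1 : ContDiff ℝ 1 fun q : ℝ × (Fin d → ℝ) => F.α (proj q.2) := hα.comp contDiff_snd
      fun_prop
    · intro p
      refine continuousOn_const.mul (ContinuousOn.mul ?_ (by fun_prop))
      exact hcont.comp (f := fun c : ℝ => (c, p)) (by fun_prop) fun c hc => ⟨hc, trivial⟩
    · intro c hc
      refine continuous_const.mul (Continuous.mul ?_ continuous_const)
      exact hcont.comp_continuous (f := fun p => (c, p)) (by fun_prop) fun p => ⟨hc, trivial⟩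
    · intro c hc x
      rw [F.proj_lift, hζ c hc]
    · intro c hc p
      obtain ⟨q, hq⟩ := hs c hc p
      obtain ⟨x, rfl⟩ := proj_surjective q
      exact ⟨x, by rw [F.proj_lift, hq]⟩
    · intro c hc x w hinj hker
      have hA : DifferentiableAt ℝ (fun q : ℝ × (Fin d → ℝ) =>
          s * ((F.α (proj q.2) - q.1) * Real.exp (l * (q.1 - c0)))) (c, x) := by
        have h1 : DifferentiableAt ℝ (fun q : ℝ × (Fin d → ℝ) => F.α (proj q.2)) (c, x) :=
          (hα.comp contDiff_snd).differentiable one_ne_zero _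
        fun_prop
      have hline : HasDerivAt (fun t : ℝ => (c, x) + t • ((1 : ℝ), w)) (1, w) 0 := by
        have := ((hasDerivAt_id (0 : ℝ)).smul_const ((1 : ℝ), w)).const_add (c, x)
        rwa [one_smul] at this
      have h1 := HasFDerivAt.comp_hasDerivAt_of_eq (0 : ℝ) hA.hasFDerivAt hline (by simp)
      have h2 : HasDerivAt (fun t : ℝ => F.α (proj (x + t • w))) (F.dα x w) 0 := by
        have h3 : HasDerivAt (fun t : ℝ => x + t • w) w 0 := by
          have := ((hasDerivAt_id (0 : ℝ)).smul_const w).const_add x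
          rwa [one_smul] at this
        exact HasFDerivAt.comp_hasDerivAt_of_eq (0 : ℝ) (F.hasFDerivAt_α x) h3 (by simp)
      have h4 : HasDerivAt (fun t : ℝ => c + t) 1 0 := (hasDerivAt_id (0 : ℝ)).const_add c
      have h5 := ((h2.sub h4).mul ((h4.sub_const c0).const_mul l).exp).const_mul s
      have h6 := h1.unique (h5.congr_of_eventuallyEq (Eventually.of_forall fun t => by
        simp [Function.comp]))
      rw [h6]
      have h7 := hreg c hc x w (isReg_of_injective hinj) hker
      have h8 := hl c ⟨hc.1.le, hc.2.le⟩
      set e := Real.exp (l * (c - c0))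
      have h9 : e ≤ 3 := by
        refine (Real.exp_le_exp.2 ((le_abs_self _).trans h8)).trans ?_
        have := Real.exp_one_lt_d9
        linarith
      have h10 : 0 ≤ e := (Real.exp_pos _).le
      have e1 : s * ((F.dα x w - 1) * e + (F.α (proj x) - c) * (e * (l * 1))) =
          e * (s * (F.dα x w - 1 + l * (F.α (proj x) - c))) := by ring
      simp only [zero_smul, add_zero, Pi.sub_apply]
      rw [e1]
      refine (le_abs_self _).trans ?_
      rw [abs_mul, abs_mul, hs1, one_mul, abs_of_nonneg h10]
      exact mul_le_mul h9 h7 (abs_nonneg _) (by norm_num)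
  rw [abs_le]
  have h1 := key 1 abs_one
  have h2 := key (-1) (by simp)
  constructor <;> linarith

/-- The derivative with respect to the parameter of the composition with the coupled maps of a
function `ζ` such that `ζ ∘ T_c = α - c`, near a regular point. -/
lemma IsReg.exists_local {c : ℝ} {x w : Fin d → ℝ} (hx : F.IsReg ν c x)
    (hw : fderiv ℝ (F.lift ν) (c, x) (1, w) = 0) {ζ : Torus d → ℝ}
    (hζ : ∀ p, ζ (F.coupled ν c p) = F.α p - c) {ε : ℝ} (hε : 0 < ε) :
    ∃ O : Set (Torus d), IsOpen O ∧ proj x ∈ O ∧ ∀ᶠ t in 𝓝 (0 : ℝ), ∀ z ∈ O,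
      |ζ (F.coupled ν (c + t) z) - ζ (F.coupled ν c z) + t * F.dα x w| ≤ ε * |t| := by
  obtain ⟨H, hH⟩ := hx.exists_strict ⟨fun p => F.α p - c, ContDiff.sub F.α.2 contDiff_const⟩ hζ
  have hF : HasStrictFDerivAt (F.lift ν) (fderiv ℝ (F.lift ν) (c, x)) (c, x) :=
    (F.contDiff_lift ν).contDiffAt.hasStrictFDerivAt (by simp)
  set F' := fderiv ℝ (F.lift ν) (c, x)
  have hcomp := hH.comp (c, x) hF
  have hdα : H (F' (0, w)) = F.dα x w := by
    have h1 := (hH.hasFDerivAt.comp x (F.hasFDerivAt_lift_snd ν c x)).unique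
      (((F.hasFDerivAt_α x).sub_const c).congr_of_eventuallyEq (Eventually.of_forall fun y => by
        change ζ (proj (F.lift ν (c, y))) = F.α (proj y) - c
        rw [F.proj_lift, hζ]))
    exact congrArg (fun u => u w) h1
  have h10 : H (F' (1, 0)) = -F.dα x w := by
    have h1 : ((1 : ℝ), (0 : Fin d → ℝ)) = (1, w) - (0, w) := by simp
    rw [h1, map_sub, hw, zero_sub, map_neg, hdα]
  have h2 := Asymptotics.isLittleO_iff.1 hcomp.isLittleO hε
  rw [nhds_prod_eq, eventually_prod_iff] at h2
  obtain ⟨P, hP, P', hP', h3⟩ := h2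
  obtain ⟨δ, hδ, h4⟩ := Metric.eventually_nhds_iff_ball.1 (hP.and hP')
  refine ⟨proj '' Metric.ball x δ, (isOpenQuotientMap_proj d).isOpenMap _ Metric.isOpen_ball,
    ⟨x, Metric.mem_ball_self hδ, rfl⟩, ?_⟩
  filter_upwards [Metric.ball_mem_nhds (0 : ℝ) hδ] with t ht
  rintro _ ⟨y, hy, rfl⟩
  have hy1 : (c + t, y) ∈ Metric.ball (c, x) δ := by
    rw [← ball_prod_same]
    refine ⟨?_, hy⟩
    rwa [Metric.mem_ball, dist_self_add_left, ← dist_zero_right]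
  have hy2 : (c, y) ∈ Metric.ball (c, x) δ := by
    rw [← ball_prod_same]
    exact ⟨Metric.mem_ball_self hδ, hy⟩
  have h5 := h3 (h4 _ hy1).1 (h4 _ hy2).2
  have h6 : ((c + t, y) : ℝ × (Fin d → ℝ)) - (c, y) = t • (1, 0) := by simp
  rw [h6, map_smul] at h5
  change ‖ζ (proj (F.lift ν (c + t, y))) - ζ (proj (F.lift ν (c, y))) - t * H (F' (1, 0))‖ ≤
    ε * ‖t • ((1 : ℝ), (0 : Fin d → ℝ))‖ at h5
  rw [h10, F.proj_lift, F.proj_lift, norm_smul] at h5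
  have h7 : ‖((1 : ℝ), (0 : Fin d → ℝ))‖ = 1 := by simp [Prod.norm_def]
  rw [h7, mul_one] at h5
  rw [show ζ (F.coupled ν (c + t) (proj y)) - ζ (F.coupled ν c (proj y)) + t * F.dα x w =
    ζ (F.coupled ν (c + t) (proj y)) - ζ (F.coupled ν c (proj y)) - t * -F.dα x w by ring]
  exact h5

end CoupledSystem

/-- The functional analytic data of the coupled system that is given by the variables. -/
local notation "𝐆" => BanachScale.core X hX F ν hR

/-! ### Functionals bounded by the total variation -/

namespace BanachScale

variable (X) in
/-- The total variation of `b` is at most `s`. -/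
def TV (b : B 3) (s : ℝ) : Prop := ∀ (φ : Cr d r) (t : ℝ), (∀ x, |φ x| ≤ t) → |X.J 3 b φ| ≤ s * t

lemma TV.nonneg {b : B 3} {s : ℝ} (h : X.TV b s) : 0 ≤ s := by
  have := h 0 1 fun x => by
    change |(0 : ℝ)| ≤ 1
    simp
  simpa using this

lemma Represents.tv {b : B 3} (h : X.Represents 3 b μ) :
    X.TV b 1 := fun φ t hφ => by
  have h1 := norm_integral_le_of_norm_le_const (μ := (μ : Measure (Torus d))) (f := fun x => φ x)
    (C := t) (ae_of_all _ fun x => hφ x)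
  rw [probReal_univ, mul_one] at h1
  rw [h φ, one_mul]
  exact h1

lemma TV.map {b : B 3} {s c : ℝ} (h : X.TV b s) (hc : F.coupledMap r ν c ∈ 𝒯) :
    X.TV (X.Lc F ν c 3 b) s := fun φ t hφ => by
  rw [J_Lc hc]
  exact h _ t fun x => hφ _

lemma Represents.map {b : B 3} (h : X.Represents 3 b μ)
    {c : ℝ} (hc : F.coupledMap r ν c ∈ 𝒯) : X.Represents 3 (X.Lc F ν c 3 b)
      (μ.map (f := F.coupled ν c) (continuous_coupled F ν c).aemeasurable) := fun φ => by
  rw [J_Lc hc, h]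
  exact (integral_map (continuous_coupled F ν c).aemeasurable
    φ.continuous.aestronglyMeasurable).symm

variable (X) in
/-- On elements of finite total variation the functional is given by the function `ζ`. -/
def Reps (Φ : B 2 →L[ℝ] ℝ) (ζ : Torus d → ℝ) : Prop :=
  ∀ ε > 0, ∃ φ : Cr d r, (∀ x, |ζ x - φ x| ≤ ε) ∧
    ∀ b s, X.TV b s → |Φ (X.incl 2 b) - X.J 3 b φ| ≤ ε * s

lemma Reps.sub_smul {Φ Φ' : B 2 →L[ℝ] ℝ} {ζ ζ' : Torus d → ℝ} (h : X.Reps Φ ζ)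
    (h' : X.Reps Φ' ζ') (q : ℝ) : X.Reps (Φ - q • Φ') fun x => ζ x - q * ζ' x := by
  intro ε hε
  set η := ε / (1 + |q|)
  have hq : 0 < 1 + |q| := by positivity
  have hη : 0 < η := div_pos hε hq
  have hηε : η + |q| * η = ε := by rw [← one_add_mul, mul_div_cancel₀ _ hq.ne']
  obtain ⟨φ, hφ, hφb⟩ := h η hη
  obtain ⟨φ', hφ', hφb'⟩ := h' η hη
  refine ⟨φ - q • φ', fun x => ?_, fun b s hb => ?_⟩
  · change |ζ x - q * ζ' x - (φ x - q * φ' x)| ≤ ε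
    rw [show ζ x - q * ζ' x - (φ x - q * φ' x) = (ζ x - φ x) - q * (ζ' x - φ' x) by ring]
    refine (abs_sub _ _).trans ?_
    rw [abs_mul, ← hηε]
    exact add_le_add (hφ x) (mul_le_mul_of_nonneg_left (hφ' x) (abs_nonneg _))
  · rw [map_sub, map_smul]
    change |Φ (X.incl 2 b) - q * Φ' (X.incl 2 b) - (X.J 3 b φ - q * X.J 3 b φ')| ≤ ε * s
    rw [show Φ (X.incl 2 b) - q * Φ' (X.incl 2 b) - (X.J 3 b φ - q * X.J 3 b φ') =
      (Φ (X.incl 2 b) - X.J 3 b φ) - q * (Φ' (X.incl 2 b) - X.J 3 b φ') by ring]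
    refine (abs_sub _ _).trans ?_
    rw [abs_mul, ← hηε, add_mul, mul_assoc]
    exact add_le_add (hφb b s hb) (mul_le_mul_of_nonneg_left (hφb' b s hb) (abs_nonneg _))

lemma Reps.abs_le {Φ : B 2 →L[ℝ] ℝ} {ζ : Torus d → ℝ} (h : X.Reps Φ ζ) {M : ℝ}
    (hM : ∀ x, |ζ x| ≤ M) {b : B 3} {s : ℝ} (hb : X.TV b s) : |Φ (X.incl 2 b)| ≤ M * s := by
  have hs := hb.nonneg
  refine le_of_forall_pos_le_add fun ε hε => ?_
  obtain ⟨φ, hφ, hφb⟩ := h (ε / (2 * s + 1)) (by positivity)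
  have h1 := hφb b s hb
  have h2 := hb φ (M + ε / (2 * s + 1)) fun x => by
    have := abs_sub_abs_le_abs_sub (φ x) (ζ x)
    rw [abs_sub_comm] at this
    linarith [hφ x, hM x]
  have h3 : ε / (2 * s + 1) * (2 * s) ≤ ε := by
    rw [div_mul_eq_mul_div, div_le_iff₀ (by positivity)]
    nlinarith
  have h4 := abs_sub_abs_le_abs_sub (Φ (X.incl 2 b)) (X.J 3 b φ)
  nlinarith

lemma Reps.eq_integral {Φ : B 2 →L[ℝ] ℝ} {ζ : Torus d → ℝ} (h : X.Reps Φ ζ)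
    (hζ : Continuous ζ) {b : B 3} (hb : X.Represents 3 b μ) :
    Φ (X.incl 2 b) = ∫ x, ζ x ∂μ := by
  refine eq_of_forall_dist_le fun ε hε => ?_
  obtain ⟨φ, hφ, hφb⟩ := h (ε / 2) (by positivity)
  have h1 := hφb b 1 hb.tv
  rw [hb φ] at h1
  have h2 : |(∫ x, ζ x ∂μ) - ∫ x, φ x ∂μ| ≤ ε / 2 := by
    rw [← integral_sub (integrable_of_continuous hζ _) (integrable_of_continuous φ.continuous _)]
    have := norm_integral_le_of_norm_le_const (μ := (μ : Measure (Torus d)))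
      (f := fun x => ζ x - φ x) (C := ε / 2) (ae_of_all _ fun x => hφ x)
    rwa [probReal_univ, mul_one] at this
  rw [Real.dist_eq]
  have h3 := abs_sub_le (Φ (X.incl 2 b)) (∫ x, φ x ∂μ)
    (∫ x, ζ x ∂μ)
  rw [abs_sub_comm (∫ x, φ x ∂μ)] at h3
  linarith

lemma reps_a2 : X.Reps 𝐆.a2 F.α := fun ε hε =>
  ⟨F.α.toCr r, fun x => by
    change |F.α x - F.α x| ≤ ε
    rw [sub_self, abs_zero]; exact hε.le, fun b s hb => by
    rw [show 𝐆.a2 (X.incl 2 b) = X.J 3 b (F.α.toCr r) from core_a3 b,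
      sub_self, abs_zero]
    exact mul_nonneg hε.le hb.nonneg⟩

lemma reps_I2 : X.Reps 𝐆.I2 fun _ => 1 := fun ε hε =>
  ⟨oneCr d r, fun x => by
    change |(1 : ℝ) - 1| ≤ ε
    rw [sub_self, abs_zero]; exact hε.le, fun b s hb => by
    rw [show 𝐆.I2 (X.incl 2 b) = X.J 3 b (oneCr d r) from core_I3 b,
      sub_self, abs_zero]
    exact mul_nonneg hε.le hb.nonneg⟩

lemma Reps.mem_bounded {Φ : B 2 →L[ℝ] ℝ} {ζ : Torus d → ℝ} (h : X.Reps Φ ζ)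
    (hζ : Continuous ζ) : Φ ∈ 𝐆.bounded X.TV := by
  obtain ⟨M, -, hM⟩ := exists_bound hζ
  exact ⟨M, fun b s hb => h.abs_le hM hb⟩

/-- The function `α ∘ T_{c (n - 1)} ∘ ⋯ ∘ T_{c 0}`. -/
noncomputable def alphaIter (r : ℕ) (F : CoupledSystem d) (ν : ℝ) : ℕ → (ℕ → ℝ) → Cr d r
  | 0, _ => F.α.toCr r
  | n + 1, c => CrMap.pullback (F.coupledMap r ν (c 0)) (alphaIter r F ν n fun k => c (k + 1))

lemma a1_iter (n : ℕ) : ∀ (c : ℕ → ℝ) (b : B 3), (∀ n, c n ∈ range F.meanα) →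
    𝐆.a1 (iter 𝐆.L1 c n (X.incl 1 (X.incl 2 b))) =
      X.J 3 b (alphaIter r F ν n c) := by
  set G := 𝐆
  induction n with
  | zero => exact fun c b _ => core_a3 b
  | succ n ih =>
    intro c b hc
    have h1 : G.L1 (c 0) (X.incl 1 (X.incl 2 b)) = X.incl 1 (X.incl 2 (X.Lc F ν (c 0) 3 b)) := by
      change G.L1 (c 0) (G.i2 (G.i3 b)) = G.i2 (G.i3 (G.L3 (c 0) b))
      rw [G.commL3, G.commL2]
    rw [iter_succ_left, h1, ih _ _ fun n => hc (n + 1), J_Lc (hR _ (hc 0))]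
    rfl

lemma reps_serFun {s c : ℕ → ℝ} {A ρ : ℝ} (hc : ∀ n, c n ∈ range F.meanα) (hρ0 : 0 < ρ)
    (hρ1 : ρ < 1) (hs : ∀ n, |s n| ≤ A * ρ ^ n) : ∃ ζ, Continuous ζ ∧
      X.Reps ((𝐆.serFun s c).comp 𝐆.i2) ζ := by
  obtain ⟨M, hM0, hM⟩ := exists_bound F.α.continuous
  have hA0 : 0 ≤ A := by simpa using (abs_nonneg _).trans (hs 0)
  have hb : ∀ n c x, |alphaIter r F ν n c x| ≤ M := fun n => by
    induction n with
    | zero => exact fun c x => hM x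
    | succ n ih => exact fun c x => ih _ _
  have hterm : ∀ n x, ‖s n * alphaIter r F ν n c x‖ ≤ A * M * ρ ^ n := fun n x => by
    rw [Real.norm_eq_abs, abs_mul, mul_right_comm]
    exact mul_le_mul (hs n) (hb n c x) (abs_nonneg _) (by positivity)
  have hsum : ∀ N, HasSum (fun n => A * M * ρ ^ (n + N)) (A * M * ρ ^ N * (1 - ρ)⁻¹) := fun N => by
    refine ((hasSum_geometric_of_lt_one hρ0.le hρ1).mul_left (A * M * ρ ^ N)).congr_fun fun n => ?_
    rw [pow_add]; ring
  have htail : ∀ (f : ℕ → ℝ) (a t : ℝ), 0 ≤ t → HasSum f a → (∀ n, |f n| ≤ A * M * ρ ^ n * t) →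
      ∀ N, |a - ∑ n ∈ Finset.range N, f n| ≤ A * M * ρ ^ N * (1 - ρ)⁻¹ * t :=
    fun f a t _ hf hft N => ((hasSum_nat_add_iff' N).2 hf).norm_le_of_bounded
      ((hsum N).mul_right t) fun n => hft _
  have hsm0 : Summable fun n => A * M * ρ ^ n := (summable_geometric_of_lt_one hρ0.le hρ1).mul_left _
  refine ⟨fun x => ∑' n, s n * alphaIter r F ν n c x, continuous_tsum
    (fun n => continuous_const.mul (alphaIter r F ν n c).continuous) hsm0 hterm, fun ε hε => ?_⟩
  have hlim : Tendsto (fun N => A * M * ρ ^ N * (1 - ρ)⁻¹) atTop (𝓝 (A * M * 0 * (1 - ρ)⁻¹)) :=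
    ((tendsto_pow_atTop_nhds_zero_of_lt_one hρ0.le hρ1).const_mul _).mul_const _
  rw [mul_zero, zero_mul] at hlim
  obtain ⟨N, hN⟩ := (hlim.eventually (gt_mem_nhds hε)).exists
  have hcoe : ∀ x, (∑ n ∈ Finset.range N, s n • alphaIter r F ν n c : Cr d r) x =
      ∑ n ∈ Finset.range N, s n * alphaIter r F ν n c x := fun x => by
    let ev : Cr d r →+ ℝ := { toFun := fun f => f x, map_zero' := rfl, map_add' := fun _ _ => rfl }
    exact map_sum ev _ _
  refine ⟨∑ n ∈ Finset.range N, s n • alphaIter r F ν n c, fun x => ?_, fun b t hbt => ?_⟩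
  · rw [hcoe]
    have h1 := htail _ _ 1 zero_le_one (Summable.of_norm_bounded hsm0 (hterm · x)).hasSum
      (fun n => by rw [mul_one]; exact hterm n x) N
    rw [mul_one] at h1
    exact h1.trans hN.le
  · have ht := hbt.nonneg
    have h1 := Core.hasSum_serFun (G := 𝐆) hc hρ0.le hρ1 hs (X.incl 1 (X.incl 2 b))
    simp only [a1_iter _ c b hc] at h1
    have h2 := htail _ _ t ht h1 (fun n => by
      rw [abs_mul, mul_right_comm A, mul_assoc (A * ρ ^ n)]
      refine mul_le_mul (hs n) ((hbt _ M (hb n c)).trans (le_of_eq (mul_comm _ _)))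
        (abs_nonneg _) (by positivity)) N
    rw [map_sum]
    simp only [map_smul, smul_eq_mul]
    exact h2.trans (mul_le_mul_of_nonneg_right hN.le ht)

/-- The values on absolutely continuous measures of a functional which is bounded by the total
variation are determined by its values on the range of a transfer operator. -/
lemma exists_integral {c : ℝ} (hc : F.coupledMap r ν c ∈ 𝒯)
    (hs : Function.Surjective (F.coupled ν c)) {b : B 3}
    (hb : X.Represents 3 b μ) (hμ : (μ : Measure (Torus d)) ≪ volume) :
    ∃ μ' : Measure (Torus d), IsProbabilityMeasure μ' ∧ μ' (F.crit ν c) = 0 ∧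
      ∀ Φ ∈ 𝐆.bounded X.TV, ∀ g : Torus d → ℝ, Continuous g →
        (∀ ψ : Cr d r, Φ (X.Lc F ν c 2 (X.emb 2 ψ)) = ∫ x, ψ x * g x) →
        Φ (X.incl 2 b) = ∫ x, g x ∂μ' := by
  obtain ⟨μ', hμ', hac, hmap, hcrit⟩ := F.exists_map_eq hs hμ
  refine ⟨μ', hμ', hcrit, ?_⟩
  rintro Φ ⟨C, hC⟩ g hg hΦ
  obtain ⟨M, hM0, hM⟩ := exists_bound hg
  refine eq_of_forall_dist_le fun ε hε => ?_
  obtain ⟨ψ, hψ⟩ := exists_smooth_approx hac (ε := ε / (|C| + M + 1)) (by positivity)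
  have hTV : X.TV (b - X.Lc F ν c 3 (X.emb 3 (ψ.toCr r))) (ε / (|C| + M + 1)) := fun φ t hφ => by
    have h1 := hψ (fun x => φ (F.coupled ν c x)) t (φ.continuous.comp (continuous_coupled F ν c))
      fun x => hφ _
    have h2 : X.J 3 b φ = ∫ x, φ (F.coupled ν c x) ∂μ' := by
      rw [hb φ, ← hmap]
      exact integral_map (continuous_coupled F ν c).aemeasurable φ.continuous.aestronglyMeasurable
    rw [map_sub, sub_apply, J_Lc hc, X.J_emb, h2]
    exact h1
  have h1 := hC _ _ hTV
  have e1 : 𝐆.i3 (b - X.Lc F ν c 3 (X.emb 3 (ψ.toCr r))) =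
      𝐆.i3 b - X.Lc F ν c 2 (X.emb 2 (ψ.toCr r)) := by
    have h2 : (X.incl 2 (X.Lc F ν c 3 (X.emb 3 (ψ.toCr r))) : B 2) =
        X.Lc F ν c 2 (X.emb 2 (ψ.toCr r)) := (incl_Lc c 2 _).trans
      (congrArg (fun y : B 2 => X.Lc F ν c 2 y) (incl_emb (X := X) 2 (ψ.toCr r)))
    exact (map_sub (X.incl 2) _ _).trans (congrArg (fun y : B 2 => 𝐆.i3 b - y) h2)
  rw [e1, map_sub, hΦ] at h1
  change |Φ (X.incl 2 b) - _| ≤ _ at h1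
  have h2 := hψ g M hg hM
  have h3 : C * (ε / (|C| + M + 1)) ≤ |C| * (ε / (|C| + M + 1)) := by gcongr; exact le_abs_self C
  have h4 : ε / (|C| + M + 1) * (|C| + M) ≤ ε := by
    rw [div_mul_eq_mul_div, div_le_iff₀ (by positivity)]
    nlinarith
  have h5 := abs_sub_le (Φ (X.incl 2 b)) (∫ x, ψ.toCr r x * g x) (∫ x, g x ∂μ')
  rw [abs_sub_comm (∫ x, ψ.toCr r x * g x)] at h5
  rw [Real.dist_eq]
  change |_ - ∫ x, ψ x * g x| ≤ _ at h1
  change _ ≤ |_ - ∫ x, ψ x * g x| + |_ - ∫ x, ψ x * g x| at h5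
  linarith

lemma ext_of_density {Φ Φ' : B 2 →L[ℝ] ℝ}
    (h : ∀ f : Cr d r, (∀ x, 0 ≤ f x) → ∫ x, f x = 1 → Φ (X.emb 2 f) = Φ' (X.emb 2 f)) :
    Φ = Φ' := by
  have hpos : ∀ f : Cr d r, (∀ x, 1 ≤ f x) → Φ (X.emb 2 f) = Φ' (X.emb 2 f) := fun f hf => by
    have h1 : 1 ≤ ∫ x, f x := by
      have := integral_mono (integrable_const (1 : ℝ)) (integrable_of_continuous f.continuous volume) hf
      rwa [integral_const, measureReal_univ_torus, one_smul] at this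
    have h0 : (∫ x, f x) ≠ 0 := by positivity
    have h2 := h ((∫ x, f x)⁻¹ • f) (fun x => mul_nonneg (by positivity) (zero_le_one.trans (hf x)))
      (by
        change ∫ x, (∫ x, f x)⁻¹ * f x = 1
        rw [integral_const_mul, inv_mul_cancel₀ h0])
    rw [map_smul, map_smul, map_smul] at h2
    exact smul_right_injective ℝ (inv_ne_zero h0) h2
  refine DFunLike.ext _ _ fun x => ?_
  refine (X.dense_emb 2).induction_on (p := fun x => Φ x = Φ' x) x
    (isClosed_eq Φ.continuous Φ'.continuous) fun f => ?_
  obtain ⟨M, hM0, hM⟩ := exists_bound f.continuous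
  have h1 := hpos (f + (M + 1) • oneCr d r) fun x => by
    change 1 ≤ f x + (M + 1) * 1
    have := neg_abs_le (f x)
    have := hM x
    rw [Real.norm_eq_abs] at this
    linarith
  have h2 := hpos (oneCr d r) fun x => le_rfl
  rw [map_add, map_add, map_add, map_smul, map_smul, map_smul, h2] at h1
  exact add_right_cancel h1

lemma isStable (hs : ∀ c ∈ range F.meanα, Function.Surjective (F.coupled ν c)) :
    𝐆.IsStable (𝐆.bounded X.TV) where
  a_mem := reps_a2.mem_bounded F.α.continuous
  I_mem := reps_I2.mem_bounded continuous_const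
  comp_mem := by
    rintro c hc Φ ⟨C, hC⟩
    refine ⟨C, fun b s hb => ?_⟩
    have h1 := hC _ _ (hb.map (hR c hc))
    rwa [show 𝐆.i3 (X.Lc F ν c 3 b) =
      𝐆.L2 c (𝐆.i3 b) from 𝐆.commL3 c b] at h1
  ser_mem := fun s c A ρ hc hρ0 hρ1 hsA => by
    obtain ⟨ζ, hζ, h⟩ := reps_serFun (hX := hX) (hR := hR) hc hρ0 hρ1 hsA
    exact h.mem_bounded hζ
  eq_zero := fun c hc Φ hΦ h0 => by
    refine ext_of_density (X := X) fun f hf hf1 => ?_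
    obtain ⟨μ, hμ⟩ := exists_hasDensity f.continuous hf hf1
    have hac : (μ : Measure (Torus d)) ≪ volume := by
      rw [show (μ : Measure (Torus d)) = _ from hμ]
      exact withDensity_absolutelyContinuous _ _
    obtain ⟨μ', -, -, h⟩ := exists_integral (hX := hX) (hR := hR) (hR c hc) (hs c hc)
      (represents_emb (X := X) (i := 3) hμ hf) hac
    have h1 := h Φ hΦ (fun _ => 0) continuous_const fun ψ => by
      simp only [mul_zero, integral_zero]
      exact congrArg (fun u => u (X.emb 2 ψ)) h0
    rwa [integral_zero, show X.incl 2 (X.emb 3 f) = X.emb 2 f from incl_emb (X := X) 2 f] at h1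

lemma const_of_a2_eq {q : ℝ} (h : 𝐆.a2 = q • 𝐆.I2) (x : Torus d) :
    F.α x = q := by
  set f : Cr d r := F.α.toCr r - q • oneCr d r with hf
  have hfx : ∀ x, f x = F.α x - q := fun x => by
    change F.α x - q * 1 = _
    rw [mul_one]
  have h1 : X.J 3 (X.emb 3 f) (F.α.toCr r) = q * X.J 3 (X.emb 3 f) (oneCr d r) :=
    (core_a3 (hX := hX) (hR := hR) _).symm.trans
      ((congrArg (fun u => u (X.incl 2 (X.emb 3 f))) h).trans
        (congrArg (fun y => q * y) (core_I3 (hX := hX) (hR := hR) _)))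
  have h2 : X.J 3 (X.emb 3 f) f = 0 := by
    nth_rewrite 2 [hf]
    rw [map_sub, map_smul, h1, smul_eq_mul, sub_self]
  rw [X.J_emb] at h2
  by_contra hne
  have h3 := (f.continuous.mul f.continuous).integral_pos_of_hasCompactSupport_nonneg_nonzero
    (μ := volume) (HasCompactSupport.of_compactSpace _) (fun x => mul_self_nonneg _)
    (x := x) (mul_self_ne_zero.2 (by rw [hfx]; exact sub_ne_zero.2 hne))
  exact h3.ne' h2

end BanachScale

/-! ### The annihilator of the range of the linearized dynamics -/

namespace Core

/-- The functional `I + κ ∘ W c` on `E2`. -/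
def normalFun (G : Core E0 E1 E2 E3) (κ : E1 →L[ℝ] ℝ) (c : ℝ) : E2 →L[ℝ] ℝ := G.I2 + κ.comp (G.W2 c)

lemma normalFun_i3 (κ : E1 →L[ℝ] ℝ) (c : ℝ) (b : E3) :
    G.normalFun κ c (G.i3 b) = G.I3 b + κ (G.i2 (G.W3 c b)) := by
  rw [G.commW3]; rfl

/-- Solutions of `κ ∘ L c = a - c I` are unique. -/
lemma IsStable.conormal_unique {V : Submodule ℝ (E2 →L[ℝ] ℝ)} (hV : G.IsStable V) {c : ℝ}
    (hc : c ∈ G.R) {κ κ' : E1 →L[ℝ] ℝ} (h : κ.comp G.i2 ∈ V) (h' : κ'.comp G.i2 ∈ V)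
    (hκ : ∀ x, κ (G.i2 (G.L2 c x)) = κ' (G.i2 (G.L2 c x))) : κ = κ' := by
  have h1 := hV.eq_zero c hc _ (V.sub_mem h h') (DFunLike.ext _ _ fun x =>
    sub_eq_zero.2 (hκ x))
  exact DFunLike.coe_injective (G.dns2.equalizer κ.continuous κ'.continuous
    (funext fun x => congrArg (fun u => u x) (sub_eq_zero.1 h1)))

lemma IsStable.comp_iter_mem {V : Submodule ℝ (E2 →L[ℝ] ℝ)} (hV : G.IsStable V) {c : ℕ → ℝ}
    (hc : ∀ n, c n ∈ G.R) (n : ℕ) : ∀ {F}, F ∈ V → F.comp (iter G.L2 c n) ∈ V := by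
  induction n with
  | zero => exact fun hF => hF
  | succ n ih => exact fun hF => ih (hV.comp_mem _ (hc n) _ hF)

namespace Family

variable {V : Submodule ℝ (E2 →L[ℝ] ℝ)}

/-- On the open set `O` of parameters, `κ y` is a solution of `κ ∘ L c = a - c I` for the mean `c`
at time `m`, which is normalized at the orbit. -/
structure IsConormal (Φ : G.Family h Y) (V : Submodule ℝ (E2 →L[ℝ] ℝ)) (m : ℕ) (O : Set Y)
    (κ : Y → E1 →L[ℝ] ℝ) : Prop where
  isOpen : IsOpen O
  sub : O ⊆ Φ.U
  cont : ContinuousOn κ O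
  mem : ∀ y ∈ O, (κ y).comp G.i2 ∈ V
  eqn : ∀ y ∈ O, ∀ x, κ y (G.i2 (G.L2 (Φ.c y m) x)) = G.a2 x - Φ.c y m * G.I2 x
  orb : ∀ y ∈ O, κ y (G.i2 (G.W3 (Φ.c y m) (Φ.b y m))) = -1

variable {m : ℕ} {O : Set Y} {κ : Y → E1 →L[ℝ] ℝ}

lemma IsConormal.unique (hκ : Φ.IsConormal V m O κ) (hV : G.IsStable V) {y y' : Y} (hy : y ∈ O)
    (hy' : y' ∈ O) (hc : Φ.c y m = Φ.c y' m) : κ y = κ y' :=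
  hV.conormal_unique (c_mem (hκ.sub hy) m) (hκ.mem y hy) (hκ.mem y' hy') fun x => by
    rw [hκ.eqn y hy, hc, hκ.eqn y' hy']

lemma IsConormal.continuousOn_normalFun (hκ : Φ.IsConormal V m O κ) (hD : DualApprox G.i1) :
    ContinuousOn (fun y => G.normalFun (κ y) (Φ.c y m)) O :=
  continuousOn_const.add (continuousOn_comp_param hD G.C_pos G.bdW2 (fun c hc c' hc' x => by
      rw [G.commW2, G.commW2]; exact G.lipW1 c hc c' hc' x) hκ.cont
    ((Φ.continuousOn_c m).mono hκ.sub) fun y hy => c_mem (hκ.sub hy) m)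

lemma IsConormal.normalFun_b (hκ : Φ.IsConormal V m O κ) {y : Y} (hy : y ∈ O) :
    G.normalFun (κ y) (Φ.c y m) (G.i3 (Φ.b y m)) = 0 := by
  rw [normalFun_i3, hκ.orb y hy, I3_b (hκ.sub hy)]
  norm_num

lemma IsConormal.exists_multiplier (hκ : Φ.IsConormal V m O κ) (hV : G.IsStable V)
    (hD : DualApprox G.i2) {y : Y} (hy : y ∈ O) (h0 : G.a2.comp (Φ.tan y m) ≠ 0) :
    ∃ q : ℝ, (G.normalFun (κ y) (Φ.c y m)).comp (Φ.tan y m) = q • G.a2.comp (Φ.tan y m) := by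
  refine MeanField.exists_multiplier hκ.isOpen (f := fun y => Φ.c y m)
    (g := fun y' => G.normalFun (κ y) (Φ.c y m) (G.i3 (Φ.b y' m)))
    (f' := fun y => G.a2.comp (Φ.tan y m))
    (g' := fun y' => (G.normalFun (κ y) (Φ.c y m)).comp (Φ.tan y' m))
    (fun y hy => hasFDerivAt_c hD m (hκ.sub hy))
    (continuousOn_comp_tan hD hκ.sub continuousOn_const m)
    (fun y hy => hasFDerivAt_b hD _ m (hκ.sub hy))
    (continuousOn_comp_tan hD hκ.sub continuousOn_const m) hy h0 fun y' hy' hc => ?_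
  rw [← hc, hκ.unique hV hy hy' hc.symm, hκ.normalFun_b hy']

lemma exists_pull_back (hV : G.IsStable V) {y : Y} (hy : y ∈ Φ.U) (n : ℕ) :
    ∀ F : E2 →L[ℝ] ℝ, ∃ P ∈ V, (F.comp (iter G.L2 (Φ.c y) n) + P).comp (Φ.tan y 0) =
      F.comp (Φ.tan y n) := by
  induction n with
  | zero => exact fun F => ⟨0, V.zero_mem, by rw [add_zero]; rfl⟩
  | succ n ih =>
    intro F
    obtain ⟨P, hP, h⟩ := ih (Φ.back y n F)
    refine ⟨(F (G.W3 (Φ.c y n) (Φ.b y n)) • G.a2).comp (iter G.L2 (Φ.c y) n) + P,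
      V.add_mem (hV.comp_iter_mem (c_mem hy) n (V.smul_mem _ hV.a_mem)) hP, ?_⟩
    rw [comp_tan_succ, ← h]
    exact DFunLike.ext _ _ fun x => (add_assoc _ _ _).symm

lemma IsConormal.comp_iter_mem (hκ : Φ.IsConormal V m O κ) (hV : G.IsStable V)
    (hD : DualApprox G.i2) {y : Y} (hy : y ∈ O) (h0 : G.a2.comp (Φ.tan y m) ≠ 0) :
    (G.normalFun (κ y) (Φ.c y m)).comp (iter G.L2 (Φ.c y) m) ∈ V := by
  have hyU := hκ.sub hy
  obtain ⟨q, hq⟩ := hκ.exists_multiplier hV hD hy h0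
  obtain ⟨P, hP, hPt⟩ := exists_pull_back hV hyU m (G.normalFun (κ y) (Φ.c y m) - q • G.a2)
  obtain ⟨q', hq'⟩ := Φ.dense ((G.normalFun (κ y) (Φ.c y m) - q • G.a2).comp
    (iter G.L2 (Φ.c y) m) + P) fun v => by
      refine (congrArg (fun u => u v) hPt).trans ?_
      exact sub_eq_zero.2 (congrArg (fun u => u v) hq)
  have h1 : (G.normalFun (κ y) (Φ.c y m)).comp (iter G.L2 (Φ.c y) m) =
      q' • G.I2 - P + (q • G.a2).comp (iter G.L2 (Φ.c y) m) := by
    rw [← hq', add_sub_cancel_right, ContinuousLinearMap.sub_comp, sub_add_cancel]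
  rw [h1]
  exact V.add_mem (V.sub_mem (V.smul_mem _ hV.I_mem) hP)
    (hV.comp_iter_mem (c_mem hyU) m (V.smul_mem _ hV.a_mem))

/-- The means of the parameters near `y` fill a neighbourhood. -/
lemma image_c_mem_nhds (hD : DualApprox G.i2) {y : Y} (hy : y ∈ Φ.U)
    (h0 : G.a2.comp (Φ.tan y m) ≠ 0) {N : Set Y} (hN : N ∈ 𝓝 y) :
    (fun y => Φ.c y m) '' N ∈ 𝓝 (Φ.c y m) := by
  obtain ⟨v, hv⟩ : ∃ v, G.a2.comp (Φ.tan y m) v ≠ 0 := by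
    by_contra! hcon
    exact h0 (ContinuousLinearMap.ext hcon)
  have h1 := hasStrictFDerivAt_of_hasFDerivAt_of_continuousAt (eventually_of_mem (Φ.isOpen.mem_nhds
    hy) fun z hz => hasFDerivAt_c hD m hz) ((continuousOn_comp_tan hD subset_rfl continuousOn_const
    m).continuousAt (Φ.isOpen.mem_nhds hy))
  have h2 : HasStrictDerivAt (fun t : ℝ => y + t • v) v 0 := by
    simpa using ((hasStrictDerivAt_id (0 : ℝ)).smul_const v).const_add y
  have h3 : y + (0 : ℝ) • v = y := by rw [zero_smul, add_zero]
  rw [← congrArg (HasStrictFDerivAt (fun y => Φ.c y m) (G.a2.comp (Φ.tan y m))) h3] at h1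
  have h6 := image_mem_map (m := (fun y => Φ.c y m) ∘ fun t : ℝ => y + t • v) ((by fun_prop :
    Continuous fun t : ℝ => y + t • v).continuousAt.eventually (p := fun z => z ∈ N) (h3.symm ▸ hN
    : N ∈ 𝓝 (y + (0 : ℝ) • v)))
  rw [(HasStrictFDerivAt.comp_hasStrictDerivAt (0 : ℝ) h1 h2).map_nhds_eq hv] at h6
  simp only [Function.comp, h3] at h6
  refine mem_of_superset h6 ?_
  rintro _ ⟨t, ht, rfl⟩
  exact ⟨_, ht, rfl⟩

end Family

end Core

/-! ### Regular points and solutions of `κ ∘ L c = a - c I` -/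

lemma abs_integral_sub_le {O : Set (Torus d)}
    (hμ : (μ : Measure (Torus d)) Oᶜ = 0) {f : Torus d → ℝ} (hf : Continuous f) {k ε : ℝ}
    (h : ∀ z ∈ O, |f z - k| ≤ ε) : |(∫ z, f z ∂μ) - k| ≤ ε := by
  have h1 := norm_integral_le_of_norm_le_const (μ := (μ : Measure (Torus d)))
    (f := fun z => f z - k) (C := ε) (Eventually.mono (mem_ae_iff.2 hμ) h)
  rwa [integral_sub (integrable_of_continuous hf _) (integrable_const k), integral_const,
    probReal_univ, mul_one, one_smul] at h1

namespace CoupledSystem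

/-- `C` bounds `dα x w - 1` for the vectors `(1, w)` in the kernel of the derivative of the lift, at
all regular points `x`. -/
def SlopeBound (F : CoupledSystem d) (ν c C : ℝ) : Prop :=
  ∀ x w, F.IsReg ν c x → fderiv ℝ (F.lift ν) (c, x) (1, w) = 0 → |F.dα x w - 1| ≤ C

lemma isClosed_slopeBound (C : ℝ) : IsClosed {c | F.SlopeBound ν c C} := by
  rw [← isOpen_compl_iff, isOpen_iff_mem_nhds]
  intro c hc
  obtain ⟨x, w, hx, hw, hC⟩ : ∃ x w, F.IsReg ν c x ∧ fderiv ℝ (F.lift ν) (c, x) (1, w) = 0 ∧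
      C < |F.dα x w - 1| := by
    by_contra! hcon
    exact hc fun x w hx hw => hcon x w hx hw
  set D : ℝ → ℝ × (Fin d → ℝ) →L[ℝ] (Fin d → ℝ) := fun c => fderiv ℝ (F.lift ν) (c, x)
  have hD : Continuous D := ((F.contDiff_lift ν).continuous_fderiv (by simp)).comp (by fun_prop)
  have hM : Continuous fun c => F.liftD ν c x := hD.clm_comp continuous_const
  have hsplit : ∀ c w, D c (1, w) = D c (1, 0) + F.liftD ν c x w := fun c w => by
    change _ = _ + D c (0, w)
    rw [← map_add, Prod.mk_add_mk, add_zero, zero_add]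
  let e := fun c (h : F.IsReg ν c x) => (F.liftD ν c x).toContinuousLinearEquivOfDetNeZero h
  have he : ∀ c h, (e c h : (Fin d → ℝ) →L[ℝ] (Fin d → ℝ)) = F.liftD ν c x := fun c h =>
    ContinuousLinearMap.coe_toContinuousLinearEquivOfDetNeZero _ h
  -- the solution of the equation for `w` depends continuously on `c`
  set W : ℝ → Fin d → ℝ := fun c => (F.liftD ν c x).inverse (-D c (1, 0))
  have hinv : ContinuousAt ContinuousLinearMap.inverse (F.liftD ν c x) := by
    have h1 := (contDiffAt_map_inverse (𝕜 := ℝ) (n := 0) (e c hx)).continuousAt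
    rwa [he] at h1
  have hW : ContinuousAt W c := (ContinuousAt.comp (f := fun c => F.liftD ν c x) hinv hM.continuousAt).clm_apply
    (hD.clm_apply continuous_const).neg.continuousAt
  have hWw : W c = w := by
    have h1 : -D c (1, 0) = e c hx w := by
      change _ = (e c hx : (Fin d → ℝ) →L[ℝ] (Fin d → ℝ)) w
      rw [he, neg_eq_iff_add_eq_zero, ← hsplit]
      exact hw
    change (F.liftD ν c x).inverse (-D c (1, 0)) = w
    rw [h1, ← he c hx, ContinuousLinearMap.inverse_equiv]
    exact (e c hx).symm_apply_apply w
  have hlt : ∀ᶠ c' in 𝓝 c, C < |F.dα x (W c') - 1| := by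
    have h1 : ContinuousAt (fun c' => |F.dα x (W c') - 1|) c :=
      (((fderiv ℝ (fun x => F.α (proj x)) x).continuous.continuousAt.comp hW).sub_const 1).abs
    exact h1.eventually (lt_mem_nhds (show C < |F.dα x (W c) - 1| by rwa [hWw]))
  have hreg : ∀ᶠ c' in 𝓝 c, F.IsReg ν c' x :=
    (ContinuousLinearMap.continuous_det.comp hM).continuousAt.eventually_ne hx
  filter_upwards [hlt, hreg] with c' h1 h2 h3
  refine (h3 x (W c') h2 ?_).not_gt h1
  change D c' (1, W c') = 0
  rw [hsplit]
  change _ + F.liftD ν c' x ((F.liftD ν c' x).inverse (-D c' (1, 0))) = 0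
  rw [← he c' h2, ContinuousLinearMap.inverse_equiv]
  change _ + e c' h2 ((e c' h2).symm _) = 0
  rw [ContinuousLinearEquiv.apply_symm_apply, add_neg_cancel]

/-- By Baire's theorem, pointwise bounds are locally uniform somewhere. -/
lemma exists_slopeBound {J : Set ℝ} (hJ : IsOpen J) (hne : J.Nonempty)
    (h : ∀ c ∈ J, ∃ C, F.SlopeBound ν c C) : ∃ J' ⊆ J, IsOpen J' ∧ J'.Nonempty ∧
      ∃ C, ∀ c ∈ J', F.SlopeBound ν c C := by
  have h1 := dense_iUnion_interior_of_closed (f := fun n : ℕ => {c | F.SlopeBound ν c n} ∪ Jᶜ)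
    (fun n => (isClosed_slopeBound _).union hJ.isClosed_compl) (eq_univ_of_forall fun c => by
      by_cases hc : c ∈ J
      · obtain ⟨C, hC⟩ := h c hc
        obtain ⟨n, hn⟩ := exists_nat_ge C
        exact mem_iUnion.2 ⟨n, Or.inl fun x w hx hw => (hC x w hx hw).trans hn⟩
      · exact mem_iUnion.2 ⟨0, Or.inr hc⟩)
  obtain ⟨c, hcJ, hc⟩ := h1.inter_open_nonempty J hJ hne
  obtain ⟨n, hn⟩ := mem_iUnion.1 hc
  exact ⟨_, inter_subset_left, hJ.inter isOpen_interior, ⟨c, hcJ, hn⟩, n, fun c' hc' =>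
    (interior_subset hc'.2).resolve_right fun h => h hc'.1⟩

lemma abs_sub_le_of_ball (hs : ∀ c ∈ range F.meanα, Function.Surjective (F.coupled ν c))
    {c0 δ l C : ℝ} (hR : Metric.ball c0 δ ⊆ range F.meanα) {ζ : ℝ → Torus d → ℝ}
    (hζ : ∀ c ∈ Metric.ball c0 δ, ∀ p, ζ c (F.coupled ν c p) = F.α p - c) (hl : |l| * δ ≤ 1)
    (hreg : ∀ c ∈ Metric.ball c0 δ, ∀ x w, F.IsReg ν c x →
      fderiv ℝ (F.lift ν) (c, x) (1, w) = 0 → |F.dα x w - 1 + l * (F.α (proj x) - c)| ≤ C)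
    {t : ℝ} (ht : |t| < δ) (p : Torus d) :
    |ζ (c0 + t) p * Real.exp (l * t) - ζ c0 p| ≤ 3 * C * |t| := by
  have hb : ∀ c, |c - c0| ≤ |t| → c ∈ Metric.ball c0 δ := fun c hc => by
    rw [Metric.mem_ball, Real.dist_eq]; exact hc.trans_lt ht
  have hlc : ∀ c, |c - c0| ≤ |t| → |l * (c - c0)| ≤ 1 := fun c hc => by
    rw [abs_mul]
    exact (mul_le_mul_of_nonneg_left (hc.trans ht.le) (abs_nonneg _)).trans hl
  rcases le_total 0 t with h0 | h0
  · have hI : ∀ c ∈ Icc c0 (c0 + t), |c - c0| ≤ |t| := fun c hc => by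
      rw [abs_of_nonneg h0, abs_le]; constructor <;> linarith [hc.1, hc.2]
    have := abs_sub_le_of_isReg (c0 := c0) (l := l) (by linarith)
      (fun c hc => hs c (hR (hb c (hI c hc)))) (fun c hc => hζ c (hb c (hI c hc)))
      (fun c hc => hlc c (hI c hc))
      (fun c hc => hreg c (hb c (hI c (Ioo_subset_Icc_self hc)))) p
    simpa [abs_of_nonneg h0] using this
  · have hI : ∀ c ∈ Icc (c0 + t) c0, |c - c0| ≤ |t| := fun c hc => by
      rw [abs_of_nonpos h0, abs_le]; constructor <;> linarith [hc.1, hc.2]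
    have := abs_sub_le_of_isReg (c0 := c0) (l := l) (by linarith)
      (fun c hc => hs c (hR (hb c (hI c hc)))) (fun c hc => hζ c (hb c (hI c hc)))
      (fun c hc => hlc c (hI c hc))
      (fun c hc => hreg c (hb c (hI c (Ioo_subset_Icc_self hc)))) p
    rw [abs_sub_comm]
    simpa [abs_of_nonpos h0] using this

end CoupledSystem

namespace BanachScale

variable (X) in
/-- There are smooth densities that are concentrated near a given point. -/
lemma exists_represents_near {O : Set (Torus d)} (hO : IsOpen O) {x : Torus d} (hx : x ∈ O) :
    ∃ b μ, X.Represents 3 b μ ∧ (μ : Measure (Torus d)) ≪ volume ∧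
      (μ : Measure (Torus d)) Oᶜ = 0 := by
  obtain ⟨ψ, h0, h1, hψ⟩ := exists_density hO hx
  obtain ⟨μ, hμ⟩ := exists_hasDensity ψ.continuous h0 h1
  have e : (μ : Measure (Torus d)) = _ := hμ
  refine ⟨X.emb 3 (ψ.toCr r), μ, represents_emb hμ h0, e ▸ withDensity_absolutelyContinuous _ _, ?_⟩
  rw [e, withDensity_apply _ hO.measurableSet.compl, setLIntegral_congr_fun
    hO.measurableSet.compl (g := fun _ => 0) fun y hy => by simp [hψ y hy]]
  simp

lemma exists_near {ζ : Torus d → ℝ} (hζ : Continuous ζ) (x : Torus d) {ε : ℝ} (hε : 0 < ε) :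
    ∃ O, IsOpen O ∧ x ∈ O ∧ ∀ z ∈ O, |ζ z - ζ x| ≤ ε :=
  ⟨{z | |ζ z - ζ x| < ε}, isOpen_lt (by fun_prop) continuous_const, by simpa using hε,
    fun z hz => le_of_lt hz⟩

lemma Reps.unique {Φ : B 2 →L[ℝ] ℝ} {ζ ζ' : Torus d → ℝ} (h : X.Reps Φ ζ) (h' : X.Reps Φ ζ')
    (hζ : Continuous ζ) (hζ' : Continuous ζ') : ζ = ζ' := by
  funext x
  refine eq_of_forall_dist_le fun ε hε => ?_
  obtain ⟨O, hO, hx, hO'⟩ := exists_near (hζ.sub hζ') x hε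
  obtain ⟨b, μ, hb, -, hμ⟩ := X.exists_represents_near hO hx
  have h1 := abs_integral_sub_le (f := fun z => ζ z - ζ' z) hμ (hζ.sub hζ') hO'
  rw [integral_sub (integrable_of_continuous hζ _) (integrable_of_continuous hζ' _),
    ← h.eq_integral hζ hb, ← h'.eq_integral hζ' hb, sub_self, zero_sub, abs_neg] at h1
  exact h1

lemma Reps.comp_L {Φ : B 2 →L[ℝ] ℝ} {ζ : Torus d → ℝ} (h : X.Reps Φ ζ) {c : ℝ}
    (hc : F.coupledMap r ν c ∈ 𝒯) :
    X.Reps (Φ.comp (X.Lc F ν c 2)) fun p => ζ (F.coupled ν c p) := fun ε hε => by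
  obtain ⟨φ, hφ, hb⟩ := h ε hε
  refine ⟨CrMap.pullback (F.coupledMap r ν c) φ, fun x => hφ _, fun b s hbs => ?_⟩
  have h1 := hb _ s (hbs.map hc)
  rw [J_Lc hc] at h1
  rwa [show X.incl 2 (X.Lc F ν c 3 b) = X.Lc F ν c 2 (X.incl 2 b) from incl_Lc c 2 b] at h1

variable (hX hR) in
/-- `K` solves `K ∘ L c = a - c I` and is given by the continuous function `ζ`. -/
structure IsSol (c : ℝ)
    (K : B 2 →L[ℝ] ℝ) (ζ : Torus d → ℝ) : Prop where
  mem : c ∈ range F.meanα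
  cont : Continuous ζ
  reps : X.Reps K ζ
  eqn : ∀ x, K (𝐆.L2 c x) = 𝐆.a2 x - c * 𝐆.I2 x
  comp : ∀ p, ζ (F.coupled ν c p) = F.α p - c

lemma exists_isSol {c p A ρ : ℝ} {s cs : ℕ → ℝ} (hc : c ∈ range F.meanα)
    (hcs : ∀ n, cs n ∈ range F.meanα) (hρ0 : 0 < ρ) (hρ1 : ρ < 1) (hs : ∀ n, |s n| ≤ A * ρ ^ n)
    (hK : ∀ x, (p • 𝐆.I1 + 𝐆.serFun s cs)
      (𝐆.i2 (𝐆.L2 c x)) =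
      𝐆.a2 x - c * 𝐆.I2 x) :
    ∃ ζ, IsSol hX hR c ((p • 𝐆.I1 + 𝐆.serFun s cs).comp
      𝐆.i2) ζ := by
  set G := 𝐆
  obtain ⟨ζ, hζ, h⟩ := reps_serFun (hX := hX) (hR := hR) hcs hρ0 hρ1 hs
  have h1 : X.Reps ((p • G.I1 + G.serFun s cs).comp G.i2) fun x => ζ x - (-p) * 1 := by
    have := h.sub_smul (reps_I2 (hX := hX) (hR := hR)) (-p)
    convert this using 1
    refine DFunLike.ext _ _ fun y => ?_
    change p * G.I2 y + G.serFun s cs (G.i2 y) = G.serFun s cs (G.i2 y) - -p * G.I2 y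
    ring
  have h2 : X.Reps (((p • G.I1 + G.serFun s cs).comp G.i2).comp (X.Lc F ν c 2))
      fun p => F.α p - c * 1 := by
    rw [show ((p • G.I1 + G.serFun s cs).comp G.i2).comp (X.Lc F ν c 2) = G.a2 - c • G.I2 from
      ContinuousLinearMap.ext hK]
    exact reps_a2.sub_smul reps_I2 c
  have hcont : Continuous fun x => ζ x - (-p) * 1 := by fun_prop
  refine ⟨_, hc, hcont, h1, hK, fun q => ?_⟩
  have h3 := congrFun ((h1.comp_L (hR c hc)).unique h2 (hcont.comp (continuous_coupled F ν c))
    (F.α.continuous.sub continuous_const)) q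
  rwa [mul_one c] at h3

/-- The value of `K ∘ W c` at densities that are concentrated near a regular point. -/
lemma IsSol.exists_local {c : ℝ} {K : B 2 →L[ℝ] ℝ} {ζ : Torus d → ℝ} (h : IsSol hX hR c K ζ)
    (hD : DualApprox 𝐆.i2) (hcR : range F.meanα ∈ 𝓝 c) {x w : Fin d → ℝ}
    (hx : F.IsReg ν c x) (hw : fderiv ℝ (F.lift ν) (c, x) (1, w) = 0) {ε : ℝ} (hε : 0 < ε) :
    ∃ O, IsOpen O ∧ proj x ∈ O ∧ ∀ b μ, X.Represents 3 b μ → (μ : Measure (Torus d)) Oᶜ = 0 →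
      |K (𝐆.W3 c b) + F.dα x w| ≤ ε := by
  obtain ⟨O, hO, hxO, hloc⟩ := hx.exists_local hw h.comp hε
  refine ⟨O, hO, hxO, fun b μ hb hμ => ?_⟩
  have hcR' : ∀ᶠ t in 𝓝 (0 : ℝ), c + t ∈ range F.meanα :=
    (continuous_const_add c).tendsto' 0 c (add_zero c) hcR
  have hint : ∀ t, c + t ∈ range F.meanα →
      K (𝐆.L2 (c + t) (𝐆.i3 b)) =
        ∫ z, ζ (F.coupled ν (c + t) z) ∂μ := fun t ht => by
    have h1 := h.reps.eq_integral h.cont (hb.map (hR _ ht))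
    rw [← 𝐆.commL3]
    exact h1.trans (integral_map (continuous_coupled F ν (c + t)).aemeasurable
      h.cont.aestronglyMeasurable)
  refine le_of_tendsto ((Core.hasDerivAt_weak hD hcR K b).tendsto_slope_zero.add_const (F.dα x w)).abs ?_
  filter_upwards [hcR'.filter_mono nhdsWithin_le_nhds, hloc.filter_mono nhdsWithin_le_nhds,
    self_mem_nhdsWithin] with t ht hl ht0
  have ht0' : t ≠ 0 := ht0
  have h0 := hint 0 (by rw [add_zero]; exact h.mem)
  rw [add_zero] at h0
  have hc1 : ∀ c', Continuous fun z => ζ (F.coupled ν c' z) := fun c' =>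
    h.cont.comp (continuous_coupled F ν c')
  have h2 := abs_integral_sub_le hμ (f := fun z => ζ (F.coupled ν (c + t) z) -
    ζ (F.coupled ν c z)) (k := -(t * F.dα x w)) ((hc1 _).sub (hc1 _)) fun z hz => by
      rw [sub_neg_eq_add]; exact hl z hz
  rw [integral_sub (integrable_of_continuous (hc1 _) _) (integrable_of_continuous (hc1 _) _),
    ← hint t ht, ← h0, sub_neg_eq_add] at h2
  rwa [smul_eq_mul, show F.dα x w = t⁻¹ * (t * F.dα x w) by field_simp, ← mul_add, abs_mul, abs_inv,
    inv_mul_le_iff₀ (abs_pos.2 ht0'), mul_comm |t|]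

/-! ### Degenerate orbit families give curves of solutions -/

lemma exists_represents_iter (hs : ∀ c ∈ range F.meanα, Function.Surjective (F.coupled ν c))
    {cs : ℕ → ℝ} (hcs : ∀ n, cs n ∈ range F.meanα) (n : ℕ) : ∀ {O : Set (Torus d)}, IsOpen O →
      ∀ x ∈ O, ∃ b μ, X.TV b 1 ∧ X.Represents 3 (iter 𝐆.L3 cs n b) μ ∧
        (μ : Measure (Torus d)) Oᶜ = 0 := by
  induction n with
  | zero =>
    intro O hO x hx
    obtain ⟨b, μ, hb, -, hμ⟩ := X.exists_represents_near hO hx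
    exact ⟨b, μ, hb.tv, hb, hμ⟩
  | succ n ih =>
    intro O hO x hx
    obtain ⟨x', rfl⟩ := hs _ (hcs n) x
    obtain ⟨b, μ, hb, hbμ, hμ⟩ := ih (hO.preimage (continuous_coupled F ν (cs n))) x' hx
    refine ⟨b, _, hb, hbμ.map (hR _ (hcs n)), ?_⟩
    exact (Measure.map_apply (continuous_coupled F ν (cs n)).measurable
      hO.measurableSet.compl).trans hμ

lemma IsSol.slopeBound {c : ℝ} {κ : B 1 →L[ℝ] ℝ} {ζ : Torus d → ℝ}
    (h : IsSol hX hR c (κ.comp 𝐆.i2) ζ)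
    (hs : ∀ c ∈ range F.meanα, Function.Surjective (F.coupled ν c))
    (hD : DualApprox 𝐆.i2) (hcR : range F.meanα ∈ 𝓝 c) {cs : ℕ → ℝ}
    (hcs : ∀ n, cs n ∈ range F.meanα) {n : ℕ} (hV : (𝐆.normalFun κ c).comp
      (iter 𝐆.L2 cs n) ∈ 𝐆.bounded X.TV) :
    ∃ C, F.SlopeBound ν c C := by
  set G := 𝐆
  obtain ⟨C, hC⟩ := hV
  refine ⟨C, fun x w hx hw => le_of_forall_pos_le_add fun ε hε => ?_⟩
  obtain ⟨O, hO, hxO, hloc⟩ := h.exists_local hD hcR hx hw hε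
  obtain ⟨b, μ, hb, hbμ, hμ⟩ := exists_represents_iter (hX := hX) (hR := hR) hs hcs n hO _ hxO
  have h1 := hC b 1 hb
  change |G.normalFun κ c (iter G.L2 cs n (G.i3 b))| ≤ _ at h1
  have h3 : G.I3 (iter G.L3 cs n b) = 1 := (core_I3 _).trans hbμ.integral
  rw [← iter_comm G.i3 _ _ G.commL3, Core.normalFun_i3, h3, mul_one] at h1
  have h2 := hloc _ μ hbμ hμ
  change |κ (G.i2 (G.W3 c (iter G.L3 cs n b))) + F.dα x w| ≤ ε at h2
  rw [abs_le] at h1 h2 ⊢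
  constructor <;> linarith [h1.1, h1.2, h2.1, h2.2]

lemma normalFun_mem_bounded (hs : ∀ c ∈ range F.meanα, Function.Surjective (F.coupled ν c))
    (hD : DualApprox 𝐆.i2) {c0 δ C : ℝ} (hδ : 0 < δ) {K : ℝ → B 2 →L[ℝ] ℝ}
    {ζ : ℝ → Torus d → ℝ} (h : ∀ c ∈ Metric.ball c0 δ, IsSol hX hR c (K c) (ζ c))
    (hC : ∀ c ∈ Metric.ball c0 δ, F.SlopeBound ν c C) {κ : B 1 →L[ℝ] ℝ}
    (hκ : κ.comp 𝐆.i2 = K c0) :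
    𝐆.normalFun κ c0 ∈ 𝐆.bounded X.TV := by
  set G := 𝐆
  have h0 := h c0 (Metric.mem_ball_self hδ)
  have hball : ∀ t : ℝ, |t| < δ → c0 + t ∈ Metric.ball c0 δ := fun t ht => by
    rwa [Metric.mem_ball, Real.dist_eq, add_sub_cancel_left]
  have hev : ∀ᶠ t in 𝓝 (0 : ℝ), |t| < δ :=
    (continuous_abs.tendsto' 0 0 abs_zero).eventually (gt_mem_nhds hδ)
  refine ⟨3 * C, fun b s hb => ?_⟩
  rw [Core.normalFun_i3, show κ (G.i2 (G.W3 c0 b)) = K c0 (G.W3 c0 b) from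
    congrArg (fun u => u (G.W3 c0 b)) hκ]
  refine le_of_tendsto ((Core.hasDerivAt_weak hD (mem_of_superset (Metric.ball_mem_nhds c0 hδ)
    fun c hc => (h c hc).mem) (K c0) b).tendsto_slope_zero.const_add (G.I3 b)).abs ?_
  filter_upwards [hev.filter_mono nhdsWithin_le_nhds, self_mem_nhdsWithin] with t ht ht0
  have ht0' : t ≠ 0 := ht0
  have h1 := h _ (hball t ht)
  have h2 := (h0.reps.sub_smul h1.reps 1).abs_le (M := 3 * C * |t|) (fun p => by
    have := F.abs_sub_le_of_ball hs (l := 0) (fun c hc => (h c hc).mem)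
      (fun c hc => (h c hc).comp) (by simp) (fun c hc x w hx hw => by
        rw [zero_mul, add_zero]; exact hC c hc x w hx hw) ht p
    rw [zero_mul, Real.exp_zero, mul_one, abs_sub_comm] at this
    rwa [one_mul]) (hb.map (hR _ h1.mem))
  change |K c0 (G.i3 (G.L3 (c0 + t) b)) - 1 * K (c0 + t) (G.i3 (G.L3 (c0 + t) b))| ≤ _ at h2
  rw [G.commL3, h1.eqn, one_mul] at h2
  rw [smul_eq_mul, h0.eqn, show G.I3 b + t⁻¹ * (K c0 (G.L2 (c0 + t) (G.i3 b)) -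
      (G.a2 (G.i3 b) - c0 * G.I2 (G.i3 b))) = t⁻¹ * (K c0 (G.L2 (c0 + t) (G.i3 b)) -
      (G.a2 (G.i3 b) - (c0 + t) * G.I2 (G.i3 b))) by
    change G.I2 (G.i3 b) + _ = _
    field_simp; ring, abs_mul, abs_inv, inv_mul_le_iff₀ (abs_pos.2 ht0')]
  exact h2.trans (le_of_eq (by ring))

lemma hasCurve_of_slope (hs : ∀ c ∈ range F.meanα, Function.Surjective (F.coupled ν c))
    {c0 δ : ℝ} (hδ : 0 < δ) {K : ℝ → B 2 →L[ℝ] ℝ} {ζ : ℝ → Torus d → ℝ}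
    (h : ∀ c ∈ Metric.ball c0 δ, IsSol hX hR c (K c) (ζ c)) {q : ℝ}
    (hq : ∀ ε > 0, ∀ᶠ c in 𝓝 c0, ∀ x w, F.IsReg ν c x →
      fderiv ℝ (F.lift ν) (c, x) (1, w) = 0 → |F.dα x w - 1 + q * (F.α (proj x) - c)| ≤ ε) :
    𝐆.HasCurve X.TV c0 := by
  have hball : ∀ t : ℝ, |t| < δ → c0 + t ∈ Metric.ball c0 δ := fun t ht => by
    rwa [Metric.mem_ball, Real.dist_eq, add_sub_cancel_left]
  have hev : ∀ {δ : ℝ}, 0 < δ → ∀ᶠ t in 𝓝 (0 : ℝ), |t| < δ := fun hδ =>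
    (continuous_abs.tendsto' 0 0 abs_zero).eventually (gt_mem_nhds hδ)
  refine ⟨fun t => K (c0 + t), -q, (hev hδ).mono fun t ht => ?_, fun ε hε => ?_⟩
  · have h1 := h _ (hball t ht)
    exact ⟨h1.mem, h1.reps.mem_bounded h1.cont, h1.eqn⟩
  obtain ⟨M, hM0, hM⟩ := exists_bound (h c0 (Metric.mem_ball_self hδ)).cont
  obtain ⟨δ', hδ', hq'⟩ := Metric.eventually_nhds_iff_ball.1 (hq (ε / 18) (by positivity))
  set δ1 := min (min δ δ') (|q| + 1)⁻¹
  have hδ1 : 0 < δ1 := lt_min (lt_min hδ hδ') (by positivity)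
  have hql : |q| * δ1 ≤ 1 := by
    refine (mul_le_mul_of_nonneg_left (min_le_right _ _) (abs_nonneg q)).trans ?_
    rw [← div_eq_mul_inv]
    exact div_le_one_of_le₀ (by linarith) (by positivity)
  have hsub : Metric.ball c0 δ1 ⊆ Metric.ball c0 δ := Metric.ball_subset_ball
    ((min_le_left _ _).trans (min_le_left _ _))
  filter_upwards [hev hδ1, hev (show 0 < ε / (2 * (q ^ 2 * M + 1)) by positivity)]
    with t ht htM b s hb
  have hp : ∀ p, |ζ (c0 + t) p - (1 + -q * t) * ζ (c0 + 0) p| ≤ ε * |t| := fun p => by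
    have h1 := F.abs_sub_le_of_ball hs (l := q) (fun c hc => (h c (hsub hc)).mem)
      (fun c hc => (h c (hsub hc)).comp) hql (fun c hc => hq' c (Metric.ball_subset_ball
        ((min_le_left _ _).trans (min_le_right _ _)) hc)) ht p
    have hqt : |-(q * t)| ≤ 1 := by
      rw [abs_neg, abs_mul]
      exact (mul_le_mul_of_nonneg_left ht.le (abs_nonneg _)).trans hql
    have h2 := Real.abs_exp_sub_one_sub_id_le hqt
    have h3 : Real.exp (-(q * t)) ≤ 3 := by
      have := (abs_le.1 h2).2
      have := (abs_le.1 hqt).2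
      nlinarith [(abs_le.1 hqt).1]
    have h4 : Real.exp (-(q * t)) * Real.exp (q * t) = 1 := by
      rw [← Real.exp_add, neg_add_cancel, Real.exp_zero]
    rw [add_zero, show ζ (c0 + t) p - (1 + -q * t) * ζ c0 p = Real.exp (-(q * t)) *
      (ζ (c0 + t) p * Real.exp (q * t) - ζ c0 p) +
      (Real.exp (-(q * t)) - 1 - -(q * t)) * ζ c0 p by linear_combination -ζ (c0 + t) p * h4]
    refine (abs_add_le _ _).trans ?_
    rw [abs_mul, abs_mul, abs_of_pos (Real.exp_pos _)]
    have h5 : Real.exp (-(q * t)) * |ζ (c0 + t) p * Real.exp (q * t) - ζ c0 p| ≤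
        3 * (3 * (ε / 18) * |t|) := mul_le_mul h3 h1 (abs_nonneg _) (by norm_num)
    have h6 : |Real.exp (-(q * t)) - 1 - -(q * t)| * |ζ c0 p| ≤ (-(q * t)) ^ 2 * M :=
      mul_le_mul h2 (hM p) (abs_nonneg _) (sq_nonneg _)
    have h7 : |t| * (q ^ 2 * M) ≤ ε / 2 := by
      rw [lt_div_iff₀ (by positivity)] at htM
      nlinarith [abs_nonneg t]
    have h8 : (-(q * t)) ^ 2 * M = |t| * (q ^ 2 * M) * |t| := by grind
    rw [h8] at h6
    nlinarith [abs_nonneg t, mul_le_mul_of_nonneg_right h7 (abs_nonneg t)]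
  have h1 := h _ (hball t (lt_of_lt_of_le ht ((min_le_left _ _).trans (min_le_left _ _))))
  have h2 := h (c0 + 0) (hball 0 (by simpa using hδ))
  exact (h1.reps.sub_smul h2.reps (1 + -q * t)).abs_le hp hb

variable {Y : Type v} [NormedAddCommGroup Y] [NormedSpace ℝ Y]
  {Φ : (X.core hX F ν hR).Family h₃ Y} {m : ℕ} {O : Set Y} {κ : Y → B 1 →L[ℝ] ℝ}

/-- If the mean at time `m` is not stationary, then there is a curve of solutions at the mean at
some time. -/
lemma exists_hasCurve (hs : ∀ c ∈ range F.meanα, Function.Surjective (F.coupled ν c))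
    (hD1 : DualApprox 𝐆.i1) (hD : DualApprox 𝐆.i2)
    (hκ : Φ.IsConormal (𝐆.bounded X.TV) m O κ) (hne : O.Nonempty)
    (hsol : ∀ y ∈ O, ∃ ζ, IsSol hX hR (Φ.c y m) ((κ y).comp 𝐆.i2) ζ)
    (hdc : ∀ y ∈ O, 𝐆.a2.comp (Φ.tan y m) ≠ 0) :
    ∃ c, 𝐆.HasCurve X.TV c := by
  let G := 𝐆
  have hV := isStable (X := X) (hX := hX) (hR := hR) hs
  set cm : Y → ℝ := fun y => Φ.c y m
  have hcm : ContinuousOn cm O := (Φ.continuousOn_c m).mono hκ.sub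
  have hnhds : ∀ y ∈ O, ∀ N ∈ 𝓝 y, cm '' N ∈ 𝓝 (cm y) := fun y hy N hN =>
    Φ.image_c_mem_nhds hD (hκ.sub hy) (hdc y hy) hN
  have hJ : IsOpen (cm '' O) := by
    rw [isOpen_iff_mem_nhds]
    rintro _ ⟨y, hy, rfl⟩
    exact hnhds y hy O (hκ.isOpen.mem_nhds hy)
  have hex : ∀ c, ∃ K ζ, c ∈ cm '' O → IsSol hX hR c K ζ ∧
      ∀ y ∈ O, cm y = c → (κ y).comp G.i2 = K := fun c => by
    by_cases hc : c ∈ cm '' O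
    · obtain ⟨y, hy, rfl⟩ := hc
      obtain ⟨ζ, hζ⟩ := hsol y hy
      exact ⟨_, ζ, fun _ => ⟨hζ, fun y' hy' h => by rw [hκ.unique hV hy' hy h]⟩⟩
    · exact ⟨0, 0, fun h => absurd h hc⟩
  choose K ζ hK using hex
  have hJR : cm '' O ⊆ range F.meanα := fun c hc => (hK c hc).1.mem
  obtain ⟨J', hJ'J, hJ'o, ⟨c1, hc1⟩, C, hC⟩ := F.exists_slopeBound hJ (hne.image cm)
    (ν := ν) fun c hc => by
      obtain ⟨y, hy, rfl⟩ := hc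
      obtain ⟨ζ, hζ⟩ := hsol y hy
      exact hζ.slopeBound hs hD (mem_of_superset (hJ.mem_nhds ⟨y, hy, rfl⟩) hJR)
        (fun n => Core.Family.c_mem (hκ.sub hy) n) (hκ.comp_iter_mem hV hD hy (hdc y hy))
  have hO1 : IsOpen (O ∩ cm ⁻¹' J') := hcm.isOpen_inter_preimage hκ.isOpen hJ'o
  have hQV : ∀ y ∈ O ∩ cm ⁻¹' J', G.normalFun (κ y) (cm y) ∈ G.bounded X.TV := fun y hy => by
    obtain ⟨δ, hδ, hb⟩ := Metric.isOpen_iff.1 hJ'o _ hy.2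
    exact normalFun_mem_bounded hs hD hδ (fun c hc => (hK c (hJ'J (hb hc))).1)
      (fun c hc => hC c (hb hc)) ((hK _ ⟨y, hy.1, rfl⟩).2 y hy.1 rfl)
  obtain ⟨y1, hy1, rfl⟩ := hJ'J hc1
  obtain ⟨O', hO'O, hO', ⟨y0, hy0⟩, hN | ⟨i, hi⟩⟩ := Φ.exists_nondeg_or_curve (m := m)
    (Q := fun y => G.normalFun (κ y) (cm y)) (fun b s => TV.nonneg) hD hV hO1 ⟨y1, hy1, hc1⟩
    (inter_subset_left.trans hκ.sub) ((hκ.continuousOn_normalFun hD1).mono inter_subset_left) hQV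
    fun y hy y' hy' h => by
      change G.normalFun (κ y) (Φ.c y m) = G.normalFun (κ y') (Φ.c y' m)
      rw [h, hκ.unique hV hy.1 hy'.1 h]
  swap
  · exact ⟨_, (hi y0 hy0).2⟩
  have hOO : O' ⊆ O := hO'O.trans inter_subset_left
  -- the normal functional is a multiple of `a - c I`
  have hU : ∀ y ∈ O', ∀ q : ℝ, (G.normalFun (κ y) (cm y)).comp (Φ.tan y m) =
      q • G.a2.comp (Φ.tan y m) → G.normalFun (κ y) (cm y) = q • (G.a2 - cm y • G.I2) := by
    intro y hy q hq
    obtain ⟨q', hq'⟩ := hN y hy (G.normalFun (κ y) (cm y) - q • G.a2) (Submodule.sub_mem _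
      (Submodule.subset_span ⟨1, rfl⟩) (Submodule.smul_mem _ _ (Core.Family.a_mem_genSpan y 0)))
      (DFunLike.ext _ _ fun v => sub_eq_zero.2 (congrArg (fun u => u v) hq))
    have h1 : 0 - q * cm y = q' * 1 := by
      have h2 := congrArg (fun u => u (G.i3 (Φ.b y m))) hq'
      change G.normalFun (κ y) (Φ.c y m) (G.i3 (Φ.b y m)) - q * Φ.c y m = q' * G.I3 (Φ.b y m) at h2
      rwa [hκ.normalFun_b (hOO hy), Core.Family.I3_b (hκ.sub (hOO hy))] at h2
    rw [zero_sub, mul_one] at h1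
    rw [sub_eq_iff_eq_add.1 hq', ← h1]
    refine DFunLike.ext _ _ fun x => ?_
    change -(q * cm y) * G.I2 x + q * G.a2 x = q * (G.a2 x - cm y * G.I2 x)
    ring
  obtain ⟨v, hv⟩ : ∃ v, G.a2 (Φ.tan y0 m v) ≠ 0 := by
    by_contra! hcon
    exact hdc y0 (hOO hy0) (ContinuousLinearMap.ext hcon)
  set q : Y → ℝ := fun y => G.normalFun (κ y) (cm y) (Φ.tan y m v) / G.a2 (Φ.tan y m v)
  have hcont : ∀ {Q : Y → B 2 →L[ℝ] ℝ}, ContinuousOn Q O →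
      ContinuousAt (fun y => Q y (Φ.tan y m v)) y0 := fun hQ =>
    ((Core.Family.continuousOn_comp_tan hD hκ.sub hQ m).clm_apply
      (continuousOn_const (c := v))).continuousAt (hκ.isOpen.mem_nhds (hOO hy0))
  have hqc : ContinuousAt q y0 :=
    (hcont (hκ.continuousOn_normalFun hD1)).div (hcont (continuousOn_const (c := G.a2))) hv
  have hav : ∀ᶠ y in 𝓝 y0, G.a2 (Φ.tan y m v) ≠ 0 :=
    (hcont (continuousOn_const (c := G.a2))).eventually_ne hv
  have hslope : ∀ y ∈ O', G.a2 (Φ.tan y m v) ≠ 0 → ∀ x w, F.IsReg ν (cm y) x →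
      fderiv ℝ (F.lift ν) (cm y, x) (1, w) = 0 →
      F.dα x w - 1 + q y * (F.α (proj x) - cm y) = 0 := by
    intro y hy hvy x w hx hw
    obtain ⟨q', hq'⟩ := hκ.exists_multiplier hV hD (hOO hy) (hdc y (hOO hy))
    have hqq : q y = q' := by
      have h1 := congrArg (fun u => u v) hq'
      change G.normalFun (κ y) (cm y) (Φ.tan y m v) = q' * G.a2 (Φ.tan y m v) at h1
      change _ / _ = _
      rw [h1, mul_div_cancel_right₀ _ hvy]
    rw [hqq]
    have hUy := hU y hy q' hq'
    obtain ⟨ζ, hζ⟩ := hsol y (hOO hy)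
    refine abs_nonpos_iff.1 (le_of_forall_pos_le_add fun ε hε => ?_)
    obtain ⟨O2, hO2, hx2, hloc⟩ := hζ.exists_local hD (mem_of_superset
      (hJ.mem_nhds ⟨y, hOO hy, rfl⟩) hJR) hx hw (half_pos hε)
    obtain ⟨O3, hO3, hx3, hnear⟩ := exists_near (ζ := fun p => q' * (F.α p - cm y))
      (by have := F.α.continuous; fun_prop) (proj x) (half_pos hε)
    obtain ⟨b, μ, hb, -, hμ⟩ := X.exists_represents_near (hO2.inter hO3) ⟨hx2, hx3⟩
    have h1 := hloc b μ hb (measure_mono_null (compl_subset_compl.2 inter_subset_left) hμ)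
    have h2 := abs_integral_sub_le (measure_mono_null
      (compl_subset_compl.2 inter_subset_right) hμ)
      (by have := F.α.continuous; fun_prop) hnear
    have h3 : G.normalFun (κ y) (cm y) (G.i3 b) =
        ∫ p, q' * (F.α p - cm y) ∂μ := by
      rw [hUy, integral_const_mul, integral_sub (integrable_of_continuous F.α.continuous _)
        (integrable_const _), integral_const, probReal_univ, one_smul]
      change q' * (G.a3 b - cm y * G.I3 b) = _
      rw [core_a3, core_I3, hb.pair, hb.integral, mul_one]
      rfl
    have h4 : G.I3 b = 1 := (core_I3 b).trans hb.integral
    rw [← h3, Core.normalFun_i3, h4] at h2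
    change |κ y (G.i2 (G.W3 (cm y) b)) + F.dα x w| ≤ _ at h1
    rw [abs_le] at h1 h2 ⊢
    constructor <;> linarith [h1.1, h1.2, h2.1, h2.2]
  obtain ⟨M, hM0, hM⟩ := exists_bound F.α.continuous
  obtain ⟨δ, hδ, hb⟩ := Metric.isOpen_iff.1 hJ _ ⟨y0, hOO hy0, rfl⟩
  refine ⟨cm y0, hasCurve_of_slope hs hδ (fun c hc => (hK c (hb hc)).1) (q := q y0) fun ε hε => ?_⟩
  set M' := M + |cm y0| + 1
  have hM' : 0 < M' := by positivity
  have hqε : ∀ᶠ y in 𝓝 y0, |q y - q y0| < ε / M' :=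
    hqc.eventually (Metric.ball_mem_nhds _ (by positivity : 0 < ε / M'))
  filter_upwards [hnhds y0 (hOO hy0) _ (inter_mem (hO'.mem_nhds hy0) (inter_mem hav hqε)),
    Metric.ball_mem_nhds (cm y0) one_pos] with c hc hc1 x w hx hw
  obtain ⟨y, ⟨hy, hvy, hqy⟩, rfl⟩ := hc
  have h1 := hslope y hy hvy x w hx hw
  rw [show F.dα x w - 1 + q y0 * (F.α (proj x) - cm y) =
    (q y0 - q y) * (F.α (proj x) - cm y) by linear_combination h1, abs_mul, abs_sub_comm]
  rw [Metric.mem_ball, Real.dist_eq] at hc1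
  have h2 : |F.α (proj x) - cm y| ≤ M' := by
    have h3 := abs_sub (F.α (proj x)) (cm y)
    have h4 := hM (proj x)
    rw [Real.norm_eq_abs] at h4
    have := abs_sub_abs_le_abs_sub (cm y) (cm y0)
    linarith
  calc _ ≤ ε / M' * M' := mul_le_mul hqy.le h2 (abs_nonneg _) (by positivity)
    _ = ε := div_mul_cancel₀ _ hM'.ne'

/-- Either there is a curve of solutions, or the mean is stationary and `α` is constant. -/
lemma exists_hasCurve_or_const
    (hs : ∀ c ∈ range F.meanα, Function.Surjective (F.coupled ν c))
    (hD1 : DualApprox 𝐆.i1) (hD : DualApprox 𝐆.i2)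
    (hc : 𝐆.a3 h₃ ∈ range F.meanα) {w : ℂ} (hw : ‖w‖ < 1)
    (hfw : ser (charCoef (𝐆.coef h₃)) w = 0)
    (Φ : 𝐆.Family h₃ Y) :
    (∃ c, 𝐆.HasCurve X.TV c) ∨ ∃ q : ℝ, ∀ x, F.α x = q := by
  let G := 𝐆
  have hV := isStable (X := X) (hX := hX) (hR := hR) hs
  obtain ⟨A, ρ, N, s, hρ0, hρ1, hsc, hA, hN, hq, hW⟩ := Core.Family.exists_relation hD1 hc hw hfw Φ
  obtain ⟨O, m, A', σ, p, hO, hne, hOU, hσ, hcont, hcon⟩ :=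
    Core.Family.exists_conormal hD1 hV hρ0 hρ1 hsc hA hN hq hW
  have hsol : ∀ y ∈ O, ∃ ζ, IsSol hX hR (Φ.c y m) ((Φ.conormal m σ p y).comp G.i2) ζ :=
    fun y hy => exists_isSol (Core.Family.c_mem (hOU hy) m)
      (fun n => Core.Family.c_mem (hOU hy) _) hρ0 hρ1 (hσ y hy) (hcon y hy).1
  have hκ : Φ.IsConormal (G.bounded X.TV) m O (Φ.conormal m σ p) :=
    ⟨hO, hOU, hcont, fun y hy => by
      obtain ⟨ζ, hζ⟩ := hsol y hy
      exact hζ.reps.mem_bounded hζ.cont, fun y hy => (hcon y hy).1, fun y hy => (hcon y hy).2⟩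
  have htan : ContinuousOn (fun y => G.a2.comp (Φ.tan y m)) O :=
    Core.Family.continuousOn_comp_tan hD hOU continuousOn_const m
  by_cases hdc : ∃ y ∈ O, G.a2.comp (Φ.tan y m) ≠ 0
  · left
    obtain ⟨y, hy, hy0⟩ := hdc
    refine exists_hasCurve hs hD1 hD (O := O ∩ {y | G.a2.comp (Φ.tan y m) ≠ 0})
      ⟨htan.isOpen_inter_preimage hO isOpen_compl_singleton, inter_subset_left.trans hκ.sub,
        hκ.cont.mono inter_subset_left, fun y hy => hκ.mem y hy.1, fun y hy => hκ.eqn y hy.1,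
        fun y hy => hκ.orb y hy.1⟩ ⟨y, hy, hy0⟩ (fun y hy => hsol y hy.1) fun y hy => hy.2
  · push Not at hdc
    obtain ⟨O', hO'O, -, ⟨y, hy⟩, hN | ⟨i, hi⟩⟩ := Φ.exists_nondeg_or_curve (m := m)
      (Q := fun _ => 0) (fun b s => TV.nonneg) hD hV hO hne hOU continuousOn_const
      (fun y _ => Submodule.zero_mem _) fun _ _ _ _ _ => rfl
    · obtain ⟨q, hq⟩ := hN y hy _ (Core.Family.a_mem_genSpan y 0) (hdc y (hO'O hy))
      exact Or.inr ⟨q, const_of_a2_eq hq⟩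
    · exact Or.inl ⟨_, (hi y hy).2⟩

end BanachScale

/-! ### Curves of solutions exist only if `α` is constant -/

namespace CoupledSystem

lemma IsReg.exists_absolutelyContinuous {c : ℝ} {x : Fin d → ℝ} (h : F.IsReg ν c x) :
    ∃ O, IsOpen O ∧ proj x ∈ O ∧ ∀ μ : Measure (Torus d), μ ≪ volume → μ Oᶜ = 0 →
      μ.map (F.coupled ν c) ≪ volume := by
  obtain ⟨O, hO, hx, hnull⟩ := h.exists_null
  have hm := (continuous_coupled F ν c).measurable
  refine ⟨proj '' O, (isOpenQuotientMap_proj d).isOpenMap _ hO, mem_image_of_mem _ hx,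
    fun μ hμ hμO => Measure.AbsolutelyContinuous.mk fun A hA h0 => ?_⟩
  have hOm : MeasurableSet (proj '' O : Set (Torus d)) :=
    ((isOpenQuotientMap_proj d).isOpenMap _ hO).measurableSet
  have h1 : volume (proj '' O ∩ F.coupled ν c ⁻¹' A) = 0 := by
    rw [← volume_preimage_proj (hOm.inter (hm hA))]
    have h2 : volume (⋃ n : Fin d → ℤ, (fun x : Fin d → ℝ => x + fun k => (n k : ℝ)) ⁻¹'
        (O ∩ {y | F.coupled ν c (proj y) ∈ A})) = 0 :=
      measure_iUnion_null fun n => (measure_preimage_add_right volume _ _).trans (hnull A hA h0)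
    refine measure_mono_null ?_ h2
    rintro y ⟨⟨z, hz, hzy⟩, hyA⟩
    obtain ⟨n, hn⟩ := proj_eq_iff.1 hzy
    refine mem_iUnion.2 ⟨n, ?_⟩
    change y + _ ∈ O ∧ F.coupled ν c (proj (y + _)) ∈ A
    rw [← hn, hzy]
    exact ⟨hz, hyA⟩
  rw [Measure.map_apply hm hA]
  refine measure_mono_null (fun y hy => ?_) (measure_union_null hμO (hμ h1))
  exact (em (y ∈ proj '' O)).symm.imp id fun h => ⟨h, hy⟩

end CoupledSystem

namespace BanachScale

/-- On absolutely continuous measures, a solution of `K ∘ L c = a - c I` is an average of `α - c`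
over regular points. -/
lemma exists_average {c : ℝ} (hc : c ∈ range F.meanα)
    (hs : Function.Surjective (F.coupled ν c)) {K : B 2 →L[ℝ] ℝ}
    (hK : K ∈ 𝐆.bounded X.TV) (heq : ∀ x, K (𝐆.L2 c x) =
      𝐆.a2 x - c * 𝐆.I2 x) {b : B 3} (hb : X.Represents 3 b μ)
    (hμ : (μ : Measure (Torus d)) ≪ volume) : ∃ μ' : Measure (Torus d), IsProbabilityMeasure μ' ∧
      (∀ᵐ p ∂μ', ∃ x, proj x = p ∧ F.IsReg ν c x) ∧
      K (𝐆.i3 b) = (∫ p, F.α p ∂μ') - c := by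
  obtain ⟨μ', hμ', hcrit, h⟩ := exists_integral (hX := hX) (hR := hR) (hR c hc) hs hb hμ
  refine ⟨μ', hμ', ?_, (h K hK (fun p => F.α p - c) (F.α.continuous.sub continuous_const)
    fun ψ => ?_).trans ?_⟩
  · filter_upwards [measure_eq_zero_iff_ae_notMem.1 hcrit] with p hp
    obtain ⟨x, rfl⟩ := proj_surjective p
    exact ⟨x, rfl, not_not.1 fun hx => hp ⟨x, hx, rfl⟩⟩
  · have e : X.emb 2 ψ = X.incl 2 (X.emb 3 ψ) := (incl_emb (X := X) 2 ψ).symm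
    have h1 : 𝐆.a2 (X.emb 2 ψ) = ∫ x, ψ x * F.α x :=
      (congrArg 𝐆.a2 e).trans ((core_a3 _).trans (X.J_emb 3 ψ _))
    have h2 : 𝐆.I2 (X.emb 2 ψ) = ∫ x, ψ x * 1 :=
      (congrArg 𝐆.I2 e).trans ((core_I3 _).trans (X.J_emb 3 ψ _))
    refine (heq _).trans ?_
    rw [h1, h2]
    simp_rw [mul_one, mul_sub]
    exact (congrArg (fun y => _ - y) ((mul_comm _ _).trans (integral_mul_const c _).symm)).trans
      (integral_sub (integrable_of_continuous (ψ.continuous.mul F.α.continuous) _)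
        (integrable_of_continuous (ψ.continuous.mul continuous_const) _)).symm
  · rw [integral_sub (integrable_of_continuous F.α.continuous _) (integrable_const _),
      integral_const, probReal_univ, one_smul]

/-- Near a regular point there are densities whose images under `L c` are absolutely continuous, with
`α`-average as close as desired to the value of `α` there. -/
lemma exists_near_max {c : ℝ} (hc : c ∈ range F.meanα) {x : Fin d → ℝ} (hx : F.IsReg ν c x)
    {ε : ℝ} (hε : 0 < ε) : ∃ b : B 3, |𝐆.a3 b - F.α (proj x)| ≤ ε ∧
      𝐆.I3 b = 1 ∧ ∃ μ : ProbabilityMeasure (Torus d),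
        X.Represents 3 (𝐆.L3 c b) μ ∧ (μ : Measure (Torus d)) ≪ volume := by
  obtain ⟨O, hO, hxO, hac⟩ := hx.exists_absolutelyContinuous
  obtain ⟨O', hO', hxO', hnear⟩ := exists_near F.α.continuous (proj x) hε
  obtain ⟨b, μ, hb, hμ, hμO⟩ := X.exists_represents_near (hO.inter hO') ⟨hxO, hxO'⟩
  refine ⟨b, ?_, (core_I3 b).trans hb.integral, _, hb.map (hR c hc), hac _ hμ
    (measure_mono_null (compl_subset_compl.2 inter_subset_left) hμO)⟩
  rw [core_a3, hb.pair]
  exact abs_integral_sub_le (measure_mono_null (compl_subset_compl.2 inter_subset_right) hμO)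
    F.α.continuous hnear

/-- The values of the solutions `K t` on absolutely continuous probability measures lie between
the extreme values of `α - (c + t)` on the set of regular points, and these bounds are sharp for
`K 0`. As they decrease with unit speed in `t`, while `K t` is close to `(1 + l t) K 0`, the upper
and the lower bound agree. -/
lemma const_of_hasCurve (hs : ∀ c ∈ range F.meanα, Function.Surjective (F.coupled ν c)) {c : ℝ}
    (h : 𝐆.HasCurve X.TV c) : ∃ q : ℝ, ∀ x, F.α x = q := by
  let G := 𝐆
  obtain ⟨K, l, hK, hKl⟩ := h
  obtain ⟨hc, hK0, hKL⟩ := hK.self_of_nhds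
  simp only [add_zero] at hc hKL
  let S : ℝ → Set ℝ := fun s => (fun x => s * F.α (proj x)) '' {x | ∃ c, F.IsReg ν c x}
  obtain ⟨N, hN0, hN⟩ := exists_bound F.α.continuous
  have hbdd : ∀ s, BddAbove (S s) := fun s => ⟨|s| * N, by
    rintro _ ⟨x, -, rfl⟩
    refine (le_abs_self _).trans ?_
    rw [abs_mul]
    exact mul_le_mul_of_nonneg_left (hN _) (abs_nonneg s)⟩
  -- absolutely continuous measures, and the bounds for them
  have hupper : ∀ s M, IsLUB (S s) M → ∀ t, c + t ∈ G.R → K t ∈ G.bounded X.TV →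
      (∀ x, K t (G.L2 (c + t) x) = G.a2 x - (c + t) * G.I2 x) → ∀ b (μ : ProbabilityMeasure (Torus d)),
      X.Represents 3 b μ → (μ : Measure (Torus d)) ≪ volume →
      s * K t (G.i3 b) ≤ M - s * (c + t) := by
    intro s M hM t ht hKt hKtL b μ hb hμ
    obtain ⟨μ', hμ', hreg, e⟩ := exists_average ht (hs _ ht) hKt hKtL hb hμ
    rw [e, mul_sub, ← integral_const_mul]
    refine sub_le_sub_right ?_ _
    have h1 := integral_mono_ae ((integrable_of_continuous F.α.continuous μ').const_mul s)
      (integrable_const M) (hreg.mono fun p hp => by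
        obtain ⟨x, rfl, hx⟩ := hp
        exact hM.1 ⟨x, ⟨_, hx⟩, rfl⟩)
    rwa [integral_const, probReal_univ, one_smul] at h1
  obtain ⟨b0, μ0, hb0, hμ0, -⟩ := X.exists_represents_near isOpen_univ (mem_univ (proj 0))
  have hne : {x | ∃ c, F.IsReg ν c x}.Nonempty := by
    obtain ⟨μ', hμ', hreg, -⟩ := exists_average hc (hs _ hc) hK0 hKL hb0 hμ0
    obtain ⟨p, x, -, hx⟩ := hreg.exists
    exact ⟨x, _, hx⟩
  have hlub : ∀ s, IsLUB (S s) (sSup (S s)) := fun s => isLUB_csSup (hne.image _) (hbdd s)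
  obtain ⟨C, hC⟩ := hK0
  have hsharp : ∀ s, |s| = 1 → ∀ η > 0, ∃ b, ∃ μ : ProbabilityMeasure (Torus d),
      X.Represents 3 b μ ∧ (μ : Measure (Torus d)) ≪ volume ∧
        sSup (S s) - s * c - η ≤ s * K 0 (G.i3 b) := by
    intro s hs1 η hη
    obtain ⟨_, ⟨x, ⟨c', hx⟩, rfl⟩, hxs⟩ := exists_lt_of_lt_csSup (hne.image _)
      (show sSup (S s) - η / 4 < sSup (S s) by linarith)
    have hsmall : ∀ᶠ t in 𝓝 (0 : ℝ), |t| * (2 + |l| * |C|) < η / 4 := by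
      have : Continuous fun t : ℝ => |t| * (2 + |l| * |C|) := by fun_prop
      exact (this.tendsto' 0 0 (by simp)).eventually (gt_mem_nhds (by positivity))
    obtain ⟨t, htx, ⟨ht, -, htL⟩, htK, hts⟩ := ((CoupledSystem.eventually_isReg hx c).and
      (((hK.and ((hKl 1 one_pos).and hsmall))).filter_mono nhdsWithin_le_nhds)).exists
    obtain ⟨b, hbα, hbI, μ, hb, hμ⟩ := exists_near_max (X := X) (hX := hX) (hR := hR) ht htx
      (show 0 < η / 4 by positivity)
    refine ⟨_, μ, hb, hμ, ?_⟩
    have h1 := htK _ 1 hb.tv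
    have h2 := hC _ 1 hb.tv
    have h3 : K t (G.i3 (G.L3 (c + t) b)) = G.a3 b - (c + t) := by
      rw [G.commL3, htL]
      change G.a3 b - (c + t) * G.I3 b = _
      rw [hbI, mul_one]
    change |K t (G.i3 (G.L3 (c + t) b)) - (1 + l * t) * K 0 (G.i3 (G.L3 (c + t) b))| ≤ _ at h1
    change |K 0 (G.i3 (G.L3 (c + t) b))| ≤ _ at h2
    change |G.a3 b - _| ≤ _ at hbα
    change sSup (S s) - s * c - η ≤ s * K 0 (G.i3 (G.L3 (c + t) b))
    set k := K 0 (G.i3 (G.L3 (c + t) b))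
    rw [h3] at h1
    have h4 : s * k = s * F.α (proj x) + s * (G.a3 b - F.α (proj x)) - s * c - s * t -
        s * (G.a3 b - (c + t) - (1 + l * t) * k) - s * (l * t * k) := by ring
    have h5 : ∀ y, -|y| ≤ s * y ∧ s * y ≤ |y| := fun y => by rw [← abs_le, abs_mul, hs1, one_mul]
    have h6 : |l * t * k| ≤ |t| * (|l| * |C|) := by
      rw [abs_mul, abs_mul, mul_comm |l|, mul_assoc]
      exact mul_le_mul_of_nonneg_left (mul_le_mul_of_nonneg_left
        (h2.trans ((mul_one C).le.trans (le_abs_self C))) (abs_nonneg _)) (abs_nonneg _)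
    have := (h5 (G.a3 b - F.α (proj x))).1
    have := (h5 t).2
    have := (h5 (G.a3 b - (c + t) - (1 + l * t) * k)).2
    have := (h5 (l * t * k)).2
    rw [h4]
    nlinarith
  have key : ∀ s, |s| = 1 → l * (sSup (S s) - s * c) = -s := by
    intro s hs1
    set m := sSup (S s) - s * c
    have h1 : ∀ ε > 0, |l * m + s| ≤ ε := by
      intro ε hε
      have h2 : ∀ᶠ t in 𝓝 (0 : ℝ), t * (l * m + s) ≤ ε * |t| := by
        have hpos : ∀ᶠ t in 𝓝 (0 : ℝ), 0 < 1 + l * t := by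
          have : Continuous fun t : ℝ => 1 + l * t := by fun_prop
          exact (this.tendsto' 0 1 (by simp)).eventually (lt_mem_nhds one_pos)
        filter_upwards [hK, hKl ε hε, hpos] with t ht htK htp
        refine le_of_forall_pos_le_add fun η hη => ?_
        obtain ⟨b, μ, hb, hμ, h3⟩ := hsharp s hs1 (η / (1 + l * t)) (by positivity)
        have h4 := hupper s _ (hlub s) t ht.1 ht.2.1 ht.2.2 b μ hb hμ
        have h5 := htK b 1 hb.tv
        have h6 : -(ε * |t| * 1) ≤ s * (K t (G.i3 b) - (1 + l * t) * K 0 (G.i3 b)) := by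
          refine (abs_le.1 ?_).1
          rw [abs_mul, hs1, one_mul]
          exact h5
        have h7 := mul_le_mul_of_nonneg_left h3 htp.le
        rw [mul_sub, mul_div_cancel₀ _ htp.ne'] at h7
        have : sSup (S s) = m + s * c := by ring
        nlinarith
      obtain ⟨δ, hδ, h3⟩ := Metric.eventually_nhds_iff_ball.1 h2
      have h4 := h3 (δ / 2) (by simp [abs_of_pos hδ, hδ])
      have h5 := h3 (-(δ / 2)) (by simp [abs_of_pos hδ, hδ])
      rw [abs_neg] at h5
      rw [abs_of_pos (half_pos hδ)] at h4 h5
      exact abs_le.2 ⟨by nlinarith, by nlinarith⟩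
    have := abs_nonpos_iff.1 (le_of_forall_pos_le_add fun ε hε => (h1 ε hε).trans (zero_add ε).ge)
    linarith
  have hp := key 1 abs_one
  have hm := key (-1) (by simp)
  have hl : l ≠ 0 := by
    rintro rfl
    norm_num at hp
  have hM : sSup (S 1) = -sSup (S (-1)) := mul_left_cancel₀ hl (by linarith)
  have hK0I : K 0 = (sSup (S 1) - c) • G.I2 := by
    refine ext_of_density (X := X) fun f hf hf1 => ?_
    obtain ⟨μ, hμ⟩ := exists_hasDensity f.continuous hf hf1
    have hb := represents_emb (X := X) (i := 3) hμ hf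
    have hac : (μ : Measure (Torus d)) ≪ volume := by
      rw [show (μ : Measure (Torus d)) = _ from hμ]
      exact withDensity_absolutelyContinuous _ _
    have h1 := fun s => hupper s _ (hlub s) 0 (by rwa [add_zero]) ⟨C, hC⟩
      (by simpa only [add_zero] using hKL) _ μ hb hac
    have h2 := h1 1
    have h3 := h1 (-1)
    rw [show G.i3 (X.emb 3 f) = X.emb 2 f from incl_emb (X := X) 2 f] at h2 h3
    have h4 : G.I2 (X.emb 2 f) = 1 := by
      rw [← show G.i3 (X.emb 3 f) = X.emb 2 f from incl_emb (X := X) 2 f]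
      exact (core_I3 _).trans hb.integral
    change _ = (sSup (S 1) - c) * G.I2 (X.emb 2 f)
    rw [h4]
    linarith
  refine ⟨sSup (S 1), const_of_a2_eq (hX := hX) (hR := hR) (DFunLike.ext _ _ fun x => ?_)⟩
  have h1 := hKL x
  rw [hK0I] at h1
  change (sSup (S 1) - c) * G.I2 (G.L2 c x) = G.a2 x - c * G.I2 x at h1
  rw [G.I2_L hc] at h1
  change G.a2 x = sSup (S 1) * G.I2 x
  linarith

end BanachScale

/-! ### Instability -/

/-- The smooth functions with zero average, with the `C^k` norm. -/
def zeroMean (d k : ℕ) : Submodule ℝ (Cr d k) where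
  carrier := {f | IsCn ∞ f ∧ ∫ x, f x = 0}
  add_mem' := fun {f g} hf hg => ⟨ContDiff.add hf.1 hg.1, by
    refine (integral_add (integrable_of_continuous f.continuous _)
      (integrable_of_continuous g.continuous _)).trans ?_
    rw [hf.2, hg.2, add_zero]⟩
  zero_mem' := ⟨contDiff_const, integral_zero _ _⟩
  smul_mem' := fun c f hf => ⟨contDiff_const.smul hf.1, (integral_const_mul c _).trans (by
    rw [hf.2, mul_zero])⟩

lemma crNorm_mono {d k k' : ℕ} (h : k ≤ k') (f : Torus d → ℝ) : crNorm k f ≤ crNorm k' f :=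
  Finset.sum_le_sum_of_subset_of_nonneg (Finset.range_mono (by omega)) fun j _ _ =>
    Real.iSup_nonneg fun x => norm_nonneg _

namespace BanachScale

variable (X) in
lemma dualApprox_incl (i : Fin 3) : DualApprox (X.incl i) := fun F ε hε => by
  obtain ⟨φ, hφ⟩ := (X.dense_dual i.succ).exists_dist_lt F hε
  refine ⟨(X.J i.castSucc).flip φ, ?_⟩
  rw [show ((X.J i.castSucc).flip φ).comp (X.incl i) = (X.J i.succ).flip φ by ext; simp [X.J_incl],
    ← dist_eq_norm]
  exact hφ.le

variable (X) in
/-- The inclusion of the smooth functions with zero average. -/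
noncomputable def embZero {k : ℕ} (hk : r ≤ k) : zeroMean d k →L[ℝ] B 3 :=
  LinearMap.mkContinuous
    { toFun := fun y => X.emb 3 (Smooth.toCr r ⟨y.1, y.2.1⟩)
      map_add' := fun y y' => (X.emb 3).map_add (Smooth.toCr r ⟨y.1, y.2.1⟩)
        (Smooth.toCr r ⟨y'.1, y'.2.1⟩)
      map_smul' := fun q y => (X.emb 3).map_smul q (Smooth.toCr r ⟨y.1, y.2.1⟩) } ‖X.emb 3‖
    fun _ => ((X.emb 3).le_opNorm _).trans
      (mul_le_mul_of_nonneg_left (crNorm_mono hk _) (norm_nonneg _))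

/-- The densities in an open set on which the convergence to `h` is uniform contain an attracted
family. -/
lemma exists_family (hX : X.Admissible) (hR : ∀ c ∈ range F.meanα, F.coupledMap r ν c ∈ 𝒯)
    (dw : CompatibleMetric (ProbabilityMeasure (Torus d))) {h : ProbabilityMeasure (Torus d)}
    (hh : X.Represents 3 h₃ h) {A : Set (Smooth d)} (hne : A.Nonempty)
    (hA : IsOpenFamily A) (hlim : Tendsto (fun n : ℕ => ⨆ μ ∈ normalizedMeasures A,
      ENNReal.ofReal (dw.dist ((F.push ν)^[n] μ) h)) atTop (𝓝 0)) :
    ∃ k, Nonempty ((X.core hX F ν hR).Family h₃ (zeroMean d k)) := by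
  set G := X.core hX F ν hR
  obtain ⟨g, hg⟩ := hne
  obtain ⟨hg0, x0, hx0⟩ := hA.1 hg
  obtain ⟨k0, ε, hε, hgA⟩ := hA.2 g hg
  set k := max k0 r
  have hk : r ≤ k := le_max_right _ _
  -- make the density positive
  set one : Smooth d := ⟨fun _ => 1, contDiff_const⟩
  set η := ε / (2 * (‖one.toCr k‖ + 1))
  have hη : 0 < η := by positivity
  have hη1 : ‖η • one.toCr k‖ < ε / 2 := by
    rw [norm_smul, Real.norm_of_nonneg hη.le, div_mul_eq_mul_div, div_lt_div_iff₀ (by positivity)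
      two_pos]
    nlinarith
  have hI : 0 < ∫ x, g x + η := by
    refine lt_of_lt_of_le hη ?_
    have := integral_mono (integrable_const η) (integrable_of_continuous
      (g.continuous.add continuous_const) volume) fun x => le_add_of_nonneg_left (hg0 x)
    rwa [integral_const, measureReal_univ_torus, one_smul] at this
  set c := ∫ x, g x + η
  set ρ := min (ε / 2) η / c
  have hρ : 0 < ρ := div_pos (lt_min (half_pos hε) hη) hI
  let f : zeroMean d k → Smooth d := fun y => ⟨fun x => g x + η + c * y.1 x,
    (ContDiff.add g.2 contDiff_const).add (contDiff_const.mul y.2.1)⟩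
  have hfI : ∀ y, ∫ x, f y x = c := fun y => by
    refine (integral_add (integrable_of_continuous (g.continuous.add continuous_const) _)
      (integrable_of_continuous (continuous_const.mul y.1.continuous) _)).trans ?_
    refine (congrArg (fun t => c + t) ((integral_const_mul c _).trans ?_)).trans (add_zero c)
    exact (congrArg (c * ·) y.2.2).trans (mul_zero c)
  have hcy : ∀ y ∈ Metric.ball (0 : zeroMean d k) ρ, ‖c • y.1‖ < min (ε / 2) η := fun y hy => by
    rw [mem_ball_zero_iff, lt_div_iff₀ hI] at hy
    rw [norm_smul, Real.norm_of_nonneg hI.le, mul_comm]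
    exact hy
  have hf0 : ∀ y ∈ Metric.ball (0 : zeroMean d k) ρ, ∀ x, 0 < f y x := fun y hy x => by
    have h1 := (c • y.1).abs_le_norm x
    have h2 := (hcy y hy).trans_le (min_le_right _ _)
    change |c * y.1 x| ≤ _ at h1
    change 0 < g x + η + c * y.1 x
    linarith [hg0 x, neg_abs_le (c * y.1 x)]
  have hfA : ∀ y ∈ Metric.ball (0 : zeroMean d k) ρ, f y ∈ A := fun y hy => by
    refine hgA _ ⟨fun x => (hf0 y hy x).le, 0, (hf0 y hy 0).ne'⟩
      ((crNorm_mono (le_max_left k0 r) _).trans_lt ?_)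
    have h1 : (fun x => f y x - g x) = (η • one.toCr k + c • y.1 : Cr d k) := funext fun x => by
      change g x + η + c * y.1 x - g x = η * 1 + c * y.1 x
      ring
    rw [h1]
    refine (norm_add_le (η • one.toCr k) (c • y.1)).trans_lt ?_
    linarith [(hcy y hy).trans_le (min_le_left _ _)]
  set β := X.emb 3 (c⁻¹ • (g.toCr r + η • one.toCr r))
  have hrep : ∀ y ∈ Metric.ball (0 : zeroMean d k) ρ, ∃ μ ∈ normalizedMeasures A,
      X.Represents 3 (β + X.embZero hk y) μ := fun y hy => by
    have h1 : ∀ x, 0 ≤ f y x / ∫ x, f y x := fun x => by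
      rw [hfI]
      exact div_nonneg (hf0 y hy x).le hI.le
    obtain ⟨μ, hμ⟩ := exists_hasDensity (ρ := fun x => f y x / ∫ x, f y x)
      ((f y).continuous.div_const _) h1 (by
        rw [integral_div, div_self]
        rw [hfI]; exact hI.ne')
    refine ⟨μ, ⟨f y, hfA y hy, hμ⟩, ?_⟩
    have h2 := represents_normalized (X := X) 3 (fun x => (hf0 y hy x).le) (by rw [hfI]; exact hI) hμ
    rw [hfI] at h2
    have h3 : c⁻¹ • (f y).toCr r = c⁻¹ • (g.toCr r + η • one.toCr r) +
        Smooth.toCr r ⟨y.1, y.2.1⟩ := Subtype.ext (funext fun x => by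
      change c⁻¹ * (g x + η + c * y.1 x) = c⁻¹ * (g x + η * 1) + y.1 x
      rw [mul_add c⁻¹, inv_mul_cancel_left₀ hI.ne', mul_one])
    rwa [h3, map_add] at h2
  have hM : ∀ y ∈ Metric.ball (0 : zeroMean d k) ρ, ∀ n,
      ‖G.orb (β + X.embZero hk y) n‖ ≤ G.C * (‖β‖ + ‖X.embZero hk‖ * ρ) := fun y hy n => by
    obtain ⟨μ, -, hμ⟩ := hrep y hy
    refine (hμ.isOrbit.norm_le n).trans (mul_le_mul_of_nonneg_left ?_ G.C_pos.le)
    refine (norm_add_le _ _).trans (add_le_add_right (((X.embZero hk).le_opNorm y).trans ?_) _)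
    rw [mem_ball_zero_iff] at hy
    gcongr
  have hemb : ∀ f : Cr d r, G.I2 (X.emb 2 f) = ∫ x, f x := fun f => by
    rw [← show G.i3 (X.emb 3 f) = X.emb 2 f from incl_emb (X := X) 2 _]
    refine ((core_I3 _).trans (X.J_emb 3 _ _)).trans ?_
    change ∫ x : Torus d, f x * 1 = _
    simp_rw [mul_one]
  refine ⟨k, ⟨{
    e := X.embZero hk
    β := β
    U := Metric.ball 0 ρ
    isOpen := Metric.isOpen_ball
    nonempty := ⟨0, Metric.mem_ball_self hρ⟩
    M := _
    orbit := fun y hy => ?_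
    norm_le := hM
    I_e := fun y => ?_
    dense := fun Φ hΦ => ?_
    attract := fun δ hδ => ?_ }⟩⟩
  · obtain ⟨μ, -, hμ⟩ := hrep y hy
    exact hμ.isOrbit
  · have := hemb (Smooth.toCr r ⟨y.1, y.2.1⟩)
    rw [← show G.i3 (X.emb 3 _) = X.emb 2 _ from incl_emb (X := X) 2 _] at this
    exact this.trans y.2.2
  · refine ⟨Φ (X.emb 2 (oneCr d r)), ?_⟩
    have hd := (X.dense_emb 2).comp (dense_smooth d r) (X.emb 2).continuous
    refine DFunLike.coe_injective (hd.equalizer Φ.continuous (ContinuousLinearMap.continuous _)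
      (funext fun φ => ?_))
    change Φ (X.emb 2 (φ.toCr r)) = Φ (X.emb 2 (oneCr d r)) * G.I2 (X.emb 2 (φ.toCr r))
    set m := ∫ x, φ x
    let y : zeroMean d k := ⟨φ.toCr k - m • oneCr d k,
        (ContDiff.sub φ.2 contDiff_const : ContDiff ℝ ∞ fun x : Fin d → ℝ => φ (proj x) - m * 1), by
      refine (integral_sub (integrable_of_continuous φ.continuous _)
        (integrable_of_continuous (continuous_const (y := m * 1)) _)).trans ?_
      rw [integral_const, measureReal_univ_torus, one_smul, mul_one, sub_self]⟩
    have h2 : X.emb 2 (φ.toCr r - m • oneCr d r) = G.i3 (X.embZero hk y) :=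
      (incl_emb (X := X) 2 _).symm
    have h3 : Φ (X.emb 2 (φ.toCr r - m • oneCr d r)) = 0 := by rw [h2]; exact hΦ y
    rw [map_sub, map_smul, map_sub, map_smul, sub_eq_zero] at h3
    rw [h3, hemb, mul_comm]
    rfl
  · obtain ⟨δ', hδ', hclose⟩ := exists_close_of_dist hX dw hh (G.C * (‖β‖ + ‖X.embZero hk‖ * ρ)) hδ
    obtain ⟨N, hN⟩ := eventually_atTop.1 (hlim.eventually (gt_mem_nhds (ENNReal.ofReal_pos.2 hδ')))
    refine ⟨N, fun n hn y hy => ?_⟩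
    obtain ⟨μ, hμA, hμ⟩ := hrep y hy
    refine (hclose _ _ (hμ.orb n) (hM y hy n) ?_).le
    have h4 := (le_iSup₂ (f := fun μ (_ : μ ∈ normalizedMeasures A) =>
      ENNReal.ofReal (dw.dist ((F.push ν)^[n] μ) h)) μ hμA).trans_lt (hN n hn)
    exact (ENNReal.ofReal_lt_ofReal_iff hδ').1 h4

/-- A spectral value outside the closed unit disc excludes that the measure is physical. -/
lemma not_isPhysical [∀ i, CompleteSpace (B i)] (hX : X.Admissible)
    (hR : ∀ c ∈ range F.meanα, F.coupledMap r ν c ∈ 𝒯)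
    (hsurj : ∀ c ∈ range F.meanα, Function.Surjective (F.coupled ν c))
    (dw : CompatibleMetric (ProbabilityMeasure (Torus d))) {h : ProbabilityMeasure (Torus d)}
    (hh : X.Represents 3 h₃ h) {z : ℂ} (hz1 : 1 < ‖z‖)
    (hz : z ∈ complexSpectrum ((X.core hX F ν hR).lin h₃)) : ¬ IsPhysical dw F ν h := by
  rintro ⟨-, A, hne, hA, hlim⟩
  set G := X.core hX F ν hR
  obtain ⟨k, ⟨Φ⟩⟩ := exists_family hX hR dw hh hne hA hlim
  have hc : G.a3 h₃ ∈ G.R := by rw [core_a3, hh.pair]; exact ⟨h, rfl⟩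
  have hw : ‖z⁻¹‖ < 1 := by rw [norm_inv]; exact inv_lt_one_of_one_lt₀ hz1
  have hser := Core.ser_eq_zero_of_mem_spectrum hc hz1 hz
  obtain ⟨q, hq⟩ : ∃ q : ℝ, ∀ x, F.α x = q := by
    obtain ⟨c, hcurve⟩ | hconst := exists_hasCurve_or_const hsurj (X.dualApprox_incl 0)
      (X.dualApprox_incl 1) hc hw hser Φ
    · exact const_of_hasCurve hsurj hcurve
    · exact hconst
  -- for constant `α` the characteristic function is `1`
  have hI : ∀ (j : ℕ) (x : B 1), G.I1 ((G.L1 (G.a3 h₃) ^ j) x) = G.I1 x := by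
    intro j
    induction j with
    | zero => exact fun x => rfl
    | succ j ih =>
      intro x
      rw [pow_succ']
      exact (G.I1_L hc _).trans (ih x)
  have hcoef : ∀ j, G.coef h₃ j = 0 := fun j => by
    refine (core_a1 _).trans ((pair_of_const 1 hq _).trans ?_)
    rw [← core_I1 (hX := hX) (hR := hR), hI, G.commW3, G.I1_W hc, mul_zero]
  refine one_ne_zero (α := ℂ) (Eq.trans ?_ hser)
  rw [ser, tsum_eq_single 0 fun l hl => ?_]
  · simp [charCoef]
  · obtain ⟨j, rfl⟩ := Nat.exists_eq_succ_of_ne_zero hl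
    simp [charCoef, hcoef]

end BanachScale

end MeanField

theorem mainTheorem3 {d r : ℕ} (hr : 12 < r)
    (F : MeanField.CoupledSystem d)
    (νstar : ℝ) (hνstar : 0 < νstar)
    (𝒯 : Set (MeanField.CrMap d r))
    (h𝒯_surj : ∀ S ∈ 𝒯, Function.Surjective S)
    (h𝒯_comp : ∀ S ∈ 𝒯, ∀ S' ∈ 𝒯, MeanField.CrMap.comp S S' ∈ 𝒯)
    (h𝒯 : ∀ ν ∈ Set.Icc (0 : ℝ) νstar, ∀ μ : ProbabilityMeasure (MeanField.Torus d),
      F.coupledMap r ν (F.meanα μ) ∈ 𝒯)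
    (B : Fin 4 → Type*) [∀ i, NormedAddCommGroup (B i)] [∀ i, NormedSpace ℝ (B i)]
    [∀ i, CompleteSpace (B i)]
    (X : MeanField.BanachScale r 𝒯 B) (hX : X.Admissible)
    (dw : MeanField.CompatibleMetric (ProbabilityMeasure (MeanField.Torus d)))
    (ν : ℝ) (hν : ν ∈ Set.Icc (0 : ℝ) νstar)
    (h : ProbabilityMeasure (MeanField.Torus d)) (hvis : MeanField.IsVisible dw F ν h) :
    ∃ h₃ : B 3, X.Represents 3 h₃ h ∧
      let S : 𝒯 := ⟨F.coupledMap r ν (F.meanα h), h𝒯 ν hν h⟩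
      let Dh : B 1 →L[ℝ] B 1 := X.linearized F ν S h₃
      MeanField.HasGateauxDifferential (X.nonlinear F ν) (X.nonlinearDomain F)
        {φ | X.integral 1 φ = 0} Dh (X.incl 1 (X.incl 2 h₃)) ∧
      (∃ Θ : B 1, X.IsTheta F ν S h₃ Θ ∧ (∀ Θ' : B 1, X.IsTheta F ν S h₃ Θ' → Θ' = Θ) ∧
        ((∃ κ : ℝ, 0 < κ ∧ κ < 1 ∧ ∀ z ∈ MeanField.complexSpectrum Dh, z ≠ 1 → ‖z‖ < κ) →
          X.pair F.α 1 Θ ≠ 1 → MeanField.IsPhysical dw F ν h)) ∧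
      ((∃ z ∈ MeanField.complexSpectrum Dh, 1 < ‖z‖) → ¬ MeanField.IsPhysical dw F ν h) := by
  have hR : ∀ c ∈ Set.range F.meanα, F.coupledMap r ν c ∈ 𝒯 := by
    rintro _ ⟨μ, rfl⟩
    exact h𝒯 ν hν μ
  obtain ⟨h₃, hh⟩ := MeanField.BanachScale.exists_represents hX hR dw hvis
  have hlin := MeanField.BanachScale.linearized_eq (hX := hX) (hR := hR) hh (h𝒯 ν hν h)
  have hdir := MeanField.BanachScale.dirW_eq (hX := hX) (hR := hR) hh (h𝒯 ν hν h)
  set G := X.core hX F ν hR with hG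
  have ha : G.a3 h₃ = F.meanα h :=
    (MeanField.BanachScale.core_a3 (hX := hX) (hR := hR) h₃).trans hh.pair
  have hc : G.a3 h₃ ∈ G.R := ha ▸ ⟨h, rfl⟩
  refine ⟨h₃, hh, ?_⟩
  intro S Dh
  have hDh : Dh = G.lin h₃ := hlin
  have hL : G.L1 (G.a3 h₃) = X.L S 1 := by
    rw [ha]
    exact dif_pos (h𝒯 ν hν h)
  obtain ⟨hΘ1, hΘ2⟩ := MeanField.Core.hasSum_theta hc (MeanField.Core.I1_dirW hc)
  have hI : ∀ x, G.I1 x = X.integral 1 x := MeanField.BanachScale.core_I1 (hX := hX) (hR := hR)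
  have ha1 : ∀ x, G.a1 x = X.pair F.α 1 x := MeanField.BanachScale.core_a1 (hX := hX) (hR := hR)
  refine ⟨?_, ⟨∑' n, (G.L1 (G.a3 h₃) ^ n) (G.dirW h₃), ⟨(hI _).symm.trans hΘ1, ?_⟩, fun Θ' hΘ' => ?_, ?_⟩, ?_⟩
  · rw [hDh]
    exact MeanField.BanachScale.hasGateauxDifferential hX hR hh
  · rw [← hL, ← hdir]
    exact hΘ2
  · refine MeanField.Core.theta_unique hc (w := G.dirW h₃) ((hI _).trans hΘ'.1) ?_ hΘ1 hΘ2
    rw [hL, hdir]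
    exact hΘ'.2
  · rintro ⟨κ, -, hκ1, hσ⟩ hΞ
    rw [hDh] at hσ
    exact MeanField.BanachScale.isPhysical_of_ser_ne_zero hX hR dw hvis hh
      (MeanField.BanachScale.ser_ne_zero_of_spectrum hc hκ1 hσ (fun h1 => hΞ ((ha1 _).symm.trans h1)))
  · rintro ⟨z, hz, hz1⟩
    rw [hDh] at hz
    exact MeanField.BanachScale.not_isPhysical hX hR (fun c hc => h𝒯_surj _ (hR c hc)) dw hh hz1 hz
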